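/- Let $\mathcal X$ be a (small) category with a Grothendieck topology. Let $F:\mathcal X\to Top$ be a covariant functor and $G:\mathcal X^{op}\to Top$ a presheaf of spaces. Notation. $\Delta^n$ is the standard $n$-simplex, a face is the affine map $\eta:\Delta^m\to\Delta^n$ given by a strictly increasing map of vertices, and for a composable sequence $\phi: X_0\to\cdots\to X_n$, $\eta^*\phi$ is the sequence obtained by restricting $\phi$ to the vertices of $\eta$. *Realization.* For a category $\mathcal C$, $F:\mathcal C\to Top$ and $G:\mathcal C^{op}\to Top$, the space $\Re_{\mathcal C}(F,G)$ is the quotient of $\coprod_{n,\ \phi:X_0\to\cdots\to X_n}F(X_0)\times G(X_n)\times\Delta^n$ by the equivalence relation generated by $(a,b,\eta(t))_{\phi}\sim(a|_{F(X_i)},b|_{G(X_j)},t)_{\eta^*\phi}$, for faces $\eta$ with first and last vertices $i,j$. It is functorial in $F$, in $G$ and in $\mathcal C$. We write $*$ for a constant functor with value a point. *Covariant descent.* $F$ satisfies covariant descent if for every object $X$ and every covering sieve $\mathcal B\subset\mathcal X/X$ the map $\Re_{\mathcal B}(F|_{\mathcal B},*)\to\Re_{\mathcal X/X}(F|_{\mathcal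 X/X},*)$ is a weak homotopy equivalence. *Sections.* $\Gamma(\mathcal C,G)$ is the space of families of continuous maps $g(\phi):\Delta^n\to G(X_0)$, one for each composable sequence $\phi:X_0\to\cdots\to X_n$ in $\mathcal C$, such that $g(\phi)\circ\eta$ is the composite of $g(\eta^*\phi)$ with the restriction $G(X_i)\to G(X_0)$, for every face $\eta$ with first vertex $i$. It has the subspace topology from the product of the mapping spaces with their compact-open topologies. *The operations $\sigma$ and $\gamma'$.* Put $\sigma(G)(X)=\Gamma(\mathcal X/X,G|_{\mathcal X/X})$. Let $Sv(X)$ be the set of covering sieves of $X$, ordered by inclusion, and let $\gamma'(G)(X)=\Re_{Sv(X)}\big(*,\ \mathcal B\mapsto\Gamma(\mathcal B,G|_{\mathcal B})\big)$. Restriction along $f:Y\to X$ is induced by composition with $f$ and by $\mathcal B\mapsto f^*\mathcal B$. There are natural morphisms $G\to\sigma(G)$, sending a point to the corresponding constant section, and $\sigma(G)\to\gamma'(G)$, the inclusion of the $0$-cell of the maximal sieve. **Lemma.** Suppose that $F$ satisfies covariant descent. Then: 1. The canonical morphism $G\to\sigma(G)\to\gamma'(G)$ induces a weak homotopy equivalence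 $\Re_{\mathcal X}(F,G)\to\Re_{\mathcal X}(F,\gamma'(G))$. 2. For every morphism of presheaves $e:\sigma(G)\to G$ that is an object-by-object weak equivalence, let $\gamma_e(G)$ be the (object-by-object) pushout of $G\xleftarrow{e}\sigma(G)\to\gamma'(G)$. Then the morphism $G\to\gamma_e(G)$ induces a weak homotopy equivalence $\Re_{\mathcal X}(F,G)\to\Re_{\mathcal X}(F,\gamma_e(G))$. -/

import Mathlib

open CategoryTheory Opposite

universe w w₁ w₂ v u v₁ u₁ v₂ u₂

noncomputable section

namespace TopRealization

/-! ### Weak homotopy equivalences -/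

section WeakEquivalence

variable {X : Type w₁} {Y : Type w₂} [TopologicalSpace X] [TopologicalSpace Y]

/-- The map `π₀(X) → π₀(Y)` on path components induced by a continuous map. -/
def pi0Map (f : C(X, Y)) : ZerothHomotopy X → ZerothHomotopy Y :=
  Quotient.map f fun _ _ h => h.map f.continuous

/-- The map on `n`-dimensional based loops induced by a continuous map. -/
def genLoopMap (f : C(X, Y)) (n : ℕ) (x : X) (p : GenLoop (Fin n) X x) :
    GenLoop (Fin n) Y (f x) :=
  ⟨f.comp p.1, fun y hy => congrArg f (p.2 y hy)⟩

/-- The map `π_n(X, x) → π_n(Y, f x)` induced by a continuous map. -/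
def piMap (f : C(X, Y)) (n : ℕ) (x : X) :
    HomotopyGroup (Fin n) X x → HomotopyGroup (Fin n) Y (f x) :=
  Quotient.map (genLoopMap f n x) fun _ _ h => h.map fun H => H.compContinuousMap f

/-- A continuous map is a weak homotopy equivalence if it is bijective on path components and
on all homotopy groups at all base points. -/
structure IsWeakHomotopyEquiv (f : C(X, Y)) : Prop where
  bijective_pi0 : Function.Bijective (pi0Map f)
  bijective_pi : ∀ (n : ℕ) (x : X), Function.Bijective (piMap f (n + 1) x)

end WeakEquivalence

/-! ### The realization of a presheaf of spaces -/

section Realization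

variable {C : Type u₁} [Category.{v₁} C] {D : Type u₂} [Category.{v₂} D]

/-- The composable sequence obtained by applying a face of the simplex. -/
def faceSeq {m n : ℕ} (φ : ComposableArrows C n) (η : Fin (m + 1) ↪o Fin (n + 1)) :
    ComposableArrows C m :=
  φ.whiskerLeft η.monotone.functor

/-- The disjoint union over all composable sequences `X₀ ⟶ ⋯ ⟶ Xₙ` of the spaces
`F(X₀) × G(Xₙ) × Δⁿ`. -/
abbrev Cells (F : C ⥤ TopCat.{w₁}) (G : Cᵒᵖ ⥤ TopCat.{w₂}) : Type _ :=
  Σ p : (Σ n : ℕ, ComposableArrows C n),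
    F.obj (p.2.obj 0) × G.obj (op (p.2.obj (Fin.last p.1))) × stdSimplex ℝ (Fin (p.1 + 1))

/-- The gluing relation: for a face `η : Δᵐ → Δⁿ` with first and last vertices `i`, `j`, the point
`(a, b, η t)` over `φ` is glued to `(a', b', t)` over the face of `φ`, with `a'` the image of `a`
in `F(Xᵢ)` and `b'` the image of `b` in `G(Xⱼ)`. -/
inductive FaceRel (F : C ⥤ TopCat.{w₁}) (G : Cᵒᵖ ⥤ TopCat.{w₂}) : Cells F G → Cells F G → Prop
  | glue {m n : ℕ} (φ : ComposableArrows C n) (η : Fin (m + 1) ↪o Fin (n + 1))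
      (a : F.obj (φ.obj 0)) (b : G.obj (op (φ.obj (Fin.last n))))
      (t : stdSimplex ℝ (Fin (m + 1))) :
      FaceRel F G ⟨⟨n, φ⟩, a, b, stdSimplex.map η t⟩
        ⟨⟨m, faceSeq φ η⟩, F.map (φ.map (homOfLE (Fin.zero_le (η 0)))) a,
          G.map (φ.map (homOfLE (Fin.le_last (η (Fin.last m))))).op b, t⟩

/-- The realization of the presheaf of spaces `G` with respect to the covariant functor `F`: the
quotient space of `∐ F(X₀) × G(Xₙ) × Δⁿ` by the equivalence relation generated by `FaceRel`. -/
def Realization (F : C ⥤ TopCat.{w₁}) (G : Cᵒᵖ ⥤ TopCat.{w₂}) : Type _ :=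
  Quot (FaceRel F G)

instance (F : C ⥤ TopCat.{w₁}) (G : Cᵒᵖ ⥤ TopCat.{w₂}) : TopologicalSpace (Realization F G) :=
  inferInstanceAs (TopologicalSpace (Quot (FaceRel F G)))

namespace Realization

/-- The point of the realization given by a point of a cell. -/
def mk {F : C ⥤ TopCat.{w₁}} {G : Cᵒᵖ ⥤ TopCat.{w₂}} {n : ℕ} (φ : ComposableArrows C n)
    (a : F.obj (φ.obj 0)) (b : G.obj (op (φ.obj (Fin.last n))))
    (t : stdSimplex ℝ (Fin (n + 1))) : Realization F G :=
  Quot.mk _ ⟨⟨n, φ⟩, a, b, t⟩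

lemma mk_congr {F : C ⥤ TopCat.{w₁}} {G : Cᵒᵖ ⥤ TopCat.{w₂}} {n : ℕ}
    {φ φ' : ComposableArrows C n} (h : φ = φ')
    {a : F.obj (φ.obj 0)} {a' : F.obj (φ'.obj 0)}
    {b : G.obj (op (φ.obj (Fin.last n)))} {b' : G.obj (op (φ'.obj (Fin.last n)))}
    (t : stdSimplex ℝ (Fin (n + 1)))
    (ha : F.map (eqToHom (by rw [h])) a = a')
    (hb : G.map (eqToHom (by rw [h])) b = b') :
    mk φ a b t = mk φ' a' b' t := by
  subst h
  simp at ha hb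
  subst ha hb
  rfl

/-- The map of realizations induced by natural transformations of both variables. -/
def map {F : C ⥤ TopCat.{w₁}} {F' : C ⥤ TopCat.{w₁}} {G : Cᵒᵖ ⥤ TopCat.{w₂}}
    {G' : Cᵒᵖ ⥤ TopCat.{w₂}} (α : F ⟶ F') (β : G ⟶ G') :
    C(Realization F G, Realization F' G') where
  toFun := Quot.map (fun c => ⟨c.1, α.app _ c.2.1, β.app _ c.2.2.1, c.2.2.2⟩) (by
    rintro _ _ ⟨φ, η, a, b, t⟩
    have h := FaceRel.glue (F := F') (G := G') φ η (α.app _ a) (β.app _ b) t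
    rwa [← NatTrans.naturality_apply, ← NatTrans.naturality_apply] at h)
  continuous_toFun := by
    refine continuous_quot_lift _ (continuous_quot_mk.comp ?_)
    refine continuous_sigma fun p => continuous_sigmaMk.comp ?_
    exact ((α.app _).hom.continuous.comp continuous_fst).prodMk
      (((β.app _).hom.continuous.comp (continuous_fst.comp continuous_snd)).prodMk
        (continuous_snd.comp continuous_snd))

/-- The map of realizations induced by a functor `π` of the base categories. -/
def pull (π : C ⥤ D) (F : D ⥤ TopCat.{w₁}) (G : Dᵒᵖ ⥤ TopCat.{w₂}) :
    C(Realization (π ⋙ F) (π.op ⋙ G), Realization F G) where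
  toFun := Quot.map (fun c => ⟨⟨c.1.1, c.1.2 ⋙ π⟩, c.2.1, c.2.2.1, c.2.2.2⟩) (by
    rintro _ _ ⟨φ, η, a, b, t⟩
    exact FaceRel.glue (F := F) (G := G) (φ ⋙ π) η a b t)
  continuous_toFun := by
    refine continuous_quot_lift _ (continuous_quot_mk.comp ?_)
    refine continuous_sigma fun p => ?_
    exact continuous_sigmaMk
      (σ := fun p : (Σ n : ℕ, ComposableArrows D n) =>
        F.obj (p.2.obj 0) × G.obj (op (p.2.obj (Fin.last p.1))) × stdSimplex ℝ (Fin (p.1 + 1)))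
      (i := ⟨p.1, p.2 ⋙ π⟩)

end Realization

/-- The constant covariant functor with value the one-point space. -/
abbrev pt (C : Type u₁) [Category.{v₁} C] : C ⥤ TopCat.{0} :=
  (Functor.const C).obj (TopCat.of PUnit)

/-- The constant contravariant functor with value the one-point space. -/
abbrev ptOp (C : Type u₁) [Category.{v₁} C] : Cᵒᵖ ⥤ TopCat.{0} :=
  (Functor.const Cᵒᵖ).obj (TopCat.of PUnit)

end Realization

/-- A morphism of presheaves of spaces is an object-by-object weak equivalence. -/
def ObjectwiseWeakEquiv {C : Type u₁} [Category.{v₁} C] {G G' : Cᵒᵖ ⥤ TopCat.{w₂}}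
    (α : G ⟶ G') : Prop :=
  ∀ X : Cᵒᵖ, IsWeakHomotopyEquiv (α.app X).hom

/-! ### Spaces of sections -/

section Sections

variable {C : Type u₁} [Category.{v₁} C] {D : Type u₂} [Category.{v₂} D]

/-- A family of maps `g(φ) : Δⁿ → G(X₀)`, one for each composable sequence, is a section if
`g(φ) ∘ η` is the restriction along `X₀ ⟶ Xᵢ` of `g` of the face of `φ`, for every face `η` with
first vertex `i`. -/
def IsSection (G : Cᵒᵖ ⥤ TopCat.{w₂})
    (g : ∀ p : (Σ n : ℕ, ComposableArrows C n),
      C(stdSimplex ℝ (Fin (p.1 + 1)), G.obj (op (p.2.obj 0)))) : Prop :=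
  ∀ ⦃m n : ℕ⦄ (φ : ComposableArrows C n) (η : Fin (m + 1) ↪o Fin (n + 1))
    (t : stdSimplex ℝ (Fin (m + 1))),
    g ⟨n, φ⟩ (stdSimplex.map η t) =
      G.map (φ.map (homOfLE (Fin.zero_le (η 0)))).op (g ⟨m, faceSeq φ η⟩ t)

/-- The space `Γ(C, G)` of sections, a subspace of the product over all composable sequences of
the mapping spaces `C(Δⁿ, G(X₀))` with the compact-open topology. -/
abbrev Sections (G : Cᵒᵖ ⥤ TopCat.{w₂}) : Type _ :=
  {g : ∀ p : (Σ n : ℕ, ComposableArrows C n),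
      C(stdSimplex ℝ (Fin (p.1 + 1)), G.obj (op (p.2.obj 0))) // IsSection G g}

/-- Restriction of sections along a functor. -/
def Sections.pull (π : C ⥤ D) (G : Dᵒᵖ ⥤ TopCat.{w₂}) :
    C(Sections G, Sections (π.op ⋙ G)) where
  toFun g := ⟨fun p => g.1 ⟨p.1, p.2 ⋙ π⟩, fun _ _ φ η t => g.2 (φ ⋙ π) η t⟩
  continuous_toFun := Continuous.subtype_mk (continuous_pi fun p =>
    (continuous_apply (⟨p.1, p.2 ⋙ π⟩ : Σ n : ℕ, ComposableArrows D n)).comp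
      continuous_subtype_val) _

lemma Sections.apply_congr {G : Cᵒᵖ ⥤ TopCat.{w₂}} (g : Sections G) {n : ℕ}
    {φ φ' : ComposableArrows C n} (h : φ = φ') (t : stdSimplex ℝ (Fin (n + 1))) :
    g.1 ⟨n, φ⟩ t ≍ g.1 ⟨n, φ'⟩ t := by
  subst h
  rfl

end Sections

/-! ### Covariant descent and the operation `γ` -/

section Site

variable {C : Type u} [Category.{v} C] (J : GrothendieckTopology C)

/-- `F` satisfies covariant descent if for every object `X` and every covering sieve `S` of `X`,
viewed as a full subcategory of `C/X`, the map `ℜ_S(F|_S, *) → ℜ_{C/X}(F|_{C/X}, *)` is a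
weak homotopy equivalence. -/
def CovariantDescent (F : C ⥤ TopCat.{w}) : Prop :=
  ∀ (X : C) (S : J.Cover X),
    IsWeakHomotopyEquiv
      (Realization.pull (ObjectProperty.ι _ : (S : Sieve X).arrows.category ⥤ Over X)
        (Over.forget X ⋙ F) (ptOp (Over X)))

/-- The objects of the fibered category `E` of pairs `(X, S)` with `S` a covering sieve of `X`. -/
structure CoverPair where
  /-- the underlying object -/
  base : C
  /-- the covering sieve -/
  cover : J.Cover base

variable {J}

/-- A morphism `(X, S) ⟶ (Y, T)` is a morphism `f : X ⟶ Y` with `S ≤ f^* T`. -/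
@[ext]
structure CoverPair.Hom (A B : CoverPair J) where
  /-- the underlying morphism -/
  hom : A.base ⟶ B.base
  le : A.cover ≤ B.cover.pullback hom

instance : Category (CoverPair J) where
  Hom := CoverPair.Hom
  id A := ⟨𝟙 _, fun Y g hg => by simpa using hg⟩
  comp f g := ⟨f.hom ≫ g.hom, fun Y k hk => by
    have := g.le _ (f.le _ hk)
    simpa using this⟩
  id_comp f := CoverPair.Hom.ext (Category.id_comp _)
  comp_id f := CoverPair.Hom.ext (Category.comp_id _)
  assoc f g h := CoverPair.Hom.ext (Category.assoc _ _ _)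

namespace CoverPair

@[ext]
lemma hom_ext {A B : CoverPair J} {f g : A ⟶ B} (h : Hom.hom f = Hom.hom g) : f = g :=
  Hom.ext h

@[simp] lemma id_hom (A : CoverPair J) : Hom.hom (𝟙 A) = 𝟙 A.base := rfl

@[simp] lemma comp_hom {A B D : CoverPair J} (f : A ⟶ B) (g : B ⟶ D) :
    Hom.hom (f ≫ g) = Hom.hom f ≫ Hom.hom g := rfl

/-- The covering sieve of a pair, as a full subcategory of `C/X`. -/
abbrev cat (A : CoverPair J) := (A.cover : Sieve A.base).arrows.category

/-- The functor from the sieve to the site, `(Y ⟶ X) ↦ Y`. -/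
abbrev proj (A : CoverPair J) : A.cat ⥤ C := (A.cover : Sieve A.base).arrows.diagram

/-- Composition with `f` is a functor between the sieves. -/
def sieveFunctor {A B : CoverPair J} (f : A ⟶ B) : A.cat ⥤ B.cat :=
  ObjectProperty.lift _ (ObjectProperty.ι _ ⋙ Over.map (Hom.hom f)) fun Y => Hom.le f _ Y.property

variable (J) in
/-- The inclusion of the fiber over `X`. -/
def fiber (X : C) : J.Cover X ⥤ CoverPair J where
  obj S := ⟨X, S⟩
  map {S T} h := ⟨𝟙 X, fun Y g hg => by simpa using leOfHom h _ hg⟩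

/-- The cartesian morphisms `(Y, f^* S) ⟶ (X, S)`, for `f : Y ⟶ X`. -/
def cartesian {X Y : C} (f : Y ⟶ X) : J.pullback f ⋙ fiber J Y ⟶ fiber J X where
  app S := ⟨f, le_rfl⟩
  naturality S T h := by ext; simp [fiber]

variable (J) in
/-- The section `ξ(X) = (X, C/X)`. -/
def xi : C ⥤ CoverPair J where
  obj X := ⟨X, ⊤⟩
  map f := ⟨f, fun _ _ _ => trivial⟩

lemma functor_ext_of_proj {A : CoverPair J} {D : Type u₂} [Category.{v₂} D] {Φ Ψ : D ⥤ A.cat}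
    (h : ∀ Y, Φ.obj Y = Ψ.obj Y)
    (h' : ∀ {Y Z} (f : Y ⟶ Z), A.proj.map (Φ.map f) =
      eqToHom (by rw [h]) ≫ A.proj.map (Ψ.map f) ≫ eqToHom (by rw [h])) : Φ = Ψ := by
  refine CategoryTheory.Functor.ext h fun Y Z f => A.proj.map_injective ?_
  rw [h', Functor.map_comp, Functor.map_comp, eqToHom_map, eqToHom_map]

lemma sieveFunctor_id (A : CoverPair J) : sieveFunctor (𝟙 A) = 𝟭 A.cat := by
  refine functor_ext_of_proj (fun Y => ?_) fun {Y Z} f => ?_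
  · refine ObjectProperty.FullSubcategory.ext ?_
    exact congrArg Over.mk (Category.comp_id Y.obj.hom)
  · exact ((Category.id_comp _).trans (Category.comp_id _)).symm

lemma sieveFunctor_comp {A B D : CoverPair J} (f : A ⟶ B) (g : B ⟶ D) :
    sieveFunctor (f ≫ g) = sieveFunctor f ⋙ sieveFunctor g := by
  refine functor_ext_of_proj (fun Y => ?_) fun {Y Z} f => ?_
  · refine ObjectProperty.FullSubcategory.ext ?_
    exact congrArg Over.mk (Category.assoc Y.obj.hom (Hom.hom f) (Hom.hom g)).symm
  · exact ((Category.id_comp _).trans (Category.comp_id _)).symm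

lemma functor_ext_cover {X : C} {D : Type u₂} [Category.{v₂} D] {Φ Ψ : D ⥤ J.Cover X}
    (h : ∀ Y, Φ.obj Y = Ψ.obj Y) : Φ = Ψ :=
  CategoryTheory.Functor.ext h fun _ _ _ => Subsingleton.elim _ _

lemma pullback_id (X : C) : J.pullback (𝟙 X) = 𝟭 (J.Cover X) :=
  functor_ext_cover fun S => GrothendieckTopology.Cover.ext _ _ fun Y f => by
    simp [GrothendieckTopology.pullback]

lemma pullback_comp {X Y Z : C} (f : X ⟶ Y) (g : Y ⟶ Z) :
    J.pullback (f ≫ g) = J.pullback g ⋙ J.pullback f :=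
  functor_ext_cover fun S => GrothendieckTopology.Cover.ext _ _ fun Y f => by
    simp [GrothendieckTopology.pullback]

end CoverPair

open CoverPair

variable (J)

/-- The presheaf of spaces `(X, S) ↦ Γ(S, G|_S)` on the category of pairs. -/
def gammaTilde (G : Cᵒᵖ ⥤ TopCat.{w}) : (CoverPair J)ᵒᵖ ⥤ TopCat.{max u v w} where
  obj A := TopCat.of (Sections (A.unop.proj.op ⋙ G))
  map {A B} f := TopCat.ofHom
    (Sections.pull (sieveFunctor f.unop) (A.unop.proj.op ⋙ G) :
      C(Sections (A.unop.proj.op ⋙ G), Sections (B.unop.proj.op ⋙ G)))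
  map_id A := by
    ext g p t
    exact eq_of_heq (Sections.apply_congr g (congrArg (p.2 ⋙ ·) (sieveFunctor_id A.unop)) t)
  map_comp f g := by
    ext s p t
    exact eq_of_heq
      (Sections.apply_congr s (congrArg (p.2 ⋙ ·) (sieveFunctor_comp g.unop f.unop)) t)

lemma gammaTilde_map_map (G : Cᵒᵖ ⥤ TopCat.{w}) {A B D : (CoverPair J)ᵒᵖ} (f : A ⟶ B) (g : B ⟶ D)
    (h : A ⟶ D) (e : Hom.hom h.unop = Hom.hom g.unop ≫ Hom.hom f.unop)
    (b : (gammaTilde J G).obj A) :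
    (gammaTilde J G).map g ((gammaTilde J G).map f b) = (gammaTilde J G).map h b := by
  have : h = f ≫ g := Quiver.Hom.unop_inj (CoverPair.hom_ext e)
  rw [this, Functor.map_comp]
  rfl

/-- The presheaf of spaces `σ(G) : X ↦ Γ(C/X, G|_{C/X})`. -/
def sigma (G : Cᵒᵖ ⥤ TopCat.{w}) : Cᵒᵖ ⥤ TopCat.{max u v w} :=
  (xi J).op ⋙ gammaTilde J G

/-- The presheaf of spaces `γ'(G)`, the special contravariant relative realization of
`gammaTilde J G` along `(X, S) ↦ X`: the presheaf of spaces whose value at `X` is the realization over the poset of covering sieves of `X`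
of `S ↦ Γ(S, G|_S)`, and whose restriction along `f : Y ⟶ X` is induced by the restrictions
`Γ(S, G|_S) → Γ(f^* S, G|_{f^* S})` followed by the functor `S ↦ f^* S`. -/
def gammaPrime (G : Cᵒᵖ ⥤ TopCat.{w}) : Cᵒᵖ ⥤ TopCat.{max u v w} where
  obj X := TopCat.of (Realization (pt (J.Cover X.unop)) ((fiber J X.unop).op ⋙ gammaTilde J G))
  map {X Y} f := TopCat.ofHom
    ((Realization.pull (J.pullback f.unop) (pt (J.Cover Y.unop))
        ((fiber J Y.unop).op ⋙ gammaTilde J G)).comp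
      (Realization.map (F := pt (J.Cover X.unop)) (F' := J.pullback f.unop ⋙ pt (J.Cover Y.unop))
        (𝟙 (pt (J.Cover X.unop)))
        (Functor.whiskerRight (NatTrans.op (cartesian f.unop)) (gammaTilde J G))))
  map_id X := by
    ext x
    obtain ⟨⟨n, φ⟩, a, b, t⟩ := x
    refine Realization.mk_congr (congrArg (φ ⋙ ·) (pullback_id X.unop)) t rfl ?_
    refine (gammaTilde_map_map J G _ _ (𝟙 _) ?_ b).trans ?_
    · exact (Category.id_comp _).symm
    · simp
  map_comp f g := by
    ext x
    obtain ⟨⟨n, φ⟩, a, b, t⟩ := x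
    refine Realization.mk_congr (congrArg (φ ⋙ ·) (pullback_comp g.unop f.unop)) t rfl ?_
    refine (gammaTilde_map_map J G _ _ (_ ≫ _) ?_ b).trans (gammaTilde_map_map J G _ _ _ rfl b).symm
    exact (Category.id_comp _).symm

/-- The canonical morphism `Γ(C/X, G|_{C/X}) → γ'(G)(X)`, the inclusion of the `0`-cell indexed by
the maximal sieve. -/
def sigmaToGammaPrime (G : Cᵒᵖ ⥤ TopCat.{w}) : sigma J G ⟶ gammaPrime J G where
  app X := TopCat.ofHom
    { toFun := fun s => Realization.mk (F := pt (J.Cover X.unop))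
        (G := (fiber J X.unop).op ⋙ gammaTilde J G)
        (ComposableArrows.mk₀ (⊤ : J.Cover X.unop)) PUnit.unit s default
      continuous_toFun := by
        refine continuous_quot_mk.comp ?_
        refine (continuous_sigmaMk (i := (⟨0, ComposableArrows.mk₀ (⊤ : J.Cover X.unop)⟩ :
          Σ n : ℕ, ComposableArrows (J.Cover X.unop) n))).comp ?_
        exact continuous_const.prodMk (continuous_id.prodMk continuous_const) }
  naturality X Y f := by
    ext s
    refine Realization.mk_congr (functor_ext_cover fun _ => ?_) default rfl ?_
    · exact GrothendieckTopology.Cover.ext _ _ fun _ _ => Iff.rfl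
    · refine gammaTilde_map_map J G ((xi J).op.map f) _ ((xi J).op.map f) ?_ s
      exact (Category.id_comp _).symm

lemma isSection_const (G : Cᵒᵖ ⥤ TopCat.{w}) (X : C) (x : G.obj (op X)) :
    IsSection (((xi J).obj X).proj.op ⋙ G)
      (fun p => ContinuousMap.const _ (G.map (Over.hom (p.2.obj 0).obj).op x)) := by
  intro m n φ η t
  have e := Over.w (φ.map (homOfLE (Fin.zero_le (η 0)))).hom
  refine (congrArg (fun k => G.map (Quiver.Hom.op k) x) e.symm).trans ?_
  exact ConcreteCategory.congr_hom (G.map_comp (Over.hom (φ.obj (η 0)).obj).op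
    (Over.Hom.left (φ.map (homOfLE (Fin.zero_le (η 0)))).hom).op) x

/-- The constant section attached to `x ∈ G(X)`: its value on `X₀ ⟶ ⋯ ⟶ Xₙ` over `X` is the
constant map at the restriction of `x` along `X₀ ⟶ X`. -/
def constSection (G : Cᵒᵖ ⥤ TopCat.{w}) (X : C) :
    C(G.obj (op X), Sections (((xi J).obj X).proj.op ⋙ G)) where
  toFun x := ⟨fun p => ContinuousMap.const _ (G.map (Over.hom (p.2.obj 0).obj).op x),
    isSection_const J G X x⟩
  continuous_toFun := Continuous.subtype_mk (continuous_pi fun p =>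
    ContinuousMap.continuous_const'.comp
      (G.map (Over.hom (p.2.obj 0).obj).op).hom.continuous) _

/-- The canonical morphism `G(X) → Γ(C/X, G|_{C/X})` given by constant sections. -/
def toSigma (G : Cᵒᵖ ⥤ TopCat.{max u v w}) : G ⟶ sigma.{max u v w} J G where
  app X := TopCat.ofHom (constSection J G X.unop)
  naturality X Y f := by
    ext x
    refine Subtype.ext (funext fun p => ContinuousMap.ext fun t => ?_)
    change G.map _ (G.map f x) = G.map _ x
    exact (ConcreteCategory.congr_hom (G.map_comp f (Over.hom (p.2.obj 0).obj).op) x).symm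

/-- The canonical morphism `G → γ'(G)`, the composite `G → σ(G) → γ'(G)`. -/
def toGammaPrime (G : Cᵒᵖ ⥤ TopCat.{max u v w}) : G ⟶ gammaPrime.{max u v w} J G :=
  toSigma J G ≫ sigmaToGammaPrime J G

end Site

end TopRealization

end

noncomputable section

namespace TopRealization

set_option linter.unusedSectionVars false

/-! ### Box filling -/

section BoxFilling

open Metric Set

variable {E : Type*} [NormedAddCommGroup E] [NormedSpace ℝ E] {Z : Type*} [TopologicalSpace Z]

/-! Let E be the category of pairs (X, B) with B a covering sieve of X, let ξ(X) be X with its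
maximal sieve, and let Γ be the presheaf (X, B) ↦ Γ(B, G|_B) on E (`gammaTilde`). The heart of the
matter is that σ(G) → γ'(G) becomes a weak equivalence after realization against F
(`weakEquiv_realization_sigmaToGammaPrime`).

Up to object-by-object weak equivalence both presheaves are realizations of Γ over E. Against the
functor Hom_E(ξX, -) one gets Γ(ξX) = σ(G)(X), by a Yoneda-type contraction (`weakEquiv_augment`).
Against Hom_C(X, base -) one gets γ'(G)(X), because sieves can be pulled back to X along cartesian
morphisms, which deforms the realization onto the fiber over X (`weakEquiv_fiberProj`). The
inclusion of the first functor in the second corresponds to σ(G) → γ'(G) up to a homotopy natural in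
X (`topHomotopy`). Realizations over C and over E can be interchanged
(`weakEquiv_realizationPresheafMap`), so it suffices to fix a pair (A, B) and to compare the
realizations over C of F with Hom_E(ξ-, (A, B)) and with Hom_C(-, A). These are ℜ_B(F, *) and
ℜ_{C/A}(F, *), and their comparison is the hypothesis of covariant descent
(`weakEquiv_coverToBase`).

For the first claim, G → σ(G) is an object-by-object weak equivalence because C/X has a terminal
object (`weakEquiv_toSigma`). For the second, σ(G)(X) sits in γ'(G)(X) as an open and closed set of
vertices; it is closed there and has a neighborhood that deforms onto it. Hence γ'(G) → γ_e(G) is an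
object-by-object weak equivalence (`weakEquiv_pushout_inr`), and two out of three applies to the
pushout square after realization.

All this needs realizations of arbitrary spaces to be homotopy invariant, without cofibrancy or
compact generation. Weak equivalences are therefore described by compression of discs (`WeakEquiv`,
equivalent to the definition by homotopy groups), which gives two out of three and a local criterion
over open covers (`WeakEquiv.of_openCover`). A realization is the fat realization of a bar
construction. It is covered by open strata, where a gap separates the i + 1 largest barycentric
coordinates from the others. An intersection of strata with largest index m deforms onto a product
of the m-simplices with a part of Δᵐ (`weakEquiv_stratumRetract`). So degreewise equivalences
realize to equivalences, and products and disjoint unions commute with realization up to weak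
equivalence. -/

/-- The retraction of the cylinder over the unit ball onto its bottom and sides. -/
def cylinderRetract (p : E × ℝ) : E × ℝ :=
  ((max ‖p.1‖ ((2 - p.2) / 2))⁻¹ • p.1, 2 - (2 - p.2) / max ‖p.1‖ ((2 - p.2) / 2))

lemma continuousOn_cylinderRetract :
    ContinuousOn (cylinderRetract (E := E)) (closedBall 0 1 ×ˢ Icc 0 1) := by
  have hpos : ∀ p ∈ (closedBall (0 : E) 1 ×ˢ Icc (0 : ℝ) 1), max ‖p.1‖ ((2 - p.2) / 2) ≠ 0 := by
    rintro ⟨x, t⟩ ⟨-, -, ht⟩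
    have : 0 < (2 - t) / 2 := by simp only at ht; linarith
    exact (lt_max_of_lt_right this).ne'
  have hc : ContinuousOn (fun p : E × ℝ => max ‖p.1‖ ((2 - p.2) / 2))
      (closedBall 0 1 ×ˢ Icc 0 1) := by fun_prop
  exact ((hc.inv₀ hpos).smul continuousOn_fst).prodMk
    (continuousOn_const.sub (ContinuousOn.div (by fun_prop) hc hpos))

/-- The map is the projection from the point `(0, 2)` above the cylinder. The maximum decides
whether the ray through `p` leaves through the side (norm 1) or through the bottom (height 0). -/
lemma cylinderRetract_mem {p : E × ℝ} (hp : p ∈ closedBall (0 : E) 1 ×ˢ Icc (0 : ℝ) 1) :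
    cylinderRetract p ∈ sphere (0 : E) 1 ×ˢ Icc 0 1 ∪ closedBall 0 1 ×ˢ {0} := by
  obtain ⟨x, t⟩ := p
  simp only [mem_prod, mem_closedBall_zero_iff, mem_Icc] at hp
  obtain ⟨hx, h0, h1⟩ := hp
  rcases le_total ((2 - t) / 2) ‖x‖ with h | h
  · left
    have hx0 : 0 < ‖x‖ := by linarith
    simp only [cylinderRetract, max_eq_left h, mem_prod, mem_sphere_zero_iff_norm, mem_Icc,
      norm_smul, norm_inv, norm_norm]
    refine ⟨inv_mul_cancel₀ hx0.ne', ?_, ?_⟩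
    · rw [sub_nonneg, div_le_iff₀ hx0]; linarith
    · rw [sub_le_comm, le_div_iff₀ hx0]; nlinarith
  · right
    have ht : 0 < (2 - t) / 2 := by linarith
    simp only [cylinderRetract, max_eq_right h, mem_prod, mem_closedBall_zero_iff,
      norm_smul, norm_inv, Real.norm_of_nonneg ht.le, mem_singleton_iff]
    refine ⟨?_, ?_⟩
    · rw [inv_mul_le_iff₀ ht]; linarith
    · have : 2 - t ≠ 0 := by linarith
      field_simp; ring

lemma cylinderRetract_eq {p : E × ℝ}
    (hp : p ∈ sphere (0 : E) 1 ×ˢ Icc (0 : ℝ) 1 ∪ closedBall 0 1 ×ˢ {0}) :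
    cylinderRetract p = p := by
  obtain ⟨x, t⟩ := p
  have : max ‖x‖ ((2 - t) / 2) = 1 := by
    rcases hp with ⟨hx, ht⟩ | ⟨hx, ht⟩
    · simp only [mem_sphere_zero_iff_norm] at hx
      rw [hx, max_eq_left]; linarith [ht.1]
    · simp only [mem_closedBall_zero_iff] at hx
      simp only [mem_singleton_iff] at ht
      subst ht
      rw [max_eq_right] <;> simp [hx]
  simp [cylinderRetract, this]

/-- The homotopy extension property of the pair (ball, sphere). -/
lemma exists_extension_cylinder {g : E × ℝ → Z}
    (hg : ContinuousOn g (sphere 0 1 ×ˢ Icc 0 1 ∪ closedBall 0 1 ×ˢ {0})) :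
    ∃ g' : E × ℝ → Z, ContinuousOn g' (closedBall 0 1 ×ˢ Icc 0 1) ∧
      EqOn g' g (sphere 0 1 ×ˢ Icc 0 1 ∪ closedBall 0 1 ×ˢ {0}) :=
  ⟨g ∘ cylinderRetract, hg.comp continuousOn_cylinderRetract fun _ => cylinderRetract_mem,
    fun _ hp => congrArg g (cylinderRetract_eq hp)⟩

lemma exists_extension_cylinder_one {g : E × ℝ → Z}
    (hg : ContinuousOn g (sphere 0 1 ×ˢ Icc 0 1 ∪ closedBall 0 1 ×ˢ {1})) :
    ∃ g' : E × ℝ → Z, ContinuousOn g' (closedBall 0 1 ×ˢ Icc 0 1) ∧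
      EqOn g' g (sphere 0 1 ×ˢ Icc 0 1 ∪ closedBall 0 1 ×ˢ {1}) := by
  have hr : Continuous fun p : E × ℝ => (p.1, 1 - p.2) := by fun_prop
  obtain ⟨g', h1, h2⟩ := exists_extension_cylinder (g := fun p => g (p.1, 1 - p.2))
    (hg.comp hr.continuousOn (by
      rintro ⟨x, t⟩ (⟨hx, ht⟩ | ⟨hx, ht⟩)
      · exact Or.inl ⟨hx, by simp only [mem_Icc] at ht ⊢; constructor <;> linarith⟩
      · simp only [mem_singleton_iff] at ht
        exact Or.inr ⟨hx, by simp [ht]⟩))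
  refine ⟨fun p => g' (p.1, 1 - p.2), h1.comp hr.continuousOn ?_, ?_⟩
  · rintro ⟨x, t⟩ ⟨hx, ht⟩
    exact ⟨hx, by simp only [mem_Icc] at ht ⊢; constructor <;> linarith⟩
  · rintro ⟨x, t⟩ h
    have := h2 (x := (x, 1 - t)) (by
      rcases h with ⟨hx, ht⟩ | ⟨hx, ht⟩
      · exact Or.inl ⟨hx, by simp only [mem_Icc] at ht ⊢; constructor <;> linarith⟩
      · simp only [mem_singleton_iff] at ht
        exact Or.inr ⟨hx, by simp [ht]⟩)
    simpa using this

/-- Filling a box: the bottom `P`, the two walls `L`, `R` and the side `Q` over the sphere determine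
a top. -/
lemma exists_box_filling {P L R : E × ℝ → Z} {Q : (E × ℝ) × ℝ → Z}
    (hP : ContinuousOn P (closedBall 0 1 ×ˢ Icc 0 1))
    (hL : ContinuousOn L (closedBall 0 1 ×ˢ Icc 0 1))
    (hR : ContinuousOn R (closedBall 0 1 ×ˢ Icc 0 1))
    (hQ : ContinuousOn Q ((sphere 0 1 ×ˢ Icc 0 1) ×ˢ Icc 0 1))
    (hPL : ∀ x ∈ closedBall (0 : E) 1, L (x, 0) = P (x, 0))
    (hPR : ∀ x ∈ closedBall (0 : E) 1, R (x, 0) = P (x, 1))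
    (hQP : ∀ x ∈ sphere (0 : E) 1, ∀ s ∈ Icc (0 : ℝ) 1, Q ((x, s), 0) = P (x, s))
    (hQL : ∀ x ∈ sphere (0 : E) 1, ∀ r ∈ Icc (0 : ℝ) 1, Q ((x, 0), r) = L (x, r))
    (hQR : ∀ x ∈ sphere (0 : E) 1, ∀ r ∈ Icc (0 : ℝ) 1, Q ((x, 1), r) = R (x, r)) :
    ∃ T : E × ℝ → Z, ContinuousOn T (closedBall 0 1 ×ˢ Icc 0 1) ∧
      (∀ x ∈ closedBall (0 : E) 1, T (x, 0) = L (x, 1)) ∧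
      (∀ x ∈ closedBall (0 : E) 1, T (x, 1) = R (x, 1)) ∧
      (∀ x ∈ sphere (0 : E) 1, ∀ s ∈ Icc (0 : ℝ) 1, T (x, s) = Q ((x, s), 1)) := by
  classical
  -- The interval becomes `[-1, 1]`, so that ball times interval is the unit ball of `E × ℝ` for the
  -- sup norm. Walls, side and bottom of the box are then the side and bottom of a cylinder over
  -- that ball, and the extension property applies one dimension higher.
  set σ : ℝ → ℝ := fun s => (s + 1) / 2 with hσ
  have hσc : Continuous σ := by fun_prop
  have hσm : ∀ {s : ℝ}, |s| ≤ 1 → σ s ∈ Icc (0 : ℝ) 1 := fun {s} h => by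
    rw [abs_le] at h; constructor <;> simp only [hσ] <;> linarith
  set g : (E × ℝ) × ℝ → Z := fun p =>
    if p.1.2 = -1 then L (p.1.1, p.2) else if p.1.2 = 1 then R (p.1.1, p.2)
    else if ‖p.1.1‖ = 1 then Q ((p.1.1, σ p.1.2), p.2) else P (p.1.1, σ p.1.2) with hg
  set S₁ : Set ((E × ℝ) × ℝ) := (closedBall 0 1 ×ˢ {-1}) ×ˢ Icc 0 1
  set S₂ : Set ((E × ℝ) × ℝ) := (closedBall 0 1 ×ˢ {1}) ×ˢ Icc 0 1
  set S₃ : Set ((E × ℝ) × ℝ) := (sphere 0 1 ×ˢ Icc (-1) 1) ×ˢ Icc 0 1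
  set S₄ : Set ((E × ℝ) × ℝ) := (closedBall 0 1 ×ˢ Icc (-1) 1) ×ˢ {0}
  have gL : EqOn g (fun p => L (p.1.1, p.2)) S₁ := by
    rintro ⟨⟨x, s⟩, r⟩ ⟨⟨hx, hs⟩, hr⟩
    simp only [mem_singleton_iff] at hs
    simp [hg, hs]
  have gR : EqOn g (fun p => R (p.1.1, p.2)) S₂ := by
    rintro ⟨⟨x, s⟩, r⟩ ⟨⟨hx, hs⟩, hr⟩
    simp only [mem_singleton_iff] at hs
    have : ¬ ((1 : ℝ) = -1) := by norm_num
    simp [hg, hs, this]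
  have gQ : EqOn g (fun p => Q ((p.1.1, σ p.1.2), p.2)) S₃ := by
    rintro ⟨⟨x, s⟩, r⟩ ⟨⟨hx, hs⟩, hr⟩
    simp only [hg]
    split_ifs with h1 h2 h3
    · subst h1; simpa [hσ] using (hQL x hx r hr).symm
    · subst h2; simpa [hσ] using (hQR x hx r hr).symm
    · rfl
    · exact absurd (by simpa using hx) h3
  have gP : EqOn g (fun p => P (p.1.1, σ p.1.2)) S₄ := by
    rintro ⟨⟨x, s⟩, r⟩ ⟨⟨hx, hs⟩, hr⟩
    simp only [mem_singleton_iff] at hr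
    subst hr
    simp only [hg]
    split_ifs with h1 h2 h3
    · subst h1; simpa [hσ] using hPL x hx
    · subst h2; simpa [hσ] using hPR x hx
    · exact hQP x (by simpa using h3) _ (hσm (abs_le.2 hs))
    · rfl
  have c₁ : ContinuousOn g S₁ := (hL.comp (by fun_prop) (by
    rintro ⟨⟨x, s⟩, r⟩ ⟨⟨hx, hs⟩, hr⟩; exact ⟨hx, hr⟩)).congr gL
  have c₂ : ContinuousOn g S₂ := (hR.comp (by fun_prop) (by
    rintro ⟨⟨x, s⟩, r⟩ ⟨⟨hx, hs⟩, hr⟩; exact ⟨hx, hr⟩)).congr gR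
  have c₃ : ContinuousOn g S₃ := (hQ.comp (by fun_prop) (by
    rintro ⟨⟨x, s⟩, r⟩ ⟨⟨hx, hs⟩, hr⟩; exact ⟨⟨hx, hσm (abs_le.2 hs)⟩, hr⟩)).congr gQ
  have c₄ : ContinuousOn g S₄ := (hP.comp (by fun_prop) (by
    rintro ⟨⟨x, s⟩, r⟩ ⟨⟨hx, hs⟩, hr⟩; exact ⟨hx, hσm (abs_le.2 hs)⟩)).congr gP
  have d₁ : IsClosed S₁ := (isClosed_closedBall.prod isClosed_singleton).prod isClosed_Icc
  have d₂ : IsClosed S₂ := (isClosed_closedBall.prod isClosed_singleton).prod isClosed_Icc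
  have d₃ : IsClosed S₃ := (isClosed_sphere.prod isClosed_Icc).prod isClosed_Icc
  have d₄ : IsClosed S₄ := (isClosed_closedBall.prod isClosed_Icc).prod isClosed_singleton
  have c : ContinuousOn g (((S₁ ∪ S₂) ∪ S₃) ∪ S₄) :=
    ((c₁.union_of_isClosed c₂ d₁ d₂).union_of_isClosed c₃ (d₁.union d₂) d₃).union_of_isClosed c₄
      ((d₁.union d₂).union d₃) d₄
  have hsub : sphere (0 : E × ℝ) 1 ×ˢ Icc (0 : ℝ) 1 ∪ closedBall (0 : E × ℝ) 1 ×ˢ {0} ⊆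
      ((S₁ ∪ S₂) ∪ S₃) ∪ S₄ := by
    rintro ⟨⟨x, s⟩, r⟩ (⟨h, hr⟩ | ⟨h, hr⟩)
    · simp only [mem_sphere_zero_iff_norm, Prod.norm_def, Real.norm_eq_abs] at h
      have hx : ‖x‖ ≤ 1 := h ▸ le_max_left _ _
      have hs : |s| ≤ 1 := h ▸ le_max_right ‖x‖ _
      rcases max_choice ‖x‖ |s| with h' | h'
      · exact Or.inl (Or.inr ⟨⟨by rw [mem_sphere_zero_iff_norm]; exact h'.symm.trans h, abs_le.1 hs⟩, hr⟩)
      · rw [h'] at h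
        rcases (abs_eq zero_le_one).1 h with h | h
        · exact Or.inl (Or.inl (Or.inr ⟨⟨by simpa using hx, by simp [h]⟩, hr⟩))
        · exact Or.inl (Or.inl (Or.inl ⟨⟨by simpa using hx, by simp [h]⟩, hr⟩))
    · simp only [mem_closedBall_zero_iff, Prod.norm_def, Real.norm_eq_abs, max_le_iff] at h
      exact Or.inr ⟨⟨by simpa using h.1, abs_le.1 h.2⟩, hr⟩
  obtain ⟨g', hg'c, hg'⟩ := exists_extension_cylinder (c.mono hsub)
  have norm1 : ∀ {x : E} {s : ℝ}, x ∈ closedBall (0 : E) 1 → |s| ≤ 1 →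
      ((x, s) : E × ℝ) ∈ closedBall (0 : E × ℝ) 1 := fun {x s} hx hs => by
    simp only [mem_closedBall_zero_iff, Prod.norm_def, Real.norm_eq_abs, max_le_iff] at hx ⊢
    exact ⟨hx, hs⟩
  have one_mem : (1 : ℝ) ∈ Icc (0 : ℝ) 1 := by simp
  have habs : ∀ {s : ℝ}, s ∈ Icc (0 : ℝ) 1 → |2 * s - 1| ≤ 1 := fun {s} hs =>
    abs_le.2 ⟨by linarith [hs.1], by linarith [hs.2]⟩
  refine ⟨fun p => g' ((p.1, 2 * p.2 - 1), 1), hg'c.comp (by fun_prop) ?_, ?_, ?_, ?_⟩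
  · rintro ⟨x, s⟩ ⟨hx, hs⟩
    exact ⟨norm1 hx (habs hs), one_mem⟩
  · intro x hx
    have h : ((x, (2 * 0 - 1 : ℝ)), (1 : ℝ)) ∈ sphere (0 : E × ℝ) 1 ×ˢ Icc (0 : ℝ) 1 := by
      refine ⟨?_, one_mem⟩
      rw [mem_closedBall_zero_iff] at hx
      rw [mem_sphere_zero_iff_norm, Prod.norm_def]
      exact (max_eq_right (by norm_num [hx])).trans (by norm_num)
    exact (hg' (Or.inl h)).trans (gL ⟨⟨hx, by simp⟩, one_mem⟩)
  · intro x hx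
    have h : ((x, (2 * 1 - 1 : ℝ)), (1 : ℝ)) ∈ sphere (0 : E × ℝ) 1 ×ˢ Icc (0 : ℝ) 1 := by
      refine ⟨?_, one_mem⟩
      rw [mem_closedBall_zero_iff] at hx
      rw [mem_sphere_zero_iff_norm, Prod.norm_def]
      exact (max_eq_right (by norm_num [hx])).trans (by norm_num)
    exact (hg' (Or.inl h)).trans (gR ⟨⟨hx, by norm_num⟩, one_mem⟩)
  · intro x hx s hs
    have h : ((x, (2 * s - 1 : ℝ)), (1 : ℝ)) ∈ sphere (0 : E × ℝ) 1 ×ˢ Icc (0 : ℝ) 1 := by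
      refine ⟨?_, one_mem⟩
      rw [mem_sphere_zero_iff_norm] at hx
      rw [mem_sphere_zero_iff_norm, Prod.norm_def]
      exact (max_eq_left ((habs hs).trans hx.ge)).trans hx
    refine (hg' (Or.inl h)).trans ((gQ ⟨⟨hx, abs_le.1 (habs hs)⟩, one_mem⟩).trans ?_)
    simp [hσ]

end BoxFilling

/-! ### Weak equivalences by compression of discs -/

section Compression

open Metric Set

variable {E E' : Type*} [NormedAddCommGroup E] [NormedSpace ℝ E]
  [NormedAddCommGroup E'] [NormedSpace ℝ E']
variable {X : Type*} {Y : Type*} {Z : Type*}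
  [TopologicalSpace X] [TopologicalSpace Y] [TopologicalSpace Z]

/-- A disc `b` in `Y` whose boundary is lifted to `a` in `X` can be compressed into `X` along `f`,
relative to the boundary. -/
def Compressible (f : X → Y) (a : E → X) (b : E → Y) : Prop :=
  ∃ (a' : E → X) (H : E × ℝ → Y), ContinuousOn a' (closedBall 0 1) ∧ EqOn a' a (sphere 0 1) ∧
    ContinuousOn H (closedBall 0 1 ×ˢ Icc 0 1) ∧
    (∀ x ∈ closedBall (0 : E) 1, H (x, 0) = f (a' x)) ∧
    (∀ x ∈ closedBall (0 : E) 1, H (x, 1) = b x) ∧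
    ∀ x ∈ sphere (0 : E) 1, ∀ t ∈ Icc (0 : ℝ) 1, H (x, t) = b x

/-- Compressibility of discs of dimension `n`. -/
def CompressesDiscs (f : X → Y) (E : Type*) [NormedAddCommGroup E] [NormedSpace ℝ E] : Prop :=
  ∀ (a : E → X) (b : E → Y), ContinuousOn a (sphere 0 1) → ContinuousOn b (closedBall 0 1) →
    (∀ x ∈ sphere (0 : E) 1, f (a x) = b x) → Compressible f a b

/-- A continuous map along which discs of all dimensions can be compressed. -/
structure WeakEquiv (f : X → Y) : Prop where
  continuous : Continuous f
  nonempty : Nonempty Y → Nonempty X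
  compresses : ∀ n : ℕ, CompressesDiscs f (Fin n → ℝ)

lemma sphere_sub {V : Type*} [SeminormedAddCommGroup V] {x : V} (hx : x ∈ sphere (0 : V) 1) :
    x ∈ closedBall (0 : V) 1 :=
  sphere_subset_closedBall hx

lemma Compressible.congr {f : X → Y} {a a₁ : E → X} {b b₁ : E → Y} (h : Compressible f a b)
    (ha : EqOn a a₁ (sphere 0 1)) (hb : EqOn b b₁ (closedBall 0 1)) : Compressible f a₁ b₁ := by
  obtain ⟨a', H, h1, h2, h3, h4, h5, h6⟩ := h
  exact ⟨a', H, h1, h2.trans ha, h3, h4, fun x hx => (h5 x hx).trans (hb hx),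
    fun x hx t ht => (h6 x hx t ht).trans (hb (sphere_sub hx))⟩

/-- Compressibility is transported along norm preserving homeomorphisms. -/
lemma Compressible.of_homeomorph {f : X → Y} (e : E' ≃ₜ E) (he : ∀ x, ‖e x‖ = ‖x‖) {a : E' → X}
    {b : E' → Y} (h : Compressible f (a ∘ e.symm) (b ∘ e.symm)) : Compressible f a b := by
  have m3 : MapsTo e (sphere 0 1) (sphere 0 1) := fun x hx => by
    simpa [he] using hx
  have m4 : MapsTo e (closedBall 0 1) (closedBall 0 1) := fun x hx => by
    simpa [he] using hx
  obtain ⟨a', H, h1, h2, h3, h4, h5, h6⟩ := h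
  refine ⟨a' ∘ e, fun p => H (e p.1, p.2), h1.comp e.continuous.continuousOn m4, fun x hx => ?_,
    h3.comp ?_ ?_, fun x hx => h4 _ (m4 hx), fun x hx => ?_, fun x hx t ht => ?_⟩
  · simpa using h2 (m3 hx)
  · exact ((e.continuous.comp continuous_fst).prodMk continuous_snd).continuousOn
  · rintro ⟨x, t⟩ ⟨hx, ht⟩; exact ⟨m4 hx, ht⟩
  · simpa using h5 _ (m4 hx)
  · simpa using h6 _ (m3 hx) t ht

lemma CompressesDiscs.of_homeomorph {f : X → Y} (h : CompressesDiscs f E) (e : E' ≃ₜ E)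
    (he : ∀ x, ‖e x‖ = ‖x‖) : CompressesDiscs f E' := by
  intro a b ha hb hab
  have he' : ∀ x, ‖e.symm x‖ = ‖x‖ := fun x => by rw [← he, e.apply_symm_apply]
  have m1 : MapsTo e.symm (sphere 0 1) (sphere 0 1) := fun x hx => by
    simpa [he'] using hx
  have m2 : MapsTo e.symm (closedBall 0 1) (closedBall 0 1) := fun x hx => by
    simpa [he'] using hx
  exact .of_homeomorph e he (h (a ∘ e.symm) (b ∘ e.symm)
    (ha.comp e.symm.continuous.continuousOn m1) (hb.comp e.symm.continuous.continuousOn m2)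
    (fun x hx => hab _ (m1 hx)))

/-- Homotopies of maps of the ball can be concatenated so that the boundary follows the second
homotopy. -/
lemma exists_concat {H K : E × ℝ → Z} (hH : ContinuousOn H (closedBall 0 1 ×ˢ Icc 0 1))
    (hK : ContinuousOn K (closedBall 0 1 ×ˢ Icc 0 1))
    (h : ∀ x ∈ closedBall (0 : E) 1, H (x, 1) = K (x, 0))
    (h' : ∀ x ∈ sphere (0 : E) 1, ∀ t ∈ Icc (0 : ℝ) 1, H (x, t) = K (x, 0)) :
    ∃ T : E × ℝ → Z, ContinuousOn T (closedBall 0 1 ×ˢ Icc 0 1) ∧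
      (∀ x ∈ closedBall (0 : E) 1, T (x, 0) = H (x, 0)) ∧
      (∀ x ∈ closedBall (0 : E) 1, T (x, 1) = K (x, 1)) ∧
      (∀ x ∈ sphere (0 : E) 1, ∀ s ∈ Icc (0 : ℝ) 1, T (x, s) = K (x, s)) := by
  -- The box has bottom `K`, left wall `H` run backwards, and a right wall and side that are
  -- constant in the new direction. Its top is the concatenation.
  obtain ⟨T, h1, h2, h3, h4⟩ := exists_box_filling (P := K) (L := fun p => H (p.1, 1 - p.2))
    (R := fun p => K (p.1, 1)) (Q := fun p => K p.1) hK
    (hH.comp (by fun_prop) (by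
      rintro ⟨x, t⟩ ⟨hx, ht⟩
      exact ⟨hx, by simp only [mem_Icc] at ht ⊢; constructor <;> linarith⟩))
    (hK.comp (by fun_prop) (by rintro ⟨x, t⟩ ⟨hx, ht⟩; exact ⟨hx, by simp⟩))
    (hK.comp (by fun_prop) (by
      rintro ⟨⟨x, t⟩, r⟩ ⟨⟨hx, ht⟩, hr⟩; exact ⟨sphere_sub hx, ht⟩))
    (fun x hx => by simpa using h x hx) (fun x hx => rfl) (fun x hx s hs => rfl)
    (fun x hx r hr => (h' x hx _ ⟨by linarith [hr.2], by linarith [hr.1]⟩).symm)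
    (fun x hx r hr => rfl)
  exact ⟨T, h1, fun x hx => by simpa using h2 x hx, h3, h4⟩

/-- Compressibility of `(a, b)` depends only on the homotopy class of the pair. -/
lemma Compressible.deform {f : X → Y} (hf : Continuous f) {A : E × ℝ → X} {B : E × ℝ → Y}
    (hA : ContinuousOn A (sphere 0 1 ×ˢ Icc 0 1))
    (hB : ContinuousOn B (closedBall 0 1 ×ˢ Icc 0 1))
    (hAB : ∀ x ∈ sphere (0 : E) 1, ∀ t ∈ Icc (0 : ℝ) 1, f (A (x, t)) = B (x, t))
    (h : Compressible f (fun x => A (x, 1)) (fun x => B (x, 1))) :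
    Compressible f (fun x => A (x, 0)) (fun x => B (x, 0)) := by
  classical
  obtain ⟨a₁, H, h1, h2, h3, h4, h5, h6⟩ := h
  have one_mem : (1 : ℝ) ∈ Icc (0 : ℝ) 1 := by simp
  have zero_mem : (0 : ℝ) ∈ Icc (0 : ℝ) 1 := by simp
  -- The lift `a₁` at time 1 is carried back along `A` by homotopy extension. Its value `A'` at time
  -- 0 is the new lift, and the box below produces its homotopy.
  have hc : ContinuousOn (fun p : E × ℝ => if p.2 = 1 then a₁ p.1 else A p)
      (sphere 0 1 ×ˢ Icc 0 1 ∪ closedBall 0 1 ×ˢ {1}) := by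
    refine ContinuousOn.union_of_isClosed (hA.congr ?_) ((h1.comp continuousOn_fst ?_).congr ?_)
      (isClosed_sphere.prod isClosed_Icc) (isClosed_closedBall.prod isClosed_singleton)
    · rintro ⟨x, t⟩ ⟨hx, ht⟩
      simp only
      split_ifs with ht1
      · subst ht1; exact h2 hx
      · rfl
    · rintro ⟨x, t⟩ ⟨hx, ht⟩; exact hx
    · rintro ⟨x, t⟩ ⟨hx, ht⟩
      simp only [mem_singleton_iff] at ht
      simp [ht]
  obtain ⟨A', hA'c, hA'⟩ := exists_extension_cylinder_one hc
  have hA's : ∀ x ∈ sphere (0 : E) 1, ∀ t ∈ Icc (0 : ℝ) 1, A' (x, t) = A (x, t) := by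
    intro x hx t ht
    rw [hA' (Or.inl ⟨hx, ht⟩)]
    simp only
    split_ifs with ht1
    · subst ht1; exact h2 hx
    · rfl
  have hA'1 : ∀ x ∈ closedBall (0 : E) 1, A' (x, 1) = a₁ x := by
    intro x hx
    rw [hA' (x := (x, 1)) (Or.inr ⟨hx, rfl⟩)]; simp
  have rev : MapsTo (fun p : E × ℝ => (p.1, 1 - p.2)) (closedBall 0 1 ×ˢ Icc 0 1)
      (closedBall 0 1 ×ˢ Icc 0 1) := by
    rintro ⟨x, t⟩ ⟨hx, ht⟩
    exact ⟨hx, by simp only [mem_Icc] at ht ⊢; constructor <;> linarith⟩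
  obtain ⟨T, t1, t2, t3, t4⟩ := exists_box_filling (P := H)
    (L := fun p => f (A' (p.1, 1 - p.2))) (R := fun p => B (p.1, 1 - p.2))
    (Q := fun p => B (p.1.1, 1 - p.2)) h3
    (hf.comp_continuousOn (hA'c.comp (by fun_prop) rev)) (hB.comp (by fun_prop) rev)
    (hB.comp (by fun_prop) (by
      rintro ⟨⟨x, t⟩, r⟩ ⟨⟨hx, ht⟩, hr⟩
      exact ⟨sphere_sub hx, by simp only [mem_Icc] at hr ⊢; constructor <;> linarith⟩))
    (fun x hx => by simp [hA'1 x hx, h4 x hx])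
    (fun x hx => by simp [h5 x hx])
    (fun x hx s hs => by simp [h6 x hx s hs])
    (fun x hx r hr => by
      have hr' : 1 - r ∈ Icc (0 : ℝ) 1 := ⟨by linarith [hr.2], by linarith [hr.1]⟩
      simp only [hA's x hx _ hr', hAB x hx _ hr'])
    (fun x hx r hr => rfl)
  refine ⟨fun x => A' (x, 0), T, hA'c.comp (by fun_prop) fun x hx => ⟨hx, zero_mem⟩,
    fun x hx => hA's x hx 0 zero_mem, t1, fun x hx => ?_, fun x hx => ?_, fun x hx t ht => ?_⟩
  · simpa using t2 x hx
  · simpa using t3 x hx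
  · simpa using t4 x hx t ht

/-- The homotopy extension and lifting property, with values in `U`. -/
lemma CompressesDiscs.lift {f : X → Y} (h : CompressesDiscs f E) {a : E → X} {h₀ : E × ℝ → Y}
    (ha : ContinuousOn a (sphere 0 1))
    (hh : ContinuousOn h₀ (sphere 0 1 ×ˢ Icc 0 1 ∪ closedBall 0 1 ×ˢ {1}))
    (hah : ∀ x ∈ sphere (0 : E) 1, h₀ (x, 0) = f (a x)) :
    ∃ (a' : E → X) (h' : E × ℝ → Y), ContinuousOn a' (closedBall 0 1) ∧ EqOn a' a (sphere 0 1) ∧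
      ContinuousOn h' (closedBall 0 1 ×ˢ Icc 0 1) ∧
      EqOn h' h₀ (sphere 0 1 ×ˢ Icc 0 1 ∪ closedBall 0 1 ×ˢ {1}) ∧
      ∀ x ∈ closedBall (0 : E) 1, h' (x, 0) = f (a' x) := by
  have zero_mem : (0 : ℝ) ∈ Icc (0 : ℝ) 1 := by simp
  obtain ⟨K, hKc, hK⟩ := exists_extension_cylinder_one hh
  obtain ⟨a', H, h1, h2, h3, h4, h5, h6⟩ := h a (fun x => K (x, 0)) ha
    (hKc.comp (by fun_prop) fun x hx => ⟨hx, zero_mem⟩)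
    (fun x hx => by rw [hK (Or.inl ⟨hx, zero_mem⟩), hah x hx])
  obtain ⟨T, t1, t2, t3, t4⟩ := exists_concat h3 hKc h5 h6
  refine ⟨a', T, h1, h2, t1, ?_, fun x hx => (t2 x hx).trans (h4 x hx)⟩
  rintro ⟨x, t⟩ hp
  rw [← hK hp]
  rcases hp with ⟨hx, ht⟩ | ⟨hx, ht⟩
  · exact t4 x hx t ht
  · simp only [mem_singleton_iff] at ht
    subst ht
    exact t3 x hx

lemma WeakEquiv.compressesDiscs {f : X → Y} (h : WeakEquiv f) (ι : Type*) [Fintype ι] :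
    CompressesDiscs f (ι → ℝ) :=
  (h.compresses (Fintype.card ι)).of_homeomorph
    { toFun := fun x i => x ((Fintype.equivFin ι).symm i)
      invFun := fun x i => x (Fintype.equivFin ι i)
      left_inv := fun x => by simp
      right_inv := fun x => by simp
      continuous_toFun := by fun_prop
      continuous_invFun := by fun_prop } fun x => by
      refine le_antisymm ((pi_norm_le_iff_of_nonneg (norm_nonneg _)).2 fun i => ?_)
        ((pi_norm_le_iff_of_nonneg (norm_nonneg _)).2 fun i => ?_)
      · exact norm_le_pi_norm x ((Fintype.equivFin ι).symm i)
      · refine le_of_eq_of_le ?_ (norm_le_pi_norm _ (Fintype.equivFin ι i))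
        simp

/-- The norm preserving homeomorphism `ℝⁿ × ℝ ≃ ℝⁿ⁺¹`. -/
def finConsHomeomorph (n : ℕ) : (Fin n → ℝ) × ℝ ≃ₜ (Fin (n + 1) → ℝ) where
  toFun p := Fin.cons p.2 p.1
  invFun x := (Fin.tail x, x 0)
  left_inv p := by simp
  right_inv x := by simp
  continuous_toFun := continuous_pi fun i => by
    refine Fin.cases ?_ (fun j => ?_) i
    · simpa using continuous_snd
    · simpa [Function.comp_def] using
        (continuous_apply j).comp (continuous_fst (X := Fin n → ℝ) (Y := ℝ))
  continuous_invFun := (continuous_pi fun i => continuous_apply i.succ).prodMk (continuous_apply 0)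

lemma norm_finConsHomeomorph (n : ℕ) (p : (Fin n → ℝ) × ℝ) : ‖finConsHomeomorph n p‖ = ‖p‖ := by
  refine le_antisymm ((pi_norm_le_iff_of_nonneg (norm_nonneg _)).2 fun i => ?_) ?_
  · refine Fin.cases ?_ (fun j => ?_) i
    · simpa [finConsHomeomorph] using norm_snd_le p
    · simpa [finConsHomeomorph] using (norm_le_pi_norm p.1 j).trans (norm_fst_le p)
  · rw [Prod.norm_def, max_le_iff]
    refine ⟨(pi_norm_le_iff_of_nonneg (norm_nonneg _)).2 fun j => ?_, ?_⟩
    · simpa [finConsHomeomorph] using norm_le_pi_norm (finConsHomeomorph n p) j.succ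
    · simpa [finConsHomeomorph] using norm_le_pi_norm (finConsHomeomorph n p) 0

lemma WeakEquiv.compressesDiscs_prod {f : X → Y} (h : WeakEquiv f) (n : ℕ) :
    CompressesDiscs f ((Fin n → ℝ) × ℝ) :=
  (h.compresses (n + 1)).of_homeomorph (finConsHomeomorph n) (norm_finConsHomeomorph n)

end Compression

/-! ### Composition, left cancellation and homotopies on the boundary of a cube -/

section Closure

open Metric Set

variable {E : Type*} [NormedAddCommGroup E] [NormedSpace ℝ E]
variable {X : Type*} {Y : Type*} {Z : Type*}
  [TopologicalSpace X] [TopologicalSpace Y] [TopologicalSpace Z]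

/-- Compress first along `g`, then compress the resulting disc of `Y` along `f`. The image under `g`
of the second homotopy concatenates with the first. -/
lemma CompressesDiscs.comp {f : X → Y} {g : Y → Z} (hg' : Continuous g) (hf : CompressesDiscs f E)
    (hg : CompressesDiscs g E) (hf' : Continuous f) : CompressesDiscs (g ∘ f) E := by
  intro a b ha hb hab
  obtain ⟨a₁, H, h1, h2, h3, h4, h5, h6⟩ := hg (f ∘ a) b (hf'.comp_continuousOn ha) hb hab
  obtain ⟨a₂, K, k1, k2, k3, k4, k5, k6⟩ := hf a a₁ ha h1 (fun x hx => (h2 hx).symm)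
  obtain ⟨T, t1, t2, t3, t4⟩ := exists_concat (H := g ∘ K) (K := H) (hg'.comp_continuousOn k3) h3
    (fun x hx => by simp [k5 x hx, h4 x hx])
    (fun x hx t ht => by simp [k6 x hx t ht, h4 x (sphere_sub hx)])
  exact ⟨a₂, T, k1, k2, t1, fun x hx => by simp [t2 x hx, k4 x hx],
    fun x hx => (t3 x hx).trans (h5 x hx), fun x hx t ht => (t4 x hx t ht).trans (h6 x hx t ht)⟩

lemma WeakEquiv.comp {f : X → Y} {g : Y → Z} (hg : WeakEquiv g) (hf : WeakEquiv f) :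
    WeakEquiv (g ∘ f) where
  continuous := hg.continuous.comp hf.continuous
  nonempty h := hf.nonempty (hg.nonempty h)
  compresses n := (hf.compresses n).comp hg.continuous (hg.compresses n) hf.continuous

lemma mem_closedBall_prod {x : E} {s : ℝ} :
    ((x, s) : E × ℝ) ∈ closedBall (0 : E × ℝ) 1 ↔ x ∈ closedBall (0 : E) 1 ∧ s ∈ Icc (-1 : ℝ) 1 := by
  simp [Prod.norm_def, abs_le]

lemma mem_sphere_prod {x : E} {s : ℝ} (h : ((x, s) : E × ℝ) ∈ sphere (0 : E × ℝ) 1) :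
    (x ∈ closedBall (0 : E) 1 ∧ s = -1) ∨ (x ∈ closedBall (0 : E) 1 ∧ s = 1) ∨
      (x ∈ sphere (0 : E) 1 ∧ s ∈ Icc (-1 : ℝ) 1) := by
  obtain ⟨hx, hs⟩ := mem_closedBall_prod.1 (sphere_sub h)
  simp only [mem_sphere_zero_iff_norm, Prod.norm_def, Real.norm_eq_abs] at h
  rcases max_choice ‖x‖ |s| with h' | h'
  · exact Or.inr (Or.inr ⟨by rw [mem_sphere_zero_iff_norm]; exact h'.symm.trans h, hs⟩)
  · rcases (abs_eq zero_le_one).1 (h'.symm.trans h) with h | h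
    · exact Or.inr (Or.inl ⟨hx, h⟩)
    · exact Or.inl ⟨hx, h⟩

lemma sphere_prod_of_left {x : E} {s : ℝ} (hx : x ∈ sphere (0 : E) 1) (hs : s ∈ Icc (-1 : ℝ) 1) :
    ((x, s) : E × ℝ) ∈ sphere (0 : E × ℝ) 1 := by
  rw [mem_sphere_zero_iff_norm] at *
  rw [Prod.norm_def]
  exact (max_eq_left ((abs_le.2 hs).trans hx.ge)).trans hx

lemma sphere_prod_of_right {x : E} {s : ℝ} (hx : x ∈ closedBall (0 : E) 1) (hs : s = 1 ∨ s = -1) :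
    ((x, s) : E × ℝ) ∈ sphere (0 : E × ℝ) 1 := by
  rw [mem_closedBall_zero_iff] at hx
  rw [mem_sphere_zero_iff_norm, Prod.norm_def]
  have : ‖s‖ = 1 := by rcases hs with rfl | rfl <;> simp
  exact (max_eq_right (hx.trans this.ge)).trans this

/-- If `g` compresses discs of one dimension more, two lifts of a homotopy relative to the sphere
are homotopic relative to the sphere. -/
lemma CompressesDiscs.lift_homotopy {g : Y → Z} (hg : CompressesDiscs g (E × ℝ)) {p q : E → Y}
    {H : E × ℝ → Z} (hp : ContinuousOn p (closedBall 0 1)) (hq : ContinuousOn q (closedBall 0 1))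
    (hpq : EqOn p q (sphere 0 1)) (hH : ContinuousOn H (closedBall 0 1 ×ˢ Icc 0 1))
    (h0 : ∀ x ∈ closedBall (0 : E) 1, H (x, 0) = g (p x))
    (h1 : ∀ x ∈ closedBall (0 : E) 1, H (x, 1) = g (q x))
    (hs : ∀ x ∈ sphere (0 : E) 1, ∀ t ∈ Icc (0 : ℝ) 1, H (x, t) = g (q x)) :
    ∃ K : E × ℝ → Y, ContinuousOn K (closedBall 0 1 ×ˢ Icc 0 1) ∧
      (∀ x ∈ closedBall (0 : E) 1, K (x, 0) = p x) ∧
      (∀ x ∈ closedBall (0 : E) 1, K (x, 1) = q x) ∧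
      ∀ x ∈ sphere (0 : E) 1, ∀ t ∈ Icc (0 : ℝ) 1, K (x, t) = q x := by
  classical
  have habs : ∀ {s : ℝ}, s ∈ Icc (0 : ℝ) 1 → 2 * s - 1 ∈ Icc (-1 : ℝ) 1 := fun {s} hs =>
    ⟨by linarith [hs.1], by linarith [hs.2]⟩
  have hσ : ∀ {s : ℝ}, s ∈ Icc (-1 : ℝ) 1 → (s + 1) / 2 ∈ Icc (0 : ℝ) 1 := fun {s} hs =>
    ⟨by linarith [hs.1], by linarith [hs.2]⟩
  -- The two lifts, together with their common values over the sphere, form a map on the boundary of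
  -- the ball of `E × ℝ`. The homotopy `H` fills its image in `Z`, so compressing this disc fills it
  -- in `Y`; the homotopy of the compression itself is not needed.
  set a : E × ℝ → Y := fun z => if z.2 = -1 then p z.1 else q z.1 with ha
  have e1 : EqOn a (fun z => p z.1) (closedBall 0 1 ×ˢ {-1}) := by
    rintro ⟨x, s⟩ ⟨hx, hs⟩
    simp only [mem_singleton_iff] at hs
    simp [ha, hs]
  have e2 : EqOn a (fun z => q z.1) (closedBall 0 1 ×ˢ {1}) := by
    rintro ⟨x, s⟩ ⟨hx, hs⟩
    simp only [mem_singleton_iff] at hs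
    have : ¬ ((1 : ℝ) = -1) := by norm_num
    simp [ha, hs, this]
  have e3 : EqOn a (fun z => q z.1) (sphere 0 1 ×ˢ Icc (-1) 1) := by
    rintro ⟨x, s⟩ ⟨hx, hs⟩
    simp only [ha]
    split_ifs
    · exact hpq hx
    · rfl
  have c : ContinuousOn a ((closedBall 0 1 ×ˢ {-1} ∪ closedBall 0 1 ×ˢ {1}) ∪
      sphere 0 1 ×ˢ Icc (-1) 1) := by
    have d1 : IsClosed (closedBall (0 : E) 1 ×ˢ {(-1 : ℝ)}) :=
      isClosed_closedBall.prod isClosed_singleton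
    have d2 : IsClosed (closedBall (0 : E) 1 ×ˢ {(1 : ℝ)}) :=
      isClosed_closedBall.prod isClosed_singleton
    refine ContinuousOn.union_of_isClosed (ContinuousOn.union_of_isClosed ?_ ?_ d1 d2) ?_
      (d1.union d2) (isClosed_sphere.prod isClosed_Icc)
    · exact (hp.comp continuousOn_fst fun z hz => hz.1).congr e1
    · exact (hq.comp continuousOn_fst fun z hz => hz.1).congr e2
    · exact (hq.comp continuousOn_fst fun z hz => sphere_sub hz.1).congr e3
  obtain ⟨K, -, k1, k2, -⟩ := hg a (fun z => H (z.1, (z.2 + 1) / 2)) (c.mono (by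
      rintro ⟨x, s⟩ h
      rcases mem_sphere_prod h with h | h | h
      · exact Or.inl (Or.inl h)
      · exact Or.inl (Or.inr h)
      · exact Or.inr h))
    (hH.comp (by fun_prop) (by
      rintro ⟨x, s⟩ h
      obtain ⟨hx, hs⟩ := mem_closedBall_prod.1 h
      exact ⟨hx, hσ hs⟩))
    (by
      rintro ⟨x, s⟩ h
      rcases mem_sphere_prod h with ⟨hx, rfl⟩ | ⟨hx, rfl⟩ | h
      · rw [e1 (x := (x, -1)) ⟨hx, rfl⟩]; simpa using (h0 x hx).symm
      · rw [e2 (x := (x, 1)) ⟨hx, rfl⟩]; simpa using (h1 x hx).symm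
      · rw [e3 h]; exact (hs x h.1 _ (hσ h.2)).symm)
  refine ⟨fun z => K (z.1, 2 * z.2 - 1), k1.comp (by fun_prop) ?_, fun x hx => ?_, fun x hx => ?_,
    fun x hx t ht => ?_⟩
  · rintro ⟨x, s⟩ ⟨hx, hs⟩
    exact mem_closedBall_prod.2 ⟨hx, habs hs⟩
  · have e : (2 * 0 - 1 : ℝ) = -1 := by norm_num
    simp only [e]
    exact (k2 (sphere_prod_of_right hx (Or.inr rfl))).trans (e1 ⟨hx, rfl⟩)
  · have e : (2 * 1 - 1 : ℝ) = 1 := by norm_num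
    simp only [e]
    exact (k2 (sphere_prod_of_right hx (Or.inl rfl))).trans (e2 ⟨hx, rfl⟩)
  · exact (k2 (sphere_prod_of_left hx (habs ht))).trans (e3 ⟨hx, habs ht⟩)

/-- Compressing `g ∘ b` along `g ∘ f` gives the new disc in `X`, but its homotopy lies in `Z`.
Lifting that homotopy through `g` costs one dimension more, which `g` provides. -/
lemma WeakEquiv.of_comp_left {f : X → Y} {g : Y → Z} (hf : Continuous f) (hg : WeakEquiv g)
    (hgf : WeakEquiv (g ∘ f)) : WeakEquiv f where
  continuous := hf
  nonempty h := hgf.nonempty (h.map g)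
  compresses n := by
    intro a b ha hb hab
    obtain ⟨a', H, h1, h2, h3, h4, h5, h6⟩ := hgf.compresses n a (g ∘ b) ha
      (hg.continuous.comp_continuousOn hb) (fun x hx => congrArg g (hab x hx))
    obtain ⟨K, k1, k2, k3, k4⟩ := (hg.compressesDiscs_prod n).lift_homotopy
      (hf.comp_continuousOn h1) hb (fun x hx => by simp [h2 hx, hab x hx]) h3 h4 h5 h6
    exact ⟨a', K, h1, h2, k1, k2, k3, k4⟩

/-- The part of the boundary of the cube other than the interior of the top face. -/
def boxBoundary (E : Type*) [NormedAddCommGroup E] : Set (E × ℝ) :=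
  sphere 0 1 ×ˢ Icc (-1) 1 ∪ closedBall 0 1 ×ˢ {-1}

lemma isClosed_boxBoundary : IsClosed (boxBoundary E) :=
  (isClosed_sphere.prod isClosed_Icc).union (isClosed_closedBall.prod isClosed_singleton)

lemma boxBoundary_subset : boxBoundary E ⊆ sphere 0 1 := by
  rintro ⟨x, s⟩ (⟨hx, hs⟩ | ⟨hx, hs⟩)
  · exact sphere_prod_of_left hx hs
  · exact sphere_prod_of_right hx (Or.inr hs)

lemma top_mem_boxBoundary {x : E} (h : ((x, 1) : E × ℝ) ∈ boxBoundary E) :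
    x ∈ sphere (0 : E) 1 := by
  rcases h with ⟨hx, hs⟩ | ⟨hx, hs⟩
  · exact hx
  · simp only [mem_singleton_iff] at hs; norm_num at hs

lemma continuousOn_glue_top {P : (E × ℝ) × ℝ → X} {T : E × ℝ → X} {f : (E × ℝ) × ℝ → X}
    (hP : ContinuousOn P (boxBoundary E ×ˢ Icc 0 1))
    (hT : ContinuousOn T (closedBall 0 1 ×ˢ Icc 0 1))
    (hfP : EqOn f P (boxBoundary E ×ˢ Icc 0 1))
    (hfT : ∀ x ∈ closedBall (0 : E) 1, ∀ t ∈ Icc (0 : ℝ) 1, f ((x, 1), t) = T (x, t)) :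
    ContinuousOn f (sphere 0 1 ×ˢ Icc 0 1) := by
  have : ContinuousOn f (boxBoundary E ×ˢ Icc 0 1 ∪ (closedBall 0 1 ×ˢ {1}) ×ˢ Icc 0 1) := by
    refine ContinuousOn.union_of_isClosed (hP.congr hfP) ?_ (isClosed_boxBoundary.prod isClosed_Icc)
      ((isClosed_closedBall.prod isClosed_singleton).prod isClosed_Icc)
    refine (hT.comp (f := fun z : (E × ℝ) × ℝ => (z.1.1, z.2)) (by fun_prop) ?_).congr ?_
    · rintro ⟨⟨x, s⟩, t⟩ ⟨⟨hx, hs⟩, ht⟩; exact ⟨hx, ht⟩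
    · rintro ⟨⟨x, s⟩, t⟩ ⟨⟨hx, hs⟩, ht⟩
      simp only [mem_singleton_iff] at hs
      subst hs
      exact hfT x hx t ht
  refine this.mono ?_
  rintro ⟨⟨x, s⟩, t⟩ ⟨h, ht⟩
  rcases mem_sphere_prod h with h | h | h
  · exact Or.inl ⟨Or.inr h, ht⟩
  · exact Or.inr ⟨h, ht⟩
  · exact Or.inl ⟨Or.inl h, ht⟩

/-- A homotopy on the box boundary extends to the sphere. -/
lemma exists_extension_boxBoundary {a : E × ℝ → X} {P : (E × ℝ) × ℝ → X}
    (ha : ContinuousOn a (sphere 0 1)) (hP : ContinuousOn P (boxBoundary E ×ˢ Icc 0 1))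
    (hPa : ∀ z ∈ boxBoundary E, P (z, 0) = a z) :
    ∃ A : (E × ℝ) × ℝ → X, ContinuousOn A (sphere 0 1 ×ˢ Icc 0 1) ∧
      (∀ z ∈ sphere (0 : E × ℝ) 1, A (z, 0) = a z) ∧ EqOn A P (boxBoundary E ×ˢ Icc 0 1) := by
  classical
  have one_mem : (1 : ℝ) ∈ Icc (-1 : ℝ) 1 := by simp
  have zero_mem : (0 : ℝ) ∈ Icc (0 : ℝ) 1 := by simp
  -- The box boundary meets the top face in the sphere of that face, so only homotopy extension for
  -- the pair (top face, its sphere) is needed.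
  set g : E × ℝ → X := fun z => if z.2 = 0 then a (z.1, 1) else P ((z.1, 1), z.2) with hg
  have e1 : EqOn g (fun z => P ((z.1, 1), z.2)) (sphere 0 1 ×ˢ Icc 0 1) := by
    rintro ⟨x, t⟩ ⟨hx, ht⟩
    simp only [hg]
    split_ifs with h
    · subst h; exact (hPa (x, 1) (Or.inl ⟨hx, one_mem⟩)).symm
    · rfl
  have e2 : EqOn g (fun z => a (z.1, 1)) (closedBall 0 1 ×ˢ {0}) := by
    rintro ⟨x, t⟩ ⟨hx, ht⟩
    simp only [mem_singleton_iff] at ht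
    simp [hg, ht]
  obtain ⟨T, hT, hTg⟩ := exists_extension_cylinder (g := g) (by
    refine ContinuousOn.union_of_isClosed ?_ ?_ (isClosed_sphere.prod isClosed_Icc)
      (isClosed_closedBall.prod isClosed_singleton)
    · refine (hP.comp (f := fun z : E × ℝ => ((z.1, (1 : ℝ)), z.2)) (by fun_prop) ?_).congr e1
      rintro ⟨x, t⟩ ⟨hx, ht⟩; exact ⟨Or.inl ⟨hx, one_mem⟩, ht⟩
    · refine (ha.comp (f := fun z : E × ℝ => (z.1, (1 : ℝ))) (by fun_prop) ?_).congr e2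
      rintro ⟨x, t⟩ ⟨hx, ht⟩; exact sphere_prod_of_right hx (Or.inl rfl))
  set A : (E × ℝ) × ℝ → X := fun z => if z.1.2 = 1 then T (z.1.1, z.2) else P z with hA
  have hAP : EqOn A P (boxBoundary E ×ˢ Icc 0 1) := by
    rintro ⟨⟨x, s⟩, t⟩ ⟨hx, ht⟩
    simp only [hA]
    split_ifs with h
    · subst h
      have hx' := top_mem_boxBoundary hx
      rw [hTg (Or.inl ⟨hx', ht⟩), e1 ⟨hx', ht⟩]
    · rfl
  have hAT : ∀ x ∈ closedBall (0 : E) 1, ∀ t ∈ Icc (0 : ℝ) 1, A ((x, 1), t) = T (x, t) :=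
    fun x _ t _ => by simp [hA]
  refine ⟨A, continuousOn_glue_top hP hT hAP hAT, ?_, hAP⟩
  rintro ⟨x, s⟩ h
  rcases mem_sphere_prod h with h | ⟨hx, rfl⟩ | h
  · have h' : (x, s) ∈ boxBoundary E := Or.inr h
    exact (hAP (x := ((x, s), 0)) ⟨h', zero_mem⟩).trans (hPa _ h')
  · rw [hAT x hx 0 zero_mem, hTg (x := (x, 0)) (Or.inr ⟨hx, rfl⟩), e2 (x := (x, 0)) ⟨hx, rfl⟩]
  · have h' : (x, s) ∈ boxBoundary E := Or.inl h
    exact (hAP (x := ((x, s), 0)) ⟨h', zero_mem⟩).trans (hPa _ h')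

/-- A map of the sphere is homotopic to a map that is constant on the box boundary. -/
lemma exists_homotopy_const_boxBoundary {a : E × ℝ → X} (ha : ContinuousOn a (sphere 0 1)) :
    ∃ A : (E × ℝ) × ℝ → X, ContinuousOn A (sphere 0 1 ×ˢ Icc 0 1) ∧
      (∀ z ∈ sphere (0 : E × ℝ) 1, A (z, 0) = a z) ∧
      ∀ z ∈ boxBoundary E, A (z, 1) = a (0, -1) := by
  have one_mem : (1 : ℝ) ∈ Icc (0 : ℝ) 1 := by simp
  set i : E × ℝ → E × ℝ := fun z => (z.1, (z.2 + 1) / 2) with hi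
  set j : E × ℝ → E × ℝ := fun z => (z.1, 2 * z.2 - 1) with hj
  -- Up to rescaling the interval, `cylinderRetract` is a retraction of the cube onto its box
  -- boundary. It brings back the straight contraction to `(0, -1)`, which leaves the sphere, where
  -- alone `a` is controlled.
  set ρ : E × ℝ → E × ℝ := fun z => j (cylinderRetract (i z)) with hρ
  have hi' : MapsTo i (closedBall 0 1) (closedBall 0 1 ×ˢ Icc 0 1) := by
    rintro ⟨x, s⟩ h
    obtain ⟨hx, hs⟩ := mem_closedBall_prod.1 h
    exact ⟨hx, by simp only [hi, mem_Icc] at hs ⊢; constructor <;> linarith⟩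
  have hρc : ContinuousOn ρ (closedBall 0 1) :=
    Continuous.comp_continuousOn (g := j) (by fun_prop)
      (continuousOn_cylinderRetract.comp (by fun_prop) hi')
  have hρm : ∀ z ∈ closedBall (0 : E × ℝ) 1, ρ z ∈ boxBoundary E := by
    intro z hz
    rcases cylinderRetract_mem (hi' hz) with ⟨hx, hs⟩ | ⟨hx, hs⟩
    · exact Or.inl ⟨hx, by simp only [mem_Icc] at hs ⊢; constructor <;> linarith⟩
    · simp only [mem_singleton_iff] at hs
      exact Or.inr ⟨hx, show 2 * (cylinderRetract (i z)).2 - 1 = (-1 : ℝ) by rw [hs]; norm_num⟩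
  have hρe : ∀ z ∈ boxBoundary E, ρ z = z := by
    intro z hz
    have : cylinderRetract (i z) = i z := by
      apply cylinderRetract_eq
      rcases hz with ⟨hx, hs⟩ | ⟨hx, hs⟩
      · exact Or.inl ⟨hx, by simp only [hi, mem_Icc] at hs ⊢; constructor <;> linarith⟩
      · simp only [mem_singleton_iff] at hs
        exact Or.inr ⟨hx, by simp [hi, hs]⟩
    change j (cylinderRetract (i z)) = z
    rw [this]
    exact Prod.ext rfl (show 2 * ((z.2 + 1) / 2) - 1 = z.2 by ring)
  have h0 : ((0, -1) : E × ℝ) ∈ boxBoundary E := Or.inr ⟨by simp, rfl⟩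
  have hconv : ∀ z ∈ boxBoundary E, ∀ t ∈ Icc (0 : ℝ) 1,
      (1 - t) • z + t • ((0, -1) : E × ℝ) ∈ closedBall (0 : E × ℝ) 1 := fun z hz t ht =>
    convex_closedBall 0 1 (sphere_sub (boxBoundary_subset hz))
      (sphere_sub (boxBoundary_subset h0)) (by linarith [ht.2]) ht.1 (by ring)
  obtain ⟨A, h1, h2, h3⟩ := exists_extension_boxBoundary
    (P := fun z => a (ρ ((1 - z.2) • z.1 + z.2 • ((0, -1) : E × ℝ)))) ha
    (ha.comp (hρc.comp (by fun_prop) fun z hz => hconv z.1 hz.1 z.2 hz.2)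
      fun z hz => boxBoundary_subset (hρm _ (hconv z.1 hz.1 z.2 hz.2)))
    (fun z hz => by simp [hρe z hz])
  refine ⟨A, h1, h2, fun z hz => ?_⟩
  rw [h3 ⟨hz, one_mem⟩]
  simp [hρe _ h0]

/-- A homotopy of the boundary lift `a` pushes forward to the boundary of the disc `b` and extends
over it. As compressibility is invariant under deformation of the pair, one may replace `a` by the
end of any homotopy, at the price of an unspecified new disc `b₁`. -/
lemma Compressible.of_homotopic {f : X → Y} (hf : Continuous f) {a : E → X} {b : E → Y}
    {A : E × ℝ → X} (hb : ContinuousOn b (closedBall 0 1))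
    (hab : ∀ x ∈ sphere (0 : E) 1, f (a x) = b x)
    (hA : ContinuousOn A (sphere 0 1 ×ˢ Icc 0 1)) (hAa : ∀ x ∈ sphere (0 : E) 1, A (x, 0) = a x)
    (h : ∀ b₁ : E → Y, ContinuousOn b₁ (closedBall 0 1) →
      (∀ x ∈ sphere (0 : E) 1, f (A (x, 1)) = b₁ x) → Compressible f (fun x => A (x, 1)) b₁) :
    Compressible f a b := by
  classical
  have one_mem : (1 : ℝ) ∈ Icc (0 : ℝ) 1 := by simp
  set g : E × ℝ → Y := fun z => if z.2 = 0 then b z.1 else f (A z) with hg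
  have e1 : EqOn g (fun z => f (A z)) (sphere 0 1 ×ˢ Icc 0 1) := by
    rintro ⟨x, t⟩ ⟨hx, ht⟩
    simp only [hg]
    split_ifs with h
    · subst h; rw [hAa x hx, hab x hx]
    · rfl
  have e2 : EqOn g (fun z => b z.1) (closedBall 0 1 ×ˢ {0}) := by
    rintro ⟨x, t⟩ ⟨hx, ht⟩
    simp only [mem_singleton_iff] at ht
    simp [hg, ht]
  obtain ⟨B, hB, hBg⟩ := exists_extension_cylinder (g := g) (by
    refine ContinuousOn.union_of_isClosed ((hf.comp_continuousOn hA).congr e1)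
      ((hb.comp (f := fun z : E × ℝ => z.1) (by fun_prop) ?_).congr e2)
      (isClosed_sphere.prod isClosed_Icc) (isClosed_closedBall.prod isClosed_singleton)
    rintro ⟨x, t⟩ ⟨hx, ht⟩; exact hx)
  have hAB : ∀ x ∈ sphere (0 : E) 1, ∀ t ∈ Icc (0 : ℝ) 1, f (A (x, t)) = B (x, t) :=
    fun x hx t ht => by rw [hBg (Or.inl ⟨hx, ht⟩), e1 ⟨hx, ht⟩]
  refine (Compressible.deform hf hA hB hAB (h (fun x => B (x, 1)) (hB.comp (by fun_prop)
    fun x hx => ⟨hx, one_mem⟩) fun x hx => hAB x hx 1 one_mem)).congr hAa fun x hx => ?_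
  exact (hBg (x := (x, 0)) (Or.inr ⟨hx, rfl⟩)).trans (e2 (x := (x, 0)) ⟨hx, rfl⟩)

end Closure

/-! ### Right cancellation, homotopy equivalences, products and disjoint unions -/

section Closure

open Metric Set

variable {E : Type*} [NormedAddCommGroup E] [NormedSpace ℝ E]
variable {X : Type*} {Y : Type*} {Z : Type*}
  [TopologicalSpace X] [TopologicalSpace Y] [TopologicalSpace Z]

lemma closedBall_fin_zero {x : Fin 0 → ℝ} : x ∈ closedBall (0 : Fin 0 → ℝ) 1 := by
  rw [Subsingleton.elim x 0]; exact mem_closedBall_self zero_le_one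

lemma notMem_sphere_fin_zero {x : Fin 0 → ℝ} : x ∉ sphere (0 : Fin 0 → ℝ) 1 := by
  rw [Subsingleton.elim x 0, mem_sphere_zero_iff_norm, norm_zero]; exact zero_ne_one

/-- Every point of the target is joined to the image of a point. -/
lemma CompressesDiscs.exists_path [Nonempty X] {f : X → Y} (h : CompressesDiscs f (Fin 0 → ℝ))
    (y : Y) : ∃ (x : X) (γ : ℝ → Y), ContinuousOn γ (Icc 0 1) ∧ γ 0 = f x ∧ γ 1 = y := by
  obtain ⟨a', H, h1, h2, h3, h4, h5, h6⟩ := h (fun _ => Classical.arbitrary X) (fun _ => y)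
    continuousOn_const continuousOn_const (fun x hx => (notMem_sphere_fin_zero hx).elim)
  exact ⟨a' 0, fun t => H (0, t), h3.comp (by fun_prop) fun t ht => ⟨closedBall_fin_zero, ht⟩,
    h4 0 closedBall_fin_zero, h5 0 closedBall_fin_zero⟩

/-- The difficulty is to lift the boundary sphere from `Y` to `X` before `g ∘ f` can be used. Deform
the sphere until it is constant outside its top face, move the constant value along a path to a
point `f x`, and then compress the top face, a disc of one dimension less, into `X` along `f`. The
sphere has become the image of a sphere `β` in `X`. -/
lemma CompressesDiscs.of_comp_right_prod [Nonempty X] {f : X → Y} {g : Y → Z} (hg : Continuous g)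
    (h₀ : CompressesDiscs f (Fin 0 → ℝ)) (hfE : CompressesDiscs f E) (hf : Continuous f)
    (hgf : CompressesDiscs (g ∘ f) (E × ℝ)) : CompressesDiscs g (E × ℝ) := by
  classical
  have rev : ∀ {t : ℝ}, t ∈ Icc (0 : ℝ) 1 → 1 - t ∈ Icc (0 : ℝ) 1 := fun {t} ht =>
    ⟨by linarith [ht.2], by linarith [ht.1]⟩
  have one_mem : (1 : ℝ) ∈ Icc (0 : ℝ) 1 := by simp
  have zero_mem : (0 : ℝ) ∈ Icc (0 : ℝ) 1 := by simp
  intro a b ha hb hab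
  obtain ⟨A, hA, hA0, hA1⟩ := exists_homotopy_const_boxBoundary ha
  refine .of_homotopic hg hb hab hA hA0 fun b₁ hb₁ hab₁ => ?_
  obtain ⟨x, γ, hγ, hγ0, hγ1⟩ := h₀.exists_path (a (0, -1))
  obtain ⟨A', hA', hA'0, hA'1⟩ := exists_extension_boxBoundary (a := fun z => A (z, 1))
    (P := fun z => γ (1 - z.2)) (hA.comp (by fun_prop) fun z hz => ⟨hz, one_mem⟩)
    (hγ.comp (by fun_prop) fun z hz => rev hz.2) (fun z hz => by simp [hγ1, hA1 z hz])
  refine .of_homotopic hg hb₁ hab₁ hA' hA'0 fun b₂ hb₂ hab₂ => ?_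
  have hJ : ∀ z ∈ boxBoundary E, A' (z, 1) = f x := fun z hz => by
    rw [hA'1 (x := (z, 1)) ⟨hz, one_mem⟩]; simp [hγ0]
  have htop : ∀ {y : E}, y ∈ sphere (0 : E) 1 → ((y, 1) : E × ℝ) ∈ boxBoundary E :=
    fun hy => Or.inl ⟨hy, by simp⟩
  obtain ⟨α, H, h1, h2, h3, h4, h5, h6⟩ := hfE (fun _ => x) (fun y => A' ((y, 1), 1))
    continuousOn_const (hA'.comp (by fun_prop) fun y hy =>
      ⟨sphere_prod_of_right hy (Or.inl rfl), one_mem⟩) (fun y hy => (hJ _ (htop hy)).symm)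
  set A'' : (E × ℝ) × ℝ → Y := fun z => if z.1.2 = 1 then H (z.1.1, 1 - z.2) else f x with hA''
  have e1 : EqOn A'' (fun _ => f x) (boxBoundary E ×ˢ Icc 0 1) := by
    rintro ⟨⟨y, s⟩, t⟩ ⟨hy, ht⟩
    simp only [hA'']
    split_ifs with h
    · subst h
      exact (h6 y (top_mem_boxBoundary hy) _ (rev ht)).trans (hJ _ hy)
    · rfl
  have hA''c : ContinuousOn A'' (sphere 0 1 ×ˢ Icc 0 1) :=
    continuousOn_glue_top (P := fun _ => f x) (T := fun z => H (z.1, 1 - z.2)) continuousOn_const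
      (h3.comp (by fun_prop) fun z hz => ⟨hz.1, rev hz.2⟩) e1 (fun y hy t ht => by simp [hA''])
  have hA''0 : ∀ z ∈ sphere (0 : E × ℝ) 1, A'' (z, 0) = A' (z, 1) := by
    rintro ⟨y, s⟩ h
    rcases mem_sphere_prod h with h | ⟨hy, rfl⟩ | h
    · have h' : (y, s) ∈ boxBoundary E := Or.inr h
      exact (e1 (x := ((y, s), 0)) ⟨h', zero_mem⟩).trans (hJ _ h').symm
    · simp [hA'', h5 y hy]
    · have h' : (y, s) ∈ boxBoundary E := Or.inl h
      exact (e1 (x := ((y, s), 0)) ⟨h', zero_mem⟩).trans (hJ _ h').symm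
  refine .of_homotopic hg hb₂ hab₂ hA''c hA''0 fun b₃ hb₃ hab₃ => ?_
  set β : E × ℝ → X := fun z => if z.2 = 1 then α z.1 else x with hβ
  have e2 : EqOn (fun z : (E × ℝ) × ℝ => β z.1) (fun _ => x) (boxBoundary E ×ˢ Icc 0 1) := by
    rintro ⟨⟨y, s⟩, t⟩ ⟨hy, ht⟩
    simp only [hβ]
    split_ifs with h
    · subst h
      exact h2 (top_mem_boxBoundary hy)
    · rfl
  have hβc : ContinuousOn β (sphere 0 1) := by
    have := continuousOn_glue_top (f := fun z : (E × ℝ) × ℝ => β z.1) (P := fun _ => x)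
      (T := fun z => α z.1) continuousOn_const (h1.comp (by fun_prop) fun z hz => hz.1) e2
      (fun y hy t ht => by simp [hβ])
    exact this.comp (f := fun z : E × ℝ => (z, (0 : ℝ))) (by fun_prop) fun z hz => ⟨hz, zero_mem⟩
  have hβA : ∀ z ∈ sphere (0 : E × ℝ) 1, f (β z) = A'' (z, 1) := by
    rintro ⟨y, s⟩ h
    simp only [hβ, hA'']
    split_ifs with hs
    · subst hs
      rcases mem_sphere_prod h with h | ⟨hy, -⟩ | h
      · norm_num at h
      · simp [h4 y hy]
      · simp [h4 y (sphere_sub h.1)]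
    · rfl
  obtain ⟨β', K, k1, k2, k3, k4, k5, k6⟩ := hgf β b₃ hβc hb₃ (fun z hz => by
    simp only [Function.comp_apply, hβA z hz]; exact hab₃ z hz)
  exact ⟨f ∘ β', K, hf.comp_continuousOn k1, fun z hz => by simp [k2 hz, hβA z hz], k3, k4, k5, k6⟩

lemma WeakEquiv.of_comp_right {f : X → Y} {g : Y → Z} (hg : Continuous g) (hf : WeakEquiv f)
    (hgf : WeakEquiv (g ∘ f)) : WeakEquiv g where
  continuous := hg
  nonempty h := (hgf.nonempty h).map f
  compresses n := by
    rcases isEmpty_or_nonempty Z with hZ | hZ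
    · exact fun a b => (hZ.false (b 0)).elim
    -- The boundary lift is a total function to `X`, so compressibility of all discs, even of
    -- points, is vacuous for empty `X`. This is why nonemptiness is carried separately.
    have hX := hgf.nonempty hZ
    cases n with
    | zero =>
      intro a b ha hb hab
      obtain ⟨a', H, h1, h2, h3, h4, h5, h6⟩ := hgf.compresses 0 (fun _ => Classical.arbitrary X) b
        continuousOn_const hb (fun x hx => (notMem_sphere_fin_zero hx).elim)
      exact ⟨f ∘ a', H, hf.continuous.comp_continuousOn h1,
        fun x hx => (notMem_sphere_fin_zero hx).elim, h3, h4, h5, h6⟩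
    | succ n =>
      exact ((hf.compresses 0).of_comp_right_prod hg (hf.compresses n) hf.continuous
        (hgf.compressesDiscs_prod n)).of_homeomorph (finConsHomeomorph n).symm (fun x => by
          rw [← norm_finConsHomeomorph, Homeomorph.apply_symm_apply])

/-- A map with a section that is a homotopy inverse is a weak equivalence. -/
lemma WeakEquiv.of_shrinkable {f : X → Y} {s : Y → X} {D : X × unitInterval → X}
    (hf : Continuous f) (hs : Continuous s) (hD : Continuous D) (hfs : ∀ y, f (s y) = y)
    (hD0 : ∀ x, D (x, 0) = x) (hD1 : ∀ x, D (x, 1) = s (f x)) : WeakEquiv f where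
  continuous := hf
  nonempty h := h.map s
  compresses n := by
    intro a b ha hb hab
    have hp : Continuous (projIcc (0 : ℝ) 1 zero_le_one) := continuous_projIcc
    -- Along `D` the boundary lift moves to a map with values in the section, where `s ∘ b₁` is an
    -- exact lift of the disc and the constant homotopy works.
    refine .of_homotopic (A := fun z => D (a z.1, projIcc 0 1 zero_le_one z.2)) hf hb hab
      (hD.comp_continuousOn ((ha.comp (by fun_prop) fun z hz => hz.1).prodMk (by fun_prop)))
      (fun x hx => by simpa using hD0 _) fun b₁ hb₁ hab₁ => ?_
    refine ⟨s ∘ b₁, fun z => b₁ z.1, hs.comp_continuousOn hb₁, fun x hx => ?_,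
      hb₁.comp (by fun_prop) fun z hz => hz.1, fun x hx => (hfs _).symm, fun x hx => rfl,
      fun x hx t ht => rfl⟩
    have h1 := hab₁ x hx
    simp only [projIcc_right] at h1 ⊢
    rw [Function.comp_apply, ← h1]
    change s (f (D (a x, 1))) = D (a x, 1)
    rw [hD1, hfs]

lemma WeakEquiv.of_homeomorph (e : X ≃ₜ Y) : WeakEquiv e :=
  .of_shrinkable (s := e.symm) (D := fun z => z.1) e.continuous e.symm.continuous continuous_fst
    (by simp) (fun _ => rfl) (by simp)

lemma WeakEquiv.id : WeakEquiv (id : X → X) := .of_homeomorph (Homeomorph.refl X)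

/-- The inclusion of a deformation retract is a weak equivalence. -/
lemma WeakEquiv.of_deformation_retract {f : X → Y} {r : Y → X} {D : Y × unitInterval → Y}
    (hf : Continuous f) (hr : Continuous r) (hD : Continuous D) (hrf : ∀ x, r (f x) = x)
    (hD0 : ∀ y, D (y, 0) = y) (hD1 : ∀ y, D (y, 1) = f (r y)) : WeakEquiv f :=
  .of_comp_left hf (.of_shrinkable hr hf hD hrf hD0 hD1) (by
    rw [show r ∘ f = _root_.id from funext hrf]; exact .id)

lemma weakEquiv_prodMk_left (t : unitInterval) : WeakEquiv (fun x : X => (x, t)) := by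
  refine .of_deformation_retract (r := Prod.fst)
    (D := fun z => (z.1.1, ⟨(1 - z.2 : ℝ) * z.1.2 + z.2 * t, ?_⟩)) (by fun_prop) continuous_fst ?_
    (fun _ => rfl) (fun y => ?_) (fun y => ?_)
  · exact convex_Icc (0 : ℝ) 1 z.1.2.2 t.2 (by linarith [z.2.2.2]) z.2.2.1 (by ring)
  · exact .prodMk (by fun_prop) (.subtype_mk (by fun_prop) _)
  · simp
  · simp

/-- The product of an identity with a weak equivalence is a weak equivalence. -/
lemma WeakEquiv.prodMap_id {f : X → Y} (h : WeakEquiv f) (A : Type*) [TopologicalSpace A] :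
    WeakEquiv (Prod.map (_root_.id : A → A) f) where
  continuous := continuous_id.prodMap h.continuous
  nonempty := fun ⟨a, y⟩ => (h.nonempty ⟨y⟩).map fun x => (a, x)
  compresses n := by
    intro a b ha hb hab
    obtain ⟨a', H, h1, h2, h3, h4, h5, h6⟩ := h.compresses n (fun x => (a x).2) (fun x => (b x).2)
      ha.snd hb.snd (fun x hx => congrArg Prod.snd (hab x hx))
    refine ⟨fun x => ((b x).1, a' x), fun z => ((b z.1).1, H z), hb.fst.prodMk h1, fun x hx => ?_,
      (hb.fst.comp (by fun_prop) fun z hz => hz.1).prodMk h3, fun x hx => ?_, fun x hx => ?_,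
      fun x hx t ht => ?_⟩
    · exact Prod.ext (congrArg Prod.fst (hab x hx)).symm (h2 hx)
    · exact Prod.ext rfl (h4 x hx)
    · exact Prod.ext rfl (h5 x hx)
    · exact Prod.ext rfl (h6 x hx t ht)

/-- Weak equivalences are stable under disjoint unions, bijective on indices. -/
lemma WeakEquiv.sigmaMap {ι κ : Type*} {X : ι → Type*} {Y : κ → Type*}
    [∀ i, TopologicalSpace (X i)] [∀ i, TopologicalSpace (Y i)] (e : ι ≃ κ)
    {f : ∀ i, X i → Y (e i)} (h : ∀ i, WeakEquiv (f i)) : WeakEquiv (Sigma.map e f) where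
  continuous := continuous_sigma fun i => continuous_sigmaMk.comp (h i).continuous
  nonempty := by
    rintro ⟨k, y⟩
    obtain ⟨i, rfl⟩ := e.surjective k
    exact ((h i).nonempty ⟨y⟩).map fun x => ⟨i, x⟩
  compresses n := by
    intro a b ha hb hab
    -- The ball is connected and the summands are open and closed, so the disc stays in one summand
    -- of the target. As `e` is injective on indices, its boundary lift stays in the corresponding
    -- summand of the source.
    have hpre : _root_.IsPreconnected (closedBall (0 : Fin n → ℝ) 1) :=
      (convex_closedBall (0 : Fin n → ℝ) 1).isPreconnected
    obtain ⟨k, y₀, hy₀⟩ : ∃ k y, b 0 = ⟨k, y⟩ := ⟨_, _, rfl⟩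
    obtain ⟨i, rfl⟩ := e.surjective k
    have hbi : ∀ x ∈ closedBall (0 : Fin n → ℝ) 1, b x ∈ range (Sigma.mk (β := Y) (e i)) := by
      have := (hpre.image b hb).subset_isClopen (t := range (Sigma.mk (β := Y) (e i)))
        ⟨isClosedMap_sigmaMk.isClosed_range, isOpenMap_sigmaMk.isOpen_range⟩
        ⟨b 0, ⟨0, by simp, rfl⟩, ⟨y₀, hy₀.symm⟩⟩
      exact fun x hx => this ⟨x, hx, rfl⟩
    obtain ⟨x₀⟩ := (h i).nonempty ⟨y₀⟩
    have hai : ∀ x ∈ sphere (0 : Fin n → ℝ) 1, a x ∈ range (Sigma.mk (β := X) i) := by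
      intro x hx
      obtain ⟨y, hy⟩ := hbi x (sphere_sub hx)
      have h1 := hab x hx
      rw [← hy] at h1
      obtain ⟨j, z, hz⟩ : ∃ j z, a x = ⟨j, z⟩ := ⟨_, _, rfl⟩
      rw [hz] at h1
      have : j = i := e.injective (congrArg Sigma.fst h1)
      subst this
      exact ⟨z, hz.symm⟩
    classical
    set b' : (Fin n → ℝ) → Y (e i) := fun x =>
      if hx : b x ∈ range (Sigma.mk (β := Y) (e i)) then hx.choose else y₀ with hb'
    set a' : (Fin n → ℝ) → X i := fun x =>
      if hx : a x ∈ range (Sigma.mk (β := X) i) then hx.choose else x₀ with ha'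
    have eb : ∀ x ∈ closedBall (0 : Fin n → ℝ) 1, (⟨e i, b' x⟩ : Σ k, Y k) = b x := fun x hx => by
      simp only [hb', dif_pos (hbi x hx)]; exact (hbi x hx).choose_spec
    have ea : ∀ x ∈ sphere (0 : Fin n → ℝ) 1, (⟨i, a' x⟩ : Σ k, X k) = a x := fun x hx => by
      simp only [ha', dif_pos (hai x hx)]; exact (hai x hx).choose_spec
    have cb : ContinuousOn b' (closedBall 0 1) := by
      rw [Topology.IsEmbedding.sigmaMk.continuousOn_iff]; exact hb.congr eb
    have ca : ContinuousOn a' (sphere 0 1) := by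
      rw [Topology.IsEmbedding.sigmaMk.continuousOn_iff]; exact ha.congr ea
    obtain ⟨a'', H, h1, h2, h3, h4, h5, h6⟩ := (h i).compresses n a' b' ca cb (fun x hx => by
      have := hab x hx
      rw [← ea x hx, ← eb x (sphere_sub hx)] at this
      exact sigma_mk_injective this)
    refine ⟨fun x => ⟨i, a'' x⟩, fun z => ⟨e i, H z⟩, continuous_sigmaMk.comp_continuousOn h1,
      fun x hx => ?_, continuous_sigmaMk.comp_continuousOn h3, fun x hx => ?_, fun x hx => ?_,
      fun x hx t ht => ?_⟩
    · simp only [h2 hx]; exact ea x hx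
    · simp only [h4 x hx]; rfl
    · simp only [h5 x hx]; exact eb x hx
    · simp only [h6 x hx t ht]; exact eb x (sphere_sub hx)

end Closure

/-! ### Compression of discs agrees with bijectivity on homotopy groups -/

section HomotopyGroups

open Metric Set

variable {X : Type*} {Y : Type*} [TopologicalSpace X] [TopologicalSpace Y]

/-- The projection of `ℝⁿ` onto the unit cube, identifying the cube `[-1, 1]ⁿ` with `[0, 1]ⁿ`. -/
def toCube {n : ℕ} (x : Fin n → ℝ) : Fin n → unitInterval :=
  fun i => projIcc 0 1 zero_le_one ((x i + 1) / 2)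

/-- The identification of `[0, 1]ⁿ` with `[-1, 1]ⁿ`. -/
def ofCube {n : ℕ} (y : Fin n → unitInterval) : Fin n → ℝ := fun i => 2 * (y i : ℝ) - 1

lemma continuous_toCube {n : ℕ} : Continuous (toCube (n := n)) := by
  have hp : Continuous (projIcc (0 : ℝ) 1 zero_le_one) := continuous_projIcc
  unfold toCube
  fun_prop

lemma continuous_ofCube {n : ℕ} : Continuous (ofCube (n := n)) := by
  unfold ofCube
  fun_prop

@[simp] lemma toCube_ofCube {n : ℕ} (y : Fin n → unitInterval) : toCube (ofCube y) = y := by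
  funext i
  have : ((2 * (y i : ℝ) - 1) + 1) / 2 = y i := by ring
  simp [toCube, ofCube]

lemma abs_le_one_of_mem {n : ℕ} {x : Fin n → ℝ} (hx : x ∈ closedBall (0 : Fin n → ℝ) 1)
    (i : Fin n) : |x i| ≤ 1 :=
  (norm_le_pi_norm x i).trans (by simpa using hx)

lemma ofCube_toCube {n : ℕ} {x : Fin n → ℝ} (hx : x ∈ closedBall (0 : Fin n → ℝ) 1) :
    ofCube (toCube x) = x := by
  funext i
  have := abs_le.1 (abs_le_one_of_mem hx i)
  have h : (x i + 1) / 2 ∈ Icc (0 : ℝ) 1 := ⟨by linarith [this.1], by linarith [this.2]⟩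
  simp only [ofCube, toCube, projIcc_of_mem zero_le_one h]
  ring

lemma ofCube_mem {n : ℕ} (y : Fin n → unitInterval) : ofCube y ∈ closedBall (0 : Fin n → ℝ) 1 := by
  rw [mem_closedBall_zero_iff, pi_norm_le_iff_of_nonneg zero_le_one]
  intro i
  rw [Real.norm_eq_abs, abs_le]
  constructor <;> simp only [ofCube] <;> linarith [(y i).2.1, (y i).2.2]

lemma ofCube_mem_sphere {n : ℕ} {y : Fin n → unitInterval} (hy : y ∈ Cube.boundary (Fin n)) :
    ofCube y ∈ sphere (0 : Fin n → ℝ) 1 := by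
  have h := ofCube_mem y
  rw [mem_closedBall_zero_iff] at h
  rw [mem_sphere_zero_iff_norm]
  obtain ⟨i, hi⟩ := hy
  refine le_antisymm h ((le_of_eq ?_).trans (norm_le_pi_norm _ i))
  rcases hi with hi | hi <;> (simp [ofCube, hi]; try norm_num)

lemma toCube_mem_boundary {n : ℕ} {x : Fin n → ℝ} (hx : x ∈ sphere (0 : Fin n → ℝ) 1) :
    toCube x ∈ Cube.boundary (Fin n) := by
  by_contra h
  have h1 : ∀ i, |x i| < 1 := fun i => by
    refine lt_of_le_of_ne (abs_le_one_of_mem (sphere_sub hx) i) fun hi => h ⟨i, ?_⟩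
    rcases (abs_eq zero_le_one).1 hi with hi | hi
    · right; simp [toCube, hi]
    · left; simp [toCube, hi]
  have : ‖x‖ < 1 := (pi_norm_lt_iff zero_lt_one).2 h1
  rw [mem_sphere_zero_iff_norm] at hx
  exact this.ne hx

lemma genLoop_toCube {n : ℕ} {x : X} (p : GenLoop (Fin n) X x) {z : Fin n → ℝ}
    (hz : z ∈ sphere (0 : Fin n → ℝ) 1) : p (toCube z) = x :=
  p.2 _ (toCube_mem_boundary hz)

/-- The based loop given by a map of the ball that is constant on the sphere. -/
def genLoopOfBall {n : ℕ} {x : X} (a : (Fin n → ℝ) → X) (ha : ContinuousOn a (closedBall 0 1))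
    (hax : ∀ z ∈ sphere (0 : Fin n → ℝ) 1, a z = x) : GenLoop (Fin n) X x :=
  ⟨⟨fun y => a (ofCube y), ha.comp_continuous continuous_ofCube ofCube_mem⟩,
    fun _ hy => hax _ (ofCube_mem_sphere hy)⟩

/-- The sup-norm ball is the cube `[-1, 1]ⁿ`, so rescaling turns homotopies of based loops into
homotopies over the ball that are constant on the sphere. -/
lemma genLoop_homotopic_iff {n : ℕ} {x : X} (p q : GenLoop (Fin n) X x) :
    GenLoop.Homotopic p q ↔ ∃ K : (Fin n → ℝ) × ℝ → X, ContinuousOn K (closedBall 0 1 ×ˢ Icc 0 1) ∧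
      (∀ z ∈ closedBall (0 : Fin n → ℝ) 1, K (z, 0) = p (toCube z)) ∧
      (∀ z ∈ closedBall (0 : Fin n → ℝ) 1, K (z, 1) = q (toCube z)) ∧
      ∀ z ∈ sphere (0 : Fin n → ℝ) 1, ∀ t ∈ Icc (0 : ℝ) 1, K (z, t) = x := by
  constructor
  · rintro ⟨F⟩
    have hp : Continuous (projIcc (0 : ℝ) 1 zero_le_one) := continuous_projIcc
    have hc := continuous_toCube (n := n)
    refine ⟨fun z => F (projIcc 0 1 zero_le_one z.2, toCube z.1), ?_, fun z hz => ?_, fun z hz => ?_,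
      fun z hz t ht => ?_⟩
    · exact (F.continuous.comp (by fun_prop)).continuousOn
    · simp
    · simp
    · exact (F.eq_fst _ (toCube_mem_boundary hz)).trans (genLoop_toCube p hz)
  · rintro ⟨K, h1, h2, h3, h4⟩
    refine ⟨⟨⟨⟨fun z => K (ofCube z.2, z.1), ?_⟩, fun y => ?_, fun y => ?_⟩, fun t y hy => ?_⟩⟩
    · have hc := continuous_ofCube (n := n)
      exact h1.comp_continuous (by fun_prop) fun z => ⟨ofCube_mem _, z.1.2⟩
    · simpa using h2 _ (ofCube_mem y)
    · simpa using h3 _ (ofCube_mem y)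
    · exact (h4 _ (ofCube_mem_sphere hy) _ t.2).trans (p.2 y hy).symm

lemma piMap_mk (f : C(X, Y)) (n : ℕ) (x : X) (p : GenLoop (Fin n) X x) :
    piMap f n x ⟦p⟧ = ⟦genLoopMap f n x p⟧ := rfl

lemma WeakEquiv.surjective_piMap {f : C(X, Y)} (h : WeakEquiv f) (n : ℕ) (x : X) :
    Function.Surjective (piMap f n x) := by
  intro q
  induction q using Quotient.inductionOn with | _ q
  obtain ⟨a', H, h1, h2, h3, h4, h5, h6⟩ := h.compresses n (fun _ => x) (fun z => q (toCube z))
    continuousOn_const (q.1.continuous.comp continuous_toCube).continuousOn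
    (fun z hz => (genLoop_toCube q hz).symm)
  refine ⟨⟦genLoopOfBall a' h1 fun z hz => h2 hz⟧, ?_⟩
  rw [piMap_mk]
  refine Quotient.sound ((genLoop_homotopic_iff _ _).2 ⟨H, h3, fun z hz => ?_, h5, fun z hz t ht => ?_⟩)
  · rw [h4 z hz]
    change _ = f (a' (ofCube (toCube z)))
    rw [ofCube_toCube hz]
  · exact (h6 z hz t ht).trans (genLoop_toCube q hz)

lemma WeakEquiv.injective_piMap {f : C(X, Y)} (h : WeakEquiv f) (n : ℕ) (x : X) :
    Function.Injective (piMap f n x) := by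
  intro p q
  induction p using Quotient.inductionOn with | _ p
  induction q using Quotient.inductionOn with | _ q
  intro hpq
  obtain ⟨H, h1, h2, h3, h4⟩ := (genLoop_homotopic_iff _ _).1 (Quotient.exact hpq)
  obtain ⟨K, k1, k2, k3, k4⟩ := (h.compressesDiscs_prod n).lift_homotopy
    (p := fun z => p (toCube z)) (q := fun z => q (toCube z))
    (p.1.continuous.comp continuous_toCube).continuousOn
    (q.1.continuous.comp continuous_toCube).continuousOn
    (fun z hz => (genLoop_toCube p hz).trans (genLoop_toCube q hz).symm) h1 h2 h3
    (fun z hz t ht => (h4 z hz t ht).trans (congrArg f (genLoop_toCube q hz)).symm)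
  exact Quotient.sound ((genLoop_homotopic_iff _ _).2 ⟨K, k1, k2, k3, fun z hz t ht =>
    (k4 z hz t ht).trans (genLoop_toCube q hz)⟩)

lemma joined_of_continuousOn {γ : ℝ → X} (h : ContinuousOn γ (Icc 0 1)) : Joined (γ 0) (γ 1) :=
  ⟨⟨⟨fun t => γ t, h.comp_continuous continuous_subtype_val fun t => t.2⟩, by simp, by simp⟩⟩

lemma WeakEquiv.isWeakHomotopyEquiv {f : C(X, Y)} (h : WeakEquiv f) : IsWeakHomotopyEquiv f where
  bijective_pi0 := by
    constructor
    · intro p q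
      induction p using Quotient.inductionOn with | _ p
      induction q using Quotient.inductionOn with | _ q
      intro hpq
      obtain ⟨γ⟩ : Joined (f p) (f q) := Quotient.exact hpq
      obtain ⟨K, k1, k2, k3, k4⟩ := (h.compressesDiscs_prod 0).lift_homotopy
        (p := fun _ => p) (q := fun _ => q) (H := fun z => γ.extend z.2) continuousOn_const
        continuousOn_const (fun z hz => (notMem_sphere_fin_zero hz).elim)
        (γ.continuous_extend.comp continuous_snd).continuousOn (fun z hz => by simp)
        (fun z hz => by simp) (fun z hz => (notMem_sphere_fin_zero hz).elim)
      have := joined_of_continuousOn (γ := fun t => K (0, t))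
        (k1.comp (by fun_prop) fun t ht => ⟨closedBall_fin_zero, ht⟩)
      simp only [k2 0 closedBall_fin_zero, k3 0 closedBall_fin_zero] at this
      exact Quotient.sound this
    · intro q
      induction q using Quotient.inductionOn with | _ q
      have := h.nonempty ⟨q⟩
      obtain ⟨x, γ, h1, h2, h3⟩ := (h.compresses 0).exists_path q
      have := joined_of_continuousOn h1
      rw [h2, h3] at this
      exact ⟨⟦x⟧, Quotient.sound this⟩
  bijective_pi n x := ⟨h.injective_piMap _ x, h.surjective_piMap _ x⟩

/-- This is surjectivity on `π_n`: a disc with constant boundary is a based loop of the target, and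
a homotopy to the image of a loop is a compression. -/
lemma IsWeakHomotopyEquiv.compressible_const {f : C(X, Y)} (h : IsWeakHomotopyEquiv f) (n : ℕ)
    (x : X) {b : (Fin n → ℝ) → Y} (hb : ContinuousOn b (closedBall 0 1))
    (hbx : ∀ z ∈ sphere (0 : Fin n → ℝ) 1, b z = f x) : Compressible f (fun _ => x) b := by
  cases n with
  | zero =>
    obtain ⟨x', hx'⟩ := h.bijective_pi0.2 ⟦b 0⟧
    induction x' using Quotient.inductionOn with | _ x'
    obtain ⟨γ⟩ : Joined (f x') (b 0) := Quotient.exact hx'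
    exact ⟨fun _ => x', fun z => γ.extend z.2, continuousOn_const,
      fun z hz => (notMem_sphere_fin_zero hz).elim,
      (γ.continuous_extend.comp continuous_snd).continuousOn, fun z hz => by simp,
      fun z hz => by simp [Subsingleton.elim z 0], fun z hz => (notMem_sphere_fin_zero hz).elim⟩
  | succ n =>
    obtain ⟨p, hp⟩ := (h.bijective_pi n x).2 ⟦genLoopOfBall b hb hbx⟧
    induction p using Quotient.inductionOn with | _ p
    rw [piMap_mk] at hp
    obtain ⟨K, k1, k2, k3, k4⟩ := (genLoop_homotopic_iff _ _).1 (Quotient.exact hp)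
    refine ⟨fun z => p (toCube z), K, (p.1.continuous.comp continuous_toCube).continuousOn,
      fun z hz => genLoop_toCube p hz, k1, k2, fun z hz => (k3 z hz).trans ?_,
      fun z hz t ht => (k4 z hz t ht).trans (hbx z hz).symm⟩
    exact congrArg b (ofCube_toCube hz)

/-- This is injectivity on `π_n`, applied to a loop and the constant loop. -/
lemma IsWeakHomotopyEquiv.exists_nullhomotopy {f : C(X, Y)} (h : IsWeakHomotopyEquiv f) (n : ℕ)
    (x : X) {a : (Fin n → ℝ) → X} (ha : ContinuousOn a (closedBall 0 1))
    (hax : ∀ z ∈ sphere (0 : Fin n → ℝ) 1, a z = x) {H : (Fin n → ℝ) × ℝ → Y}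
    (hH : ContinuousOn H (closedBall 0 1 ×ˢ Icc 0 1))
    (hH0 : ∀ z ∈ closedBall (0 : Fin n → ℝ) 1, H (z, 0) = f (a z))
    (hH1 : ∀ z ∈ closedBall (0 : Fin n → ℝ) 1, H (z, 1) = f x)
    (hHs : ∀ z ∈ sphere (0 : Fin n → ℝ) 1, ∀ t ∈ Icc (0 : ℝ) 1, H (z, t) = f x) :
    ∃ K : (Fin n → ℝ) × ℝ → X, ContinuousOn K (closedBall 0 1 ×ˢ Icc 0 1) ∧
      (∀ z ∈ closedBall (0 : Fin n → ℝ) 1, K (z, 0) = a z) ∧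
      (∀ z ∈ closedBall (0 : Fin n → ℝ) 1, K (z, 1) = x) ∧
      ∀ z ∈ sphere (0 : Fin n → ℝ) 1, ∀ t ∈ Icc (0 : ℝ) 1, K (z, t) = x := by
  cases n with
  | zero =>
    have hj : Joined (f (a 0)) (f x) := by
      have := joined_of_continuousOn (γ := fun t => H (0, t))
        (hH.comp (by fun_prop) fun t ht => ⟨closedBall_fin_zero, ht⟩)
      simpa only [hH0 0 closedBall_fin_zero, hH1 0 closedBall_fin_zero] using this
    obtain ⟨γ⟩ : Joined (a 0) x := Quotient.exact
      (h.bijective_pi0.1 (show pi0Map f ⟦a 0⟧ = pi0Map f ⟦x⟧ from Quotient.sound hj))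
    exact ⟨fun z => γ.extend z.2, (γ.continuous_extend.comp continuous_snd).continuousOn,
      fun z hz => by simp [Subsingleton.elim z 0], fun z hz => by simp,
      fun z hz => (notMem_sphere_fin_zero hz).elim⟩
  | succ n =>
    have hp : piMap f (n + 1) x ⟦genLoopOfBall a ha hax⟧ = piMap f (n + 1) x ⟦GenLoop.const⟧ := by
      rw [piMap_mk, piMap_mk]
      refine Quotient.sound ((genLoop_homotopic_iff _ _).2 ⟨H, hH, fun z hz => ?_, hH1, hHs⟩)
      refine (hH0 z hz).trans (congrArg (fun y => f (a y)) (ofCube_toCube hz).symm)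
    obtain ⟨K, k1, k2, k3, k4⟩ := (genLoop_homotopic_iff _ _).1
      (Quotient.exact ((h.bijective_pi n x).1 hp))
    exact ⟨K, k1, fun z hz => (k2 z hz).trans (congrArg a (ofCube_toCube hz)), k3, k4⟩

/-- After a deformation the boundary lift is constant outside the top face, and so is a based loop
there. The disc in the target shows that the image of this loop is null, so by injectivity the loop
is null in `X`. The nullhomotopy fills the sphere, which is therefore contractible to a point in
`X`, and for constant boundary surjectivity suffices. -/
lemma IsWeakHomotopyEquiv.weakEquiv {f : C(X, Y)} (h : IsWeakHomotopyEquiv f) : WeakEquiv f where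
  continuous := f.continuous
  nonempty := fun ⟨y⟩ => by
    obtain ⟨x', -⟩ := h.bijective_pi0.2 ⟦y⟧
    induction x' using Quotient.inductionOn with | _ x'
    exact ⟨x'⟩
  compresses n := by
    cases n with
    | zero =>
      intro a b ha hb hab
      exact (h.compressible_const 0 (a 0) hb fun z hz => (notMem_sphere_fin_zero hz).elim).congr
        (fun z hz => (notMem_sphere_fin_zero hz).elim) fun z hz => rfl
    | succ n =>
      refine CompressesDiscs.of_homeomorph (E := (Fin n → ℝ) × ℝ) ?_ (finConsHomeomorph n).symm
        (fun x => by rw [← norm_finConsHomeomorph, Homeomorph.apply_symm_apply])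
      have one_mem : (1 : ℝ) ∈ Icc (0 : ℝ) 1 := by simp
      intro a b ha hb hab
      obtain ⟨A, hA, hA0, hA1⟩ := exists_homotopy_const_boxBoundary ha
      refine .of_homotopic f.continuous hb hab hA hA0 fun b₁ hb₁ hab₁ => ?_
      set x := a (0, -1)
      have htop : ∀ {y : Fin n → ℝ}, y ∈ closedBall 0 1 →
          ((y, 1) : (Fin n → ℝ) × ℝ) ∈ sphere (0 : (Fin n → ℝ) × ℝ) 1 :=
        fun hy => sphere_prod_of_right hy (Or.inl rfl)
      have htopJ : ∀ {y : Fin n → ℝ}, y ∈ sphere (0 : Fin n → ℝ) 1 →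
          ((y, 1) : (Fin n → ℝ) × ℝ) ∈ boxBoundary (Fin n → ℝ) :=
        fun hy => Or.inl ⟨hy, by simp⟩
      have hb₁J : ∀ z ∈ boxBoundary (Fin n → ℝ), b₁ z = f x := fun z hz => by
        rw [← hab₁ z (boxBoundary_subset hz), hA1 z hz]
      -- The disc `b₁`, read from its top face at height 1 down to its bottom at height -1, is the
      -- nullhomotopy in the target.
      obtain ⟨K, k1, k2, k3, k4⟩ := h.exists_nullhomotopy n x (a := fun y => A ((y, 1), 1))
        (H := fun z => b₁ (z.1, 1 - 2 * z.2))
        (hA.comp (by fun_prop) fun y hy => ⟨htop hy, one_mem⟩)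
        (fun y hy => hA1 _ (htopJ hy))
        (hb₁.comp (by fun_prop) fun z hz => mem_closedBall_prod.2
          ⟨hz.1, by linarith [hz.2.2], by linarith [hz.2.1]⟩)
        (fun y hy => by simpa using (hab₁ _ (htop hy)).symm)
        (fun y hy => hb₁J _ (Or.inr ⟨hy, by norm_num⟩))
        (fun y hy t ht => hb₁J _ (Or.inl ⟨hy, by linarith [ht.2], by linarith [ht.1]⟩))
      set β : (Fin n → ℝ) × ℝ → X := fun z => K (z.1, (1 - z.2) / 2) with hβ
      have hβc : ContinuousOn β (closedBall 0 1) := k1.comp (by fun_prop) fun z hz => by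
        obtain ⟨h1, h2⟩ := mem_closedBall_prod.1 hz
        exact ⟨h1, by linarith [h2.2], by linarith [h2.1]⟩
      have hβA : ∀ z ∈ sphere (0 : (Fin n → ℝ) × ℝ) 1, β z = A (z, 1) := by
        rintro ⟨y, s⟩ hz
        rcases mem_sphere_prod hz with ⟨hy, rfl⟩ | ⟨hy, rfl⟩ | ⟨hy, hs⟩
        · rw [hA1 (y, -1) (Or.inr ⟨hy, rfl⟩)]
          simp only [hβ]
          norm_num [k3 y hy]
        · simpa [hβ] using k2 y hy
        · rw [hA1 _ (Or.inl ⟨hy, hs⟩)]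
          exact k4 y hy _ ⟨by linarith [hs.2], by linarith [hs.1]⟩
      -- As `β` extends the lift over the whole ball, shrinking the radius to 0 deforms the lift to
      -- the constant `β 0`.
      refine .of_homotopic (A := fun z => β ((1 - z.2) • z.1)) f.continuous hb₁ hab₁
        (hβc.comp (by fun_prop) ?_) (fun z hz => by simp [hβA z hz]) fun b₂ hb₂ hab₂ => ?_
      · rintro ⟨z, t⟩ ⟨hz, ht⟩
        rw [mem_sphere_zero_iff_norm] at hz
        rw [mem_closedBall_zero_iff, norm_smul, hz, mul_one, Real.norm_eq_abs, abs_le]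
        exact ⟨by linarith [ht.2], by linarith [ht.1]⟩
      · simp only [sub_self, zero_smul] at hab₂ ⊢
        refine .of_homeomorph (finConsHomeomorph n) (norm_finConsHomeomorph n)
          (h.compressible_const (n + 1) (β 0) (hb₂.comp (finConsHomeomorph n).symm.continuous.continuousOn
            fun z hz => ?_) fun z hz => (hab₂ _ ?_).symm)
        · simpa [← norm_finConsHomeomorph] using hz
        · simpa [← norm_finConsHomeomorph] using hz

lemma isWeakHomotopyEquiv_iff {f : C(X, Y)} : IsWeakHomotopyEquiv f ↔ WeakEquiv f :=
  ⟨IsWeakHomotopyEquiv.weakEquiv, WeakEquiv.isWeakHomotopyEquiv⟩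

end HomotopyGroups

/-! ### Weak equivalences are local on the target -/

section LocalToGlobal

open Metric Set

variable {E E' : Type*} [TopologicalSpace E] [TopologicalSpace E']
variable {X : Type*} {Y : Type*} [TopologicalSpace X] [TopologicalSpace Y]

/-- The homotopy extension and lifting problem for the pair `(K, L)`, where the homotopy at `p` is
controlled by `O p`. -/
def Solvable (f : X → Y) (O : E → Set Y) (K L : Set E) : Prop :=
  ∀ (a : E → X) (h : E × ℝ → Y), ContinuousOn a L →
    ContinuousOn h (L ×ˢ Icc 0 1 ∪ K ×ˢ {1}) → (∀ p ∈ L, h (p, 0) = f (a p)) →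
    (∀ p ∈ K, h (p, 1) ∈ O p) → (∀ p ∈ L, ∀ t ∈ Icc (0 : ℝ) 1, h (p, t) ∈ O p) →
    ∃ (a' : E → X) (h' : E × ℝ → Y), ContinuousOn a' K ∧ EqOn a' a L ∧
      ContinuousOn h' (K ×ˢ Icc 0 1) ∧ EqOn h' h (L ×ˢ Icc 0 1 ∪ K ×ˢ {1}) ∧
      (∀ p ∈ K, h' (p, 0) = f (a' p)) ∧ ∀ p ∈ K, ∀ t ∈ Icc (0 : ℝ) 1, h' (p, t) ∈ O p

lemma Solvable.trans {f : X → Y} {O : E → Set Y} {K₂ K₁ L : Set E} (hK₁ : IsClosed K₁)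
    (hK₂ : IsClosed K₂) (hLK : L ⊆ K₁) (hK : K₁ ⊆ K₂) (h₁ : Solvable f O K₁ L)
    (h₂ : Solvable f O K₂ K₁) : Solvable f O K₂ L := by
  classical
  intro a h ha hh hah hO hOL
  obtain ⟨a₁, h₁, b1, b2, b3, b4, b5, b6⟩ := h₁ a h ha
    (hh.mono (union_subset_union_right _ (prod_mono hK subset_rfl))) hah (fun p hp => hO p (hK hp))
    hOL
  set g : E × ℝ → Y := fun z => if z.1 ∈ K₁ then h₁ z else h z with hg
  have e1 : EqOn g h₁ (K₁ ×ˢ Icc 0 1) := fun z hz => if_pos hz.1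
  have e2 : EqOn g h (K₂ ×ˢ {1}) := by
    intro z hz
    simp only [hg]
    split_ifs with h'
    · exact b4 (Or.inr ⟨h', hz.2⟩)
    · rfl
  obtain ⟨a₂, h₂, c1, c2, c3, c4, c5, c6⟩ := h₂ a₁ g b1
    (ContinuousOn.union_of_isClosed (b3.congr e1)
      ((hh.mono subset_union_right).congr e2) (hK₁.prod isClosed_Icc)
      (hK₂.prod isClosed_singleton))
    (fun p hp => (e1 (x := (p, 0)) ⟨hp, by simp⟩).trans (b5 p hp))
    (fun p hp => by rw [e2 (x := (p, 1)) ⟨hp, rfl⟩]; exact hO p hp)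
    (fun p hp t ht => by rw [e1 (x := (p, t)) ⟨hp, ht⟩]; exact b6 p hp t ht)
  refine ⟨a₂, h₂, c1, (c2.mono hLK).trans b2, c3, ?_, c5, c6⟩
  rintro ⟨p, t⟩ (⟨hp, ht⟩ | hp)
  · rw [c4 (Or.inl ⟨hLK hp, ht⟩), e1 ⟨hLK hp, ht⟩, b4 (Or.inl ⟨hp, ht⟩)]
  · rw [c4 (Or.inr hp), e2 hp]

/-- Over `L` the data are already a solution, so a solution over `K` relative to the overlap glues
with them. -/
lemma Solvable.excision {f : X → Y} {O : E → Set Y} {K L : Set E} (hK : IsClosed K)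
    (hL : IsClosed L) (h : Solvable f O K (K ∩ L)) : Solvable f O (K ∪ L) L := by
  classical
  intro a g ha hg hag hO hOL
  obtain ⟨a₁, h₁, b1, b2, b3, b4, b5, b6⟩ := h a g (ha.mono inter_subset_right)
    (hg.mono (union_subset_union (prod_mono inter_subset_right subset_rfl)
      (prod_mono subset_union_left subset_rfl))) (fun p hp => hag p hp.2)
    (fun p hp => hO p (Or.inl hp)) (fun p hp => hOL p hp.2)
  have e1 : EqOn (fun p => if p ∈ K then a₁ p else a p) a L := by
    intro p hp
    simp only
    split_ifs with h'
    · exact b2 ⟨h', hp⟩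
    · rfl
  have e2 : EqOn (fun p => if p ∈ K then a₁ p else a p) a₁ K := fun p hp => if_pos hp
  have e3 : EqOn (fun z : E × ℝ => if z.1 ∈ K then h₁ z else g z) g (L ×ˢ Icc 0 1) := by
    intro z hz
    simp only
    split_ifs with h'
    · exact b4 (Or.inl ⟨⟨h', hz.1⟩, hz.2⟩)
    · rfl
  have e4 : EqOn (fun z : E × ℝ => if z.1 ∈ K then h₁ z else g z) h₁ (K ×ˢ Icc 0 1) :=
    fun z hz => if_pos hz.1
  refine ⟨_, fun z => if z.1 ∈ K then h₁ z else g z,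
    ContinuousOn.union_of_isClosed (b1.congr e2) (ha.congr e1) hK hL, e1, ?_, ?_, ?_, ?_⟩
  · rw [union_prod]
    exact ContinuousOn.union_of_isClosed (b3.congr e4) ((hg.mono subset_union_left).congr e3)
      (hK.prod isClosed_Icc) (hL.prod isClosed_Icc)
  · rintro z (hz | hz)
    · exact e3 hz
    · simp only
      split_ifs with h'
      · exact b4 (Or.inr ⟨h', hz.2⟩)
      · rfl
  · intro p hp
    by_cases h' : p ∈ K
    · simp [h', b5 p h']
    · simp [h', hag p (hp.resolve_left h')]
  · intro p hp t ht
    by_cases h' : p ∈ K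
    · simpa [h'] using b6 p h' t ht
    · simpa [h'] using hOL p (hp.resolve_left h') t ht

lemma Solvable.transport {f : X → Y} {O : E → Set Y} {K L : Set E} {K' L' : Set E'} {e : E' → E}
    {g : E → E'} (he : Continuous e) (hg : Continuous g) (heK : MapsTo e K' K)
    (heL : MapsTo e L' L) (hgK : MapsTo g K K') (hgL : MapsTo g L L') (hLK : L ⊆ K)
    (heg : ∀ p ∈ K, e (g p) = p) (h : Solvable f (fun p => O (e p)) K' L') : Solvable f O K L := by
  intro a k ha hk hak hO hOL
  have hc : Continuous fun z : E' × ℝ => (e z.1, z.2) := by fun_prop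
  have hc' : Continuous fun z : E × ℝ => (g z.1, z.2) := by fun_prop
  obtain ⟨a₁, h₁, b1, b2, b3, b4, b5, b6⟩ := h (a ∘ e) (fun z => k (e z.1, z.2))
    (ha.comp he.continuousOn heL) (hk.comp hc.continuousOn (by
      rintro ⟨p, t⟩ (⟨hp, ht⟩ | ⟨hp, ht⟩)
      · exact Or.inl ⟨heL hp, ht⟩
      · exact Or.inr ⟨heK hp, ht⟩)) (fun p hp => hak _ (heL hp)) (fun p hp => hO _ (heK hp))
    (fun p hp => hOL _ (heL hp))
  refine ⟨a₁ ∘ g, fun z => h₁ (g z.1, z.2), b1.comp hg.continuousOn hgK, fun p hp => ?_,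
    b3.comp hc'.continuousOn fun z hz => ⟨hgK hz.1, hz.2⟩, ?_, fun p hp => b5 _ (hgK hp),
    fun p hp t ht => ?_⟩
  · simp [b2 (hgL hp), heg p (hLK hp)]
  · rintro ⟨p, t⟩ (⟨hp, ht⟩ | ⟨hp, ht⟩)
    · simpa [heg p (hLK hp)] using b4 (x := (g p, t)) (Or.inl ⟨hgL hp, ht⟩)
    · simpa [heg p hp] using b4 (x := (g p, t)) (Or.inr ⟨hgK hp, ht⟩)
  · simpa [heg p hp] using b6 _ (hgK hp) t ht

/-- Over `L` the control is part of the data. Elsewhere in `K` it follows from the constant control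
`U`, which is contained in `O p` there. -/
lemma Solvable.control {f : X → Y} {O : E → Set Y} {U : Set Y} {K L : Set E} (hLK : L ⊆ K)
    (hOU : ∀ p ∈ K, O p ⊆ U) (hUO : ∀ p ∈ K, p ∉ L → U ⊆ O p)
    (h : Solvable f (fun _ => U) K L) : Solvable f O K L := by
  intro a k ha hk hak hO hOL
  obtain ⟨a₁, h₁, b1, b2, b3, b4, b5, b6⟩ := h a k ha hk hak (fun p hp => hOU p hp (hO p hp))
    (fun p hp t ht => hOU p (hLK hp) (hOL p hp t ht))
  refine ⟨a₁, h₁, b1, b2, b3, b4, b5, fun p hp t ht => ?_⟩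
  by_cases hpL : p ∈ L
  · rw [b4 (Or.inl ⟨hpL, ht⟩)]; exact hOL p hpL t ht
  · exact hUO p hp hpL (b6 p hp t ht)

/-- When the control is one set `U`, the whole problem takes place over `U`, where the restricted
map has the homotopy extension and lifting property. -/
lemma solvable_ball_of_weakEquiv {ι : Type*} [Fintype ι] {f : X → Y} {U : Set Y}
    (hU : WeakEquiv (U.restrictPreimage f)) :
    Solvable f (fun _ => U) (closedBall (0 : ι → ℝ) 1) (sphere 0 1) := by
  classical
  intro a k ha hk hak hO hOL
  have zero_mem : (0 : ℝ) ∈ Icc (0 : ℝ) 1 := by simp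
  have hk0 : k (0, 1) ∈ U := hO 0 (by simp)
  obtain ⟨x₀⟩ := hU.nonempty ⟨⟨_, hk0⟩⟩
  set a₁ : (ι → ℝ) → f ⁻¹' U := fun p => if hp : a p ∈ f ⁻¹' U then ⟨a p, hp⟩ else x₀ with ha₁
  set k₁ : (ι → ℝ) × ℝ → U := fun z => if hz : k z ∈ U then ⟨k z, hz⟩ else ⟨_, hk0⟩ with hk₁
  have ea : EqOn (fun p => (a₁ p : X)) a (sphere 0 1) := fun p hp => by
    have : a p ∈ f ⁻¹' U := by
      rw [mem_preimage, ← hak p hp]; exact hOL p hp 0 zero_mem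
    simp only [ha₁, dif_pos this]
  have ek : EqOn (fun z => (k₁ z : Y)) k (sphere 0 1 ×ˢ Icc 0 1 ∪ closedBall 0 1 ×ˢ {1}) := by
    rintro ⟨p, t⟩ hz
    have : k (p, t) ∈ U := by
      rcases hz with ⟨hp, ht⟩ | ⟨hp, ht⟩
      · exact hOL p hp t ht
      · simp only [mem_singleton_iff] at ht
        subst ht
        exact hO p hp
    simp only [hk₁, dif_pos this]
  obtain ⟨a', h', b1, b2, b3, b4, b5⟩ := (hU.compressesDiscs ι).lift (a := a₁) (h₀ := k₁)
    (Topology.IsEmbedding.subtypeVal.continuousOn_iff.2 (ha.congr ea))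
    (Topology.IsEmbedding.subtypeVal.continuousOn_iff.2 (hk.congr ek))
    (fun p hp => Subtype.ext (by
      have h1 := ea hp
      have h2 := ek (x := (p, 0)) (Or.inl ⟨hp, zero_mem⟩)
      simp only at h1 h2
      rw [h2, hak p hp, restrictPreimage_coe, h1]))
  refine ⟨fun p => a' p, fun z => h' z, continuous_subtype_val.comp_continuousOn b1, fun p hp => ?_,
    continuous_subtype_val.comp_continuousOn b3, fun z hz => ?_, fun p hp => ?_,
    fun p hp t ht => (h' (p, t)).2⟩
  · simp only [b2 hp]; exact ea hp
  · simp only [b4 hz]; exact ek hz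
  · simp [b5 p hp]

lemma mem_sphere_pi_iff {ι : Type*} [Fintype ι] {x : ι → ℝ} :
    x ∈ sphere (0 : ι → ℝ) 1 ↔ (∀ i, |x i| ≤ 1) ∧ ∃ i, |x i| = 1 := by
  rw [mem_sphere_zero_iff_norm]
  constructor
  · intro h
    have h1 : ∀ i, |x i| ≤ 1 := fun i => (norm_le_pi_norm x i).trans h.le
    refine ⟨h1, ?_⟩
    by_contra! hne
    exact ((pi_norm_lt_iff zero_lt_one).2 fun i => lt_of_le_of_ne (h1 i) (hne i)).ne h
  · rintro ⟨h1, i, hi⟩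
    exact le_antisymm ((pi_norm_le_iff_of_nonneg zero_le_one).2 h1) (hi.ge.trans (norm_le_pi_norm x i))

lemma mem_closedBall_pi_iff {ι : Type*} [Fintype ι] {x : ι → ℝ} :
    x ∈ closedBall (0 : ι → ℝ) 1 ↔ ∀ i, |x i| ≤ 1 := by
  rw [mem_closedBall_zero_iff, pi_norm_le_iff_of_nonneg zero_le_one]
  rfl

variable {n : ℕ}

/-- The box with integral corners `lo` and `hi`. -/
def intBox (lo hi : Fin n → ℤ) : Set (Fin n → ℝ) := {p | ∀ i, (lo i : ℝ) ≤ p i ∧ p i ≤ hi i}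

/-- The relative boundary of a box. -/
def intBoxBoundary (lo hi : Fin n → ℤ) : Set (Fin n → ℝ) :=
  {p | p ∈ intBox lo hi ∧ ∃ i, lo i < hi i ∧ (p i = lo i ∨ p i = hi i)}

lemma isClosed_intBox (lo hi : Fin n → ℤ) : IsClosed (intBox lo hi) := by
  have : intBox lo hi = ⋂ i, {p : Fin n → ℝ | (lo i : ℝ) ≤ p i} ∩ {p | p i ≤ (hi i : ℝ)} := by
    ext p; simp [intBox]
  rw [this]
  exact isClosed_iInter fun i => (isClosed_le (by fun_prop) (by fun_prop)).inter
    (isClosed_le (by fun_prop) (by fun_prop))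

lemma isClosed_intBoxBoundary (lo hi : Fin n → ℤ) : IsClosed (intBoxBoundary lo hi) := by
  have : intBoxBoundary lo hi = intBox lo hi ∩
      ⋃ i : {i // lo i < hi i}, ({p | p i = (lo i : ℝ)} ∪ {p | p i = (hi i : ℝ)}) := by
    ext p; simp [intBoxBoundary]
  rw [this]
  exact (isClosed_intBox lo hi).inter (isClosed_iUnion_of_finite fun i =>
    (isClosed_eq (by fun_prop) (by fun_prop)).union (isClosed_eq (by fun_prop) (by fun_prop)))

lemma solvable_unit_intBox {f : X → Y} {U : Set Y} (hU : WeakEquiv (U.restrictPreimage f))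
    {lo hi : Fin n → ℤ} (h1 : ∀ i, lo i ≤ hi i) (h2 : ∀ i, hi i ≤ lo i + 1) :
    Solvable f (fun _ => U) (intBox lo hi) (intBoxBoundary lo hi) := by
  classical
  have hhi : ∀ {i}, lo i < hi i → (hi i : ℝ) = lo i + 1 := fun {i} hi' => by
    have : hi i = lo i + 1 := by have := h2 i; omega
    rw [this]; push_cast; ring
  have hhi' : ∀ {i}, ¬ lo i < hi i → (hi i : ℝ) = lo i := fun {i} hi' => by
    have : hi i = lo i := by have := h1 i; omega
    rw [this]
  refine Solvable.transport (E' := {i // lo i < hi i} → ℝ)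
    (e := fun x i => if h : lo i < hi i then lo i + (x ⟨i, h⟩ + 1) / 2 else lo i)
    (g := fun p i => 2 * (p i - lo i) - 1) (K' := closedBall 0 1) (L' := sphere 0 1) ?_ (by fun_prop)
    ?_ ?_ ?_ ?_ (fun p hp => hp.1) ?_ (solvable_ball_of_weakEquiv hU)
  · refine continuous_pi fun i => ?_
    by_cases h : lo i < hi i
    · simp only [dif_pos h]; fun_prop
    · simp only [dif_neg h]; fun_prop
  · intro x hx i
    rw [mem_closedBall_pi_iff] at hx
    by_cases h : lo i < hi i
    · have := abs_le.1 (hx ⟨i, h⟩)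
      simp only [dif_pos h, hhi h]
      constructor <;> linarith
    · simp [dif_neg h, hhi' h]
  · intro x hx
    obtain ⟨hx, ⟨i, hi'⟩, hxi⟩ := mem_sphere_pi_iff.1 hx
    refine ⟨fun i => ?_, i, hi', ?_⟩
    · by_cases h : lo i < hi i
      · have := abs_le.1 (hx ⟨i, h⟩)
        simp only [dif_pos h, hhi h]
        constructor <;> linarith
      · simp [dif_neg h, hhi' h]
    · simp only [dif_pos hi', hhi hi']
      rcases (abs_eq zero_le_one).1 hxi with h | h
      · right; rw [h]; ring
      · left; rw [h]; ring
  · intro p hp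
    rw [mem_closedBall_pi_iff]
    rintro ⟨i, hi'⟩
    have := hp i
    rw [hhi hi'] at this
    rw [abs_le]
    constructor <;> linarith [this.1, this.2]
  · rintro p ⟨hp, i, hi', hpi⟩
    rw [mem_sphere_pi_iff]
    refine ⟨?_, ⟨i, hi'⟩, ?_⟩
    · rintro ⟨i, hi'⟩
      have := hp i
      rw [hhi hi'] at this
      rw [abs_le]
      constructor <;> linarith [this.1, this.2]
    · rw [hhi hi'] at hpi
      rcases hpi with h | h
      · simp [h]
      · simp [h]; norm_num
  · intro p hp
    funext i
    by_cases h : lo i < hi i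
    · simp only [dif_pos h]; ring
    · have := hp i
      rw [hhi' h] at this
      simp only [dif_neg h]
      exact le_antisymm this.1 this.2

/-- The control at `p` is the intersection of the sets assigned to all unit cubes containing `p`, so
solutions in neighboring cubes are compatible. On the relative interior of a cell of the cubical
grid these cubes are exactly the ones containing the cell; hence the control there is one finite
intersection, over which `f` is assumed to be a weak equivalence. Larger boxes are cut and handled
by induction on the sum of the edge lengths. -/
lemma solvable_intBox {f : X → Y} {κ : Type*} {U : κ → Set Y}
    (hU : ∀ s : Finset κ, s.Nonempty → WeakEquiv ((⋂ i ∈ s, U i).restrictPreimage f))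
    (c : (Fin n → ℤ) → κ) (N : ℕ) : ∀ (lo hi : Fin n → ℤ), (∀ i, lo i ≤ hi i) →
      ∑ i, (hi i - lo i) = N →
      Solvable f (fun p => {y | ∀ q : Fin n → ℤ, p ∈ intBox q (q + 1) → y ∈ U (c q)})
        (intBox lo hi) (intBoxBoundary lo hi) := by
  classical
  induction N using Nat.strong_induction_on with
  | _ N IH =>
  intro lo hi hle hN
  by_cases hunit : ∀ i, hi i ≤ lo i + 1
  -- These are the unit cubes containing the cell. Their lower corners differ from `lo` by 0 or 1 in
  -- each direction, so there are finitely many.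
  · set Q : Finset (Fin n → ℤ) := (Fintype.piFinset fun i => Finset.Icc (lo i - 1) (lo i)).filter
      fun q => intBox lo hi ⊆ intBox q (q + 1) with hQ
    have hlo : (fun i => (lo i : ℝ)) ∈ intBox lo hi := fun i =>
      ⟨le_rfl, Int.cast_le.2 (hle i)⟩
    have hQmem : ∀ {q}, intBox lo hi ⊆ intBox q (q + 1) → q ∈ Q := fun {q} hq => by
      refine Finset.mem_filter.2 ⟨Fintype.mem_piFinset.2 fun i => Finset.mem_Icc.2 ?_, hq⟩
      have := hq hlo i
      simp only [Pi.add_apply, Pi.one_apply] at this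
      have h1 : q i ≤ lo i := by exact_mod_cast this.1
      have h2 : lo i ≤ q i + 1 := by exact_mod_cast this.2
      omega
    have hQne : Q.Nonempty := ⟨lo, hQmem fun p hp i => ⟨(hp i).1, (hp i).2.trans (by
      have : hi i ≤ (lo + 1) i := hunit i
      exact_mod_cast this)⟩⟩
    refine (solvable_unit_intBox (hU (Q.image c) (hQne.image c)) hle hunit).control
      (fun p hp => hp.1) ?_ ?_
    · intro p hp y hy
      simp only [mem_iInter, Finset.mem_image]
      rintro _ ⟨q, hq, rfl⟩
      exact hy q ((Finset.mem_filter.1 hq).2 hp)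
    -- A point off the relative boundary lies strictly between the integers `lo i` and `hi i` in
    -- each nondegenerate direction, so every unit cube through it contains the whole cell.
    · intro p hp hpb y hy q hpq
      simp only [mem_iInter, Finset.mem_image] at hy
      refine hy _ ⟨q, hQmem fun r hr i => ?_, rfl⟩
      have e1 := hpq i
      simp only [Pi.add_apply, Pi.one_apply] at e1
      have e2 := hp i
      simp only [Pi.add_apply, Pi.one_apply]
      by_cases hi' : lo i < hi i
      · have hlt1 : (lo i : ℝ) < p i := lt_of_le_of_ne e2.1 fun h => hpb ⟨hp, i, hi', Or.inl h.symm⟩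
        have hlt2 : p i < hi i := lt_of_le_of_ne e2.2 fun h => hpb ⟨hp, i, hi', Or.inr h⟩
        have h3 : lo i < q i + 1 := by
          have := hlt1.trans_le e1.2; exact_mod_cast this
        have h4 : q i < hi i := by
          have := e1.1.trans_lt hlt2; exact_mod_cast this
        have h5 : q i = lo i := by have := hunit i; omega
        have h6 : hi i = q i + 1 := by have := hunit i; omega
        have := hr i
        rw [h6, ← h5] at this
        exact this
      · have h3 : hi i = lo i := by have := hle i; omega
        have h4 : p i = lo i := le_antisymm (by rw [← h3]; exact e2.2) e2.1
        have h5 : r i = lo i := le_antisymm (by rw [← h3]; exact (hr i).2) (hr i).1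
        rw [h5, ← h4]
        exact e1
  · push Not at hunit
    obtain ⟨i, hi'⟩ := hunit
    -- The cut is by the hyperplane of height `m` in direction `i`. The slice `M` and the pieces
    -- `B₁`, `B₂` on its two sides all have smaller total edge length.
    set m : ℤ := lo i + 1 with hm
    have hlm : lo i < m := by omega
    have hmh : m < hi i := by omega
    have hlmR : (lo i : ℝ) < m := by exact_mod_cast hlm
    have hmhR : (m : ℝ) < hi i := by exact_mod_cast hmh
    set M := intBox (Function.update lo i m) (Function.update hi i m) with hM
    set B₁ := intBox lo (Function.update hi i m) with hB₁
    set B₂ := intBox (Function.update lo i m) hi with hB₂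
    set L := intBoxBoundary lo hi with hL
    have sum_lt : ∀ lo' hi' : Fin n → ℤ, (∀ j, lo' j ≤ hi' j) → (∀ j, hi' j - lo' j ≤ hi j - lo j) →
        hi' i - lo' i < hi i - lo i →
        Solvable f (fun p => {y | ∀ q : Fin n → ℤ, p ∈ intBox q (q + 1) → y ∈ U (c q)})
          (intBox lo' hi') (intBoxBoundary lo' hi') := by
      intro lo' hi' h1 h2 h3
      have hpos : 0 ≤ ∑ j, (hi' j - lo' j) := Finset.sum_nonneg fun j _ => by linarith [h1 j]
      have hlt : ∑ j, (hi' j - lo' j) < ∑ j, (hi j - lo j) :=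
        Finset.sum_lt_sum (fun j _ => h2 j) ⟨i, Finset.mem_univ _, h3⟩
      obtain ⟨k, hk⟩ := Int.eq_ofNat_of_zero_le hpos
      exact IH k (by omega) lo' hi' h1 hk
    have memM : ∀ {p}, p ∈ M ↔ p ∈ intBox lo hi ∧ p i = m := by
      intro p
      constructor
      · intro h
        have hpi := h i
        simp only [Function.update_self] at hpi
        have hpm : p i = m := le_antisymm hpi.2 hpi.1
        refine ⟨fun j => ?_, hpm⟩
        by_cases hj : j = i
        · subst hj; rw [hpm]; exact ⟨hlmR.le, hmhR.le⟩
        · simpa [hj] using h j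
      · rintro ⟨h, hpm⟩ j
        by_cases hj : j = i
        · subst hj; simp [hpm]
        · simpa [hj] using h j
    have memB₁ : ∀ {p}, p ∈ B₁ ↔ p ∈ intBox lo hi ∧ p i ≤ m := by
      intro p
      constructor
      · intro h
        have hpi := h i
        simp only [Function.update_self] at hpi
        refine ⟨fun j => ?_, hpi.2⟩
        by_cases hj : j = i
        · subst hj; exact ⟨hpi.1, hpi.2.trans hmhR.le⟩
        · simpa [hj] using h j
      · rintro ⟨h, hpm⟩ j
        by_cases hj : j = i
        · subst hj; simp [hpm, (h j).1]
        · simpa [hj] using h j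
    have memB₂ : ∀ {p}, p ∈ B₂ ↔ p ∈ intBox lo hi ∧ m ≤ p i := by
      intro p
      constructor
      · intro h
        have hpi := h i
        simp only [Function.update_self] at hpi
        refine ⟨fun j => ?_, hpi.1⟩
        by_cases hj : j = i
        · subst hj; exact ⟨hlmR.le.trans hpi.1, hpi.2⟩
        · simpa [hj] using h j
      · rintro ⟨h, hpm⟩ j
        by_cases hj : j = i
        · subst hj; simp [hpm, (h j).2]
        · simpa [hj] using h j
    have hsM := sum_lt (Function.update lo i m) (Function.update hi i m)
      (fun j => by by_cases hj : j = i <;> simp [hj, hle])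
      (fun j => by by_cases hj : j = i <;> simp [hj, hle])
      (by simp; omega)
    have hsB₁ := sum_lt lo (Function.update hi i m)
      (fun j => by by_cases hj : j = i <;> simp [hj, hle]; omega)
      (fun j => by by_cases hj : j = i <;> simp [hj]; omega)
      (by simp; omega)
    have hsB₂ := sum_lt (Function.update lo i m) hi
      (fun j => by by_cases hj : j = i <;> simp [hj, hle]; omega)
      (fun j => by by_cases hj : j = i <;> simp [hj]; omega)
      (by simp; omega)
    have cM : IsClosed M := isClosed_intBox _ _
    have cB₁ : IsClosed B₁ := isClosed_intBox _ _
    have cB₂ : IsClosed B₂ := isClosed_intBox _ _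
    have cL : IsClosed L := isClosed_intBoxBoundary _ _
    have eM : intBoxBoundary (Function.update lo i m) (Function.update hi i m) = M ∩ L := by
      ext p
      constructor
      · rintro ⟨hp, j, hj, hpj⟩
        have hji : j ≠ i := by rintro rfl; simp at hj
        simp only [Function.update_of_ne hji] at hj hpj
        exact ⟨hp, (memM.1 hp).1, j, hj, hpj⟩
      · rintro ⟨hp, hpb, j, hj, hpj⟩
        have hji : j ≠ i := by
          rintro rfl
          have := (memM.1 hp).2
          rcases hpj with h | h <;> linarith
        exact ⟨hp, j, by simpa [hji] using hj, by simpa [hji] using hpj⟩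
    have eB₁ : intBoxBoundary lo (Function.update hi i m) = B₁ ∩ (M ∪ L) := by
      ext p
      constructor
      · rintro ⟨hp, j, hj, hpj⟩
        have hpb := (memB₁.1 hp).1
        by_cases hji : j = i
        · subst hji
          simp only [Function.update_self] at hpj
          rcases hpj with h | h
          · exact ⟨hp, Or.inr ⟨hpb, j, by omega, Or.inl h⟩⟩
          · exact ⟨hp, Or.inl (memM.2 ⟨hpb, h⟩)⟩
        · simp only [Function.update_of_ne hji] at hj hpj
          exact ⟨hp, Or.inr ⟨hpb, j, hj, hpj⟩⟩
      · rintro ⟨hp, hpM | ⟨hpb, j, hj, hpj⟩⟩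
        · exact ⟨hp, i, by simpa using hlm, by simp [(memM.1 hpM).2]⟩
        · by_cases hji : j = i
          · subst hji
            refine ⟨hp, j, by simpa using hlm, Or.inl (hpj.resolve_right fun h => ?_)⟩
            have := (memB₁.1 hp).2
            linarith
          · exact ⟨hp, j, by simpa [hji] using hj, by simpa [hji] using hpj⟩
    have eB₂ : intBoxBoundary (Function.update lo i m) hi = B₂ ∩ (B₁ ∪ (M ∪ L)) := by
      ext p
      constructor
      · rintro ⟨hp, j, hj, hpj⟩
        have hpb := (memB₂.1 hp).1
        by_cases hji : j = i
        · subst hji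
          simp only [Function.update_self] at hpj
          rcases hpj with h | h
          · exact ⟨hp, Or.inl (memB₁.2 ⟨hpb, h.le⟩)⟩
          · exact ⟨hp, Or.inr (Or.inr ⟨hpb, j, by omega, Or.inr h⟩)⟩
        · simp only [Function.update_of_ne hji] at hj hpj
          exact ⟨hp, Or.inr (Or.inr ⟨hpb, j, hj, hpj⟩)⟩
      · rintro ⟨hp, hpB | hpM | ⟨hpb, j, hj, hpj⟩⟩
        · refine ⟨hp, i, by simpa using hmh, Or.inl ?_⟩
          simpa using le_antisymm (memB₁.1 hpB).2 (memB₂.1 hp).2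
        · exact ⟨hp, i, by simpa using hmh, Or.inl (by simpa using (memM.1 hpM).2)⟩
        · by_cases hji : j = i
          · subst hji
            refine ⟨hp, j, by simpa using hmh, Or.inr (hpj.resolve_left fun h => ?_)⟩
            have := (memB₂.1 hp).2
            linarith
          · exact ⟨hp, j, by simpa [hji] using hj, by simpa [hji] using hpj⟩
    rw [eM] at hsM
    rw [eB₁] at hsB₁
    rw [eB₂] at hsB₂
    -- The slice is solved relative to `L`, then `B₁` relative to the slice and `L`, then `B₂`
    -- relative to everything before. The identities `eM`, `eB₁`, `eB₂` say that each piece meets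
    -- what is already solved exactly in its relative boundary.
    have key := (((hsM.excision cM cL).trans (cM.union cL) (cB₁.union (cM.union cL))
      subset_union_right subset_union_right (hsB₁.excision cB₁ (cM.union cL))).trans
      (cB₁.union (cM.union cL)) (cB₂.union (cB₁.union (cM.union cL)))
      (subset_union_right.trans subset_union_right) subset_union_right
      (hsB₂.excision cB₂ (cB₁.union (cM.union cL))))
    have e : B₂ ∪ (B₁ ∪ (M ∪ L)) = intBox lo hi := by
      ext p
      constructor
      · rintro (h | h | h | h)
        · exact (memB₂.1 h).1
        · exact (memB₁.1 h).1
        · exact (memM.1 h).1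
        · exact h.1
      · intro h
        rcases le_total (m : ℝ) (p i) with h' | h'
        · exact Or.inl (memB₂.2 ⟨h, h'⟩)
        · exact Or.inr (Or.inl (memB₁.2 ⟨h, h'⟩))
    rwa [e] at key

/-- A continuous map that restricts to weak equivalences over all finite intersections of the
members of an open cover of the target is a weak equivalence. -/
theorem WeakEquiv.of_openCover {f : X → Y} (hf : Continuous f) {κ : Type*} {U : κ → Set Y}
    (hUo : ∀ i, IsOpen (U i)) (hUc : ⋃ i, U i = univ)
    (hU : ∀ s : Finset κ, s.Nonempty → WeakEquiv ((⋂ i ∈ s, U i).restrictPreimage f)) :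
    WeakEquiv f where
  continuous := hf
  nonempty := fun ⟨y⟩ => by
    obtain ⟨i, hi⟩ := mem_iUnion.1 (hUc.ge (mem_univ y))
    obtain ⟨x⟩ := (hU {i} (by simp)).nonempty ⟨⟨y, by simpa using hi⟩⟩
    exact ⟨x.1⟩
  compresses n := by
    intro a b ha hb hab
    -- Clamping to the cube extends `b` continuously to the whole space, so unit cubes outside the
    -- box also receive a member of the cover. It does not increase distances, so the Lebesgue
    -- number still applies.
    set cl : (Fin n → ℝ) → Fin n → ℝ := fun p i => max (-1) (min 1 (p i)) with hcl
    have clc : Continuous cl := by fun_prop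
    have clm : ∀ p, cl p ∈ closedBall (0 : Fin n → ℝ) 1 := fun p => by
      rw [mem_closedBall_pi_iff]
      intro i
      rw [abs_le]
      exact ⟨le_max_left _ _, max_le (by norm_num) (min_le_left _ _)⟩
    have cle : ∀ p ∈ closedBall (0 : Fin n → ℝ) 1, cl p = p := fun p hp => by
      rw [mem_closedBall_pi_iff] at hp
      funext i
      have := abs_le.1 (hp i)
      simp [hcl, this.1, this.2]
    have cld : ∀ p q, dist (cl p) (cl q) ≤ dist p q := fun p q => by
      refine (dist_pi_le_iff dist_nonneg).2 fun i => le_trans ?_ (dist_le_pi_dist p q i)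
      rw [Real.dist_eq, Real.dist_eq]
      have h1 := abs_max_sub_max_le_abs (min 1 (p i)) (min 1 (q i)) (-1)
      have h2 := abs_min_sub_min_le_max 1 (p i) 1 (q i)
      have h3 : max |(1 : ℝ) - 1| |p i - q i| = |p i - q i| := by simp
      simp only [hcl, max_comm (-1 : ℝ)]
      exact h1.trans (h2.trans_eq h3)
    have hbc : Continuous (b ∘ cl) := hb.comp_continuous clc clm
    obtain ⟨δ, hδ, hδb⟩ := lebesgue_number_lemma_of_metric (isCompact_closedBall (0 : Fin n → ℝ) 1)
      (fun i => (hUo i).preimage hbc) (fun p _ => by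
        obtain ⟨i, hi⟩ := mem_iUnion.1 (hUc.ge (mem_univ (b (cl p))))
        exact mem_iUnion.2 ⟨i, hi⟩)
    obtain ⟨N, hN⟩ := exists_nat_one_div_lt hδ
    -- Scaling by `R` turns the ball into a box with integral corners, each of whose unit cubes is
    -- mapped by `b` into one member of the cover.
    set R : ℝ := ((N + 1 : ℕ) : ℝ) with hR
    have hR0 : 0 < R := by positivity
    have hR' : 1 / R < δ := by simpa [hR] using hN
    have hc : ∀ q : Fin n → ℤ, ∃ i, ∀ p ∈ intBox q (q + 1), b (cl (R⁻¹ • p)) ∈ U i := by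
      intro q
      obtain ⟨i, hi⟩ := hδb (cl (R⁻¹ • fun j => (q j : ℝ))) (clm _)
      refine ⟨i, fun p hp => ?_⟩
      have hd : dist (cl (R⁻¹ • p)) (cl (R⁻¹ • fun j => (q j : ℝ))) < δ := by
        refine (cld _ _).trans_lt (lt_of_le_of_lt ?_ hR')
        rw [dist_pi_le_iff (by positivity)]
        intro j
        have := hp j
        simp only [Pi.add_apply, Pi.one_apply, Int.cast_add, Int.cast_one] at this
        simp only [Pi.smul_apply, smul_eq_mul, Real.dist_eq, ← mul_sub, abs_mul,
          abs_of_pos (inv_pos.2 hR0), one_div]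
        refine mul_le_of_le_one_right (inv_pos.2 hR0).le (abs_le.2 ⟨?_, ?_⟩) <;> linarith
      have := hi (mem_ball.2 hd)
      simpa [cle _ (clm _)] using this
    choose c hc using hc
    have hsol := solvable_intBox (f := f) hU c (∑ _i : Fin n, 2 * (N + 1)) (fun _ => -(N + 1 : ℕ))
      (fun _ => (N + 1 : ℕ)) (fun i => by push_cast; omega) (by push_cast; simp; ring_nf)
    set lo : Fin n → ℤ := fun _ => -(N + 1 : ℕ) with hlo
    set hi : Fin n → ℤ := fun _ => (N + 1 : ℕ) with hhi
    have hloR : ∀ i, (lo i : ℝ) = -R := fun i => by simp [hlo, hR]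
    have hhiR : ∀ i, (hi i : ℝ) = R := fun i => by simp [hhi, hR]
    have hlohi : ∀ i, lo i < hi i := fun i => by
      have : (lo i : ℝ) < hi i := by rw [hloR i, hhiR i]; linarith
      exact_mod_cast this
    have boxM : ∀ p, p ∈ closedBall (0 : Fin n → ℝ) 1 ↔ R • p ∈ intBox lo hi := fun p => by
      rw [mem_closedBall_pi_iff]
      refine forall_congr' fun i => ?_
      simp only [Pi.smul_apply, smul_eq_mul, hloR, hhiR, abs_le]
      constructor
      · intro h; constructor <;> nlinarith [h.1, h.2]
      · intro h; constructor <;> nlinarith [h.1, h.2]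
    have boxB : ∀ p, p ∈ sphere (0 : Fin n → ℝ) 1 ↔ R • p ∈ intBoxBoundary lo hi := fun p => by
      rw [mem_sphere_pi_iff, ← mem_closedBall_pi_iff, boxM]
      refine and_congr_right fun _ => exists_congr fun i => ?_
      simp only [Pi.smul_apply, smul_eq_mul, hloR, hhiR, hlohi, true_and]
      rw [abs_eq zero_le_one]
      constructor
      · rintro (h | h) <;> simp [h]
      · rintro (h | h)
        · right; field_simp at h; nlinarith
        · left; field_simp at h; nlinarith
    have inv_smul' : ∀ p : Fin n → ℝ, R • (R⁻¹ • p) = p := fun p => smul_inv_smul₀ hR0.ne' p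
    have smul_inv' : ∀ p : Fin n → ℝ, R⁻¹ • (R • p) = p := fun p => inv_smul_smul₀ hR0.ne' p
    -- The homotopy to be extended is the constant one at `b`, so the solution is precisely a
    -- compression.
    obtain ⟨a', h', c1, c2, c3, c4, c5, -⟩ := hsol (fun p => a (R⁻¹ • p))
      (fun z => b (cl (R⁻¹ • z.1)))
      (ha.comp (by fun_prop) fun p hp => (boxB _).2 (by rwa [inv_smul']))
      (hbc.comp (by fun_prop : Continuous fun z : (Fin n → ℝ) × ℝ => R⁻¹ • z.1)).continuousOn
      (fun p hp => by
        have hp' : R⁻¹ • p ∈ sphere (0 : Fin n → ℝ) 1 := (boxB _).2 (by rwa [inv_smul'])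
        simp [hab _ hp', cle _ (sphere_sub hp')])
      (fun p hp q hq => hc q p hq) (fun p hp t ht q hq => hc q p hq)
    refine ⟨fun p => a' (R • p), fun z => h' (R • z.1, z.2), c1.comp (by fun_prop) fun p hp =>
      (boxM p).1 hp, fun p hp => ?_, c3.comp (by fun_prop) fun z hz => ⟨(boxM _).1 hz.1, hz.2⟩,
      fun p hp => c5 _ ((boxM p).1 hp), fun p hp => ?_, fun p hp t ht => ?_⟩
    · simp only [c2 ((boxB p).1 hp), smul_inv']
    · change h' (R • p, 1) = b p
      rw [c4 (x := (R • p, 1)) (Or.inr ⟨(boxM p).1 hp, rfl⟩)]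
      simp only [smul_inv', cle p hp]
    · change h' (R • p, t) = b p
      rw [c4 (x := (R • p, t)) (Or.inl ⟨(boxB p).1 hp, ht⟩)]
      simp only [smul_inv', cle p (sphere_sub hp)]

end LocalToGlobal

/-! ### Barycentric coordinates and straight paths in a simplex -/

section Simplex

open Set

variable {ι κ : Type*} [Fintype ι] [Fintype κ]

lemma stdSimplex_map_apply {f : ι → κ} (hf : Function.Injective f) (t : stdSimplex ℝ ι) (i : ι) :
    stdSimplex.map f t (f i) = t i := by
  classical
  rw [stdSimplex.map_coe, FunOnFinite.linearMap_apply_apply, Finset.sum_eq_single i]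
  · intro j hj hji
    exact absurd (hf (Finset.mem_filter.1 hj).2) hji
  · simp

lemma stdSimplex_map_apply_of_notMem {f : ι → κ} (t : stdSimplex ℝ ι) {k : κ}
    (hk : k ∉ range f) : stdSimplex.map f t k = 0 := by
  classical
  rw [stdSimplex.map_coe, FunOnFinite.linearMap_apply_apply]
  refine Finset.sum_eq_zero fun j hj => absurd ⟨j, (Finset.mem_filter.1 hj).2⟩ hk

lemma continuous_stdSimplex_apply (i : ι) : Continuous fun t : stdSimplex ℝ ι => t i :=
  (continuous_apply i).comp continuous_subtype_val

/-- The point dividing the segment from `a` to `b` in the ratio given by `s`. -/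
def mix (s : unitInterval) (a b : stdSimplex ℝ ι) : stdSimplex ℝ ι :=
  ⟨fun i => (1 - (s : ℝ)) * a i + s * b i,
    fun i => add_nonneg (mul_nonneg (sub_nonneg.2 s.2.2) (a.2.1 i)) (mul_nonneg s.2.1 (b.2.1 i)),
    by rw [Finset.sum_add_distrib, ← Finset.mul_sum, ← Finset.mul_sum]; simp⟩

@[simp] lemma mix_apply (s : unitInterval) (a b : stdSimplex ℝ ι) (i : ι) :
    mix s a b i = (1 - (s : ℝ)) * a i + s * b i := rfl

@[simp] lemma mix_zero (a b : stdSimplex ℝ ι) : mix 0 a b = a := by ext i; simp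

@[simp] lemma mix_one (a b : stdSimplex ℝ ι) : mix 1 a b = b := by ext i; simp

lemma map_mix (f : ι → κ) (s : unitInterval) (a b : stdSimplex ℝ ι) :
    stdSimplex.map f (mix s a b) = mix s (stdSimplex.map f a) (stdSimplex.map f b) := by
  classical
  ext k
  simp only [mix_apply, stdSimplex.map_coe, FunOnFinite.linearMap_apply_apply, Finset.mul_sum]
  exact (Finset.sum_congr rfl fun i _ => mix_apply s a b i).trans Finset.sum_add_distrib

lemma continuous_mix :
    Continuous fun p : unitInterval × stdSimplex ℝ ι × stdSimplex ℝ ι => mix p.1 p.2.1 p.2.2 := by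
  refine Continuous.subtype_mk (continuous_pi fun i => ?_) _
  have h1 := (continuous_stdSimplex_apply i).comp
    (continuous_fst.comp (continuous_snd (X := unitInterval)
      (Y := stdSimplex ℝ ι × stdSimplex ℝ ι)))
  have h2 := (continuous_stdSimplex_apply i).comp
    (continuous_snd.comp (continuous_snd (X := unitInterval)
      (Y := stdSimplex ℝ ι × stdSimplex ℝ ι)))
  exact ((continuous_const.sub (continuous_subtype_val.comp continuous_fst)).mul h1).add
    ((continuous_subtype_val.comp continuous_fst).mul h2)

/-- Rescaling of a positive vector to a point of the simplex. -/
def normalize [Nonempty ι] (v : {v : ι → ℝ // ∀ i, 0 < v i}) : stdSimplex ℝ ι :=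
  ⟨fun i => v.1 i / ∑ j, v.1 j,
    fun i => div_nonneg (v.2 i).le (Finset.sum_nonneg fun j _ => (v.2 j).le), by
    rw [← Finset.sum_div]
    exact div_self (Finset.sum_pos (fun j _ => v.2 j) Finset.univ_nonempty).ne'⟩

lemma continuous_normalize [Nonempty ι] : Continuous (normalize (ι := ι)) := by
  refine Continuous.subtype_mk (continuous_pi fun i => ?_) _
  refine ((continuous_apply i).comp continuous_subtype_val).div
    (continuous_finsetSum _ fun j _ => (continuous_apply j).comp continuous_subtype_val)
    fun v => (Finset.sum_pos (fun j _ => v.2 j) Finset.univ_nonempty).ne'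

lemma normalize_coe [Nonempty ι] (t : stdSimplex ℝ ι) (h : ∀ i, 0 < t i) :
    normalize ⟨t, h⟩ = t := by
  ext i
  change t i / ∑ j, t j = t i
  simp

end Simplex

/-! ### Gaps between the barycentric coordinates -/

section Gaps

open Set

variable {k m n : ℕ}

/-- The coordinates of `t` at the vertices in the image of `e` are positive and larger than all
the others. -/
def IsTop (e : Fin (k + 1) ↪o Fin (n + 1)) (t : stdSimplex ℝ (Fin (n + 1))) : Prop :=
  ∀ i, 0 < t (e i) ∧ ∀ b ∉ range e, t b < t (e i)

/-- There is a gap in the coordinates of `t` after the `k + 1` largest ones. -/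
def HasGap (k : ℕ) (t : stdSimplex ℝ (Fin (n + 1))) : Prop :=
  ∃ e : Fin (k + 1) ↪o Fin (n + 1), IsTop e t

/-- If a vertex of `e` were missing from `e'`, then any vertex of `e'` missing from `e` would give
two opposite strict inequalities. So all of `e'` would lie strictly inside `e`, against the
cardinalities. -/
lemma IsTop.range_subset {e : Fin (k + 1) ↪o Fin (n + 1)} {e' : Fin (m + 1) ↪o Fin (n + 1)}
    {t : stdSimplex ℝ (Fin (n + 1))} (h : IsTop e t) (h' : IsTop e' t) (hkm : k ≤ m) :
    range e ⊆ range e' := by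
  rintro _ ⟨i, rfl⟩
  by_contra hi
  have hsub : range e' ⊆ range e := by
    rintro _ ⟨j, rfl⟩
    by_contra hj
    exact lt_asymm ((h i).2 _ hj) ((h' j).2 _ hi)
  have hss : range e' ⊂ range e := ssubset_iff_subset_ne.2 ⟨hsub, fun he => hi (he ▸ ⟨i, rfl⟩)⟩
  have := Set.ncard_lt_ncard hss
  rw [← Set.image_univ, ← Set.image_univ, Set.ncard_image_of_injective _ e.injective,
    Set.ncard_image_of_injective _ e'.injective] at this
  simp at this
  omega

lemma IsTop.unique {e e' : Fin (k + 1) ↪o Fin (n + 1)} {t : stdSimplex ℝ (Fin (n + 1))}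
    (h : IsTop e t) (h' : IsTop e' t) : e = e' := by
  have : range e = range e' := (h.range_subset h' le_rfl).antisymm (h'.range_subset h le_rfl)
  exact DFunLike.coe_injective ((e.strictMono.range_inj e'.strictMono).1 this)

lemma isOpen_isTop (e : Fin (k + 1) ↪o Fin (n + 1)) :
    IsOpen {t : stdSimplex ℝ (Fin (n + 1)) | IsTop e t} := by
  simp only [IsTop, Set.ofPred_forall, Set.ofPred_and]
  refine isOpen_iInter_of_finite fun i => IsOpen.inter ?_ ?_
  · exact isOpen_lt continuous_const (continuous_stdSimplex_apply _)
  · exact isOpen_iInter_of_finite fun b => isOpen_iInter_of_finite fun _ =>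
      isOpen_lt (continuous_stdSimplex_apply _) (continuous_stdSimplex_apply _)

lemma isOpen_hasGap (k : ℕ) : IsOpen {t : stdSimplex ℝ (Fin (n + 1)) | HasGap k t} := by
  simp only [HasGap, Set.ofPred_exists]
  exact isOpen_iUnion isOpen_isTop

lemma IsTop.map {e : Fin (k + 1) ↪o Fin (m + 1)} {t : stdSimplex ℝ (Fin (m + 1))}
    (h : IsTop e t) (η : Fin (m + 1) ↪o Fin (n + 1)) : IsTop (e.trans η) (stdSimplex.map η t) := by
  intro i
  have h1 : stdSimplex.map η t ((e.trans η) i) = t (e i) :=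
    stdSimplex_map_apply η.injective t (e i)
  rw [h1]
  refine ⟨(h i).1, fun b hb => ?_⟩
  by_cases hb' : b ∈ range η
  · obtain ⟨b, rfl⟩ := hb'
    rw [stdSimplex_map_apply η.injective]
    refine (h i).2 b fun ⟨j, hj⟩ => hb ⟨j, ?_⟩
    simp [hj]
  · rw [stdSimplex_map_apply_of_notMem _ hb']
    exact (h i).1

/-- Positivity in `IsTop` keeps the vanishing coordinates outside a face from counting among the
largest ones. The condition is thus compatible with gluing along faces and descends to the fat
realization. -/
lemma hasGap_map {t : stdSimplex ℝ (Fin (m + 1))} (η : Fin (m + 1) ↪o Fin (n + 1)) :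
    HasGap k (stdSimplex.map η t) ↔ HasGap k t := by
  refine ⟨fun ⟨e, he⟩ => ?_, fun ⟨e, he⟩ => ⟨_, he.map η⟩⟩
  have hr : ∀ i, ∃ j, η j = e i := fun i => by
    by_contra hi
    have := (he i).1
    rw [stdSimplex_map_apply_of_notMem _ hi] at this
    exact lt_irrefl _ this
  choose g hg using hr
  refine ⟨OrderEmbedding.ofMapLEIff g fun a b => ?_, fun i => ?_⟩
  · rw [← η.le_iff_le, hg, hg, e.le_iff_le]
  · have h := he i
    simp only [← hg, stdSimplex_map_apply η.injective] at h
    refine ⟨h.1, fun b hb => ?_⟩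
    have := h.2 (η b) fun ⟨j, hj⟩ => hb ⟨j, η.injective ((hg j).trans hj)⟩
    rwa [stdSimplex_map_apply η.injective] at this

/-- The vertices carrying the `k + 1` largest coordinates. -/
def HasGap.emb {t : stdSimplex ℝ (Fin (n + 1))} (h : HasGap k t) : Fin (k + 1) ↪o Fin (n + 1) :=
  h.choose

lemma HasGap.isTop {t : stdSimplex ℝ (Fin (n + 1))} (h : HasGap k t) : IsTop h.emb t :=
  h.choose_spec

lemma HasGap.emb_eq {t : stdSimplex ℝ (Fin (n + 1))} (h : HasGap k t)
    {e : Fin (k + 1) ↪o Fin (n + 1)} (he : IsTop e t) : h.emb = e :=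
  h.isTop.unique he

/-- The rescaled `k + 1` largest coordinates. -/
def HasGap.restrict {t : stdSimplex ℝ (Fin (n + 1))} (h : HasGap k t) :
    stdSimplex ℝ (Fin (k + 1)) :=
  normalize ⟨fun i => t (h.emb i), fun i => (h.isTop i).1⟩

/-- The straight path from `t` to the point given by its `k + 1` largest coordinates. -/
def HasGap.push {t : stdSimplex ℝ (Fin (n + 1))} (h : HasGap k t) (s : unitInterval) :
    stdSimplex ℝ (Fin (n + 1)) :=
  mix s t (stdSimplex.map h.emb h.restrict)

lemma HasGap.emb_map {t : stdSimplex ℝ (Fin (m + 1))} (h : HasGap k t)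
    (η : Fin (m + 1) ↪o Fin (n + 1)) (h' : HasGap k (stdSimplex.map η t)) :
    h'.emb = h.emb.trans η :=
  h'.emb_eq (h.isTop.map η)

lemma HasGap.restrict_map {t : stdSimplex ℝ (Fin (m + 1))} (h : HasGap k t)
    (η : Fin (m + 1) ↪o Fin (n + 1)) (h' : HasGap k (stdSimplex.map η t)) :
    h'.restrict = h.restrict := by
  refine congrArg normalize (Subtype.ext (funext fun i => ?_))
  change stdSimplex.map η t (h'.emb i) = t (h.emb i)
  rw [h.emb_map η h']
  exact stdSimplex_map_apply η.injective t _

lemma HasGap.push_map {t : stdSimplex ℝ (Fin (m + 1))} (h : HasGap k t)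
    (η : Fin (m + 1) ↪o Fin (n + 1)) (h' : HasGap k (stdSimplex.map η t)) (s : unitInterval) :
    h'.push s = stdSimplex.map η (h.push s) := by
  rw [HasGap.push, HasGap.push, map_mix, stdSimplex.map_comp_apply, h.restrict_map η h',
    h.emb_map η h']
  rfl

lemma HasGap.emb_restrict {t : stdSimplex ℝ (Fin (k + 1))} (h : HasGap k t) :
    h.emb = RelEmbedding.refl _ ∧ h.restrict = t := by
  have he : h.emb = RelEmbedding.refl _ := OrderEmbedding.range_inj.1 (by
    have := Finite.injective_iff_surjective.1 h.emb.injective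
    rw [this.range_eq]; exact Set.range_id.symm)
  refine ⟨he, ?_⟩
  have hp : ∀ i, 0 < t i := fun i => by simpa [he] using (h.isTop i).1
  refine Eq.trans (congrArg normalize (Subtype.ext (funext fun i => ?_))) (normalize_coe t hp)
  change t (h.emb i) = t i
  rw [he]; rfl

/-- Along the push the `m + 1` largest coordinates change by one strictly increasing function and
the others only shrink, so every gap at `k ≤ m` persists. -/
lemma HasGap.hasGap_push {t : stdSimplex ℝ (Fin (n + 1))} (h : HasGap m t) (hk : HasGap k t)
    (hkm : k ≤ m) (s : unitInterval) : HasGap k (h.push s) := by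
  have hsub := hk.isTop.range_subset h.isTop hkm
  set σ := ∑ j, t (h.emb j) with hσ
  have hσ0 : 0 < σ := Finset.sum_pos (fun j _ => (h.isTop j).1) Finset.univ_nonempty
  have hin : ∀ j, h.push s (h.emb j) = (1 - (s : ℝ)) * t (h.emb j) + s * (t (h.emb j) / σ) := by
    intro j
    rw [HasGap.push, mix_apply, stdSimplex_map_apply h.emb.injective]
    rfl
  have hout : ∀ b ∉ range h.emb, h.push s b = (1 - (s : ℝ)) * t b := by
    intro b hb
    rw [HasGap.push, mix_apply, stdSimplex_map_apply_of_notMem _ hb]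
    simp
  have hs0 := s.2.1
  have hs1 := s.2.2
  have hpos : ∀ x y : ℝ, x < y → (1 - (s : ℝ)) * x + s * (x / σ) < (1 - s) * y + s * (y / σ) := by
    intro x y hxy
    have hd : x / σ < y / σ := div_lt_div_of_pos_right hxy hσ0
    rcases hs0.eq_or_lt with h0 | h0
    · rw [← h0]; simpa using hxy
    · have := mul_lt_mul_of_pos_left hd h0
      have := mul_le_mul_of_nonneg_left hxy.le (sub_nonneg.2 hs1)
      linarith
  refine ⟨hk.emb, fun i => ?_⟩
  obtain ⟨j, hj⟩ := hsub ⟨i, rfl⟩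
  have hi := hk.isTop i
  rw [← hj] at hi ⊢
  rw [hin]
  refine ⟨by simpa using hpos 0 _ hi.1, fun b hb => ?_⟩
  by_cases hb' : b ∈ range h.emb
  · obtain ⟨b, rfl⟩ := hb'
    rw [hin]
    exact hpos _ _ (hi.2 _ hb)
  · rw [hout b hb']
    refine lt_of_le_of_lt ?_ (hpos _ _ (hi.2 _ hb))
    exact le_add_of_nonneg_right (mul_nonneg hs0 (div_nonneg (t.2.1 b) hσ0.le))

lemma HasGap.push_zero {t : stdSimplex ℝ (Fin (n + 1))} (h : HasGap k t) : h.push 0 = t :=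
  mix_zero _ _

lemma HasGap.push_one {t : stdSimplex ℝ (Fin (n + 1))} (h : HasGap k t) :
    h.push 1 = stdSimplex.map h.emb h.restrict :=
  mix_one _ _

lemma HasGap.hasGap_restrict {t : stdSimplex ℝ (Fin (n + 1))} (h : HasGap m t) (hk : HasGap k t)
    (hkm : k ≤ m) : HasGap k h.restrict := by
  have := h.hasGap_push hk hkm 1
  rwa [h.push_one, hasGap_map] at this

/-- The vertices where the maximal coordinate is attained are separated from the rest. This is what
makes the strata cover the realization. -/
lemma exists_hasGap (t : stdSimplex ℝ (Fin (n + 1))) : ∃ k, HasGap k t := by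
  classical
  obtain ⟨a, -, ha⟩ := Finset.exists_max_image Finset.univ t Finset.univ_nonempty
  set S := Finset.univ.filter fun b => t b = t a with hS
  have haS : a ∈ S := by simp [hS]
  obtain ⟨k, hk⟩ : ∃ k, S.card = k + 1 :=
    ⟨S.card - 1, (Nat.succ_pred_eq_of_pos (Finset.card_pos.2 ⟨a, haS⟩)).symm⟩
  refine ⟨k, S.orderEmbOfFin hk, fun i => ?_⟩
  have hi : t (S.orderEmbOfFin hk i) = t a :=
    (Finset.mem_filter.1 (Finset.orderEmbOfFin_mem S hk i)).2
  rw [hi]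
  have hapos : 0 < t a := by
    by_contra h0
    have : ∑ b, t b ≤ 0 := Finset.sum_nonpos fun b hb => (ha b hb).trans (not_lt.1 h0)
    rw [stdSimplex.sum_eq_one] at this
    linarith
  refine ⟨hapos, fun b hb => lt_of_le_of_ne (ha b (Finset.mem_univ _)) fun hba => hb ?_⟩
  rw [Finset.range_orderEmbOfFin]
  simp [hS, hba]

/-- The discrete topology on the faces of a simplex. -/
local instance faceTopology : TopologicalSpace (Fin (k + 1) ↪o Fin (n + 1)) := ⊥

local instance faceDiscrete : DiscreteTopology (Fin (k + 1) ↪o Fin (n + 1)) := ⟨rfl⟩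

lemma continuous_emb : Continuous fun t : {t : stdSimplex ℝ (Fin (n + 1)) // HasGap k t} =>
    t.2.emb := by
  refine continuous_discrete_rng.2 fun e => ?_
  have : (fun t : {t : stdSimplex ℝ (Fin (n + 1)) // HasGap k t} => t.2.emb) ⁻¹' {e} =
      Subtype.val ⁻¹' {t | IsTop e t} := by
    ext t
    exact ⟨fun h => by simpa [← Set.mem_singleton_iff.1 h] using t.2.isTop,
      fun h => t.2.emb_eq h⟩
  rw [this]
  exact (isOpen_isTop e).preimage continuous_subtype_val

/-- The set of largest vertices is locally constant, since `IsTop e` is an open condition and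
determines `e`. Continuity may therefore be checked for each fixed `e`. -/
lemma continuous_emb_comp {A Z : Type*} [TopologicalSpace A] [TopologicalSpace Z]
    {g : (Fin (k + 1) ↪o Fin (n + 1)) → A → Z} (hg : ∀ e, Continuous (g e))
    {τ : A → stdSimplex ℝ (Fin (n + 1))} (hτ : Continuous τ) (h : ∀ a, HasGap k (τ a)) :
    Continuous fun a => g (h a).emb a := by
  have h1 : Continuous fun p : (Fin (k + 1) ↪o Fin (n + 1)) × A => g p.1 p.2 :=
    continuous_prod_of_discrete_left.2 hg
  exact h1.comp ((continuous_emb.comp (hτ.subtype_mk h)).prodMk continuous_id)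

lemma continuous_restrict : Continuous fun t : {t : stdSimplex ℝ (Fin (n + 1)) // HasGap k t} =>
    t.2.restrict := by
  refine continuous_normalize.comp (Continuous.subtype_mk (continuous_pi fun i => ?_) _)
  exact continuous_emb_comp (A := {t : stdSimplex ℝ (Fin (n + 1)) // HasGap k t})
    (g := fun e t => t.1 (e i))
    (fun e => (continuous_stdSimplex_apply _).comp continuous_subtype_val) continuous_subtype_val
    fun t => t.2

lemma continuous_push :
    Continuous fun p : {t : stdSimplex ℝ (Fin (n + 1)) // HasGap k t} × unitInterval =>
      p.1.2.push p.2 := by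
  have h1 : Continuous fun p : {t : stdSimplex ℝ (Fin (n + 1)) // HasGap k t} × unitInterval =>
      stdSimplex.map p.1.2.emb p.1.2.restrict :=
    continuous_emb_comp (A := {t : stdSimplex ℝ (Fin (n + 1)) // HasGap k t} × unitInterval)
      (g := fun e p => stdSimplex.map e p.1.2.restrict)
      (fun e => (stdSimplex.continuous_map e).comp (continuous_restrict.comp continuous_fst))
      (continuous_subtype_val.comp continuous_fst) fun p => p.1.2
  exact continuous_mix.comp (continuous_snd.prodMk
    ((continuous_subtype_val.comp continuous_fst).prodMk h1))

end Gaps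

/-! ### Continuity on products with disjoint unions -/

section SigmaProd

lemma continuous_sigma_prod {ι : Type*} {X : ι → Type*} {Y Z : Type*} [∀ i, TopologicalSpace (X i)]
    [TopologicalSpace Y] [TopologicalSpace Z] {f : (Σ i, X i) × Y → Z}
    (h : ∀ i, Continuous fun p : X i × Y => f (⟨i, p.1⟩, p.2)) : Continuous f :=
  Homeomorph.sigmaProdDistrib.symm.comp_continuous_iff'.1 (continuous_sigma h)

lemma continuous_prod_sigma {ι : Type*} {X : ι → Type*} {Y Z : Type*} [∀ i, TopologicalSpace (X i)]
    [TopologicalSpace Y] [TopologicalSpace Z] {f : Y × (Σ i, X i) → Z}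
    (h : ∀ i, Continuous fun p : Y × X i => f (p.1, ⟨i, p.2⟩)) : Continuous f :=
  (continuous_sigma_prod (f := f ∘ Prod.swap) fun i => (h i).comp continuous_swap).comp
    continuous_swap

end SigmaProd

/-! ### Fat realizations and their open strata -/

section SemiSimplicial

open Set Topology

/-- A semi-simplicial space: spaces of simplices with face maps. -/
structure SemiSimplicialSpace where
  /-- the space of `n`-simplices -/
  obj : ℕ → Type w
  [top : ∀ n, TopologicalSpace (obj n)]
  /-- the face of a simplex -/
  face : ∀ {m n : ℕ}, (Fin (m + 1) ↪o Fin (n + 1)) → obj n → obj m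
  continuous_face : ∀ {m n : ℕ} (η : Fin (m + 1) ↪o Fin (n + 1)), Continuous (face η)
  face_refl : ∀ {n : ℕ} (x : obj n), face (RelEmbedding.refl _) x = x
  face_face : ∀ {l m n : ℕ} (θ : Fin (l + 1) ↪o Fin (m + 1)) (η : Fin (m + 1) ↪o Fin (n + 1))
    (x : obj n), face θ (face η x) = face (θ.trans η) x

namespace SemiSimplicialSpace

attribute [instance] SemiSimplicialSpace.top

/-- A map of semi-simplicial spaces. -/
structure Hom (X : SemiSimplicialSpace.{w₁}) (Y : SemiSimplicialSpace.{w₂}) where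
  /-- the map on `n`-simplices -/
  app : ∀ n, X.obj n → Y.obj n
  continuous_app : ∀ n, Continuous (app n)
  app_face : ∀ {m n : ℕ} (η : Fin (m + 1) ↪o Fin (n + 1)) (x : X.obj n),
    app m (X.face η x) = Y.face η (app n x)

variable (X : SemiSimplicialSpace.{w}) {Y : SemiSimplicialSpace.{w₁}}

/-- The disjoint union of the spaces `Xₙ × Δⁿ`. -/
abbrev Cell : Type _ := Σ n : ℕ, X.obj n × stdSimplex ℝ (Fin (n + 1))

/-- The gluing relation along faces. -/
inductive Glue : X.Cell → X.Cell → Prop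
  | glue {m n : ℕ} (η : Fin (m + 1) ↪o Fin (n + 1)) (x : X.obj n)
      (t : stdSimplex ℝ (Fin (m + 1))) :
      Glue ⟨n, x, stdSimplex.map η t⟩ ⟨m, X.face η x, t⟩

/-- The fat realization of a semi-simplicial space. -/
def Fat : Type _ := Quot X.Glue

instance : TopologicalSpace X.Fat := inferInstanceAs (TopologicalSpace (Quot X.Glue))

variable {X}

/-- The point of the fat realization given by a point of a cell. -/
def cell {n : ℕ} (x : X.obj n) (t : stdSimplex ℝ (Fin (n + 1))) : X.Fat := Quot.mk _ ⟨n, x, t⟩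

lemma cell_map {m n : ℕ} (η : Fin (m + 1) ↪o Fin (n + 1)) (x : X.obj n)
    (t : stdSimplex ℝ (Fin (m + 1))) : cell x (stdSimplex.map η t) = cell (X.face η x) t :=
  Quot.sound (.glue η x t)

lemma continuous_cell (n : ℕ) :
    Continuous fun p : X.obj n × stdSimplex ℝ (Fin (n + 1)) => cell p.1 p.2 :=
  continuous_quot_mk.comp (continuous_sigmaMk (σ := fun n : ℕ => X.obj n ×
    stdSimplex ℝ (Fin (n + 1))))

lemma Fat.ind {p : X.Fat → Prop} (h : ∀ n (x : X.obj n) t, p (cell x t)) (q : X.Fat) : p q :=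
  Quot.ind (fun c => h c.1 c.2.1 c.2.2) q

/-- Maps out of the fat realization. -/
def Fat.lift {Z : Type*} (g : ∀ n, X.obj n → stdSimplex ℝ (Fin (n + 1)) → Z)
    (hg : ∀ {m n : ℕ} (η : Fin (m + 1) ↪o Fin (n + 1)) (x : X.obj n) (t),
      g n x (stdSimplex.map η t) = g m (X.face η x) t) : X.Fat → Z :=
  Quot.lift (fun c => g c.1 c.2.1 c.2.2) fun _ _ ⟨η, x, t⟩ => hg η x t

lemma Fat.continuous_of_comp_cell {Z : Type*} [TopologicalSpace Z] {g : X.Fat → Z}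
    (hg : ∀ n, Continuous fun p : X.obj n × stdSimplex ℝ (Fin (n + 1)) => g (cell p.1 p.2)) :
    Continuous g :=
  isQuotientMap_quot_mk.continuous_iff.2 (continuous_sigma hg)

/-- The map of fat realizations induced by a map of semi-simplicial spaces. -/
def Hom.map (f : Hom X Y) : X.Fat → Y.Fat :=
  Fat.lift (fun n x t => cell (f.app n x) t) fun η x t => by rw [cell_map, f.app_face]

lemma Hom.continuous_map (f : Hom X Y) : Continuous f.map :=
  Fat.continuous_of_comp_cell fun n =>
    (continuous_cell n).comp (((f.continuous_app n).comp continuous_fst).prodMk continuous_snd)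

/-- The points of the fat realization with gaps after the `i + 1` largest coordinates for all
`i ∈ I`. -/
def stratum (X : SemiSimplicialSpace.{w}) (I : Finset ℕ) : Set X.Fat :=
  {q | Fat.lift (fun _ _ t => ∀ i ∈ I, HasGap i t)
    (fun η _ t => by simp only [hasGap_map]) q}

lemma cell_mem_stratum {I : Finset ℕ} {n : ℕ} {x : X.obj n} {t : stdSimplex ℝ (Fin (n + 1))} :
    cell x t ∈ X.stratum I ↔ ∀ i ∈ I, HasGap i t := Iff.rfl

lemma Hom.map_mem_stratum (f : Hom X Y) {I : Finset ℕ} {q : X.Fat} :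
    f.map q ∈ Y.stratum I ↔ q ∈ X.stratum I := by
  induction q using Fat.ind
  exact Iff.rfl

/-- The part of the simplex with gaps after the `i + 1` largest coordinates for all `i ∈ I`. -/
abbrev GapSpace (I : Finset ℕ) (n : ℕ) : Type :=
  {t : stdSimplex ℝ (Fin (n + 1)) // ∀ i ∈ I, HasGap i t}

lemma isOpen_gaps (I : Finset ℕ) (n : ℕ) :
    IsOpen {t : stdSimplex ℝ (Fin (n + 1)) | ∀ i ∈ I, HasGap i t} := by
  simp only [Set.ofPred_forall]
  exact isOpen_biInter_finset fun i _ => isOpen_hasGap i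

lemma isOpen_stratum (I : Finset ℕ) : IsOpen (X.stratum I) := by
  refine isQuotientMap_quot_mk.isOpen_preimage.1 (isOpen_sigma_iff.2 fun n => ?_)
  exact (isOpen_gaps I n).preimage continuous_snd

lemma iInter_stratum (I : Finset ℕ) : ⋂ i ∈ I, X.stratum {i} = X.stratum I := by
  ext q
  induction q using Fat.ind
  simp [cell_mem_stratum]

lemma iUnion_stratum : ⋃ i, X.stratum {i} = univ := by
  refine eq_univ_of_forall fun q => ?_
  induction q using Fat.ind with | h n x t
  obtain ⟨k, hk⟩ := exists_hasGap t
  exact mem_iUnion.2 ⟨k, cell_mem_stratum.2 (by simpa using hk)⟩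

/-- The parametrization of a stratum by cells. -/
def stratumMk (I : Finset ℕ) :
    (Σ n : ℕ, X.obj n × GapSpace I n) → X.stratum I :=
  fun c => ⟨cell c.2.1 c.2.2.1, c.2.2.2⟩

/-- A quotient map restricts to a quotient map over an open subset, and strata are open. -/
lemma isQuotientMap_stratumMk (I : Finset ℕ) : IsQuotientMap (stratumMk (X := X) I) := by
  have hq : IsQuotientMap (Quot.mk X.Glue) := isQuotientMap_quot_mk
  have hcont : Continuous (stratumMk (X := X) I) := by
    refine Continuous.subtype_mk (continuous_sigma fun n => ?_) _
    exact (continuous_cell n).comp (continuous_fst.prodMk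
      (continuous_subtype_val.comp continuous_snd))
  refine ⟨.of_isOpen_preimage_iff_isOpen fun s => ⟨fun h => ?_, fun h => h.preimage hcont⟩, ?_⟩
  rotate_left
  · rintro ⟨q, hq⟩
    induction q using Fat.ind with | h n x t
    exact ⟨⟨n, x, t, hq⟩, rfl⟩
  · have : IsOpen (Subtype.val '' s : Set X.Fat) := by
      refine hq.isOpen_preimage.1 (isOpen_sigma_iff.2 fun n => ?_)
      have h1 := isOpen_sigma_iff.1 h n
      have h2 : IsOpenMap (Prod.map id Subtype.val : X.obj n ×
          GapSpace I n →
          X.obj n × stdSimplex ℝ (Fin (n + 1))) :=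
        IsOpenMap.id.prodMap (isOpen_gaps I n).isOpenMap_subtype_val
      convert h2 _ h1 using 1
      ext ⟨x, t⟩
      constructor
      · rintro ⟨⟨q, hq⟩, hqs, he⟩
        change q = cell x t at he
        subst he
        exact ⟨⟨x, t, hq⟩, hqs, rfl⟩
      · rintro ⟨⟨x, t, ht⟩, hs, he⟩
        cases he
        exact ⟨_, hs, rfl⟩
    rw [← preimage_image_eq s Subtype.val_injective]
    exact this.preimage continuous_subtype_val

variable {I : Finset ℕ} {m : ℕ}

open Classical in
/-- The retraction of a stratum, with values in an option to be defined everywhere. -/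
def stratumRetractAux (X : SemiSimplicialSpace.{w}) (m : ℕ) :
    X.Fat → Option (X.obj m × stdSimplex ℝ (Fin (m + 1))) :=
  Fat.lift (fun _ x t => if h : HasGap m t then some (X.face h.emb x, h.restrict) else none) (by
    intro k n η x t
    by_cases h : HasGap m t
    · have h' := (hasGap_map η).2 h
      rw [dif_pos h, dif_pos h', h.restrict_map η h', h.emb_map η h', X.face_face]
    · rw [dif_neg h, dif_neg (by rwa [hasGap_map])])

/-- On a stratum with `m ∈ I` the partially defined retraction never takes the value `none`. That
`m` is the largest index ensures that the other gaps survive in the retracted point. -/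
lemma exists_stratumRetract (hm : m ∈ I) (hI : ∀ i ∈ I, i ≤ m) (q : X.stratum I) :
    ∃ p : X.obj m × GapSpace I m,
      stratumRetractAux X m q = some (p.1, p.2.1) := by
  obtain ⟨q, hq⟩ := q
  induction q using Fat.ind with | h n x t
  have h := cell_mem_stratum.1 hq
  exact ⟨⟨X.face (h m hm).emb x, (h m hm).restrict, fun i hi =>
    (h m hm).hasGap_restrict (h i hi) (hI i hi)⟩, dif_pos (h m hm)⟩

/-- The retraction of a stratum to the part lying in the cells of the lowest dimension. -/
def stratumRetract (hm : m ∈ I) (hI : ∀ i ∈ I, i ≤ m) (q : X.stratum I) :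
    X.obj m × GapSpace I m :=
  (exists_stratumRetract hm hI q).choose

lemma stratumRetract_cell (hm : m ∈ I) (hI : ∀ i ∈ I, i ≤ m) {n : ℕ} (x : X.obj n)
    (t : stdSimplex ℝ (Fin (n + 1))) (h : ∀ i ∈ I, HasGap i t) :
    stratumRetract hm hI ⟨cell x t, h⟩ = ⟨X.face (h m hm).emb x, (h m hm).restrict, fun i hi =>
      (h m hm).hasGap_restrict (h i hi) (hI i hi)⟩ := by
  have h1 := (exists_stratumRetract hm hI (⟨cell x t, h⟩ : X.stratum I)).choose_spec
  have h2 := h1.symm.trans (dif_pos (h m hm))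
  rw [Option.some.injEq, Prod.mk.injEq] at h2
  exact Prod.ext h2.1 (Subtype.ext h2.2)

lemma continuous_stratumRetract (hm : m ∈ I) (hI : ∀ i ∈ I, i ≤ m) :
    Continuous (stratumRetract (X := X) hm hI) := by
  refine (isQuotientMap_stratumMk I).continuous_iff.2 (continuous_sigma fun n => ?_)
  have h1 : Continuous fun p : X.obj n ×
      GapSpace I n =>
      X.face (p.2.2 m hm).emb p.1 :=
    continuous_emb_comp (A := X.obj n ×
      GapSpace I n)
      (g := fun e p => X.face e p.1) (fun e => (X.continuous_face e).comp continuous_fst)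
      (continuous_subtype_val.comp continuous_snd) fun p => p.2.2 m hm
  have h2 : Continuous fun p : X.obj n ×
      GapSpace I n => (p.2.2 m hm).restrict :=
    continuous_restrict.comp ((continuous_subtype_val.comp continuous_snd).subtype_mk
      fun p : X.obj n × GapSpace I n => p.2.2 m hm)
  convert h1.prodMk (h2.subtype_mk (p := fun t => ∀ i ∈ I, HasGap i t) fun (p : X.obj n × GapSpace I n) i hi =>
    (p.2.2 m hm).hasGap_restrict (p.2.2 i hi) (hI i hi)) using 1
  funext p
  exact stratumRetract_cell hm hI p.1 p.2.1 p.2.2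

open Classical in
/-- The deformation of a stratum, extended by the identity. -/
def pushMap (X : SemiSimplicialSpace.{w}) (m : ℕ) (s : unitInterval) : X.Fat → X.Fat :=
  Fat.lift (fun _ x t => if h : HasGap m t then cell x (h.push s) else cell x t) (by
    intro k n η x t
    by_cases h : HasGap m t
    · have h' := (hasGap_map η).2 h
      rw [dif_pos h, dif_pos h', h.push_map η h', cell_map]
    · rw [dif_neg h, dif_neg (by rwa [hasGap_map]), cell_map])

lemma pushMap_cell {n : ℕ} (x : X.obj n) {t : stdSimplex ℝ (Fin (n + 1))} (h : HasGap m t)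
    (s : unitInterval) : pushMap X m s (cell x t) = cell x (h.push s) :=
  dif_pos h

/-- The deformation of a stratum. -/
def stratumPush (hm : m ∈ I) (hI : ∀ i ∈ I, i ≤ m) (p : X.stratum I × unitInterval) :
    X.stratum I :=
  ⟨pushMap X m p.2 p.1.1, by
    obtain ⟨⟨q, hq⟩, s⟩ := p
    induction q using Fat.ind with | h n x t
    have h := cell_mem_stratum.1 hq
    change pushMap X m s (cell x t) ∈ _
    rw [pushMap_cell x (h m hm)]
    exact fun i hi => (h m hm).hasGap_push (h i hi) (hI i hi) s⟩

/-- Local compactness of the unit interval keeps the parametrization by cells a quotient map after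
taking the product with it. -/
lemma continuous_stratumPush (hm : m ∈ I) (hI : ∀ i ∈ I, i ≤ m) :
    Continuous (stratumPush (X := X) hm hI) := by
  refine (isQuotientMap_stratumMk I).continuous_lift_prod_left (Continuous.subtype_mk ?_ _)
  refine continuous_sigma_prod fun n => ?_
  have h1 : Continuous fun p : (X.obj n ×
      GapSpace I n) × unitInterval =>
      (p.1.2.2 m hm).push p.2 :=
    continuous_push.comp (((continuous_subtype_val.comp
      (continuous_snd.comp continuous_fst)).subtype_mk
      fun p : (X.obj n × GapSpace I n) × unitInterval => p.1.2.2 m hm).prodMk continuous_snd)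
  convert (continuous_cell n).comp ((continuous_fst.comp continuous_fst).prodMk h1) using 1
  funext p
  exact pushMap_cell p.1.1 (p.1.2.2 m hm) p.2

lemma stratumPush_zero (hm : m ∈ I) (hI : ∀ i ∈ I, i ≤ m) (q : X.stratum I) :
    stratumPush hm hI (q, 0) = q := by
  obtain ⟨q, hq⟩ := q
  induction q using Fat.ind with | h n x t
  refine Subtype.ext ((pushMap_cell x (cell_mem_stratum.1 hq m hm) 0).trans ?_)
  rw [HasGap.push_zero]

lemma stratumPush_one (hm : m ∈ I) (hI : ∀ i ∈ I, i ≤ m) (q : X.stratum I) :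
    stratumPush hm hI (q, 1) = ⟨cell (stratumRetract hm hI q).1 (stratumRetract hm hI q).2.1,
      (stratumRetract hm hI q).2.2⟩ := by
  obtain ⟨q, hq⟩ := q
  induction q using Fat.ind with | h n x t
  refine Subtype.ext ((pushMap_cell x (cell_mem_stratum.1 hq m hm) 1).trans ?_)
  have h1 := stratumRetract_cell hm hI x t hq
  rw [HasGap.push_one, cell_map]
  exact (congrArg (fun p : X.obj m × GapSpace I m => cell p.1 p.2.1) h1).symm

/-- Every stratum is equivalent to its part lying in the cells of the lowest dimension. -/
lemma weakEquiv_stratumRetract (hm : m ∈ I) (hI : ∀ i ∈ I, i ≤ m) :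
    WeakEquiv (stratumRetract (X := X) hm hI) := by
  refine .of_shrinkable (s := fun p => ⟨cell p.1 p.2.1, p.2.2⟩) (D := stratumPush hm hI)
    (continuous_stratumRetract hm hI) ?_ (continuous_stratumPush hm hI) (fun p => ?_)
    (stratumPush_zero hm hI) (stratumPush_one hm hI)
  · exact Continuous.subtype_mk ((continuous_cell m).comp (continuous_fst.prodMk
      (continuous_subtype_val.comp continuous_snd))) _
  · obtain ⟨x, t, ht⟩ := p
    rw [stratumRetract_cell]
    obtain ⟨h1, h2⟩ := (ht m hm).emb_restrict
    simp only [h2]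
    rw [h1, X.face_refl]

/-- A map to an open-covered space is a weak equivalence if it is one over the strata. -/
lemma weakEquiv_of_stratum {Z : Type*} [TopologicalSpace Z] {f : X.Fat → Z} (hf : Continuous f)
    {U : ℕ → Set Z} (hUo : ∀ i, IsOpen (U i)) (hUc : ⋃ i, U i = univ)
    (hUf : ∀ i, f ⁻¹' U i = X.stratum {i})
    (h : ∀ (I : Finset ℕ) (m : ℕ), m ∈ I → (∀ i ∈ I, i ≤ m) →
      ∀ g : X.stratum I → (⋂ i ∈ I, U i : Set Z), Continuous g → (∀ q, (g q : Z) = f q) →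
      WeakEquiv g) : WeakEquiv f := by
  refine .of_openCover hf hUo hUc fun I hI => ?_
  have hpre : f ⁻¹' (⋂ i ∈ I, U i) = X.stratum I := by
    simp only [preimage_iInter, hUf, iInter_stratum]
  -- The preimage is generalized to a set `V` so that the equality with the stratum can be
  -- eliminated without transporting maps between subtypes.
  have key : ∀ (V : Set X.Fat) (hV : f ⁻¹' (⋂ i ∈ I, U i) = V),
      (∀ g : V → (⋂ i ∈ I, U i : Set Z), Continuous g → (∀ q, (g q : Z) = f q) → WeakEquiv g) →
      WeakEquiv ((⋂ i ∈ I, U i).restrictPreimage f) := by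
    rintro V rfl h
    exact h _ (hf.restrictPreimage) fun _ => rfl
  exact key _ hpre (h I (I.max' hI) (I.max'_mem hI) fun i hi => I.le_max' i hi)

/-- A map of semi-simplicial spaces which is a weak equivalence in every degree induces a weak
equivalence of fat realizations. -/
theorem Hom.weakEquiv_map (f : Hom X Y) (hf : ∀ n, WeakEquiv (f.app n)) : WeakEquiv f.map := by
  refine weakEquiv_of_stratum f.continuous_map (U := fun i => Y.stratum {i})
    (fun i => isOpen_stratum _) iUnion_stratum (fun i => ?_) fun I m hm hI g hg hgf => ?_
  · ext q; exact f.map_mem_stratum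
  -- After the retractions of source and target, the map over the stratum becomes `f.app m` times
  -- the identity of a space of gaps, a weak equivalence by hypothesis; two out of three gives the
  -- claim.
  · refine .of_comp_left hg (g := (stratumRetract hm hI) ∘ Homeomorph.setCongr (iInter_stratum I))
      ((weakEquiv_stratumRetract hm hI).comp (.of_homeomorph _)) ?_
    have h1 : WeakEquiv (Prod.map (f.app m) (_root_.id :
        GapSpace I m → _)) := by
      have := ((WeakEquiv.of_homeomorph (Homeomorph.prodComm _ _)).comp ((hf m).prodMap_id
        (GapSpace I m))).comp
        (.of_homeomorph (Homeomorph.prodComm _ _))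
      exact this
    convert h1.comp (weakEquiv_stratumRetract (X := X) hm hI) using 1
    funext q
    obtain ⟨q, hq⟩ := q
    induction q using Fat.ind with | h n x t
    have h2 : (Homeomorph.setCongr (iInter_stratum I)) (g ⟨cell x t, hq⟩) =
        (⟨cell (f.app n x) t, hq⟩ : Y.stratum I) := Subtype.ext (hgf ⟨cell x t, hq⟩)
    have h3 := stratumRetract_cell hm hI x t hq
    have h4 := stratumRetract_cell hm hI (f.app n x) t hq
    simp only [Function.comp, h2, Prod.map, _root_.id]
    refine h4.trans ?_
    rw [← f.app_face]
    exact (congrArg (fun p : X.obj m × GapSpace I m => (f.app m p.1, p.2)) h3).symm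

end SemiSimplicialSpace

end SemiSimplicial

/-! ### Products, disjoint unions and the interchange of iterated realizations -/

section BiSemiSimplicial

open Set Topology

namespace SemiSimplicialSpace

section Augment

variable {ι : Type*} {A : ι → Type*} [∀ j, TopologicalSpace (A j)]
  {X : ι → SemiSimplicialSpace.{w}} {Z : SemiSimplicialSpace.{w₁}}
  (e : ∀ n, Z.obj n ≃ₜ Σ j, A j × (X j).obj n)
  (he : ∀ {m n : ℕ} (η : Fin (m + 1) ↪o Fin (n + 1)) (z : Z.obj n),
    e m (Z.face η z) = ⟨(e n z).1, (e n z).2.1, (X _).face η (e n z).2.2⟩)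

/-- The comparison map from the fat realization of a disjoint union of products. -/
def distrib : Z.Fat → Σ j, A j × (X j).Fat :=
  Fat.lift (fun n z t => ⟨(e n z).1, (e n z).2.1, cell (e n z).2.2 t⟩) fun η z t => by
    rw [cell_map]
    exact (congrArg (fun c : Σ j, A j × (X j).obj _ =>
      (⟨c.1, c.2.1, cell c.2.2 t⟩ : Σ j, A j × (X j).Fat)) (he η z)).symm

lemma continuous_distrib : Continuous (distrib e he) := by
  refine Fat.continuous_of_comp_cell fun n => ?_
  have h1 : Continuous fun p : (Σ j, A j × (X j).obj n) × stdSimplex ℝ (Fin (n + 1)) =>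
      (⟨p.1.1, p.1.2.1, cell p.1.2.2 p.2⟩ : Σ j, A j × (X j).Fat) :=
    continuous_sigma_prod fun j => continuous_sigmaMk.comp
      ((continuous_fst.comp continuous_fst).prodMk ((continuous_cell n).comp
        ((continuous_snd.comp continuous_fst).prodMk continuous_snd)))
  exact h1.comp (((e n).continuous.comp continuous_fst).prodMk continuous_snd)

/-- The factors `A j` are arbitrary spaces, so the product with a quotient need not have the
quotient topology and the comparison need not be a homeomorphism. Over every intersection of strata,
however, both sides retract to the disjoint union of the spaces `A j × (X j).obj m × GapSpace I m`.
-/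
theorem weakEquiv_distrib : WeakEquiv (distrib e he) := by
  have hUo : ∀ I : Finset ℕ, IsOpen {z : Σ j, A j × (X j).Fat | z.2.2 ∈ (X z.1).stratum I} :=
    fun I => isOpen_sigma_iff.2 fun j => (isOpen_stratum I).preimage continuous_snd
  have hUI : ∀ I : Finset ℕ, ⋂ i ∈ I, {z : Σ j, A j × (X j).Fat | z.2.2 ∈ (X z.1).stratum {i}} =
      {z : Σ j, A j × (X j).Fat | z.2.2 ∈ (X z.1).stratum I} := fun I => by
    ext z
    change _ ↔ z.2.2 ∈ (X z.1).stratum I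
    rw [← iInter_stratum]
    simp
  refine weakEquiv_of_stratum (continuous_distrib e he)
    (U := fun i => {z : Σ j, A j × (X j).Fat | z.2.2 ∈ (X z.1).stratum {i}})
    (fun i => hUo {i}) ?_ (fun i => ?_) ?_
  · refine eq_univ_of_forall fun z => ?_
    obtain ⟨i, hi⟩ := mem_iUnion.1 ((iUnion_stratum (X := X z.1)).ge (mem_univ z.2.2))
    exact mem_iUnion.2 ⟨i, hi⟩
  · ext q
    induction q using Fat.ind
    exact Iff.rfl
  intro I m hm hI
  rw [hUI I]
  intro g hg hgf
  let k : (Σ j, A j × (X j).stratum I) →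
      {z : Σ j, A j × (X j).Fat | z.2.2 ∈ (X z.1).stratum I} :=
    fun c => ⟨⟨c.1, c.2.1, c.2.2.1⟩, c.2.2.2⟩
  have hk' : Continuous fun c => (k c).1 := continuous_sigma fun j =>
    (continuous_sigmaMk (σ := fun j => A j × (X j).Fat) (i := j)).comp
      (continuous_fst.prodMk (continuous_subtype_val.comp continuous_snd))
  have hk : Continuous k := hk'.subtype_mk _
  have hko : IsOpenMap k := by
    have h1 : IsOpenMap (fun c => (k c).1) := isOpenMap_sigma.2 fun j =>
      isOpenMap_sigmaMk.comp (IsOpenMap.id.prodMap (isOpen_stratum I).isOpenMap_subtype_val)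
    intro s hs
    have h2 := (h1 s hs).preimage (continuous_subtype_val
      (p := fun z => z ∈ {z : Σ j, A j × (X j).Fat | z.2.2 ∈ (X z.1).stratum I}))
    convert h2 using 1
    rw [← preimage_image_eq (k '' s) Subtype.val_injective, image_image]
  let E : (Σ j, A j × (X j).stratum I) ≃
      {z : Σ j, A j × (X j).Fat | z.2.2 ∈ (X z.1).stratum I} :=
    { toFun := k
      invFun := fun z => ⟨z.1.1, z.1.2.1, z.1.2.2, z.2⟩
      left_inv := fun _ => rfl
      right_inv := fun _ => rfl }
  -- The part of the target over the intersection of strata is the disjoint union of the products of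
  -- `A j` with strata, so the retractions of the single strata apply to it.
  let E' := E.toHomeomorphOfContinuousOpen hk hko
  have hr := WeakEquiv.sigmaMap (X := fun j => A j × (X j).stratum I)
    (Y := fun j => A j × (X j).obj m × GapSpace I m) (Equiv.refl ι)
    fun j => (weakEquiv_stratumRetract hm hI).prodMap_id (A j)
  refine .of_comp_left hg (hr.comp (.of_homeomorph E'.symm)) ?_
  have h1 := (WeakEquiv.sigmaMap (X := fun j => (A j × (X j).obj m) × GapSpace I m)
    (Y := fun j => A j × (X j).obj m × GapSpace I m) (Equiv.refl ι) (fun j => WeakEquiv.of_homeomorph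
    (Homeomorph.prodAssoc (A j) ((X j).obj m) (GapSpace I m)))).comp ((WeakEquiv.of_homeomorph
      (((e m).prodCongr (Homeomorph.refl (GapSpace I m))).trans
        Homeomorph.sigmaProdDistrib)).comp (weakEquiv_stratumRetract (X := Z) hm hI))
  convert h1 using 1
  funext q
  obtain ⟨q, hq⟩ := q
  induction q using Fat.ind with | h n z t
  have h2 : g ⟨cell z t, hq⟩ = ⟨⟨(e n z).1, (e n z).2.1, cell (e n z).2.2 t⟩, hq⟩ :=
    Subtype.ext (hgf ⟨cell z t, hq⟩)
  have h3 := stratumRetract_cell hm hI z t hq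
  have h4 := stratumRetract_cell hm hI (e n z).2.2 t hq
  change (⟨(E'.symm (g ⟨cell z t, hq⟩)).1, (E'.symm (g ⟨cell z t, hq⟩)).2.1,
    stratumRetract hm hI (E'.symm (g ⟨cell z t, hq⟩)).2.2⟩ :
      Σ j, A j × (X j).obj m × GapSpace I m) = (fun p : Z.obj m × GapSpace I m =>
      (⟨(e m p.1).1, (e m p.1).2.1, (e m p.1).2.2, p.2⟩ : Σ j, A j × (X j).obj m × GapSpace I m))
      (stratumRetract hm hI ⟨cell z t, hq⟩)
  rw [h2, h3]
  refine (congrArg (fun p : (X (e n z).1).obj m × GapSpace I m =>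
    (⟨(e n z).1, (e n z).2.1, p⟩ : Σ j, A j × (X j).obj m × GapSpace I m)) h4).trans ?_
  exact (congrArg (fun c : Σ j, A j × (X j).obj m => (⟨c.1, c.2.1, c.2.2, _⟩ :
    Σ j, A j × (X j).obj m × GapSpace I m)) (he (hq m hm).emb z)).symm

end Augment

end SemiSimplicialSpace

open SemiSimplicialSpace

/-- A bi-semi-simplicial space. -/
structure BiSemiSimplicialSpace where
  /-- the space of `(m, n)`-simplices -/
  obj : ℕ → ℕ → Type w
  [top : ∀ m n, TopologicalSpace (obj m n)]
  /-- the faces in the first direction -/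
  face₁ : ∀ {m n : ℕ} (k : ℕ), (Fin (m + 1) ↪o Fin (n + 1)) → obj n k → obj m k
  /-- the faces in the second direction -/
  face₂ : ∀ {m n : ℕ} (k : ℕ), (Fin (m + 1) ↪o Fin (n + 1)) → obj k n → obj k m
  continuous_face₁ : ∀ {m n : ℕ} (k : ℕ) (η : Fin (m + 1) ↪o Fin (n + 1)), Continuous (face₁ k η)
  continuous_face₂ : ∀ {m n : ℕ} (k : ℕ) (η : Fin (m + 1) ↪o Fin (n + 1)), Continuous (face₂ k η)
  face₁_refl : ∀ {n : ℕ} (k : ℕ) (x : obj n k), face₁ k (RelEmbedding.refl _) x = x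
  face₂_refl : ∀ {n : ℕ} (k : ℕ) (x : obj k n), face₂ k (RelEmbedding.refl _) x = x
  face₁_face₁ : ∀ {l m n : ℕ} (k : ℕ) (θ : Fin (l + 1) ↪o Fin (m + 1))
    (η : Fin (m + 1) ↪o Fin (n + 1)) (x : obj n k), face₁ k θ (face₁ k η x) = face₁ k (θ.trans η) x
  face₂_face₂ : ∀ {l m n : ℕ} (k : ℕ) (θ : Fin (l + 1) ↪o Fin (m + 1))
    (η : Fin (m + 1) ↪o Fin (n + 1)) (x : obj k n), face₂ k θ (face₂ k η x) = face₂ k (θ.trans η) x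
  face₁_face₂ : ∀ {k l m n : ℕ} (θ : Fin (k + 1) ↪o Fin (l + 1))
    (η : Fin (m + 1) ↪o Fin (n + 1)) (x : obj l n),
    face₁ m θ (face₂ l η x) = face₂ k η (face₁ n θ x)

namespace BiSemiSimplicialSpace

attribute [instance] BiSemiSimplicialSpace.top

/-- Exchange of the two directions. -/
def flip (Z : BiSemiSimplicialSpace.{w}) : BiSemiSimplicialSpace.{w} where
  obj m n := Z.obj n m
  face₁ := Z.face₂
  face₂ := Z.face₁
  continuous_face₁ := Z.continuous_face₂
  continuous_face₂ := Z.continuous_face₁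
  face₁_refl := Z.face₂_refl
  face₂_refl := Z.face₁_refl
  face₁_face₁ := Z.face₂_face₂
  face₂_face₂ := Z.face₁_face₁
  face₁_face₂ θ η x := (Z.face₁_face₂ η θ x).symm

/-- The semi-simplicial space of `(m, n)`-simplices with `m` fixed. -/
def row (Z : BiSemiSimplicialSpace.{w}) (m : ℕ) : SemiSimplicialSpace.{w} where
  obj n := Z.obj m n
  face η := Z.face₂ m η
  continuous_face := Z.continuous_face₂ m
  face_refl := Z.face₂_refl m
  face_face := Z.face₂_face₂ m

/-- A map of bi-semi-simplicial spaces. -/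
structure Hom (Z : BiSemiSimplicialSpace.{w₁}) (Z' : BiSemiSimplicialSpace.{w₂}) where
  /-- the map on `(m, n)`-simplices -/
  app : ∀ m n, Z.obj m n → Z'.obj m n
  continuous_app : ∀ m n, Continuous (app m n)
  app_face₁ : ∀ {m n : ℕ} (k : ℕ) (η : Fin (m + 1) ↪o Fin (n + 1)) (x : Z.obj n k),
    app m k (Z.face₁ k η x) = Z'.face₁ k η (app n k x)
  app_face₂ : ∀ {m n : ℕ} (k : ℕ) (η : Fin (m + 1) ↪o Fin (n + 1)) (x : Z.obj k n),
    app k m (Z.face₂ k η x) = Z'.face₂ k η (app k n x)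

variable {Z : BiSemiSimplicialSpace.{w₁}} {Z' : BiSemiSimplicialSpace.{w₂}}

/-- Exchange of the two directions. -/
def Hom.flip (f : Hom Z Z') : Hom Z.flip Z'.flip where
  app m n := f.app n m
  continuous_app m n := f.continuous_app n m
  app_face₁ := f.app_face₂
  app_face₂ := f.app_face₁

/-- The map on simplices with fixed first degree. -/
def Hom.row (f : Hom Z Z') (m : ℕ) : SemiSimplicialSpace.Hom (Z.row m) (Z'.row m) where
  app := f.app m
  continuous_app := f.continuous_app m
  app_face := f.app_face₂ m

/-- The face maps between the rows. -/
def rowFace (Z : BiSemiSimplicialSpace.{w}) {m n : ℕ} (η : Fin (m + 1) ↪o Fin (n + 1)) :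
    SemiSimplicialSpace.Hom (Z.row n) (Z.row m) where
  app k := Z.face₁ k η
  continuous_app k := Z.continuous_face₁ k η
  app_face θ x := Z.face₁_face₂ η θ x

/-- The semi-simplicial space of fat realizations of the rows. -/
def rows (Z : BiSemiSimplicialSpace.{w}) : SemiSimplicialSpace.{w} where
  obj m := (Z.row m).Fat
  face η := (Z.rowFace η).map
  continuous_face η := (Z.rowFace η).continuous_map
  face_refl x := by
    induction x using Fat.ind with | h k x t
    exact congrArg (cell · t) (Z.face₁_refl k x)
  face_face θ η x := by
    induction x using Fat.ind with | h k x t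
    exact congrArg (cell · t) (Z.face₁_face₁ k θ η x)

/-- The map of fat realizations of rows. -/
def Hom.rows (f : Hom Z Z') : SemiSimplicialSpace.Hom Z.rows Z'.rows where
  app m := (f.row m).map
  continuous_app m := (f.row m).continuous_map
  app_face η x := by
    induction x using Fat.ind with | h k x t
    exact congrArg (cell · t) (f.app_face₁ k η x)

/-- The exchange map between the two iterated fat realizations. -/
def swap (Z : BiSemiSimplicialSpace.{w}) : Z.rows.Fat → Z.flip.rows.Fat :=
  Fat.lift (fun m q s => Fat.lift (X := Z.row m)
      (fun n z t => cell (X := Z.flip.rows) (cell (X := Z.flip.row n) (n := m) z s) t)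
      (fun η z t => cell_map (X := Z.flip.rows) η _ t) q) (by
    intro k m η q s
    induction q using Fat.ind with | h n z t
    exact congrArg (cell (X := Z.flip.rows) · t) (cell_map (X := Z.flip.row n) η z s))

/-- Here products with quotients are harmless, because the other factor is a simplex and hence
locally compact. -/
lemma continuous_swap (Z : BiSemiSimplicialSpace.{w}) : Continuous Z.swap := by
  refine Fat.continuous_of_comp_cell fun m => ?_
  refine (isQuotientMap_quot_mk (r := (Z.row m).Glue)).continuous_lift_prod_left ?_
  refine continuous_sigma_prod fun n => ?_
  have h1 := continuous_cell (X := Z.flip.row n) m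
  have h2 := continuous_cell (X := Z.flip.rows) n
  exact h2.comp ((h1.comp ((continuous_fst.comp continuous_fst).prodMk continuous_snd)).prodMk
    (continuous_snd.comp continuous_fst))

/-- The two iterated fat realizations are homeomorphic. -/
def swapHomeomorph (Z : BiSemiSimplicialSpace.{w}) : Z.rows.Fat ≃ₜ Z.flip.rows.Fat where
  toFun := Z.swap
  invFun := Z.flip.swap
  left_inv q := by
    induction q using Fat.ind with | h m q s
    change (Z.row m).Fat at q
    induction q using Fat.ind with | h n z t
    rfl
  right_inv q := by
    induction q using Fat.ind with | h m q s
    change (Z.flip.row m).Fat at q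
    induction q using Fat.ind with | h n z t
    rfl
  continuous_toFun := Z.continuous_swap
  continuous_invFun := Z.flip.continuous_swap

/-- Realize the columns first: by hypothesis this gives degreewise weak equivalences, hence an
equivalence of fat realizations. The exchange homeomorphism carries the result to the realization by
rows. -/
theorem Hom.weakEquiv_rows_map (f : Hom Z Z') (hf : ∀ n, WeakEquiv (f.flip.row n).map) :
    WeakEquiv f.rows.map := by
  refine .of_comp_left f.rows.continuous_map (.of_homeomorph Z'.swapHomeomorph) ?_
  convert (f.flip.rows.weakEquiv_map hf).comp (.of_homeomorph Z.swapHomeomorph) using 1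
  funext q
  induction q using Fat.ind with | h m q s
  change (Z.row m).Fat at q
  induction q using Fat.ind with | h n z t
  rfl

end BiSemiSimplicialSpace

end BiSemiSimplicial

/-! ### Realizations as fat realizations of bar constructions -/

section Bar

open Set Topology SemiSimplicialSpace

variable {C : Type u₁} [Category.{v₁} C] {E : Type u₂} [Category.{v₂} E]

lemma map_homOfLE_comp {n : ℕ} (φ : ComposableArrows C n) {i j k : Fin (n + 1)} (hij : i ≤ j)
    (hjk : j ≤ k) (hik : i ≤ k) :
    φ.map (homOfLE hij) ≫ φ.map (homOfLE hjk) = φ.map (homOfLE hik) := by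
  rw [← φ.map_comp]; rfl

/-- The space of `n`-simplices of the bar construction. -/
abbrev BarObj (F : C ⥤ TopCat.{w₁}) (G : Cᵒᵖ ⥤ TopCat.{w₂}) (n : ℕ) : Type _ :=
  Σ φ : ComposableArrows C n, F.obj (φ.obj 0) × G.obj (op (φ.obj (Fin.last n)))

/-- The semi-simplicial space whose fat realization is the realization of a presheaf. -/
def bar (F : C ⥤ TopCat.{w₁}) (G : Cᵒᵖ ⥤ TopCat.{w₂}) : SemiSimplicialSpace where
  obj n := BarObj F G n
  face {m n} η x := ⟨faceSeq x.1 η, F.map (x.1.map (homOfLE (Fin.zero_le (η 0)))) x.2.1,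
    G.map (x.1.map (homOfLE (Fin.le_last (η (Fin.last m))))).op x.2.2⟩
  continuous_face {m n} η := continuous_sigma fun φ =>
    (continuous_sigmaMk (σ := fun φ : ComposableArrows C m =>
      F.obj (φ.obj 0) × G.obj (op (φ.obj (Fin.last m)))) (i := faceSeq φ η)).comp
      (((F.map (φ.map (homOfLE (Fin.zero_le (η 0))))).hom.continuous.comp continuous_fst).prodMk
        ((G.map (φ.map (homOfLE (Fin.le_last (η (Fin.last m))))).op).hom.continuous.comp
          continuous_snd))
  face_refl {n} x := by
    obtain ⟨φ, a, b⟩ := x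
    have h1 : φ.map (homOfLE (Fin.zero_le ((RelEmbedding.refl (· ≤ ·) :
      Fin (n + 1) ↪o Fin (n + 1)) 0))) = 𝟙 (φ.obj 0) := φ.map_id _
    have h2 : φ.map (homOfLE (Fin.le_last ((RelEmbedding.refl (· ≤ ·) :
      Fin (n + 1) ↪o Fin (n + 1)) (Fin.last n)))) = 𝟙 (φ.obj (Fin.last n)) := φ.map_id _
    refine congrArg (Sigma.mk φ) (Prod.ext ?_ ?_)
    · exact (ConcreteCategory.congr_hom (congrArg F.map h1) a).trans
        (ConcreteCategory.congr_hom (F.map_id _) a)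
    · exact (ConcreteCategory.congr_hom (congrArg (fun k => G.map (Quiver.Hom.op k)) h2) b).trans
        (ConcreteCategory.congr_hom (G.map_id _) b)
  face_face {l m n} θ η x := by
    obtain ⟨φ, a, b⟩ := x
    refine congrArg (Sigma.mk (faceSeq φ (θ.trans η))) (Prod.ext ?_ ?_)
    · refine (ConcreteCategory.congr_hom (F.map_comp _ _) a).symm.trans ?_
      exact ConcreteCategory.congr_hom (congrArg F.map
        (map_homOfLE_comp φ (Fin.zero_le (η 0)) (η.monotone (Fin.zero_le (θ 0))) _)) a
    · refine (ConcreteCategory.congr_hom (G.map_comp _ _) b).symm.trans ?_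
      exact ConcreteCategory.congr_hom (congrArg (fun k => G.map (Quiver.Hom.op k))
        (map_homOfLE_comp φ (η.monotone (Fin.le_last (θ (Fin.last l))))
          (Fin.le_last (η (Fin.last m))) _)) b

lemma Realization.ind {F : C ⥤ TopCat.{w₁}} {G : Cᵒᵖ ⥤ TopCat.{w₂}} {p : Realization F G → Prop}
    (h : ∀ (n : ℕ) (φ : ComposableArrows C n) a b t, p (Realization.mk φ a b t))
    (q : Realization F G) : p q :=
  Quot.ind (fun c => h c.1.1 c.1.2 c.2.1 c.2.2.1 c.2.2.2) q

lemma Realization.continuous_mk {F : C ⥤ TopCat.{w₁}} {G : Cᵒᵖ ⥤ TopCat.{w₂}} {n : ℕ}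
    (φ : ComposableArrows C n) :
    Continuous fun p : F.obj (φ.obj 0) × G.obj (op (φ.obj (Fin.last n))) ×
      stdSimplex ℝ (Fin (n + 1)) => Realization.mk (F := F) (G := G) φ p.1 p.2.1 p.2.2 :=
  continuous_quot_mk.comp (continuous_sigmaMk (σ := fun p : (Σ n : ℕ, ComposableArrows C n) =>
    F.obj (p.2.obj 0) × G.obj (op (p.2.obj (Fin.last p.1))) × stdSimplex ℝ (Fin (p.1 + 1)))
    (i := ⟨n, φ⟩))

lemma Realization.mk_map {F : C ⥤ TopCat.{w₁}} {G : Cᵒᵖ ⥤ TopCat.{w₂}} {m n : ℕ}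
    (φ : ComposableArrows C n) (η : Fin (m + 1) ↪o Fin (n + 1))
    (a : F.obj (φ.obj 0)) (b : G.obj (op (φ.obj (Fin.last n)))) (t : stdSimplex ℝ (Fin (m + 1))) :
    Realization.mk φ a b (stdSimplex.map η t) =
      Realization.mk (faceSeq φ η) (F.map (φ.map (homOfLE (Fin.zero_le (η 0)))) a)
        (G.map (φ.map (homOfLE (Fin.le_last (η (Fin.last m))))).op b) t :=
  Quot.sound (.glue φ η a b t)

lemma Realization.continuous_of_comp_mk {F : C ⥤ TopCat.{w₁}} {G : Cᵒᵖ ⥤ TopCat.{w₂}}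
    {Z : Type*} [TopologicalSpace Z] {g : Realization F G → Z}
    (hg : ∀ (n : ℕ) (φ : ComposableArrows C n),
      Continuous fun p : F.obj (φ.obj 0) × G.obj (op (φ.obj (Fin.last n))) ×
      stdSimplex ℝ (Fin (n + 1)) => g (Realization.mk φ p.1 p.2.1 p.2.2)) : Continuous g :=
  isQuotientMap_quot_mk.continuous_iff.2 (continuous_sigma fun p => hg p.1 p.2)

lemma Realization.continuous_prod_of_comp_mk {F : C ⥤ TopCat.{w₁}} {G : Cᵒᵖ ⥤ TopCat.{w₂}}
    {Y Z : Type*} [TopologicalSpace Y] [LocallyCompactSpace Y] [TopologicalSpace Z]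
    {g : Realization F G × Y → Z}
    (hg : ∀ (n : ℕ) (φ : ComposableArrows C n),
      Continuous fun p : (F.obj (φ.obj 0) × G.obj (op (φ.obj (Fin.last n))) ×
      stdSimplex ℝ (Fin (n + 1))) × Y => g (Realization.mk φ p.1.1 p.1.2.1 p.1.2.2, p.2)) :
    Continuous g :=
  (isQuotientMap_quot_mk (r := FaceRel F G)).continuous_lift_prod_left
    (continuous_sigma_prod fun p => hg p.1 p.2)

/-- Maps out of a realization. -/
def Realization.lift {F : C ⥤ TopCat.{w₁}} {G : Cᵒᵖ ⥤ TopCat.{w₂}} {Z : Type*}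
    (g : ∀ (n : ℕ) (φ : ComposableArrows C n), F.obj (φ.obj 0) →
      G.obj (op (φ.obj (Fin.last n))) → stdSimplex ℝ (Fin (n + 1)) → Z)
    (hg : ∀ {m n : ℕ} (φ : ComposableArrows C n) (η : Fin (m + 1) ↪o Fin (n + 1)) a b t,
      g n φ a b (stdSimplex.map η t) =
      g m (faceSeq φ η) (F.map (φ.map (homOfLE (Fin.zero_le (η 0)))) a)
        (G.map (φ.map (homOfLE (Fin.le_last (η (Fin.last m))))).op b) t) :
    Realization F G → Z :=
  Quot.lift (fun c => g c.1.1 c.1.2 c.2.1 c.2.2.1 c.2.2.2) fun _ _ ⟨φ, η, a, b, t⟩ => hg φ η a b t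

/-- The realization as the fat realization of the bar construction. -/
def barHomeomorph (F : C ⥤ TopCat.{w₁}) (G : Cᵒᵖ ⥤ TopCat.{w₂}) :
    Realization F G ≃ₜ (bar F G).Fat where
  toFun := Realization.lift (fun n φ a b t => cell (X := bar F G) (n := n) (⟨φ, a, b⟩ : BarObj F G n) t)
    fun φ η a b t => cell_map (X := bar F G) η (⟨φ, a, b⟩ : BarObj F G _) t
  invFun := Fat.lift (fun n (x : BarObj F G n) t => Realization.mk x.1 x.2.1 x.2.2 t)
    fun η (x : BarObj F G _) t => Realization.mk_map x.1 η x.2.1 x.2.2 t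
  left_inv q := by
    induction q using Realization.ind
    rfl
  right_inv q := by
    induction q using Fat.ind
    rfl
  continuous_toFun := Realization.continuous_of_comp_mk fun n φ =>
    (continuous_cell (X := bar F G) n).comp
      ((continuous_sigmaMk (σ := fun φ : ComposableArrows C n =>
        F.obj (φ.obj 0) × G.obj (op (φ.obj (Fin.last n)))) (i := φ)).comp
        (continuous_fst.prodMk (continuous_fst.comp continuous_snd)) |>.prodMk
        (continuous_snd.comp continuous_snd))
  continuous_invFun := Fat.continuous_of_comp_cell fun n => continuous_sigma_prod fun φ =>
    (Realization.continuous_mk φ).comp ((continuous_fst.comp continuous_fst).prodMk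
      ((continuous_snd.comp continuous_fst).prodMk continuous_snd))

/-- The map of bar constructions induced by natural transformations. -/
def barMap {F F' : C ⥤ TopCat.{w₁}} {G G' : Cᵒᵖ ⥤ TopCat.{w₂}} (α : F ⟶ F') (β : G ⟶ G') :
    SemiSimplicialSpace.Hom (bar F G) (bar F' G') where
  app n (x : BarObj F G n) := (⟨x.1, α.app _ x.2.1, β.app _ x.2.2⟩ : BarObj F' G' n)
  continuous_app n := continuous_sigma fun φ =>
    (continuous_sigmaMk (σ := fun φ : ComposableArrows C n =>
      F'.obj (φ.obj 0) × G'.obj (op (φ.obj (Fin.last n)))) (i := φ)).comp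
      (((α.app _).hom.continuous.comp continuous_fst).prodMk
        ((β.app _).hom.continuous.comp continuous_snd))
  app_face η x := by
    obtain ⟨φ, a, b⟩ : BarObj F G _ := x
    exact congrArg (Sigma.mk (faceSeq φ η)) (Prod.ext (NatTrans.naturality_apply α _ a)
      (NatTrans.naturality_apply β _ b))

lemma weakEquiv_barMap_iff {F F' : C ⥤ TopCat.{w₁}} {G G' : Cᵒᵖ ⥤ TopCat.{w₂}} (α : F ⟶ F')
    (β : G ⟶ G') : WeakEquiv (barMap α β).map ↔ WeakEquiv (Realization.map α β) := by
  have h : (barMap α β).map ∘ barHomeomorph F G = barHomeomorph F' G' ∘ Realization.map α β := by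
    funext q
    induction q using Realization.ind
    rfl
  refine ⟨fun hw => .of_comp_left (Realization.map α β).continuous
    (.of_homeomorph (barHomeomorph F' G')) (h ▸ hw.comp (.of_homeomorph _)),
    fun hw => .of_comp_right (barMap α β).continuous_map (.of_homeomorph (barHomeomorph F G)) ?_⟩
  rw [h]
  exact (WeakEquiv.of_homeomorph _).comp hw

/-- Objectwise weak equivalences of presheaves induce weak equivalences of realizations. -/
theorem weakEquiv_realization_map (F : C ⥤ TopCat.{w₁}) {G G' : Cᵒᵖ ⥤ TopCat.{w₂}} (β : G ⟶ G')
    (hβ : ∀ X, WeakEquiv (β.app X)) : WeakEquiv (Realization.map (𝟙 F) β) :=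
  (weakEquiv_barMap_iff _ _).1 <| (barMap (𝟙 F) β).weakEquiv_map fun n =>
    WeakEquiv.sigmaMap (X := fun φ : ComposableArrows C n =>
        F.obj (φ.obj 0) × G.obj (op (φ.obj (Fin.last n))))
      (Y := fun φ : ComposableArrows C n => F.obj (φ.obj 0) × G'.obj (op (φ.obj (Fin.last n))))
      (Equiv.refl _) fun φ => (hβ (op (φ.obj (Fin.last n)))).prodMap_id (F.obj (φ.obj 0))

end Bar

/-! ### The double bar construction -/

section Fubini

open Set Topology SemiSimplicialSpace

variable {C : Type u₁} [Category.{v₁} C] {E : Type u₂} [Category.{v₂} E]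
  (F : C ⥤ TopCat.{w}) (K : Cᵒᵖ ⥤ E ⥤ TopCat.{w₁}) {K' : Cᵒᵖ ⥤ E ⥤ TopCat.{w₁}}
  (H : Eᵒᵖ ⥤ TopCat.{w₂})

/-- The presheaf of realizations of a presheaf of functors. -/
def realizationPresheaf : Cᵒᵖ ⥤ TopCat where
  obj X := TopCat.of (Realization (K.obj X) H)
  map f := TopCat.ofHom (Realization.map (K.map f) (𝟙 H))
  map_id X := by
    ext q
    induction q using Realization.ind with | h n φ a b t
    change Realization.mk φ ((K.map (𝟙 X)).app _ a) b t = Realization.mk φ a b t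
    rw [K.map_id]; rfl
  map_comp f g := by
    ext q
    induction q using Realization.ind with | h n φ a b t
    change Realization.mk φ ((K.map (f ≫ g)).app _ a) b t = _
    rw [K.map_comp]; rfl

variable {K} in
/-- The map of presheaves of realizations. -/
def realizationPresheafMap (α : K ⟶ K') : realizationPresheaf K H ⟶ realizationPresheaf K' H where
  app X := TopCat.ofHom (Realization.map (α.app X) (𝟙 H))
  naturality X Y f := by
    ext q
    induction q using Realization.ind with | h n φ a b t
    change Realization.mk φ ((K.map f ≫ α.app Y).app _ a) b t = _
    rw [α.naturality]; rfl

/-- The double bar construction. -/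
def doubleBar : BiSemiSimplicialSpace where
  obj m n := Σ φ : ComposableArrows C m, F.obj (φ.obj 0) ×
    (bar (K.obj (op (φ.obj (Fin.last m)))) H).obj n
  face₁ {m n} k η x := ⟨faceSeq x.1 η, F.map (x.1.map (homOfLE (Fin.zero_le (η 0)))) x.2.1,
    (barMap (K.map (x.1.map (homOfLE (Fin.le_last (η (Fin.last m))))).op) (𝟙 H)).app k x.2.2⟩
  face₂ k η x := ⟨x.1, x.2.1, (bar _ H).face η x.2.2⟩
  continuous_face₁ {m n} k η := continuous_sigma fun φ =>
    (continuous_sigmaMk (σ := fun φ : ComposableArrows C m => F.obj (φ.obj 0) ×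
      (bar (K.obj (op (φ.obj (Fin.last m)))) H).obj k) (i := faceSeq φ η)).comp
      (((F.map (φ.map (homOfLE (Fin.zero_le (η 0))))).hom.continuous.comp continuous_fst).prodMk
        (((barMap (K.map (φ.map (homOfLE (Fin.le_last (η (Fin.last m))))).op) (𝟙 H)).continuous_app k).comp continuous_snd))
  continuous_face₂ {m n} k η := continuous_sigma fun φ =>
    (continuous_sigmaMk (σ := fun φ : ComposableArrows C k => F.obj (φ.obj 0) ×
      (bar (K.obj (op (φ.obj (Fin.last k)))) H).obj m) (i := φ)).comp
      (continuous_fst.prodMk (((bar _ H).continuous_face η).comp continuous_snd))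
  face₁_refl {n} k x := by
    obtain ⟨φ, a, x⟩ := x
    obtain ⟨ψ, c, h⟩ : BarObj _ H k := x
    refine congrArg (Sigma.mk φ) (Prod.ext ?_
      (congrArg (fun c => (⟨ψ, c, h⟩ : BarObj (K.obj (op (φ.obj (Fin.last n)))) H k)) ?_))
    · exact (ConcreteCategory.congr_hom (congrArg F.map (φ.map_id 0)) a).trans
        (ConcreteCategory.congr_hom (F.map_id _) a)
    · have h1 : K.map (φ.map (𝟙 (Fin.last n))).op = 𝟙 _ := by
        rw [φ.map_id]; exact K.map_id _
      exact ConcreteCategory.congr_hom (NatTrans.congr_app h1 (ψ.obj 0)) c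
  face₂_refl k x := by
    obtain ⟨φ, a, x⟩ := x
    exact congrArg (fun y => (⟨φ, a, y⟩ : Σ φ : ComposableArrows C k, F.obj (φ.obj 0) ×
      (bar (K.obj (op (φ.obj (Fin.last k)))) H).obj _)) ((bar _ H).face_refl x)
  face₁_face₁ {l m n} k θ η x := by
    obtain ⟨φ, a, x⟩ := x
    obtain ⟨ψ, c, h⟩ : BarObj _ H k := x
    refine congrArg (Sigma.mk (faceSeq φ (θ.trans η))) (Prod.ext ?_ (congrArg (fun c => (⟨ψ, c, h⟩ :
      BarObj (K.obj (op (φ.obj (η (θ (Fin.last l)))))) H k)) ?_))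
    · refine (ConcreteCategory.congr_hom (F.map_comp _ _) a).symm.trans ?_
      exact ConcreteCategory.congr_hom (congrArg F.map
        (map_homOfLE_comp φ (Fin.zero_le (η 0)) (η.monotone (Fin.zero_le (θ 0))) _)) a
    · have h1 := congrArg (fun k => K.map (Quiver.Hom.op k))
        (map_homOfLE_comp φ (η.monotone (Fin.le_last (θ (Fin.last l))))
          (Fin.le_last (η (Fin.last m))) (Fin.le_last _))
      have h2 := (K.map_comp _ _).symm.trans h1
      exact ConcreteCategory.congr_hom (NatTrans.congr_app h2 (ψ.obj 0)) c
  face₂_face₂ k θ η x := by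
    obtain ⟨φ, a, x⟩ := x
    exact congrArg (fun y => (⟨φ, a, y⟩ : Σ φ : ComposableArrows C k, F.obj (φ.obj 0) ×
      (bar (K.obj (op (φ.obj (Fin.last k)))) H).obj _)) ((bar _ H).face_face θ η x)
  face₁_face₂ {k l m n} θ η x := by
    obtain ⟨φ, a, x⟩ := x
    exact congrArg (fun y => (⟨faceSeq φ θ, F.map (φ.map (homOfLE (Fin.zero_le (θ 0)))) a, y⟩ :
      Σ φ : ComposableArrows C k, F.obj (φ.obj 0) ×
      (bar (K.obj (op (φ.obj (Fin.last k)))) H).obj m)) ((barMap _ (𝟙 H)).app_face η x)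

end Fubini

/-! ### Interchange of realizations over two categories -/

section FubiniEquivalence

open Set Topology SemiSimplicialSpace

variable {C : Type u₁} [Category.{v₁} C] {E : Type u₂} [Category.{v₂} E]
  (F : C ⥤ TopCat.{w}) {K : Cᵒᵖ ⥤ E ⥤ TopCat.{w₁}} {K' : Cᵒᵖ ⥤ E ⥤ TopCat.{w₁}}
  (H : Eᵒᵖ ⥤ TopCat.{w₂})

/-- The morphism of presheaves obtained by evaluation at an object of `E`. -/
def flipMap (α : K ⟶ K') (e : E) : K.flip.obj e ⟶ K'.flip.obj e where
  app X := (α.app X).app e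
  naturality _ _ f := NatTrans.congr_app (α.naturality f) e

/-- The map of double bar constructions. -/
def doubleBarMap (α : K ⟶ K') :
    BiSemiSimplicialSpace.Hom (doubleBar F K H) (doubleBar F K' H) where
  app m n x := ⟨x.1, x.2.1, (barMap (α.app _) (𝟙 H)).app n x.2.2⟩
  continuous_app m n := continuous_sigma fun φ =>
    (continuous_sigmaMk (σ := fun φ : ComposableArrows C m => F.obj (φ.obj 0) ×
      (bar (K'.obj (op (φ.obj (Fin.last m)))) H).obj n) (i := φ)).comp
      (continuous_fst.prodMk (((barMap (α.app (op (φ.obj (Fin.last m)))) (𝟙 H)).continuous_app n).comp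
        continuous_snd))
  app_face₁ {m n} k η x := by
    obtain ⟨φ, a, x⟩ := x
    obtain ⟨ψ, c, h⟩ : BarObj _ H k := x
    refine congrArg (Sigma.mk (faceSeq φ η)) (Prod.ext rfl (congrArg (fun c => (⟨ψ, c, h⟩ :
      BarObj (K'.obj (op (φ.obj (η (Fin.last m))))) H k)) ?_))
    exact ConcreteCategory.congr_hom (NatTrans.congr_app
      (α.naturality (φ.map (homOfLE (Fin.le_last (η (Fin.last m))))).op) (ψ.obj 0)) c
  app_face₂ {m n} k η x := by
    obtain ⟨φ, a, x⟩ := x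
    exact congrArg (fun y => (⟨φ, a, y⟩ : Σ φ : ComposableArrows C k, F.obj (φ.obj 0) ×
      (bar (K'.obj (op (φ.obj (Fin.last k)))) H).obj m)) ((barMap _ (𝟙 H)).app_face η x)

variable (K)

/-- The comparison of a row of the double bar construction with simplices of the bar construction
of the presheaf of realizations. -/
def rowMap (m : ℕ) : ((doubleBar F K H).row m).Fat → (bar F (realizationPresheaf K H)).obj m :=
  Sigma.map (Equiv.refl _) (fun φ : ComposableArrows C m => Prod.map (_root_.id : F.obj (φ.obj 0) → _)
    (barHomeomorph (K.obj (op (φ.obj (Fin.last m)))) H).symm) ∘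
  distrib (Z := (doubleBar F K H).row m) (A := fun φ : ComposableArrows C m => F.obj (φ.obj 0))
    (X := fun φ => bar (K.obj (op (φ.obj (Fin.last m)))) H) (fun _ => Homeomorph.refl _)
    fun _ _ => rfl

lemma weakEquiv_rowMap (m : ℕ) : WeakEquiv (rowMap F K H m) :=
  (WeakEquiv.sigmaMap (X := fun φ : ComposableArrows C m => F.obj (φ.obj 0) ×
      (bar (K.obj (op (φ.obj (Fin.last m)))) H).Fat)
    (Y := fun φ : ComposableArrows C m => F.obj (φ.obj 0) ×
      (realizationPresheaf K H).obj (op (φ.obj (Fin.last m)))) (Equiv.refl _) fun φ =>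
    (WeakEquiv.of_homeomorph (barHomeomorph (K.obj (op (φ.obj (Fin.last m)))) H).symm).prodMap_id
      (F.obj (φ.obj 0))).comp (weakEquiv_distrib (Z := (doubleBar F K H).row m)
        (A := fun φ : ComposableArrows C m => F.obj (φ.obj 0))
        (X := fun φ => bar (K.obj (op (φ.obj (Fin.last m)))) H) (fun _ => Homeomorph.refl _)
        fun _ _ => rfl)

/-- The comparison of the rows of the double bar construction with the bar construction
of the presheaf of realizations. -/
def rowsHom : SemiSimplicialSpace.Hom (doubleBar F K H).rows (bar F (realizationPresheaf K H)) where
  app := rowMap F K H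
  continuous_app m := (weakEquiv_rowMap F K H m).continuous
  app_face η q := by
    induction q using Fat.ind with | h n x t
    rfl

/-- Exchange of the factors in the simplices of the double bar construction. -/
def doubleBarFlip (m n : ℕ) : (doubleBar F K H).flip.obj n m ≃ₜ
    Σ ψ : ComposableArrows E n, H.obj (op (ψ.obj (Fin.last n))) ×
      (bar F (K.flip.obj (ψ.obj 0))).obj m where
  toFun x := ⟨x.2.2.1, x.2.2.2.2, x.1, x.2.1, x.2.2.2.1⟩
  invFun y := ⟨y.2.2.1, y.2.2.2.1, y.1, y.2.2.2.2, y.2.1⟩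
  left_inv _ := rfl
  right_inv _ := rfl
  continuous_toFun := continuous_sigma fun φ => continuous_prod_sigma fun ψ =>
    (continuous_sigmaMk (σ := fun ψ : ComposableArrows E n => H.obj (op (ψ.obj (Fin.last n))) ×
      (bar F (K.flip.obj (ψ.obj 0))).obj m) (i := ψ)).comp
      ((continuous_snd.comp continuous_snd).prodMk
        ((continuous_sigmaMk (σ := fun φ : ComposableArrows C m => F.obj (φ.obj 0) ×
          (K.flip.obj (ψ.obj 0)).obj (op (φ.obj (Fin.last m)))) (i := φ)).comp
          (continuous_fst.prodMk (continuous_fst.comp continuous_snd))))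
  continuous_invFun := continuous_sigma fun ψ => continuous_prod_sigma fun φ =>
    (continuous_sigmaMk (σ := fun φ : ComposableArrows C m => F.obj (φ.obj 0) ×
      (bar (K.obj (op (φ.obj (Fin.last m)))) H).obj n) (i := φ)).comp
      ((continuous_fst.comp continuous_snd).prodMk
        ((continuous_sigmaMk (σ := fun ψ : ComposableArrows E n =>
          (K.obj (op (φ.obj (Fin.last m)))).obj (ψ.obj 0) × H.obj (op (ψ.obj (Fin.last n))))
          (i := ψ)).comp ((continuous_snd.comp continuous_snd).prodMk continuous_fst)))

lemma doubleBarFlip_face (k : ℕ) {m n : ℕ} (η : Fin (m + 1) ↪o Fin (n + 1))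
    (x : (doubleBar F K H).obj n k) :
    doubleBarFlip F K H m k ((doubleBar F K H).face₁ k η x) =
      ⟨(doubleBarFlip F K H n k x).1, (doubleBarFlip F K H n k x).2.1,
        (bar F (K.flip.obj _)).face η (doubleBarFlip F K H n k x).2.2⟩ := rfl

/-- The comparison of a column of the double bar construction with a union of realizations. -/
def colMap (n : ℕ) : ((doubleBar F K H).flip.row n).Fat →
    Σ ψ : ComposableArrows E n, H.obj (op (ψ.obj (Fin.last n))) ×
      (bar F (K.flip.obj (ψ.obj 0))).Fat :=
  distrib (Z := (doubleBar F K H).flip.row n)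
    (A := fun ψ : ComposableArrows E n => H.obj (op (ψ.obj (Fin.last n))))
    (X := fun ψ => bar F (K.flip.obj (ψ.obj 0))) (fun m => doubleBarFlip F K H m n)
    (doubleBarFlip_face F K H n)

variable {K}

/-- A morphism of presheaves of functors which induces weak equivalences of realizations over `C`
induces a weak equivalence of realizations of the presheaves of realizations over `E`. -/
theorem weakEquiv_realizationPresheafMap (α : K ⟶ K')
    (hα : ∀ e, WeakEquiv (Realization.map (𝟙 F) (flipMap α e))) :
    WeakEquiv (Realization.map (𝟙 F) (realizationPresheafMap H α)) := by
  rw [← weakEquiv_barMap_iff]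
  -- A column is, up to weak equivalence, the disjoint union over the sequences `ψ` in `E` of the
  -- products of `H` at the last object with the realization over `C` of `K` at `ψ.obj 0`. There
  -- `hα` applies.
  have hcol : ∀ n, WeakEquiv ((doubleBarMap F H α).flip.row n).map := by
    intro n
    refine .of_comp_left (Hom.continuous_map _) (g := colMap F K' H n) (weakEquiv_distrib _ _) ?_
    have h1 := (WeakEquiv.sigmaMap
      (X := fun ψ : ComposableArrows E n => H.obj (op (ψ.obj (Fin.last n))) ×
        (bar F (K.flip.obj (ψ.obj 0))).Fat)
      (Y := fun ψ : ComposableArrows E n => H.obj (op (ψ.obj (Fin.last n))) ×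
        (bar F (K'.flip.obj (ψ.obj 0))).Fat) (Equiv.refl _) fun ψ =>
      ((weakEquiv_barMap_iff _ _).2 (hα (ψ.obj 0))).prodMap_id
        (H.obj (op (ψ.obj (Fin.last n))))).comp
      (weakEquiv_distrib (Z := (doubleBar F K H).flip.row n)
        (A := fun ψ : ComposableArrows E n => H.obj (op (ψ.obj (Fin.last n))))
        (X := fun ψ => bar F (K.flip.obj (ψ.obj 0))) (fun m => doubleBarFlip F K H m n)
        (doubleBarFlip_face F K H n))
    convert h1 using 1
    funext q
    induction q using Fat.ind with | h m x t
    rfl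
  have hrow := (doubleBarMap F H α).weakEquiv_rows_map hcol
  -- The rows, on the other hand, compute the bar construction of the presheaf of realizations.
  have hr := (rowsHom F K H).weakEquiv_map (weakEquiv_rowMap F K H)
  have hr' := (rowsHom F K' H).weakEquiv_map (weakEquiv_rowMap F K' H)
  refine .of_comp_right (Hom.continuous_map _) hr ?_
  convert hr'.comp hrow using 1
  funext q
  induction q using Fat.ind with | h m q s
  change ((doubleBar F K H).row m).Fat at q
  induction q using Fat.ind with | h n x t
  rfl

end FubiniEquivalence

/-! ### Realization of discrete presheaves over their categories of elements -/

section Elements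

open Set Topology SemiSimplicialSpace

variable {B : Type u₁} [Category.{v₁} B] {C : Type u₂} [Category.{v₂} C]
  (F : C ⥤ TopCat.{w}) (p : B ⥤ C) (Q : Cᵒᵖ ⥤ TopCat.{w₁}) (R : Bᵒᵖ ⥤ TopCat.{w₂})
  (x : ∀ b, Q.obj (op (p.obj b)))
  (hx : ∀ {b b' : B} (f : b ⟶ b'), Q.map (p.map f).op (x b') = x b)

/-- The map of bar constructions given by a compatible family of elements of a presheaf. -/
def elementsHom : SemiSimplicialSpace.Hom (bar (p ⋙ F) R) (bar F Q) where
  app n (y : BarObj (p ⋙ F) R n) := (⟨y.1 ⋙ p, y.2.1, x (y.1.obj (Fin.last n))⟩ : BarObj F Q n)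
  continuous_app n := continuous_sigma fun φ =>
    (continuous_sigmaMk (σ := fun φ : ComposableArrows C n =>
      F.obj (φ.obj 0) × Q.obj (op (φ.obj (Fin.last n)))) (i := φ ⋙ p)).comp
      (continuous_fst.prodMk (continuous_const (y := x (φ.obj (Fin.last n)))))
  app_face {m n} η y := by
    obtain ⟨φ, a, b⟩ : BarObj (p ⋙ F) R n := y
    exact congrArg (Sigma.mk (faceSeq (φ ⋙ p) η)) (Prod.ext rfl
      (hx (φ.map (homOfLE (Fin.le_last (η (Fin.last m)))))).symm)

variable [∀ X, DiscreteTopology (Q.obj X)]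

/-- If the simplices of `B` are the simplices of `C` decorated with elements of `Q` at their last
vertex, then the realization over `B` of a one-point presheaf is the realization of `Q`. -/
lemma weakEquiv_elementsHom (hR : ∀ b, Nonempty (Unique (R.obj b)))
    (hb : ∀ n, Function.Bijective fun φ : ComposableArrows B n =>
      (⟨φ ⋙ p, x (φ.obj (Fin.last n))⟩ :
        Σ Y : ComposableArrows C n, Q.obj (op (Y.obj (Fin.last n))))) :
    WeakEquiv (elementsHom F p Q R x hx).map := by
  refine Hom.weakEquiv_map _ fun n => ?_
  have h1 := WeakEquiv.sigmaMap
    (X := fun φ : ComposableArrows B n => (p ⋙ F).obj (φ.obj 0) × R.obj (op (φ.obj (Fin.last n))))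
    (Y := fun z : Σ Y : ComposableArrows C n, Q.obj (op (Y.obj (Fin.last n))) => F.obj (z.1.obj 0))
    (Equiv.ofBijective _ (hb n)) (f := fun φ => Prod.fst) fun φ => by
      obtain ⟨h⟩ := hR (op (φ.obj (Fin.last n)))
      exact .of_homeomorph (Homeomorph.prodUnique ((p ⋙ F).obj (φ.obj 0))
        (R.obj (op (φ.obj (Fin.last n)))))
  -- Since `Q` is discrete, the product with a value of `Q` is a disjoint union over its points.
  let e : (Σ z : Σ Y : ComposableArrows C n, Q.obj (op (Y.obj (Fin.last n))), F.obj (z.1.obj 0)) ≃ₜ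
      BarObj F Q n :=
    { toFun := fun y => ⟨y.1.1, y.2, y.1.2⟩
      invFun := fun y => ⟨⟨y.1, y.2.2⟩, y.2.1⟩
      left_inv := fun _ => rfl
      right_inv := fun _ => rfl
      continuous_toFun := continuous_sigma fun z =>
        (continuous_sigmaMk (σ := fun φ : ComposableArrows C n =>
          F.obj (φ.obj 0) × Q.obj (op (φ.obj (Fin.last n)))) (i := z.1)).comp
          (continuous_id.prodMk (continuous_const (y := z.2)))
      continuous_invFun := continuous_sigma fun Y => continuous_prod_of_discrete_right.2 fun q =>
        continuous_sigmaMk (σ := fun z : Σ Y : ComposableArrows C n,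
          Q.obj (op (Y.obj (Fin.last n))) => F.obj (z.1.obj 0)) (i := ⟨Y, q⟩) }
  exact (WeakEquiv.of_homeomorph e).comp h1

/-- The map of realizations given by a compatible family of elements of a presheaf. -/
def elementsMap : Realization (p ⋙ F) R → Realization F Q :=
  (barHomeomorph F Q).symm ∘ (elementsHom F p Q R x hx).map ∘ barHomeomorph (p ⋙ F) R

lemma weakEquiv_elementsMap (hR : ∀ b, Nonempty (Unique (R.obj b)))
    (hb : ∀ n, Function.Bijective fun φ : ComposableArrows B n =>
      (⟨φ ⋙ p, x (φ.obj (Fin.last n))⟩ :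
        Σ Y : ComposableArrows C n, Q.obj (op (Y.obj (Fin.last n))))) :
    WeakEquiv (elementsMap F p Q R x hx) :=
  (WeakEquiv.of_homeomorph _).comp ((weakEquiv_elementsHom F p Q R x hx hR hb).comp
    (.of_homeomorph _))

end Elements

/-! ### Covariant descent as a comparison of two discrete presheaves -/

section Descent

variable {C : Type u} [Category.{v} C] (J : GrothendieckTopology C)

/-- The morphisms from the maximal sieve of `X` to a covering sieve, as a discrete space. -/
def coverHom : Cᵒᵖ ⥤ CoverPair J ⥤ TopCat.{v} where
  obj X :=
    { obj e := TopCat.discrete.obj ((CoverPair.xi J).obj X.unop ⟶ e)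
      map f := TopCat.discrete.map (↾ fun u => u ≫ f)
      map_id e := by ext u; exact Category.comp_id (obj := CoverPair J) u
      map_comp f g := by ext u; exact (Category.assoc (obj := CoverPair J) u f g).symm }
  map g :=
    { app e := TopCat.discrete.map (↾ fun u => (CoverPair.xi J).map g.unop ≫ u)
      naturality e e' f := by
        ext u; exact (Category.assoc (obj := CoverPair J) ((CoverPair.xi J).map g.unop) u f).symm }
  map_id X := by
    ext e u
    exact CoverPair.hom_ext (Category.id_comp _)
  map_comp f g := by
    ext e u
    exact CoverPair.hom_ext (Category.assoc _ _ _)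

/-- The morphisms from `X` to the object under a covering sieve, as a discrete space. -/
def baseHom : Cᵒᵖ ⥤ CoverPair J ⥤ TopCat.{v} where
  obj X :=
    { obj e := TopCat.discrete.obj (X.unop ⟶ e.base)
      map f := TopCat.discrete.map (↾ fun u => u ≫ CoverPair.Hom.hom f)
      map_id e := by ext u; exact Category.comp_id (obj := C) u
      map_comp f g := by ext u; exact (Category.assoc (obj := C) u f.hom g.hom).symm }
  map g :=
    { app e := TopCat.discrete.map (↾ fun u => g.unop ≫ u)
      naturality e e' f := by ext u; exact (Category.assoc (obj := C) g.unop u f.hom).symm }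
  map_id X := by
    ext e u
    exact Category.id_comp (obj := C) u
  map_comp f g := by
    ext e u
    exact Category.assoc (obj := C) g.unop f.unop u

/-- The inclusion of the morphisms compatible with the sieves in all morphisms. -/
def coverToBase : coverHom J ⟶ baseHom J where
  app X :=
    { app e := TopCat.discrete.map (↾ fun u => CoverPair.Hom.hom u) }

variable {J}

/-- The sequence over `X` given by a sequence with a morphism from its last object to `X`. -/
def overSeq {X : C} {n : ℕ} (Y : ComposableArrows C n) (f : Y.obj (Fin.last n) ⟶ X) :
    ComposableArrows (Over X) n where
  obj i := Over.mk (Y.map (homOfLE (Fin.le_last i)) ≫ f)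
  map g := Over.homMk (Y.map g) (by
    simp only [Over.mk_hom, Over.mk_left, ← Category.assoc, ← Y.map_comp]; rfl)
  map_id i := by ext; exact Y.map_id i
  map_comp g h := by ext; exact Y.map_comp g h

lemma over_functor_ext {X : C} {D : Type u₂} [Category.{v₂} D] {Φ Ψ : D ⥤ Over X}
    (h : ∀ Y, Φ.obj Y = Ψ.obj Y)
    (h' : ∀ {Y Z} (f : Y ⟶ Z), (Over.forget X).map (Φ.map f) =
      eqToHom (by rw [h]) ≫ (Over.forget X).map (Ψ.map f) ≫ eqToHom (by rw [h])) : Φ = Ψ := by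
  refine CategoryTheory.Functor.ext h fun Y Z f => (Over.forget X).map_injective ?_
  rw [h', Functor.map_comp, Functor.map_comp, eqToHom_map, eqToHom_map]

lemma overSeq_forget {X : C} {n : ℕ} (φ : ComposableArrows (Over X) n) :
    overSeq (φ ⋙ Over.forget X) (φ.obj (Fin.last n)).hom = φ := by
  refine over_functor_ext (fun i => ?_) fun f => ?_
  · exact congrArg Over.mk (Over.w (φ.map (homOfLE (Fin.le_last i))))
  · exact ((Category.id_comp _).trans (Category.comp_id _)).symm

/-- The structure maps of a sequence over `X` are all composites with the structure map of its last
object. -/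
lemma bijective_overSeq (X : C) (n : ℕ) :
    Function.Bijective fun φ : ComposableArrows (Over X) n =>
      (⟨φ ⋙ Over.forget X, (φ.obj (Fin.last n)).hom⟩ :
        Σ Y : ComposableArrows C n, Y.obj (Fin.last n) ⟶ X) := by
  refine ⟨fun φ φ' h => ?_, fun z => ⟨overSeq z.1 z.2, ?_⟩⟩
  · have := congrArg (fun z : Σ Y : ComposableArrows C n, Y.obj (Fin.last n) ⟶ X =>
      overSeq z.1 z.2) h
    simpa only [overSeq_forget] using this
  · have h : z.1.map (homOfLE (Fin.le_last (Fin.last n))) = 𝟙 _ := z.1.map_id _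
    refine congrArg (Sigma.mk z.1) ?_
    change z.1.map (homOfLE (Fin.le_last (Fin.last n))) ≫ z.2 = z.2
    rw [h, Category.id_comp]

/-- The sequence in a sieve given by a sequence with a morphism from its last object. -/
def sieveSeq {A : CoverPair J} {n : ℕ} (Y : ComposableArrows C n)
    (f : (CoverPair.xi J).obj (Y.obj (Fin.last n)) ⟶ A) : ComposableArrows A.cat n :=
  ObjectProperty.lift _ (overSeq Y (CoverPair.Hom.hom f)) fun _ => CoverPair.Hom.le f _ trivial

/-- The morphism from the maximal sieve given by an element of a sieve. -/
def ofMem {A : CoverPair J} (b : A.cat) : (CoverPair.xi J).obj (A.proj.obj b) ⟶ A :=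
  ⟨b.obj.hom, fun _ k _ => (A.cover : Sieve A.base).downward_closed b.property k⟩

lemma sieveSeq_proj {A : CoverPair J} {n : ℕ} (φ : ComposableArrows A.cat n) :
    sieveSeq (φ ⋙ A.proj) (ofMem (φ.obj (Fin.last n))) = φ := by
  refine CoverPair.functor_ext_of_proj (fun i => ?_) fun f => ?_
  · refine ObjectProperty.FullSubcategory.ext ?_
    exact congrArg Over.mk (Over.w (φ.map (homOfLE (Fin.le_last i))).hom)
  · exact ((Category.id_comp _).trans (Category.comp_id _)).symm

/-- A morphism from `ξ(Y)` to a pair `(X, S)` is the same as a morphism `Y ⟶ X` belonging to `S`.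
Once the structure map of the last object is in the sieve, those of the others are too, because
sieves are closed under precomposition. -/
lemma bijective_sieveSeq (A : CoverPair J) (n : ℕ) :
    Function.Bijective fun φ : ComposableArrows A.cat n =>
      (⟨φ ⋙ A.proj, ofMem (φ.obj (Fin.last n))⟩ :
        Σ Y : ComposableArrows C n, (CoverPair.xi J).obj (Y.obj (Fin.last n)) ⟶ A) := by
  refine ⟨fun φ φ' h => ?_, fun z => ⟨sieveSeq z.1 z.2, ?_⟩⟩
  · have := congrArg (fun z : Σ Y : ComposableArrows C n,
      (CoverPair.xi J).obj (Y.obj (Fin.last n)) ⟶ A => sieveSeq z.1 z.2) h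
    simpa only [sieveSeq_proj] using this
  · have h : z.1.map (homOfLE (Fin.le_last (Fin.last n))) = 𝟙 _ := z.1.map_id _
    refine congrArg (Sigma.mk z.1) (CoverPair.hom_ext ?_)
    exact (congrArg (· ≫ CoverPair.Hom.hom z.2) h).trans (Category.id_comp _)

instance (A : CoverPair J) (X : Cᵒᵖ) : DiscreteTopology (((coverHom J).flip.obj A).obj X) :=
  inferInstanceAs (DiscreteTopology (TopCat.discrete.obj ((CoverPair.xi J).obj X.unop ⟶ A)))

instance (A : CoverPair J) (X : Cᵒᵖ) : DiscreteTopology (((baseHom J).flip.obj A).obj X) :=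
  inferInstanceAs (DiscreteTopology (TopCat.discrete.obj (X.unop ⟶ A.base)))

/-- Covariant descent in terms of discrete presheaves. -/
lemma weakEquiv_coverToBase {F : C ⥤ TopCat.{w}} (hF : CovariantDescent J F) (A : CoverPair J) :
    WeakEquiv (Realization.map (𝟙 F) (flipMap (coverToBase J) A)) := by
  have h1 := weakEquiv_elementsMap F A.proj ((coverHom J).flip.obj A)
    ((ObjectProperty.ι _ : A.cat ⥤ Over A.base).op ⋙ ptOp (Over A.base)) (fun b => ofMem b)
    (fun {b b'} f => CoverPair.hom_ext (Over.w f.hom))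
    (fun _ => ⟨inferInstanceAs (Unique PUnit)⟩) (bijective_sieveSeq A)
  have h2 := weakEquiv_elementsMap F (Over.forget A.base) ((baseHom J).flip.obj A)
    (ptOp (Over A.base)) (fun b => b.hom) (fun {b b'} f => Over.w f)
    (fun _ => ⟨inferInstanceAs (Unique PUnit)⟩) (bijective_overSeq A.base)
  have h3 := isWeakHomotopyEquiv_iff.1 (hF A.base A.cover)
  -- The identifications `h1` and `h2` of the two discrete realizations with those over the sieve
  -- and over the slice form a commutative square with the descent map `h3`.
  refine .of_comp_right (ContinuousMap.continuous _) h1 ?_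
  have h4 := h2.comp h3
  refine Eq.mp (congrArg WeakEquiv (funext fun q => ?_)) h4
  induction q using Realization.ind
  rfl

end Descent

/-! ### Cones with a new first vertex -/

section Cone

variable {m n : ℕ}

/-- The face of the cone with a new first vertex on a simplex. -/
def coneFace (η : Fin (m + 1) ↪o Fin (n + 1)) : Fin (m + 2) ↪o Fin (n + 2) :=
  OrderEmbedding.ofMapLEIff (Fin.cases 0 fun i => (η i).succ) fun i j => by
    cases i using Fin.cases <;> cases j using Fin.cases <;> simp

/-- The point of the cone with a new first vertex on a simplex. -/
def cone (s : unitInterval) (t : stdSimplex ℝ (Fin (n + 1))) : stdSimplex ℝ (Fin (n + 2)) :=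
  mix s (stdSimplex.map Fin.succ t) (stdSimplex.vertex 0)

lemma cone_map (η : Fin (m + 1) ↪o Fin (n + 1)) (s : unitInterval)
    (t : stdSimplex ℝ (Fin (m + 1))) :
    cone s (stdSimplex.map η t) = stdSimplex.map (coneFace η) (cone s t) := by
  rw [cone, cone, map_mix, stdSimplex.map_comp_apply, stdSimplex.map_comp_apply,
    stdSimplex.map_vertex]
  rfl

lemma continuous_cone :
    Continuous fun p : unitInterval × stdSimplex ℝ (Fin (n + 1)) => cone p.1 p.2 :=
  continuous_mix.comp (continuous_fst.prodMk
    (((stdSimplex.continuous_map _).comp continuous_snd).prodMk continuous_const))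

lemma cone_zero (t : stdSimplex ℝ (Fin (n + 1))) :
    cone 0 t = stdSimplex.map (Fin.succOrderEmb (n + 1)) t := mix_zero _ _

/-- The inclusion of a vertex. -/
def vertexEmb (i : Fin (n + 1)) : Fin (0 + 1) ↪o Fin (n + 1) :=
  OrderEmbedding.ofMapLEIff (fun _ => i) fun a b => by simp [Subsingleton.elim (α := Fin 1) a b]

lemma vertex_eq_map (i : Fin (n + 1)) :
    (stdSimplex.vertex i : stdSimplex ℝ (Fin (n + 1))) = stdSimplex.map (vertexEmb i) default := by
  rw [show (default : stdSimplex ℝ (Fin (0 + 1))) = stdSimplex.vertex 0 from Subsingleton.elim _ _,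
    stdSimplex.map_vertex]
  rfl

lemma cone_one (t : stdSimplex ℝ (Fin (n + 1))) :
    cone 1 t = stdSimplex.map (vertexEmb 0) default := by
  rw [← vertex_eq_map]; exact mix_one _ _

variable {B : Type u₁} [Category.{v₁} B]

/-- The objects of the sequence obtained by adding a first object. -/
def coneObj (b : B) (φ : ComposableArrows B n) : Fin (n + 2) → B
  | ⟨0, _⟩ => b
  | ⟨i + 1, hi⟩ => φ.obj ⟨i, Nat.lt_of_succ_lt_succ hi⟩

/-- The morphisms of the sequence obtained by adding a first object. -/
def coneMap {b : B} (φ : ComposableArrows B n) (u : b ⟶ φ.obj 0) :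
    ∀ i j : Fin (n + 2), i ≤ j → (coneObj b φ i ⟶ coneObj b φ j)
  | ⟨0, _⟩, ⟨0, _⟩, _ => 𝟙 b
  | ⟨0, _⟩, ⟨_ + 1, _⟩, _ => u ≫ φ.map (homOfLE (Fin.zero_le _))
  | ⟨_ + 1, _⟩, ⟨_ + 1, _⟩, h => φ.map (homOfLE (Nat.le_of_succ_le_succ h))
  | ⟨_ + 1, _⟩, ⟨0, _⟩, h => absurd h (Nat.not_succ_le_zero _)

/-- The sequence obtained by adding a first object. -/
def coneSeq {b : B} (φ : ComposableArrows B n) (u : b ⟶ φ.obj 0) : ComposableArrows B (n + 1) where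
  obj := coneObj b φ
  map {i j} f := coneMap φ u i j (leOfHom f)
  map_id i := by
    obtain ⟨_ | i, hi⟩ := i
    · rfl
    · exact φ.map_id _
  map_comp {i j k} f g := by
    have hij := leOfHom f
    have hjk := leOfHom g
    obtain ⟨_ | i, hi⟩ := i <;> obtain ⟨_ | j, hj⟩ := j <;> obtain ⟨_ | k, hk⟩ := k
    · exact (Category.comp_id _).symm
    · exact (Category.id_comp _).symm
    · exact absurd hjk (Nat.not_succ_le_zero _)
    · refine Eq.trans (congrArg (u ≫ ·) ?_) (Category.assoc _ _ _).symm
      exact (map_homOfLE_comp φ _ _ _).symm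
    · exact absurd hij (Nat.not_succ_le_zero _)
    · exact absurd hij (Nat.not_succ_le_zero _)
    · exact absurd hjk (Nat.not_succ_le_zero _)
    · exact (map_homOfLE_comp φ _ _ _).symm

lemma faceSeq_coneSeq_succ {b : B} (φ : ComposableArrows B n) (u : b ⟶ φ.obj 0) :
    faceSeq (coneSeq φ u) (Fin.succOrderEmb (n + 1)) = φ := rfl

lemma faceSeq_coneSeq {b : B} (φ : ComposableArrows B n) (u : b ⟶ φ.obj 0)
    (η : Fin (m + 1) ↪o Fin (n + 1)) :
    faceSeq (coneSeq φ u) (coneFace η) =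
      coneSeq (faceSeq φ η) (u ≫ φ.map (homOfLE (Fin.zero_le (η 0)))) := by
  refine CategoryTheory.Functor.ext (fun i => ?_) fun i j f => ?_
  · obtain ⟨_ | i, hi⟩ := i <;> rfl
  · have hij := leOfHom f
    obtain ⟨_ | i, hi⟩ := i <;> obtain ⟨_ | j, hj⟩ := j
    · exact ((Category.id_comp _).trans (Category.comp_id _)).symm
    · refine Eq.trans ?_ ((Category.id_comp _).trans (Category.comp_id _)).symm
      refine Eq.trans (congrArg (u ≫ ·) ?_) (Category.assoc _ _ _).symm
      exact (map_homOfLE_comp φ _ _ _).symm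
    · exact absurd hij (Nat.not_succ_le_zero _)
    · exact ((Category.id_comp _).trans (Category.comp_id _)).symm

end Cone

/-! ### Equality of points in different cells -/

section MkEq

variable {B : Type u₁} [Category.{v₁} B]

lemma Realization.mk_eq_mk {F : B ⥤ TopCat.{w₁}} {G : Bᵒᵖ ⥤ TopCat.{w₂}} {m n : ℕ}
    {φ : ComposableArrows B n} {φ' : ComposableArrows B m} (η : Fin (m + 1) ↪o Fin (n + 1))
    {a : F.obj (φ.obj 0)} {a' : F.obj (φ'.obj 0)}
    {b : G.obj (op (φ.obj (Fin.last n)))} {b' : G.obj (op (φ'.obj (Fin.last m)))}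
    {t : stdSimplex ℝ (Fin (n + 1))} {t' : stdSimplex ℝ (Fin (m + 1))}
    (ht : t = stdSimplex.map η t') (hφ : faceSeq φ η = φ')
    (ha : F.map (eqToHom (by rw [← hφ]; rfl)) (F.map (φ.map (homOfLE (Fin.zero_le (η 0)))) a) = a')
    (hb : G.map (eqToHom (by rw [← hφ]; rfl))
      (G.map (φ.map (homOfLE (Fin.le_last (η (Fin.last m))))).op b) = b') :
    Realization.mk φ a b t = Realization.mk φ' a' b' t' := by
  subst ht
  rw [Realization.mk_map]
  exact Realization.mk_congr hφ t' ha hb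

end MkEq

/-! ### Realization against a represented functor -/

section Augmentation

open Topology

variable {B : Type u₁} [Category.{v₁} B]

/-- The covariant functor represented by an object, as a functor to discrete spaces. -/
def homFrom (b : B) : B ⥤ TopCat.{v₁} where
  obj e := TopCat.discrete.obj (b ⟶ e)
  map f := TopCat.discrete.map (↾ fun u => u ≫ f)
  map_id e := by ext u; exact Category.comp_id (obj := B) u
  map_comp f g := by ext u; exact (Category.assoc (obj := B) u f g).symm

instance (b e : B) : DiscreteTopology ((homFrom b).obj e) :=
  inferInstanceAs (DiscreteTopology (TopCat.discrete.obj (b ⟶ e)))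

/-- The morphism given by a point of the represented functor. -/
def toHom {b e : B} (u : (homFrom b).obj e) : b ⟶ e := u

/-- The point of the represented functor given by a morphism. -/
def ofHom {b e : B} (u : b ⟶ e) : (homFrom b).obj e := u

lemma map_op_map_op (H : Bᵒᵖ ⥤ TopCat.{w}) {x y z : B} (f : x ⟶ y) (g : y ⟶ z)
    (h : H.obj (op z)) : H.map f.op (H.map g.op h) = H.map (f ≫ g).op h :=
  (ConcreteCategory.congr_hom (H.map_comp g.op f.op) h).symm

variable (b : B) (H : Bᵒᵖ ⥤ TopCat.{w})

/-- The augmentation of the realization of a presheaf with respect to a represented functor. -/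
def augment : C(Realization (homFrom b) H, H.obj (op b)) where
  toFun := Realization.lift (fun n φ u h _ =>
      H.map (toHom u ≫ φ.map (homOfLE (Fin.zero_le (Fin.last n)))).op h) fun {m n} φ η u h t => by
    refine Eq.trans ?_ (map_op_map_op H _ _ h).symm
    refine congrArg (fun k => H.map (Quiver.Hom.op k) h) ?_
    have h1 := map_homOfLE_comp φ (Fin.zero_le (η 0)) (η.monotone (Fin.zero_le (Fin.last m)))
      (Fin.zero_le _)
    have h2 := map_homOfLE_comp φ (Fin.zero_le (η (Fin.last m))) (Fin.le_last _)
      (Fin.zero_le (Fin.last n))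
    calc toHom u ≫ φ.map (homOfLE (Fin.zero_le (Fin.last n)))
        = toHom u ≫ (φ.map (homOfLE (Fin.zero_le (η 0))) ≫
          φ.map (homOfLE (η.monotone (Fin.zero_le (Fin.last m))))) ≫
          φ.map (homOfLE (Fin.le_last (η (Fin.last m)))) := by rw [h1, h2]
      _ = ((toHom u ≫ φ.map (homOfLE (Fin.zero_le (η 0)))) ≫
          φ.map (homOfLE (η.monotone (Fin.zero_le (Fin.last m))))) ≫
          φ.map (homOfLE (Fin.le_last (η (Fin.last m)))) := by simp only [Category.assoc]
  continuous_toFun := Realization.continuous_of_comp_mk fun n φ => by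
    have h1 : Continuous fun p : (homFrom b).obj (φ.obj 0) × H.obj (op (φ.obj (Fin.last n))) =>
        H.map (toHom p.1 ≫ φ.map (homOfLE (Fin.zero_le (Fin.last n)))).op p.2 :=
      continuous_prod_of_discrete_left.2 fun u =>
        (H.map (toHom u ≫ φ.map (homOfLE (Fin.zero_le (Fin.last n)))).op).hom.continuous
    exact h1.comp (continuous_fst.prodMk (continuous_fst.comp continuous_snd))

lemma augment_mk {n : ℕ} (φ : ComposableArrows B n) (u : (homFrom b).obj (φ.obj 0))
    (h : H.obj (op (φ.obj (Fin.last n)))) (t : stdSimplex ℝ (Fin (n + 1))) :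
    augment b H (Realization.mk φ u h t) =
      H.map (toHom u ≫ φ.map (homOfLE (Fin.zero_le (Fin.last n)))).op h := rfl

/-- The contraction of the realization with respect to a represented functor. -/
def augmentHomotopy (p : Realization (homFrom b) H × unitInterval) : Realization (homFrom b) H :=
  Realization.lift (F := homFrom b) (G := H) (fun n φ u h t =>
    Realization.mk (F := homFrom b) (G := H) (coneSeq φ (toHom u)) (ofHom (𝟙 b)) h (cone p.2 t))
    (fun {m n} φ η u h t => by
      refine Realization.mk_eq_mk (coneFace η) (cone_map η p.2 t)
        (faceSeq_coneSeq φ (toHom u) η) ?_ ?_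
      · exact (Category.comp_id (obj := B) _).trans (Category.comp_id (obj := B) _)
      · exact (ConcreteCategory.congr_hom (H.map_id _) _)) p.1

lemma continuous_augmentHomotopy : Continuous (augmentHomotopy b H) := by
  refine Realization.continuous_prod_of_comp_mk fun n φ => ?_
  have h1 : Continuous fun p : (homFrom b).obj (φ.obj 0) ×
      ((H.obj (op (φ.obj (Fin.last n))) × stdSimplex ℝ (Fin (n + 1))) × unitInterval) =>
      Realization.mk (F := homFrom b) (G := H) (coneSeq φ (toHom p.1)) (ofHom (𝟙 b)) p.2.1.1
        (cone p.2.2 p.2.1.2) := by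
    refine continuous_prod_of_discrete_left.2 fun u => ?_
    refine (Realization.continuous_mk (F := homFrom b) (G := H) (coneSeq φ (toHom u))).comp
      (f := fun p : (H.obj (op (φ.obj (Fin.last n))) × stdSimplex ℝ (Fin (n + 1))) ×
        unitInterval => (ofHom (𝟙 b), p.1.1, cone p.2 p.1.2)) ?_
    exact continuous_const.prodMk ((continuous_fst.comp continuous_fst).prodMk
      (continuous_cone.comp (continuous_snd.prodMk (continuous_snd.comp continuous_fst))))
  exact h1.comp ((continuous_fst.comp continuous_fst).prodMk
    ((continuous_snd.comp continuous_fst).prodMk continuous_snd))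

/-- This is the homotopical Yoneda lemma. A point over a sequence with a morphism `u` from `b` to
its first object also lies on the cell of the sequence extended by `b` in front, where `u` is
replaced by the identity. Moving straight to the new vertex contracts everything onto the points
over `b` itself. -/
theorem weakEquiv_augment : WeakEquiv (augment b H) := by
  refine .of_shrinkable (s := fun h => Realization.mk (F := homFrom b) (G := H)
    (ComposableArrows.mk₀ b) (ofHom (𝟙 b)) h default) (D := augmentHomotopy b H)
    (augment b H).continuous ?_ (continuous_augmentHomotopy b H) (fun h => ?_) (fun q => ?_)
    fun q => ?_
  · refine (Realization.continuous_mk (F := homFrom b) (G := H) (ComposableArrows.mk₀ b)).comp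
      (f := fun h => (ofHom (𝟙 b), h, default)) ?_
    exact continuous_const.prodMk (continuous_id.prodMk continuous_const)
  · refine (augment_mk b H _ _ _ _).trans ?_
    refine Eq.trans (congrArg (fun k => H.map (Quiver.Hom.op k) h) (Category.comp_id (𝟙 b))) ?_
    exact ConcreteCategory.congr_hom (H.map_id _) h
  · induction q using Realization.ind with | h n φ u h t
    change Realization.mk (F := homFrom b) (G := H) (coneSeq φ (toHom u)) (ofHom (𝟙 b)) h
      (cone 0 t) = _
    refine Realization.mk_eq_mk (Fin.succOrderEmb (n + 1)) (cone_zero t)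
      (faceSeq_coneSeq_succ φ (toHom u)) ?_ ?_
    · exact (Category.comp_id (obj := B) _).trans ((Category.id_comp (obj := B) _).trans
        ((congrArg (toHom u ≫ ·) (φ.map_id _)).trans (Category.comp_id (toHom u))))
    · exact (ConcreteCategory.congr_hom (H.map_id _) _).trans ((congrArg (fun k =>
        H.map (Quiver.Hom.op k) h) (φ.map_id _)).trans (ConcreteCategory.congr_hom (H.map_id _) h))
  · induction q using Realization.ind with | h n φ u h t
    change Realization.mk (F := homFrom b) (G := H) (coneSeq φ (toHom u)) (ofHom (𝟙 b)) h
      (cone 1 t) = _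
    refine Realization.mk_eq_mk (vertexEmb 0) (cone_one t) (ComposableArrows.ext₀ rfl) ?_ ?_
    · exact (Category.comp_id (obj := B) _).trans (Category.comp_id (obj := B) _)
    · exact ConcreteCategory.congr_hom (H.map_id _) _

end Augmentation

/-! ### Faces of a simplex and supports of points -/

section Restrict

open Set

variable {ι κ : Type*} [Fintype ι] [Fintype κ]

lemma sum_mul_map (f : ι → κ) (g : κ → ℝ) (t : stdSimplex ℝ ι) :
    ∑ k, g k * stdSimplex.map f t k = ∑ i, g (f i) * t i := by
  classical
  simp only [stdSimplex.map_coe, FunOnFinite.linearMap_apply_apply, Finset.mul_sum]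
  rw [← Finset.sum_fiberwise Finset.univ f fun i => g (f i) * t i]
  refine Finset.sum_congr rfl fun k _ => Finset.sum_congr rfl fun i hi => ?_
  rw [(Finset.mem_filter.1 hi).2]

/-- The coordinates on the image of an injective map, if all the others vanish. -/
def pullSimplex {f : ι → κ} (hf : Function.Injective f) (t : stdSimplex ℝ κ)
    (h : ∀ k ∉ range f, t k = 0) : stdSimplex ℝ ι :=
  ⟨fun i => t (f i), fun i => t.2.1 _, by
    rw [← stdSimplex.sum_eq_one t]
    exact Finset.sum_of_injOn f hf.injOn (fun _ _ => Finset.mem_coe.2 (Finset.mem_univ _))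
      (fun k _ hk => h k fun ⟨i, hi⟩ => hk ⟨i, by simp, hi⟩) fun _ _ => rfl⟩

lemma map_pullSimplex {f : ι → κ} (hf : Function.Injective f) (t : stdSimplex ℝ κ)
    (h : ∀ k ∉ range f, t k = 0) : stdSimplex.map f (pullSimplex hf t h) = t := by
  ext k
  by_cases hk : k ∈ range f
  · obtain ⟨i, rfl⟩ := hk
    rw [stdSimplex_map_apply hf]; rfl
  · rw [stdSimplex_map_apply_of_notMem _ hk, h k hk]

lemma stdSimplex_map_injective {f : ι → κ} (hf : Function.Injective f) :
    Function.Injective (stdSimplex.map (S := ℝ) f) := fun s t h => by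
  ext i
  rw [← stdSimplex_map_apply hf s, h, stdSimplex_map_apply hf]

/-- The face is spanned by the support of the point. It provides the normal form in which points on
different chains are compared. -/
lemma exists_positive_face {k : ℕ} (t : stdSimplex ℝ (Fin (k + 1))) :
    ∃ (l : ℕ) (η : Fin (l + 1) ↪o Fin (k + 1)) (s : stdSimplex ℝ (Fin (l + 1))),
      t = stdSimplex.map η s ∧ ∀ i, 0 < s i := by
  classical
  set S := Finset.univ.filter fun i => 0 < t i with hS
  have hne : S.Nonempty := by
    by_contra h
    rw [Finset.not_nonempty_iff_eq_empty, hS, Finset.filter_eq_empty_iff] at h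
    have : ∑ i, t i ≤ 0 := Finset.sum_nonpos fun i hi => not_lt.1 (h hi)
    rw [stdSimplex.sum_eq_one] at this
    linarith
  obtain ⟨l, hl⟩ : ∃ l, S.card = l + 1 :=
    ⟨S.card - 1, (Nat.succ_pred_eq_of_pos (Finset.card_pos.2 hne)).symm⟩
  have h0 : ∀ i ∉ range (S.orderEmbOfFin hl), t i = 0 := fun i hi => by
    rw [Finset.range_orderEmbOfFin] at hi
    refine le_antisymm (not_lt.1 fun h => hi ?_) (t.2.1 i)
    simpa [hS] using h
  exact ⟨l, S.orderEmbOfFin hl, pullSimplex (S.orderEmbOfFin hl).injective t h0,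
    (map_pullSimplex _ _ _).symm, fun i =>
      (Finset.mem_filter.1 (Finset.orderEmbOfFin_mem S hl i)).2⟩

end Restrict

/-! ### Maps from the order complex of a finite poset of objects -/

section Chains

open Set Topology

variable {B : Type u₁} [Category.{v₁} B] {F : B ⥤ TopCat.{w₁}} {G : Bᵒᵖ ⥤ TopCat.{w₂}}
  {P : Type v} [Fintype P] [PartialOrder P] (Ψ : P ⥤ B) {p₀ p₁ : P} (h₀ : ∀ p, p₀ ≤ p)
  (h₁ : ∀ p, p ≤ p₁) (a : F.obj (Ψ.obj p₀)) (b : G.obj (op (Ψ.obj p₁)))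

/-- The point of the realization given by a chain in a poset of objects. -/
def chainMk {k : ℕ} (e : Fin (k + 1) ↪o P) (t : stdSimplex ℝ (Fin (k + 1))) : Realization F G :=
  Realization.mk (F := F) (G := G) (n := k) (e.monotone.functor ⋙ Ψ)
    (F.map (Ψ.map (homOfLE (h₀ (e 0)))) a)
    (G.map (Ψ.map (homOfLE (h₁ (e (Fin.last k))))).op b) t

lemma chainMk_map {k l : ℕ} (e : Fin (k + 1) ↪o P) (η : Fin (l + 1) ↪o Fin (k + 1))
    (t : stdSimplex ℝ (Fin (l + 1))) :
    chainMk Ψ h₀ h₁ a b e (stdSimplex.map η t) = chainMk Ψ h₀ h₁ a b (η.trans e) t := by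
  refine (Realization.mk_map _ η _ _ t).trans ?_
  refine Realization.mk_congr rfl t ?_ ?_
  · refine (ConcreteCategory.congr_hom (F.map_id _) _).trans ?_
    refine (ConcreteCategory.congr_hom (F.map_comp _ _) a).symm.trans ?_
    exact congrArg (fun k => F.map k a) ((Ψ.map_comp _ _).symm.trans rfl)
  · refine (ConcreteCategory.congr_hom (G.map_id _) _).trans ?_
    refine (map_op_map_op G _ _ b).trans ?_
    exact congrArg (fun k => G.map (Quiver.Hom.op k) b) ((Ψ.map_comp _ _).symm.trans rfl)

/-- After discarding zero coordinates, a chain is the support of the point it represents, listed in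
increasing order. The chain and its coordinates are thus determined by the point of the simplex on
`P`. -/
lemma chainMk_congr {k k' : ℕ} {e : Fin (k + 1) ↪o P} {e' : Fin (k' + 1) ↪o P}
    {t : stdSimplex ℝ (Fin (k + 1))} {t' : stdSimplex ℝ (Fin (k' + 1))}
    (h : stdSimplex.map e t = stdSimplex.map e' t') :
    chainMk Ψ h₀ h₁ a b e t = chainMk Ψ h₀ h₁ a b e' t' := by
  obtain ⟨l, η, s, rfl, hs⟩ := exists_positive_face t
  obtain ⟨l', η', s', rfl, hs'⟩ := exists_positive_face t'
  rw [chainMk_map, chainMk_map]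
  rw [stdSimplex.map_comp_apply, stdSimplex.map_comp_apply] at h
  change stdSimplex.map (η.trans e) s = stdSimplex.map (η'.trans e') s' at h
  have hsupp : ∀ {m : ℕ} (g : Fin (m + 1) ↪o P) (r : stdSimplex ℝ (Fin (m + 1))),
      (∀ i, 0 < r i) → range g = {p | stdSimplex.map g r p ≠ 0} := by
    intro m g r hr
    ext p
    constructor
    · rintro ⟨i, rfl⟩
      change stdSimplex.map g r (g i) ≠ 0
      rw [stdSimplex_map_apply g.injective]
      exact (hr i).ne'
    · intro hp
      by_contra hp'
      exact hp (stdSimplex_map_apply_of_notMem r hp')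
  have hr : range (η.trans e) = range (η'.trans e') := by
    rw [hsupp _ s hs, hsupp _ s' hs', h]
  obtain rfl : l = l' := by
    have := congrArg Set.ncard hr
    rw [← Set.image_univ, ← Set.image_univ, Set.ncard_image_of_injective _ (η.trans e).injective,
      Set.ncard_image_of_injective _ (η'.trans e').injective] at this
    simpa using this
  have he := OrderEmbedding.range_inj.1 hr
  rw [he] at h ⊢
  rw [stdSimplex_map_injective (η'.trans e').injective h]

variable (P) in
/-- The part of the simplex on a poset given by the chains. -/
abbrev ChainSpace : Type _ :=
  {w : stdSimplex ℝ P // ∃ (k : ℕ) (e : Fin (k + 1) ↪o P) (t : stdSimplex ℝ (Fin (k + 1))),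
    stdSimplex.map e t = w}

/-- The map from the order complex of a poset of objects to the realization. -/
def chainCell (w : ChainSpace P) : Realization F G :=
  chainMk Ψ h₀ h₁ a b w.2.choose_spec.choose w.2.choose_spec.choose_spec.choose

lemma chainCell_eq {k : ℕ} (e : Fin (k + 1) ↪o P) (t : stdSimplex ℝ (Fin (k + 1)))
    {w : ChainSpace P} (h : stdSimplex.map e t = w.1) :
    chainCell Ψ h₀ h₁ a b w = chainMk Ψ h₀ h₁ a b e t :=
  chainMk_congr _ _ _ _ _ (w.2.choose_spec.choose_spec.choose_spec.trans h.symm)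

lemma continuous_chainCell :
    Continuous fun p : G.obj (op (Ψ.obj p₁)) × ChainSpace P => chainCell Ψ h₀ h₁ a p.1 p.2 := by
  classical
  -- A chain has at most `Fintype.card P` elements, so finitely many chains occur. The points
  -- supported on a given chain form a closed set, on which the map is a single cell of the
  -- realization.
  let κ := Σ k : Fin (Fintype.card P), (Fin (k.1 + 1) ↪o P)
  have : ∀ k : Fin (Fintype.card P), Finite (Fin (k.1 + 1) ↪o P) := fun k =>
    DFunLike.finite _
  let s : κ → Set (G.obj (op (Ψ.obj p₁)) × ChainSpace P) :=
    fun i => {p | ∀ x ∉ range i.2, p.2.1 x = 0}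
  refine (locallyFinite_of_finite s).continuous ?_ (fun i => ?_) fun i => ?_
  · refine eq_univ_of_forall fun p => ?_
    obtain ⟨k, e, t, h⟩ := p.2.2
    have hk : k < Fintype.card P := by
      have := Fintype.card_le_of_injective e e.injective
      simpa using this
    refine mem_iUnion.2 ⟨⟨⟨k, hk⟩, e⟩, fun x hx => ?_⟩
    rw [← h]
    exact stdSimplex_map_apply_of_notMem t hx
  · simp only [s, Set.ofPred_forall]
    exact isClosed_iInter fun x => isClosed_iInter fun _ => isClosed_eq
      ((continuous_stdSimplex_apply x).comp (continuous_subtype_val.comp continuous_snd))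
      continuous_const
  · rw [continuousOn_iff_continuous_domRestrict]
    have h1 : Continuous fun p : s i => pullSimplex i.2.injective p.1.2.1 p.2 :=
      Continuous.subtype_mk (continuous_pi fun j => (continuous_stdSimplex_apply _).comp
        (continuous_subtype_val.comp (continuous_snd.comp continuous_subtype_val))) _
    have h2 := (Realization.continuous_mk (F := F) (G := G) (n := i.1.1)
      (i.2.monotone.functor ⋙ Ψ)).comp (f := fun p : s i => (F.map (Ψ.map (homOfLE (h₀ (i.2 0)))) a,
        G.map (Ψ.map (homOfLE (h₁ (i.2 (Fin.last i.1.1))))).op p.1.1,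
        pullSimplex i.2.injective p.1.2.1 p.2))
      (continuous_const.prodMk (((G.map _).hom.continuous.comp
        (continuous_fst.comp continuous_subtype_val)).prodMk h1))
    refine h2.congr fun p => ?_
    exact (chainCell_eq Ψ h₀ h₁ a p.1.1 i.2 (pullSimplex i.2.injective p.1.2.1 p.2)
      (map_pullSimplex i.2.injective p.1.2.1 p.2)).symm

end Chains

/-! ### The triangulation of a prism by stacking coordinates -/

section PrismWeights

open Set Topology

variable {m n : ℕ}

/-- The sum of the coordinates before a given vertex. -/
def partialSum (t : stdSimplex ℝ (Fin (n + 1))) (i : Fin (n + 1)) : ℝ :=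
  ∑ j, (if j < i then 1 else 0) * t j

/-- The part of the `i`-th coordinate which lies below the level `r` when the coordinates
are stacked. -/
def lowerPart (r : ℝ) (t : stdSimplex ℝ (Fin (n + 1))) (i : Fin (n + 1)) : ℝ :=
  max 0 (min (t i) (r - partialSum t i))

lemma partialSum_map (η : Fin (m + 1) ↪o Fin (n + 1)) (t : stdSimplex ℝ (Fin (m + 1)))
    (i : Fin (m + 1)) : partialSum (stdSimplex.map η t) (η i) = partialSum t i := by
  rw [partialSum, sum_mul_map η fun j => if j < η i then (1 : ℝ) else 0]
  simp [partialSum]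

lemma lowerPart_map (η : Fin (m + 1) ↪o Fin (n + 1)) (r : ℝ) (t : stdSimplex ℝ (Fin (m + 1)))
    (i : Fin (m + 1)) : lowerPart r (stdSimplex.map η t) (η i) = lowerPart r t i := by
  rw [lowerPart, lowerPart, partialSum_map, stdSimplex_map_apply η.injective]

lemma lowerPart_le (r : ℝ) (t : stdSimplex ℝ (Fin (n + 1))) (i : Fin (n + 1)) :
    lowerPart r t i ≤ t i :=
  max_le (t.2.1 i) (min_le_left _ _)

lemma partialSum_nonneg (t : stdSimplex ℝ (Fin (n + 1))) (i : Fin (n + 1)) :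
    0 ≤ partialSum t i :=
  Finset.sum_nonneg fun j _ => mul_nonneg (by split_ifs <;> norm_num) (t.2.1 j)

lemma partialSum_add_le (t : stdSimplex ℝ (Fin (n + 1))) {i j : Fin (n + 1)} (h : i < j) :
    partialSum t i + t i ≤ partialSum t j := by
  have h1 : t i = ∑ k, (if k = i then (1 : ℝ) else 0) * t k := by simp
  rw [h1, partialSum, partialSum, ← Finset.sum_add_distrib]
  refine Finset.sum_le_sum fun k _ => ?_
  rw [← add_mul]
  refine mul_le_mul_of_nonneg_right ?_ (t.2.1 k)
  split_ifs with h1 h2 h3 h4 <;> first | omega | norm_num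

lemma partialSum_add_le_one (t : stdSimplex ℝ (Fin (n + 1))) (i : Fin (n + 1)) :
    partialSum t i + t i ≤ 1 := by
  have h1 : t i = ∑ k, (if k = i then (1 : ℝ) else 0) * t k := by simp
  rw [h1, partialSum, ← Finset.sum_add_distrib, ← stdSimplex.sum_eq_one t]
  refine Finset.sum_le_sum fun k _ => ?_
  rw [← add_mul]
  refine mul_le_of_le_one_left (t.2.1 k) ?_
  split_ifs with h1 h2 <;> norm_num
  exact absurd h1 (by rw [h2]; exact lt_irrefl _)

lemma partialSum_succ (t : stdSimplex ℝ (Fin (n + 1))) (i : Fin n) :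
    partialSum t i.succ = partialSum t i.castSucc + t i.castSucc := by
  have h1 : t i.castSucc = ∑ k, (if k = i.castSucc then (1 : ℝ) else 0) * t k := by simp
  rw [h1, partialSum, partialSum, ← Finset.sum_add_distrib]
  refine Finset.sum_congr rfl fun k _ => ?_
  rw [← add_mul]
  congr 1
  have h0 : k < i.succ ↔ k ≤ i.castSucc := by
    rw [Fin.lt_def, Fin.le_def, Fin.val_succ, Fin.val_castSucc]; omega
  simp only [h0, le_iff_lt_or_eq]
  by_cases h2 : k < i.castSucc
  · simp [h2, h2.ne]
  · by_cases h3 : k = i.castSucc <;> simp [h2, h3]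

lemma partialSum_last (t : stdSimplex ℝ (Fin (n + 1))) :
    partialSum t (Fin.last n) + t (Fin.last n) = 1 := by
  rw [← stdSimplex.sum_eq_one t, Fin.sum_univ_castSucc, partialSum, Fin.sum_univ_castSucc]
  simp [Fin.castSucc_lt_last]

/-- The weights on the vertices of a prism of the point at height `r` over a point of the
simplex. -/
def prism (r : unitInterval) (t : stdSimplex ℝ (Fin (n + 1))) :
    stdSimplex ℝ (Fin (n + 1) × Bool) :=
  ⟨fun p => bif p.2 then t p.1 - lowerPart r t p.1 else lowerPart r t p.1, by
    rintro ⟨i, _ | _⟩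
    · exact le_max_left _ _
    · exact sub_nonneg.2 (lowerPart_le _ _ _), by
    rw [Fintype.sum_prod_type]
    simp⟩

lemma prism_false (r : unitInterval) (t : stdSimplex ℝ (Fin (n + 1))) (i : Fin (n + 1)) :
    prism r t (i, false) = lowerPart r t i := rfl

lemma prism_true (r : unitInterval) (t : stdSimplex ℝ (Fin (n + 1))) (i : Fin (n + 1)) :
    prism r t (i, true) = t i - lowerPart r t i := rfl

lemma continuous_prism :
    Continuous fun p : unitInterval × stdSimplex ℝ (Fin (n + 1)) => prism p.1 p.2 := by
  have h1 : ∀ i, Continuous fun p : unitInterval × stdSimplex ℝ (Fin (n + 1)) => p.2 i := fun i =>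
    (continuous_stdSimplex_apply i).comp continuous_snd
  have h2 : ∀ i, Continuous fun p : unitInterval × stdSimplex ℝ (Fin (n + 1)) =>
      lowerPart p.1 p.2 i := fun i =>
    continuous_const.max ((h1 i).min ((continuous_subtype_val.comp continuous_fst).sub
      (continuous_finsetSum _ fun j _ => continuous_const.mul (h1 j))))
  refine Continuous.subtype_mk (continuous_pi ?_) _
  rintro ⟨i, _ | _⟩
  · exact h2 i
  · exact (h1 i).sub (h2 i)

/-- Vanishing coordinates do not change the partial sums, so the subdivision of the prism is
compatible with faces. -/
lemma prism_map (η : Fin (m + 1) ↪o Fin (n + 1)) (r : unitInterval)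
    (t : stdSimplex ℝ (Fin (m + 1))) :
    prism r (stdSimplex.map η t) = stdSimplex.map (Prod.map η id) (prism r t) := by
  have hinj : Function.Injective (Prod.map η (id : Bool → Bool)) :=
    η.injective.prodMap Function.injective_id
  ext ⟨j, x⟩
  by_cases hj : j ∈ range η
  · obtain ⟨i, rfl⟩ := hj
    have h1 := stdSimplex_map_apply hinj (prism r t) (i, x)
    refine Eq.trans ?_ h1.symm
    cases x
    · exact lowerPart_map η r t i
    · rw [prism_true, prism_true, lowerPart_map, stdSimplex_map_apply η.injective]
  · have h1 : (j, x) ∉ range (Prod.map η (id : Bool → Bool)) := by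
      rintro ⟨⟨i, y⟩, h⟩
      exact hj ⟨i, congrArg Prod.fst h⟩
    have h2 := stdSimplex_map_apply_of_notMem t hj
    have h3 := lowerPart_le r (stdSimplex.map η t) j
    have h4 : 0 ≤ lowerPart r (stdSimplex.map η t) j := le_max_left _ _
    rw [stdSimplex_map_apply_of_notMem _ h1]
    cases x
    · rw [prism_false]; linarith
    · rw [prism_true]; linarith

/-- The vertices `(i, x)` of the prism. -/
def prismEdge (n : ℕ) (x : Bool) : Fin (n + 1) ↪o Fin (n + 1) × Bool :=
  OrderEmbedding.ofMapLEIff (fun i => (i, x)) fun i j => by simp [Prod.le_def]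

lemma prism_zero (t : stdSimplex ℝ (Fin (n + 1))) :
    stdSimplex.map (prismEdge n true) t = prism 0 t := by
  have h : ∀ i, lowerPart (0 : unitInterval) t i = 0 := fun i => by
    refine max_eq_left ((min_le_right _ _).trans ?_)
    have := partialSum_nonneg t i
    simpa using this
  ext ⟨i, x⟩
  cases x
  · rw [prism_false, h]
    refine stdSimplex_map_apply_of_notMem t ?_
    rintro ⟨j, hj⟩
    exact absurd (congrArg Prod.snd hj) (by simp [prismEdge])
  · rw [prism_true, h, sub_zero]
    exact stdSimplex_map_apply (prismEdge n true).injective t i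

lemma prism_one (t : stdSimplex ℝ (Fin (n + 1))) :
    stdSimplex.map (prismEdge n false) t = prism 1 t := by
  have h : ∀ i, lowerPart (1 : unitInterval) t i = t i := fun i => by
    have := partialSum_add_le_one t i
    rw [lowerPart, min_eq_left]
    · exact max_eq_right (t.2.1 i)
    · rw [Set.Icc.coe_one]
      linarith
  ext ⟨i, x⟩
  cases x
  · rw [prism_false, h]
    exact stdSimplex_map_apply (prismEdge n false).injective t i
  · rw [prism_true, h, sub_self]
    refine stdSimplex_map_apply_of_notMem t ?_
    rintro ⟨j, hj⟩
    exact absurd (congrArg Prod.snd hj) (by simp [prismEdge])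

/-- The maximal chains of the prism. -/
def prismChain (i : Fin (n + 1)) : Fin (n + 1 + 1) ↪o Fin (n + 1) × Bool :=
  OrderEmbedding.ofMapLEIff (fun j => if h : j.1 ≤ i.1 then (⟨j.1, by omega⟩, false) else
    (⟨j.1 - 1, by omega⟩, true)) fun a b => by
    rw [Prod.le_def, Fin.le_def (a := a)]
    by_cases ha : a.1 ≤ i.1 <;> by_cases hb : b.1 ≤ i.1
    · simp [ha, hb]
    · simp only [ha, hb, dite_true, dite_false, Fin.le_def, Bool.le_true, and_true]
      omega
    · simp only [ha, hb, dite_true, dite_false]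
      exact iff_of_false (fun h => absurd h.2 (by decide)) (by omega)
    · simp only [ha, hb, dite_false, Fin.le_def, le_refl, and_true]
      omega

/-- Stack the coordinates as consecutive intervals in `[0, 1]`. The weight goes to the bottom copies
below the level `r` and to the top copies above it. Only one interval need be divided, so the point
lies on a chain that climbs from bottom to top at that index. -/
lemma exists_prismChain (r : unitInterval) (t : stdSimplex ℝ (Fin (n + 1))) :
    ∃ i, ∀ p ∉ range (prismChain i), prism r t p = 0 := by
  classical
  have hne : (Finset.univ.filter fun i => (r : ℝ) ≤ partialSum t i + t i).Nonempty :=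
    ⟨Fin.last n, by simpa [partialSum_last] using r.2.2⟩
  -- This is the first index whose interval reaches the level `r`; by minimality its lower end is at
  -- most `r`.
  set i := (Finset.univ.filter fun i => (r : ℝ) ≤ partialSum t i + t i).min' hne with hi
  have h1 : (r : ℝ) ≤ partialSum t i + t i := (Finset.mem_filter.1 (Finset.min'_mem _ hne)).2
  have h2 : partialSum t i ≤ r := by
    by_contra h
    rw [not_le] at h
    obtain h0 | ⟨k, hk⟩ := Fin.eq_zero_or_eq_succ i
    · rw [h0] at h
      have : partialSum t 0 = 0 := by simp [partialSum]
      linarith [r.2.1]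
    · rw [hk, partialSum_succ] at h
      have := Finset.min'_le (Finset.univ.filter fun i => (r : ℝ) ≤ partialSum t i + t i)
        k.castSucc (Finset.mem_filter.2 ⟨Finset.mem_univ _, h.le⟩)
      rw [← hi, hk] at this
      exact absurd this (not_le.2 (Fin.castSucc_lt_succ))
  refine ⟨i, ?_⟩
  rintro ⟨j, _ | _⟩ hj
  · have hij : i < j := by
      by_contra h
      refine hj ⟨⟨j.1, by omega⟩, ?_⟩
      have : j.1 ≤ i.1 := not_lt.1 h
      simp [prismChain, this]
    have := partialSum_add_le t hij
    exact max_eq_left ((min_le_right _ _).trans (by linarith))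
  · have hij : j < i := by
      by_contra h
      refine hj ⟨⟨j.1 + 1, by omega⟩, ?_⟩
      have h' : i.1 ≤ j.1 := not_lt.1 h
      have : ¬ j.1 + 1 ≤ i.1 := by omega
      simp [prismChain, this]
    have := partialSum_add_le t hij
    rw [prism_true, lowerPart, min_eq_left (by linarith), sub_eq_zero]
    exact (max_eq_right (t.2.1 j)).symm

lemma prism_mem (r : unitInterval) (t : stdSimplex ℝ (Fin (n + 1))) :
    ∃ (k : ℕ) (e : Fin (k + 1) ↪o Fin (n + 1) × Bool) (s : stdSimplex ℝ (Fin (k + 1))),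
      stdSimplex.map e s = prism r t := by
  obtain ⟨i, hi⟩ := exists_prismChain r t
  exact ⟨_, prismChain i, _, map_pullSimplex (prismChain i).injective _ hi⟩

end PrismWeights

/-! ### Compatibility of order complexes with subposets -/

section ChainRestrict

variable {B : Type u₁} [Category.{v₁} B] {F : B ⥤ TopCat.{w₁}} {G : Bᵒᵖ ⥤ TopCat.{w₂}}
  {P : Type v} [Fintype P] [PartialOrder P] {Q : Type u} [Fintype Q] [PartialOrder Q]

/-- This is what makes homotopies defined prism by prism respect the gluing along faces. The
functors on the two posets agree only propositionally, whence the `eqToHom` corrections. -/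
lemma chainCell_comp (Ψ : P ⥤ B) {p₀ p₁ : P} (h₀ : ∀ p, p₀ ≤ p) (h₁ : ∀ p, p ≤ p₁)
    {q₀ q₁ : Q} (h₀' : ∀ q, q₀ ≤ q) (h₁' : ∀ q, q ≤ q₁) (e : Q ↪o P) {Ψ' : Q ⥤ B}
    (hΨ : Ψ' = e.monotone.functor ⋙ Ψ)
    {a : F.obj (Ψ.obj p₀)} {b : G.obj (op (Ψ.obj p₁))}
    {a' : F.obj (Ψ'.obj q₀)} {b' : G.obj (op (Ψ'.obj q₁))}
    (ha : F.map (Ψ.map (homOfLE (h₀ (e q₀))) ≫ eqToHom (by rw [hΨ]; rfl)) a = a')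
    (hb : G.map (eqToHom (by rw [hΨ]; rfl) ≫ Ψ.map (homOfLE (h₁ (e q₁)))).op b = b')
    {w : ChainSpace P} {w' : ChainSpace Q} (hw : w.1 = stdSimplex.map e w'.1) :
    chainCell Ψ h₀ h₁ a b w = chainCell Ψ' h₀' h₁' a' b' w' := by
  subst hΨ
  obtain ⟨k, c, t, h⟩ := w'.2
  rw [chainCell_eq _ h₀' h₁' a' b' c t h, chainCell_eq Ψ h₀ h₁ a b (c.trans e) t
    (by rw [hw, ← h, stdSimplex.map_comp_apply]; rfl)]
  refine Realization.mk_congr rfl t ?_ ?_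
  · refine (ConcreteCategory.congr_hom (F.map_id _) _).trans ?_
    rw [← ha]
    refine Eq.trans ?_ (ConcreteCategory.congr_hom (F.map_comp _ _) a)
    refine congrArg (fun k => F.map k a) ?_
    refine Eq.trans ?_ (congrArg (· ≫ Ψ.map (homOfLE (e.monotone (h₀' (c 0)))))
      (Category.comp_id _).symm)
    exact ((Ψ.map_comp _ _).symm.trans rfl).symm
  · refine (ConcreteCategory.congr_hom (G.map_id _) _).trans ?_
    rw [← hb]
    refine Eq.trans ?_ (map_op_map_op G _ _ b).symm
    refine congrArg (fun k => G.map (Quiver.Hom.op k) b) ?_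
    refine Eq.trans ?_ (congrArg (Ψ.map (homOfLE (e.monotone (h₁' (c (Fin.last k))))) ≫ ·)
      (Category.id_comp _).symm)
    exact ((Ψ.map_comp _ _).symm.trans rfl).symm

end ChainRestrict

/-- The vertices of the prism on a simplex, as a poset. -/
def Prism (n : ℕ) : Type := Fin (n + 1) × Bool

instance (n : ℕ) : PartialOrder (Prism n) := inferInstanceAs (PartialOrder (Fin (n + 1) × Bool))

instance (n : ℕ) : Fintype (Prism n) := inferInstanceAs (Fintype (Fin (n + 1) × Bool))

/-! ### Pulling back sequences of covering sieves -/

section PullbackSequence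

variable {C : Type u} [Category.{v} C] {J : GrothendieckTopology C} {X : C} {m n : ℕ}

/-- The family of morphisms to the objects of a sequence given by a morphism to the first
object. -/
def spread (φ : ComposableArrows (CoverPair J) n) (u : X ⟶ (φ.obj 0).base) (i : Fin (n + 1)) :
    X ⟶ (φ.obj i).base :=
  u ≫ CoverPair.Hom.hom (φ.map (homOfLE (Fin.zero_le i)))

lemma spread_comp (φ : ComposableArrows (CoverPair J) n) (u : X ⟶ (φ.obj 0).base)
    {i j : Fin (n + 1)} (h : i ≤ j) :
    spread φ u i ≫ CoverPair.Hom.hom (φ.map (homOfLE h)) = spread φ u j := by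
  rw [spread, Category.assoc, ← CoverPair.comp_hom, map_homOfLE_comp]
  rfl

lemma spread_faceSeq (φ : ComposableArrows (CoverPair J) n) (u : X ⟶ (φ.obj 0).base)
    (η : Fin (m + 1) ↪o Fin (n + 1)) :
    spread (faceSeq φ η) (u ≫ CoverPair.Hom.hom (φ.map (homOfLE (Fin.zero_le (η 0))))) =
      fun i => spread φ u (η i) :=
  funext fun i => spread_comp φ u (η.monotone (Fin.zero_le i))

/-- The pullbacks of the covering sieves of a sequence along a compatible family. -/
def pullbackSeq (φ : ComposableArrows (CoverPair J) n) (u : ∀ i, X ⟶ (φ.obj i).base)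
    (hu : ∀ {i j} (h : i ≤ j), u i ≫ CoverPair.Hom.hom (φ.map (homOfLE h)) = u j) :
    ComposableArrows (J.Cover X) n where
  obj i := (φ.obj i).cover.pullback (u i)
  map {i j} f := homOfLE fun Y g hg => by
    have h := CoverPair.Hom.le (φ.map (homOfLE (leOfHom f))) _ hg
    change (φ.obj j).cover (g ≫ u j)
    rw [← hu (leOfHom f)]
    simpa using h

lemma faceSeq_pullbackSeq (φ : ComposableArrows (CoverPair J) n) (u : ∀ i, X ⟶ (φ.obj i).base)
    (hu : ∀ {i j} (h : i ≤ j), u i ≫ CoverPair.Hom.hom (φ.map (homOfLE h)) = u j)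
    (η : Fin (m + 1) ↪o Fin (n + 1)) {u' : ∀ i, X ⟶ ((faceSeq φ η).obj i).base}
    (hu' : ∀ {i j} (h : i ≤ j), u' i ≫ CoverPair.Hom.hom ((faceSeq φ η).map (homOfLE h)) = u' j)
    (h : u' = fun i => u (η i)) :
    faceSeq (pullbackSeq φ u hu) η = pullbackSeq (faceSeq φ η) u' hu' := by
  subst h
  rfl

/-- The cartesian morphism to a pair. -/
def toPair (A : CoverPair J) (u : X ⟶ A.base) :
    (CoverPair.fiber J X).obj (A.cover.pullback u) ⟶ A := ⟨u, le_rfl⟩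

/-- The sequences in the fiber over `X` and in the category of pairs, joined by cartesian
morphisms. -/
def prismFunctor (φ : ComposableArrows (CoverPair J) n) (u : ∀ i, X ⟶ (φ.obj i).base)
    (hu : ∀ {i j} (h : i ≤ j), u i ≫ CoverPair.Hom.hom (φ.map (homOfLE h)) = u j) :
    Prism n ⥤ CoverPair J where
  obj p := Bool.rec ((CoverPair.fiber J X).obj ((pullbackSeq φ u hu).obj p.1)) (φ.obj p.1) p.2
  map {p q} f := match p, q, leOfHom f with
    | (i, false), (j, false), h => (CoverPair.fiber J X).map ((pullbackSeq φ u hu).map (homOfLE h.1))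
    | (i, false), (j, true), h => toPair (φ.obj i) (u i) ≫ φ.map (homOfLE h.1)
    | (i, true), (j, true), h => φ.map (homOfLE h.1)
    | (i, true), (j, false), h => absurd (show true ≤ false from h.2) (by decide)
  map_id p := by
    obtain ⟨i, _ | _⟩ := p
    · rfl
    · exact φ.map_id _
  map_comp {p q r} f g := by
    have h1 := leOfHom f
    have h2 := leOfHom g
    obtain ⟨i, _ | _⟩ := p <;> obtain ⟨j, _ | _⟩ := q <;> obtain ⟨k, _ | _⟩ := r
    · exact CoverPair.hom_ext (Category.comp_id _).symm
    · refine CoverPair.hom_ext ?_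
      refine Eq.trans ?_ (Category.id_comp _).symm
      exact (hu (h1.1.trans h2.1)).trans (hu h2.1).symm
    · exact absurd (show true ≤ false from h2.2) (by decide)
    · refine Eq.trans ?_ (Category.assoc _ _ _).symm
      exact congrArg (toPair (φ.obj i) (u i) ≫ ·)
        (map_homOfLE_comp φ h1.1 h2.1 (h1.1.trans h2.1)).symm
    · exact absurd (show true ≤ false from h1.2) (by decide)
    · exact absurd (show true ≤ false from h1.2) (by decide)
    · exact absurd (show true ≤ false from h2.2) (by decide)
    · exact (map_homOfLE_comp φ _ _ _).symm

/-- The map of prisms given by a face. -/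
def prismFace (η : Fin (m + 1) ↪o Fin (n + 1)) : Prism m ↪o Prism n :=
  OrderEmbedding.ofMapLEIff (Prod.map η id) fun _ _ => and_congr η.le_iff_le Iff.rfl

lemma prismFunctor_face (φ : ComposableArrows (CoverPair J) n) (u : ∀ i, X ⟶ (φ.obj i).base)
    (hu : ∀ {i j} (h : i ≤ j), u i ≫ CoverPair.Hom.hom (φ.map (homOfLE h)) = u j)
    (η : Fin (m + 1) ↪o Fin (n + 1)) {u' : ∀ i, X ⟶ ((faceSeq φ η).obj i).base}
    (hu' : ∀ {i j} (h : i ≤ j), u' i ≫ CoverPair.Hom.hom ((faceSeq φ η).map (homOfLE h)) = u' j)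
    (h : u' = fun i => u (η i)) :
    prismFunctor (faceSeq φ η) u' hu' = (prismFace η).monotone.functor ⋙ prismFunctor φ u hu := by
  subst h
  refine CategoryTheory.Functor.ext (fun p => rfl) fun p q f => ?_
  refine Eq.trans ?_ ((Category.id_comp _).trans (Category.comp_id _)).symm
  have h1 := leOfHom f
  obtain ⟨i, _ | _⟩ := p <;> obtain ⟨j, _ | _⟩ := q
  · rfl
  · rfl
  · exact absurd (show true ≤ false from h1.2) (by decide)
  · rfl

end PullbackSequence

/-! ### The relative realization deforms to the fiber -/

section FiberProjection

open Topology

variable {C : Type u} [Category.{v} C] {J : GrothendieckTopology C} {X : C} {m n : ℕ}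
  (H : (CoverPair J)ᵒᵖ ⥤ TopCat.{w})

lemma CoverPair.eqToHom_hom {A B : CoverPair J} (h : A = B) :
    CoverPair.Hom.hom (eqToHom h) = eqToHom (congrArg CoverPair.base h) := by
  subst h
  rfl

lemma fiber_map_map_op {S T : (J.Cover X)ᵒᵖ} (f : S ⟶ T) {A : CoverPair J}
    (g : (CoverPair.fiber J X).obj S.unop ⟶ A) (k : (CoverPair.fiber J X).obj T.unop ⟶ A)
    (hk : CoverPair.Hom.hom g = CoverPair.Hom.hom k) (h : H.obj (op A)) :
    ((CoverPair.fiber J X).op ⋙ H).map f (H.map g.op h) = H.map k.op h :=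
  (map_op_map_op H ((CoverPair.fiber J X).map f.unop) g h).trans
    (congrArg (fun k => H.map (Quiver.Hom.op k) h)
      (CoverPair.hom_ext ((Category.id_comp _).trans hk)))

/-- The morphism given by a point of the discrete presheaf. -/
def toBase {A : CoverPair J} (u : ((baseHom J).obj (op X)).obj A) : X ⟶ A.base := u

/-- The point of the discrete presheaf given by a morphism. -/
def ofBase {A : CoverPair J} (u : X ⟶ A.base) : ((baseHom J).obj (op X)).obj A := u

instance (A : CoverPair J) (Y : Cᵒᵖ) : DiscreteTopology (((baseHom J).obj Y).obj A) :=
  inferInstanceAs (DiscreteTopology (TopCat.discrete.obj (Y.unop ⟶ A.base)))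

variable (X)

/-- The projection of the relative realization to the fiber realization, by pulling back the
covering sieves. -/
def fiberProj : C(Realization ((baseHom J).obj (op X)) H,
    Realization (pt (J.Cover X)) ((CoverPair.fiber J X).op ⋙ H)) where
  toFun := Realization.lift (fun n φ u h t =>
      Realization.mk (F := pt (J.Cover X)) (G := (CoverPair.fiber J X).op ⋙ H)
        (pullbackSeq φ (spread φ (toBase u)) (spread_comp φ _)) PUnit.unit
        (H.map (toPair _ (spread φ (toBase u) (Fin.last n))).op h) t) fun {m n} φ η u h t => by
    refine Realization.mk_eq_mk η rfl (faceSeq_pullbackSeq _ _ _ η _ (spread_faceSeq φ _ η)) rfl ?_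
    refine Eq.trans ?_ (map_op_map_op H _ _ h).symm
    refine (congrArg _ (fiber_map_map_op H _ _ (toPair _ (spread φ (toBase u) (η (Fin.last m))) ≫
      φ.map (homOfLE (Fin.le_last _))) ?_ h)).trans (fiber_map_map_op H _ _ _ ?_ h)
    · exact (spread_comp φ _ _).symm
    · exact congrArg (· ≫ CoverPair.Hom.hom (φ.map (homOfLE (Fin.le_last (η (Fin.last m))))))
        (congrFun (spread_faceSeq φ (toBase u) η) (Fin.last m)).symm
  continuous_toFun := Realization.continuous_of_comp_mk fun n φ => by
    refine continuous_prod_of_discrete_left.2 fun u => ?_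
    refine (Realization.continuous_mk (F := pt (J.Cover X)) (G := (CoverPair.fiber J X).op ⋙ H)
      (pullbackSeq φ (spread φ (toBase u)) (spread_comp φ _))).comp
      (f := fun p : H.obj (op (φ.obj (Fin.last n))) × stdSimplex ℝ (Fin (n + 1)) =>
        (PUnit.unit, H.map (toPair _ (spread φ (toBase u) (Fin.last n))).op p.1, p.2)) ?_
    exact (continuous_const (y := PUnit.unit)).prodMk
      (((H.map _).hom.continuous.comp continuous_fst).prodMk continuous_snd)

/-- The inclusion of the fiber realization in the relative realization. -/
def fiberIncl : C(Realization (pt (J.Cover X)) ((CoverPair.fiber J X).op ⋙ H),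
    Realization ((baseHom J).obj (op X)) H) where
  toFun := Realization.lift (fun n ψ _ h t =>
      Realization.mk (F := (baseHom J).obj (op X)) (G := H) (ψ ⋙ CoverPair.fiber J X)
        (ofBase (𝟙 X)) h t) fun {m n} ψ η u h t => by
    refine Realization.mk_eq_mk η rfl rfl ?_ ?_
    · exact (Category.comp_id (obj := C) _).trans (Category.comp_id (obj := C) _)
    · exact ConcreteCategory.congr_hom (H.map_id _) _
  continuous_toFun := Realization.continuous_of_comp_mk fun n ψ =>
    (Realization.continuous_mk (F := (baseHom J).obj (op X)) (G := H)
      (ψ ⋙ CoverPair.fiber J X)).comp ((continuous_const (y := ofBase (𝟙 X))).prodMk continuous_snd)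

lemma fiberProj_fiberIncl (q) : fiberProj X H (fiberIncl X H q) = q := by
  induction q using Realization.ind with | h n ψ u h t
  refine Realization.mk_congr (CoverPair.functor_ext_cover fun i => ?_) t rfl ?_
  · refine GrothendieckTopology.Cover.ext _ _ fun Y f => ?_
    change ψ.obj i (f ≫ 𝟙 X ≫ 𝟙 X) ↔ ψ.obj i f
    rw [Category.comp_id, Category.comp_id]
  · exact (fiber_map_map_op H _ _ (𝟙 _) (Category.comp_id _) h).trans
      (ConcreteCategory.congr_hom (H.map_id _) _)

variable {X}

/-- The least vertex of the prism. -/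
def prismBot (n : ℕ) : Prism n := ((0, false) : Fin (n + 1) × Bool)

/-- The greatest vertex of the prism. -/
def prismTop (n : ℕ) : Prism n := ((Fin.last n, true) : Fin (n + 1) × Bool)

lemma prismBot_le (p : Prism n) : prismBot n ≤ p := ⟨Fin.zero_le _, Bool.false_le _⟩

lemma le_prismTop (p : Prism n) : p ≤ prismTop n := ⟨Fin.le_last _, Bool.le_true _⟩

/-- The point of the prism at a given height, as a point of the order complex. -/
def prismPoint (r : unitInterval) (t : stdSimplex ℝ (Fin (n + 1))) : ChainSpace (Prism n) :=
  ⟨prism r t, prism_mem r t⟩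

lemma continuous_prismPoint :
    Continuous fun p : unitInterval × stdSimplex ℝ (Fin (n + 1)) => prismPoint p.1 p.2 :=
  Continuous.subtype_mk continuous_prism _

variable (X)

/-- The points of the realization over a prism. -/
def prismCell (φ : ComposableArrows (CoverPair J) n) (u : X ⟶ (φ.obj 0).base)
    (h : H.obj (op (φ.obj (Fin.last n)))) (w : ChainSpace (Prism n)) :
    Realization ((baseHom J).obj (op X)) H :=
  chainCell (F := (baseHom J).obj (op X)) (G := H) (prismFunctor φ (spread φ u) (spread_comp φ u))
    prismBot_le le_prismTop (ofBase (𝟙 X)) h w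

lemma continuous_prismCell (φ : ComposableArrows (CoverPair J) n) (u : X ⟶ (φ.obj 0).base) :
    Continuous fun p : H.obj (op (φ.obj (Fin.last n))) × ChainSpace (Prism n) =>
      prismCell X H φ u p.1 p.2 :=
  continuous_chainCell (F := (baseHom J).obj (op X)) (G := H)
    (prismFunctor φ (spread φ u) (spread_comp φ u)) prismBot_le le_prismTop (ofBase (𝟙 X))

lemma prismCell_eq (φ : ComposableArrows (CoverPair J) n) (u : X ⟶ (φ.obj 0).base)
    (h : H.obj (op (φ.obj (Fin.last n)))) (e : Fin (m + 1) ↪o Prism n)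
    (t : stdSimplex ℝ (Fin (m + 1))) {w : ChainSpace (Prism n)} (hw : stdSimplex.map e t = w.1) :
    prismCell X H φ u h w = chainMk (F := (baseHom J).obj (op X)) (G := H)
      (prismFunctor φ (spread φ u) (spread_comp φ u)) prismBot_le le_prismTop (ofBase (𝟙 X)) h e t :=
  chainCell_eq (F := (baseHom J).obj (op X)) (G := H)
    (prismFunctor φ (spread φ u) (spread_comp φ u)) prismBot_le le_prismTop (ofBase (𝟙 X)) h e t hw

/-- The deformation of the relative realization to the fiber realization. -/
def fiberHomotopy (p : Realization ((baseHom J).obj (op X)) H × unitInterval) :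
    Realization ((baseHom J).obj (op X)) H :=
  Realization.lift (F := (baseHom J).obj (op X)) (G := H)
    (fun n φ u h t => prismCell X H φ (toBase u) h (prismPoint p.2 t)) (fun {m n} φ η u h t => by
      refine chainCell_comp _ prismBot_le le_prismTop prismBot_le le_prismTop (prismFace η)
        (prismFunctor_face _ _ _ η _ (spread_faceSeq φ (toBase u) η)) ?_ ?_ (prism_map η p.2 t)
      · refine (Category.id_comp (obj := C) _).trans ?_
        exact (Category.id_comp (obj := C) _).trans (CoverPair.eqToHom_hom _)
      · exact congrArg (fun k => H.map (Quiver.Hom.op k) h) (Category.id_comp _)) p.1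

lemma continuous_prismCell_prismPoint (φ : ComposableArrows (CoverPair J) n) :
    Continuous fun p : ((baseHom J).obj (op X)).obj (φ.obj 0) ×
      ((H.obj (op (φ.obj (Fin.last n))) × stdSimplex ℝ (Fin (n + 1))) × unitInterval) =>
      prismCell X H φ (toBase p.1) p.2.1.1 (prismPoint p.2.2 p.2.1.2) := by
  refine continuous_prod_of_discrete_left.2 fun u => ?_
  have h1 : Continuous fun p : (H.obj (op (φ.obj (Fin.last n))) ×
      stdSimplex ℝ (Fin (n + 1))) × unitInterval => prismPoint p.2 p.1.2 :=
    continuous_prismPoint.comp (continuous_snd.prodMk (continuous_snd.comp continuous_fst))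
  have h2 : Continuous fun p : (H.obj (op (φ.obj (Fin.last n))) ×
      stdSimplex ℝ (Fin (n + 1))) × unitInterval => p.1.1 := continuous_fst.comp continuous_fst
  exact (continuous_prismCell X H φ (toBase u)).comp (h2.prodMk h1)

lemma fiberHomotopy_mk (φ : ComposableArrows (CoverPair J) n) (u h t) (r : unitInterval) :
    fiberHomotopy X H (Realization.mk φ u h t, r) =
      prismCell X H φ (toBase u) h (prismPoint r t) := rfl

lemma continuous_fiberHomotopy : Continuous (fiberHomotopy X H) := by
  refine Realization.continuous_prod_of_comp_mk fun n φ => ?_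
  simp only [fiberHomotopy_mk]
  exact (continuous_prismCell_prismPoint X H φ).comp
    ((continuous_fst.comp continuous_fst).prodMk
      ((continuous_snd.comp continuous_fst).prodMk continuous_snd))

/-- The cartesian morphisms from the pulled back sieves to the given pairs form a natural
transformation, and the prism over each sequence turns it into a homotopy. At height 0 it is the
identity (top edge), at height 1 the inclusion after the projection (bottom edge). The least vertex
of each prism lies over `X` itself, so the covariant coordinate there is the identity of `X`. -/
theorem weakEquiv_fiberProj : WeakEquiv (fiberProj X H) := by
  refine .of_shrinkable (s := fiberIncl X H) (D := fiberHomotopy X H) (fiberProj X H).continuous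
    (fiberIncl X H).continuous (continuous_fiberHomotopy X H) (fiberProj_fiberIncl X H)
    (fun q => ?_) fun q => ?_
  · induction q using Realization.ind with | h n φ u h t
    refine (prismCell_eq X H φ (toBase u) h (w := prismPoint 0 t) (prismEdge n true) t (prism_zero t)).trans ?_
    refine Realization.mk_congr rfl t ?_ ?_
    · refine (Category.comp_id (obj := C) _).trans ((Category.id_comp (obj := C) _).trans ?_)
      refine (spread_comp φ (toBase u) le_rfl).trans ?_
      refine Eq.trans (congrArg (fun k => toBase u ≫ CoverPair.Hom.hom k) (φ.map_id _)) ?_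
      exact Category.comp_id (toBase u)
    · refine (ConcreteCategory.congr_hom (H.map_id _) _).trans ?_
      exact (congrArg (fun k => H.map (Quiver.Hom.op k) h) (φ.map_id _)).trans
        (ConcreteCategory.congr_hom (H.map_id _) h)
  · induction q using Realization.ind with | h n φ u h t
    refine (prismCell_eq X H φ (toBase u) h (w := prismPoint 1 t) (prismEdge n false) t (prism_one t)).trans ?_
    refine Realization.mk_congr rfl t ?_ ?_
    · exact (Category.comp_id (obj := C) _).trans (Category.comp_id (obj := C) _)
    · refine (ConcreteCategory.congr_hom (H.map_id _) _).trans ?_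
      refine congrArg (fun k => H.map (Quiver.Hom.op k) h) ?_
      exact (congrArg (toPair _ (spread φ (toBase u) (Fin.last n)) ≫ ·) (φ.map_id _)).trans
        (Category.comp_id _)

end FiberProjection

/-! ### Cones with a new last vertex -/

section LastCone

variable {m n : ℕ}

/-- The face of the cone with a new last vertex on a simplex. -/
def lastConeFace (η : Fin (m + 1) ↪o Fin (n + 1)) : Fin (m + 2) ↪o Fin (n + 2) :=
  OrderEmbedding.ofMapLEIff
    (Fin.lastCases (motive := fun _ => Fin (n + 2)) (Fin.last _) fun i => (η i).castSucc)
    fun i j => by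
      cases i using Fin.lastCases <;> cases j using Fin.lastCases <;> simp [Fin.le_last]

lemma lastConeFace_last (η : Fin (m + 1) ↪o Fin (n + 1)) :
    lastConeFace η (Fin.last _) = Fin.last _ :=
  Fin.lastCases_last (motive := fun _ => Fin (n + 2))

lemma lastConeFace_castSucc (η : Fin (m + 1) ↪o Fin (n + 1)) (i : Fin (m + 1)) :
    lastConeFace η i.castSucc = (η i).castSucc :=
  Fin.lastCases_castSucc (motive := fun _ => Fin (n + 2)) i

/-- The point of the cone with a new last vertex on a simplex. -/
def lastCone (s : unitInterval) (t : stdSimplex ℝ (Fin (n + 1))) : stdSimplex ℝ (Fin (n + 2)) :=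
  mix s (stdSimplex.map Fin.castSucc t) (stdSimplex.vertex (Fin.last _))

lemma lastCone_map (η : Fin (m + 1) ↪o Fin (n + 1)) (s : unitInterval)
    (t : stdSimplex ℝ (Fin (m + 1))) :
    lastCone s (stdSimplex.map η t) = stdSimplex.map (lastConeFace η) (lastCone s t) := by
  rw [lastCone, lastCone, map_mix, stdSimplex.map_comp_apply, stdSimplex.map_comp_apply,
    stdSimplex.map_vertex, lastConeFace_last]
  congr 2
  exact funext fun i => (lastConeFace_castSucc η i).symm

lemma continuous_lastCone :
    Continuous fun p : unitInterval × stdSimplex ℝ (Fin (n + 1)) => lastCone p.1 p.2 :=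
  continuous_mix.comp (continuous_fst.prodMk
    (((stdSimplex.continuous_map _).comp continuous_snd).prodMk continuous_const))

lemma lastCone_zero (t : stdSimplex ℝ (Fin (n + 1))) :
    lastCone 0 t = stdSimplex.map (Fin.castSuccOrderEmb (n := n + 1)) t := mix_zero _ _

lemma lastCone_one (t : stdSimplex ℝ (Fin (n + 1))) :
    lastCone 1 t = stdSimplex.map (vertexEmb (Fin.last _)) default := by
  rw [← vertex_eq_map]; exact mix_one _ _

end LastCone

/-! ### Homotopic morphisms of presheaves -/

section Cylinder

variable {C : Type u} [Category.{v} C]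

/-- The cylinder on a presheaf of spaces. -/
def cylinder (P : Cᵒᵖ ⥤ TopCat.{w}) : Cᵒᵖ ⥤ TopCat.{w} where
  obj X := TopCat.of (P.obj X × unitInterval)
  map f := TopCat.ofHom ⟨Prod.map (P.map f) id, (P.map f).hom.continuous.prodMap continuous_id⟩
  map_id X := by
    refine TopCat.hom_ext (ContinuousMap.ext fun p => Prod.ext ?_ rfl)
    exact ConcreteCategory.congr_hom (P.map_id X) p.1
  map_comp f g := by
    refine TopCat.hom_ext (ContinuousMap.ext fun p => Prod.ext ?_ rfl)
    exact ConcreteCategory.congr_hom (P.map_comp f g) p.1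

/-- The inclusion of a presheaf in its cylinder at a given height. -/
def cylinderIncl (P : Cᵒᵖ ⥤ TopCat.{w}) (s : unitInterval) : P ⟶ cylinder P where
  app X := TopCat.ofHom ⟨fun q => (q, s), continuous_id.prodMk continuous_const⟩

lemma weakEquiv_cylinderIncl (P : Cᵒᵖ ⥤ TopCat.{w}) (s : unitInterval) (X : Cᵒᵖ) :
    WeakEquiv ((cylinderIncl P s).app X) :=
  weakEquiv_prodMk_left (X := P.obj X) s

lemma realization_map_comp (F : C ⥤ TopCat.{w₁}) {P P' P'' : Cᵒᵖ ⥤ TopCat.{w₂}} (α : P ⟶ P')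
    (β : P' ⟶ P'') : (Realization.map (𝟙 F) (α ≫ β) : Realization F P → Realization F P'') =
      Realization.map (𝟙 F) β ∘ Realization.map (𝟙 F) α := by
  funext q
  induction q using Realization.ind
  rfl

/-- Homotopic morphisms of presheaves induce weak equivalences of realizations simultaneously. -/
lemma weakEquiv_realization_map_of_cylinder (F : C ⥤ TopCat.{w₁}) {P P' : Cᵒᵖ ⥤ TopCat.{w₂}}
    (N : cylinder P ⟶ P') {s r : unitInterval}
    (h : WeakEquiv (Realization.map (𝟙 F) (cylinderIncl P s ≫ N))) :
    WeakEquiv (Realization.map (𝟙 F) (cylinderIncl P r ≫ N)) := by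
  -- Both end inclusions are object-by-object equivalences, so two out of three passes from one end
  -- to the map on the cylinder and back to the other end. No comparison of the realization of a
  -- cylinder with a product is needed.
  have h1 : ∀ s, WeakEquiv (Realization.map (𝟙 F) (cylinderIncl P s)) := fun s =>
    weakEquiv_realization_map F _ (weakEquiv_cylinderIncl P s)
  rw [realization_map_comp] at h ⊢
  exact (WeakEquiv.of_comp_right (ContinuousMap.continuous _) (h1 s) h).comp (h1 r)

end Cylinder

/-! ### From relative realizations to the map from `σ` to `γ'` -/

section Comparison

variable {C : Type u} [Category.{v} C] (J : GrothendieckTopology C) (G : Cᵒᵖ ⥤ TopCat.{w})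

lemma fiberProj_mk_comp {X Y : C} (f : Y ⟶ X) (H : (CoverPair J)ᵒᵖ ⥤ TopCat.{w}) {n : ℕ}
    (φ : ComposableArrows (CoverPair J) n) (u : X ⟶ (φ.obj 0).base)
    (h : H.obj (op (φ.obj (Fin.last n)))) (t : stdSimplex ℝ (Fin (n + 1))) :
    Realization.mk (F := pt (J.Cover Y)) (G := (CoverPair.fiber J Y).op ⋙ H)
      (pullbackSeq φ (spread φ (f ≫ u)) (spread_comp φ _)) PUnit.unit
      (H.map (toPair _ (spread φ (f ≫ u) (Fin.last n))).op h) t =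
    Realization.mk (F := pt (J.Cover Y)) (G := (CoverPair.fiber J Y).op ⋙ H)
      (pullbackSeq φ (spread φ u) (spread_comp φ u) ⋙ J.pullback f) PUnit.unit
      (H.map ((CoverPair.cartesian f).app ((φ.obj (Fin.last n)).cover.pullback
        (spread φ u (Fin.last n)))).op (H.map (toPair _ (spread φ u (Fin.last n))).op h)) t := by
  refine Realization.mk_congr (CoverPair.functor_ext_cover fun i => ?_) t rfl ?_
  · refine GrothendieckTopology.Cover.ext _ _ fun Z g => ?_
    have h1 : g ≫ spread φ (f ≫ u) i = (g ≫ f) ≫ spread φ u i := by simp [spread]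
    exact iff_of_eq (congrArg (fun k => (φ.obj i).cover k) h1)
  · refine (fiber_map_map_op H _ _ ((CoverPair.cartesian f).app _ ≫ toPair _ _) ?_ h).trans
      (map_op_map_op H _ _ h).symm
    exact Category.assoc _ _ _

lemma gammaPrime_map_mk {X Y : Cᵒᵖ} (f : X ⟶ Y) {n : ℕ}
    (ψ : ComposableArrows (J.Cover X.unop) n) (a : PUnit)
    (h : (gammaTilde J G).obj (op ((CoverPair.fiber J X.unop).obj (ψ.obj (Fin.last n)))))
    (t : stdSimplex ℝ (Fin (n + 1))) :
    (gammaPrime J G).map f (Realization.mk (F := pt (J.Cover X.unop))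
      (G := (CoverPair.fiber J X.unop).op ⋙ gammaTilde J G) ψ a h t) =
    Realization.mk (F := pt (J.Cover Y.unop))
      (G := (CoverPair.fiber J Y.unop).op ⋙ gammaTilde J G) (ψ ⋙ J.pullback f.unop) a
      ((gammaTilde J G).map ((CoverPair.cartesian f.unop).app (ψ.obj (Fin.last n))).op h) t := rfl

lemma realizationPresheaf_map_mk {E : Type u₂} [Category.{v₂} E] (K : Cᵒᵖ ⥤ E ⥤ TopCat.{w₁})
    (H : Eᵒᵖ ⥤ TopCat.{w₂}) {X Y : Cᵒᵖ} (f : X ⟶ Y) {n : ℕ} (φ : ComposableArrows E n)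
    (a : (K.obj X).obj (φ.obj 0)) (h : H.obj (op (φ.obj (Fin.last n))))
    (t : stdSimplex ℝ (Fin (n + 1))) :
    (realizationPresheaf K H).map f (Realization.mk (F := K.obj X) (G := H) φ a h t) =
      Realization.mk (F := K.obj Y) (G := H) φ ((K.map f).app _ a) h t := rfl

lemma fiberProj_mk {X : C} (H : (CoverPair J)ᵒᵖ ⥤ TopCat.{w}) {n : ℕ}
    (φ : ComposableArrows (CoverPair J) n) (u : ((baseHom J).obj (op X)).obj (φ.obj 0))
    (h : H.obj (op (φ.obj (Fin.last n)))) (t : stdSimplex ℝ (Fin (n + 1))) :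
    fiberProj X H (Realization.mk φ u h t) =
      Realization.mk (F := pt (J.Cover X)) (G := (CoverPair.fiber J X).op ⋙ H)
        (pullbackSeq φ (spread φ (toBase u)) (spread_comp φ _)) PUnit.unit
        (H.map (toPair _ (spread φ (toBase u) (Fin.last n))).op h) t := rfl

lemma fiberProj_naturality {X Y : Cᵒᵖ} (f : X ⟶ Y)
    (q : Realization ((baseHom J).obj X) (gammaTilde J G)) :
    fiberProj Y.unop (gammaTilde J G)
      ((realizationPresheaf (baseHom J) (gammaTilde J G)).map f q) =
    (gammaPrime J G).map f (fiberProj X.unop (gammaTilde J G) q) := by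
  induction q using Realization.ind with | h n φ u h t
  have h1 := realizationPresheaf_map_mk (baseHom J) (gammaTilde J G) f φ u h t
  have h2 := fiberProj_mk_comp J f.unop (gammaTilde J G) φ (toBase u) h t
  have h3 := gammaPrime_map_mk J G f (pullbackSeq φ (spread φ (toBase u)) (spread_comp φ _))
    PUnit.unit ((gammaTilde J G).map (toPair _ (spread φ (toBase u) (Fin.last n))).op h) t
  have h4 := congrArg (fiberProj Y.unop (gammaTilde J G)) h1
  have h5 := h4.trans (fiberProj_mk J (gammaTilde J G) φ _ h t)
  have h6 := h2.trans h3.symm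
  have h7 := congrArg ((gammaPrime J G).map f)
    (fiberProj_mk J (X := X.unop) (gammaTilde J G) φ u h t)
  have h8 := h5.trans h6
  exact h8.trans h7.symm

/-- The projection of the relative realization to `γ'`. -/
def projPrime : realizationPresheaf (baseHom J) (gammaTilde J G) ⟶ gammaPrime J G where
  app X := TopCat.ofHom (fiberProj X.unop (gammaTilde J G))
  naturality _ _ f := TopCat.hom_ext (ContinuousMap.ext fun q => fiberProj_naturality J G f q)

lemma augment_naturality (H : (CoverPair J)ᵒᵖ ⥤ TopCat.{w}) {X Y : Cᵒᵖ} (f : X ⟶ Y)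
    (q : Realization ((coverHom J).obj X) H) :
    augment ((CoverPair.xi J).obj Y.unop) H ((realizationPresheaf (coverHom J) H).map f q) =
    H.map ((CoverPair.xi J).map f.unop).op (augment ((CoverPair.xi J).obj X.unop) H q) := by
  induction q using Realization.ind with | h n φ u h t
  have h1 := map_op_map_op H ((CoverPair.xi J).map f.unop) (toHom u ≫ φ.map (homOfLE
    (Fin.zero_le (Fin.last n)))) h
  refine Eq.trans ?_ h1.symm
  exact congrArg (fun k => H.map (Quiver.Hom.op k) h) (Category.assoc (obj := CoverPair J) _ _ _)

/-- The augmentation of the relative realization to `σ`. -/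
def augmentSigma : realizationPresheaf (coverHom J) (gammaTilde J G) ⟶ sigma J G where
  app X := TopCat.ofHom (augment ((CoverPair.xi J).obj X.unop) (gammaTilde J G))
  naturality _ _ f := TopCat.hom_ext (ContinuousMap.ext fun q =>
    augment_naturality J (gammaTilde J G) f q)

lemma weakEquiv_augmentSigma (X : Cᵒᵖ) : WeakEquiv ((augmentSigma J G).app X) :=
  weakEquiv_augment ((CoverPair.xi J).obj X.unop) (gammaTilde J G)

lemma weakEquiv_projPrime (X : Cᵒᵖ) : WeakEquiv ((projPrime J G).app X) :=
  weakEquiv_fiberProj X.unop (gammaTilde J G)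

variable {J}

/-- The point of the fiber realization given by a sequence of covering sieves. -/
def fiberMk {X : C} (H : (CoverPair J)ᵒᵖ ⥤ TopCat.{w}) {n : ℕ} (ψ : ComposableArrows (J.Cover X) n)
    (h : H.obj (op ((CoverPair.fiber J X).obj (ψ.obj (Fin.last n)))))
    (t : stdSimplex ℝ (Fin (n + 1))) :
    Realization (pt (J.Cover X)) ((CoverPair.fiber J X).op ⋙ H) :=
  Realization.mk (F := pt (J.Cover X)) (G := (CoverPair.fiber J X).op ⋙ H) ψ PUnit.unit h t

lemma continuous_fiberMk {X : C} (H : (CoverPair J)ᵒᵖ ⥤ TopCat.{w}) {n : ℕ}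
    (ψ : ComposableArrows (J.Cover X) n) :
    Continuous fun p : H.obj (op ((CoverPair.fiber J X).obj (ψ.obj (Fin.last n)))) ×
      stdSimplex ℝ (Fin (n + 1)) => fiberMk H ψ p.1 p.2 :=
  (Realization.continuous_mk (F := pt (J.Cover X)) (G := (CoverPair.fiber J X).op ⋙ H) ψ).comp
    ((continuous_const (y := PUnit.unit)).prodMk continuous_id)

lemma fiberMk_eq {X : C} (H : (CoverPair J)ᵒᵖ ⥤ TopCat.{w}) {m n : ℕ}
    {ψ : ComposableArrows (J.Cover X) n} {ψ' : ComposableArrows (J.Cover X) m}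
    (η : Fin (m + 1) ↪o Fin (n + 1)) (hψ : ∀ i, ψ.obj (η i) = ψ'.obj i)
    {t : stdSimplex ℝ (Fin (n + 1))} {t' : stdSimplex ℝ (Fin (m + 1))}
    (ht : t = stdSimplex.map η t') {A : CoverPair J} (x : H.obj (op A))
    (g : (CoverPair.fiber J X).obj (ψ.obj (Fin.last n)) ⟶ A)
    (g' : (CoverPair.fiber J X).obj (ψ'.obj (Fin.last m)) ⟶ A)
    (hg : CoverPair.Hom.hom g = CoverPair.Hom.hom g') :
    fiberMk H ψ (H.map g.op x) t = fiberMk H ψ' (H.map g'.op x) t' := by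
  obtain rfl : faceSeq ψ η = ψ' := CoverPair.functor_ext_cover hψ
  subst ht
  refine (Realization.mk_map _ η _ _ t').trans ?_
  exact congrArg (fun k => fiberMk H (faceSeq ψ η) k t') (fiber_map_map_op H _ g g' hg x)

/-- The constant sequence at the maximal sieve. -/
def topSeq (X : C) (n : ℕ) : ComposableArrows (J.Cover X) n := (Functor.const _).obj ⊤

/-- The homotopy between the projection and the augmentation. -/
def topHomotopy (X : C) (H : (CoverPair J)ᵒᵖ ⥤ TopCat.{w})
    (p : Realization (homFrom ((CoverPair.xi J).obj X)) H × unitInterval) :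
    Realization (pt (J.Cover X)) ((CoverPair.fiber J X).op ⋙ H) :=
  Realization.lift (F := homFrom ((CoverPair.xi J).obj X)) (G := H) (fun n φ u h t =>
    fiberMk H (topSeq X (n + 1)) (H.map (toHom u ≫ φ.map (homOfLE (Fin.zero_le (Fin.last n)))).op h)
      (lastCone p.2 t)) (fun {m n} φ η u h t => by
    have h1 := (augment_mk _ H φ u h (stdSimplex.map η t)).symm.trans
      (congrArg (augment _ H) (Realization.mk_map φ η u h t))
    have h2 := fiberMk_eq H (ψ := topSeq X (n + 1)) (ψ' := topSeq X (m + 1)) (lastConeFace η)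
      (fun _ => rfl) (lastCone_map η p.2 t) h
      (toHom u ≫ φ.map (homOfLE (Fin.zero_le (Fin.last n))))
      (toHom u ≫ φ.map (homOfLE (Fin.zero_le (Fin.last n)))) rfl
    exact h2.trans (congrArg (fun k => fiberMk H (topSeq X (m + 1)) k (lastCone p.2 t)) h1)) p.1

lemma topHomotopy_mk (X : C) (H : (CoverPair J)ᵒᵖ ⥤ TopCat.{w}) {n : ℕ}
    (φ : ComposableArrows (CoverPair J) n) (u h t) (s : unitInterval) :
    topHomotopy X H (Realization.mk φ u h t, s) = fiberMk H (topSeq X (n + 1))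
      (H.map (toHom u ≫ φ.map (homOfLE (Fin.zero_le (Fin.last n)))).op h) (lastCone s t) := rfl

lemma continuous_topHomotopy (X : C) (H : (CoverPair J)ᵒᵖ ⥤ TopCat.{w}) :
    Continuous (topHomotopy X H) := by
  refine Realization.continuous_prod_of_comp_mk fun n φ => ?_
  simp only [topHomotopy_mk]
  have h1 : Continuous fun p : ((homFrom ((CoverPair.xi J).obj X)).obj (φ.obj 0) ×
      H.obj (op (φ.obj (Fin.last n))) × stdSimplex ℝ (Fin (n + 1))) × unitInterval =>
      H.map (toHom p.1.1 ≫ φ.map (homOfLE (Fin.zero_le (Fin.last n)))).op p.1.2.1 := by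
    have h1 : Continuous fun p : (homFrom ((CoverPair.xi J).obj X)).obj (φ.obj 0) ×
        H.obj (op (φ.obj (Fin.last n))) =>
        H.map (toHom p.1 ≫ φ.map (homOfLE (Fin.zero_le (Fin.last n)))).op p.2 :=
      continuous_prod_of_discrete_left.2 fun u =>
        (H.map (toHom u ≫ φ.map (homOfLE (Fin.zero_le (Fin.last n)))).op).hom.continuous
    exact h1.comp ((continuous_fst.comp continuous_fst).prodMk
      (continuous_fst.comp (continuous_snd.comp continuous_fst)))
  have h2 : Continuous fun p : ((homFrom ((CoverPair.xi J).obj X)).obj (φ.obj 0) ×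
      H.obj (op (φ.obj (Fin.last n))) × stdSimplex ℝ (Fin (n + 1))) × unitInterval =>
      lastCone p.2 p.1.2.2 :=
    continuous_lastCone.comp (continuous_snd.prodMk
      (continuous_snd.comp (continuous_snd.comp continuous_fst)))
  exact (continuous_fiberMk H (topSeq X (n + 1))).comp (h1.prodMk h2)

/-- A morphism from `ξ(X)` to a pair says that the pullback of its sieve to `X` is maximal. The
projected sequence of sieves is therefore constant at the maximal sieve, and is the base of the
cone. -/
lemma topHomotopy_zero (X : C) (H : (CoverPair J)ᵒᵖ ⥤ TopCat.{w})
    (q : Realization ((coverHom J).obj (op X)) H) :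
    topHomotopy X H (q, 0) =
      fiberProj X H (Realization.map ((coverToBase J).app (op X)) (𝟙 H) q) := by
  induction q using Realization.ind with | h n φ u h t
  refine (topHomotopy_mk X H φ u h t 0).trans ?_
  refine Eq.trans ?_ (fiberProj_mk J H φ (((coverToBase J).app (op X)).app _ u) h t).symm
  refine fiberMk_eq H (ψ := topSeq X (n + 1)) (ψ' := pullbackSeq φ _ _) Fin.castSuccOrderEmb
    (fun i => ?_) (lastCone_zero t) h (toHom u ≫ φ.map (homOfLE (Fin.zero_le (Fin.last n))))
    (toPair _ _) rfl
  refine GrothendieckTopology.Cover.ext _ _ fun Y f => iff_of_true trivial ?_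
  exact CoverPair.Hom.le (toHom u ≫ φ.map (homOfLE (Fin.zero_le i))) f trivial

/-- The last vertex of the cone is the `0`-cell of the maximal sieve. The element of `Γ` does not
change along the cone and is the value of the augmentation. -/
lemma topHomotopy_one (X : C) (q : Realization ((coverHom J).obj (op X)) (gammaTilde J G)) :
    topHomotopy X (gammaTilde J G) (q, 1) = (sigmaToGammaPrime J G).app (op X)
      (augment ((CoverPair.xi J).obj X) (gammaTilde J G) q) := by
  induction q using Realization.ind with | h n φ u h t
  refine (topHomotopy_mk X (gammaTilde J G) φ u h t 1).trans ?_
  exact fiberMk_eq (gammaTilde J G) (ψ := topSeq X (n + 1))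
    (ψ' := ComposableArrows.mk₀ (⊤ : J.Cover X)) (vertexEmb (Fin.last _))
    (fun i => rfl) (lastCone_one t) h (toHom u ≫ φ.map (homOfLE (Fin.zero_le (Fin.last n))))
    (toHom u ≫ φ.map (homOfLE (Fin.zero_le (Fin.last n)))) rfl

lemma topHomotopy_naturality {X Y : Cᵒᵖ} (f : X ⟶ Y)
    (q : Realization ((coverHom J).obj X) (gammaTilde J G)) (s : unitInterval) :
    topHomotopy Y.unop (gammaTilde J G)
      ((realizationPresheaf (coverHom J) (gammaTilde J G)).map f q, s) =
    (gammaPrime J G).map f (topHomotopy X.unop (gammaTilde J G) (q, s)) := by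
  induction q using Realization.ind with | h n φ u h t
  have h0 := realizationPresheaf_map_mk (coverHom J) (gammaTilde J G) f φ u h t
  have h1 := congrArg (fun q => topHomotopy Y.unop (gammaTilde J G) (q, s)) h0
  have h2 := h1.trans (topHomotopy_mk Y.unop (gammaTilde J G) φ _ h t s)
  have h3 := gammaPrime_map_mk J G f (topSeq X.unop (n + 1)) PUnit.unit ((gammaTilde J G).map
    (toHom u ≫ φ.map (homOfLE (Fin.zero_le (Fin.last n)))).op h) (lastCone s t)
  have h4 := congrArg ((gammaPrime J G).map f)
    (topHomotopy_mk X.unop (gammaTilde J G) φ u h t s)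
  refine h2.trans (Eq.trans ?_ (h4.trans h3).symm)
  let k : (CoverPair.fiber J Y.unop).obj
      ((topSeq X.unop (n + 1) ⋙ J.pullback f.unop).obj (Fin.last (n + 1))) ⟶
      (CoverPair.xi J).obj X.unop :=
    (CoverPair.cartesian f.unop).app ((topSeq X.unop (n + 1)).obj (Fin.last (n + 1)))
  have h5 := fiberMk_eq (gammaTilde J G) (ψ := topSeq Y.unop (n + 1))
    (ψ' := topSeq X.unop (n + 1) ⋙ J.pullback f.unop) (RelEmbedding.refl _)
    (fun i => GrothendieckTopology.Cover.ext _ _ fun _ _ => Iff.rfl)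
    (stdSimplex.map_id_apply (lastCone s t)).symm h
    (((CoverPair.xi J).map f.unop ≫ toHom u) ≫ φ.map (homOfLE (Fin.zero_le (Fin.last n))))
    (k ≫ toHom u ≫ φ.map (homOfLE (Fin.zero_le (Fin.last n)))) (Category.assoc _ _ _)
  exact h5.trans (congrArg (fun x => fiberMk (gammaTilde J G)
    (topSeq X.unop (n + 1) ⋙ J.pullback f.unop) x (lastCone s t))
    (map_op_map_op (gammaTilde J G) k _ h).symm)

/-- The homotopy between the projection and the augmentation, as a morphism of presheaves. -/
def topCylinder : cylinder (realizationPresheaf (coverHom J) (gammaTilde J G)) ⟶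
    gammaPrime J G where
  app X := TopCat.ofHom ⟨topHomotopy X.unop (gammaTilde J G), continuous_topHomotopy _ _⟩
  naturality _ _ f := TopCat.hom_ext (ContinuousMap.ext fun p =>
    topHomotopy_naturality G f p.1 p.2)

/-- By interchange of realizations and descent, the inclusion of `coverHom` in `baseHom` followed by
the projection to `γ'` realizes to a weak equivalence. It is homotopic, naturally in the object, to
the augmentation onto `σ` followed by `σ → γ'`; as the augmentation is an object-by-object
equivalence, it can be cancelled. -/
theorem weakEquiv_realization_sigmaToGammaPrime {F : C ⥤ TopCat.{w₁}} (hF : CovariantDescent J F) :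
    WeakEquiv (Realization.map (𝟙 F) (sigmaToGammaPrime J G)) := by
  have h1 := weakEquiv_realizationPresheafMap F (gammaTilde J G) (coverToBase J)
    fun e => weakEquiv_coverToBase hF e
  have h2 := (weakEquiv_realization_map F (projPrime J G) (weakEquiv_projPrime J G)).comp h1
  rw [← realization_map_comp] at h2
  have h3 : realizationPresheafMap (gammaTilde J G) (coverToBase J) ≫ projPrime J G =
      cylinderIncl _ 0 ≫ topCylinder G := by
    refine NatTrans.ext (funext fun X => TopCat.hom_ext (ContinuousMap.ext fun q => ?_))
    exact (topHomotopy_zero X.unop (gammaTilde J G) q).symm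
  have h4 : cylinderIncl _ 1 ≫ topCylinder G = augmentSigma J G ≫ sigmaToGammaPrime J G := by
    refine NatTrans.ext (funext fun X => TopCat.hom_ext (ContinuousMap.ext fun q => ?_))
    exact topHomotopy_one G X.unop q
  rw [h3] at h2
  have h5 := weakEquiv_realization_map_of_cylinder F (topCylinder G) (r := 1) h2
  rw [h4, realization_map_comp] at h5
  exact .of_comp_right (ContinuousMap.continuous _)
    (weakEquiv_realization_map F (augmentSigma J G) (weakEquiv_augmentSigma J G)) h5

end Comparison

/-! ### Values of sections on chains in a poset of objects -/

section SectionValues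

variable {B : Type u₁} [Category.{v₁} B] {H : Bᵒᵖ ⥤ TopCat.{w}} {P : Type*} [PartialOrder P]
  {Q : Type*} [PartialOrder Q] {k l : ℕ}

/-- The value of a section on a chain in a poset of objects, restricted to the least object. -/
def chainValue (Ψ : P ⥤ B) {p₀ : P} (h₀ : ∀ p, p₀ ≤ p) (g : Sections H)
    (e : Fin (k + 1) ↪o P) (t : stdSimplex ℝ (Fin (k + 1))) : H.obj (op (Ψ.obj p₀)) :=
  H.map (Ψ.map (homOfLE (h₀ (e 0)))).op (g.1 ⟨k, e.monotone.functor ⋙ Ψ⟩ t)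

lemma chainValue_map (Ψ : P ⥤ B) {p₀ : P} (h₀ : ∀ p, p₀ ≤ p) (g : Sections H)
    (e : Fin (k + 1) ↪o P) (η : Fin (l + 1) ↪o Fin (k + 1)) (t : stdSimplex ℝ (Fin (l + 1))) :
    chainValue Ψ h₀ g e (stdSimplex.map η t) = chainValue Ψ h₀ g (η.trans e) t := by
  refine (congrArg _ (g.2 (e.monotone.functor ⋙ Ψ) η t)).trans ?_
  refine (map_op_map_op H _ _ _).trans ?_
  refine congrArg (fun k => H.map (Quiver.Hom.op k)
    (g.1 ⟨l, (OrderEmbedding.monotone (η.trans e)).functor ⋙ Ψ⟩ t)) ?_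
  exact (Ψ.map_comp _ _).symm.trans rfl

lemma map_chainValue (Ψ : P ⥤ B) {p₀ : P} (h₀ : ∀ p, p₀ ≤ p) {q₀ : Q} (h₀' : ∀ q, q₀ ≤ q)
    (g : Sections H) (c : Q ↪o P) (e : Fin (k + 1) ↪o Q) (t : stdSimplex ℝ (Fin (k + 1))) :
    H.map (Ψ.map (homOfLE (h₀ (c q₀)))).op
      (chainValue (c.monotone.functor ⋙ Ψ) h₀' g e t) = chainValue Ψ h₀ g (e.trans c) t := by
  refine (map_op_map_op H _ _ _).trans ?_
  refine congrArg (fun j => H.map (Quiver.Hom.op j)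
    (g.1 ⟨k, (OrderEmbedding.monotone (e.trans c)).functor ⋙ Ψ⟩ t)) ?_
  exact (Ψ.map_comp _ _).symm.trans rfl

end SectionValues

/-! ### Contraction of sections over a category with a terminal object -/

section Terminal

variable {B : Type u₁} [Category.{v₁} B] {T : B} (hT : Limits.IsTerminal T) {m n : ℕ}

/-- A sequence followed by a terminal object. -/
def terminalFunctor (φ : ComposableArrows B n) : WithTop (Fin (n + 1)) ⥤ B where
  obj p := match p with
    | none => T
    | some i => φ.obj i
  map {p q} f := match p, q, leOfHom f with
    | none, none, _ => 𝟙 T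
    | some _, none, _ => hT.from _
    | some _, some _, h => φ.map (homOfLE (WithTop.coe_le_coe.1 h))
    | none, some _, h => absurd h (WithTop.not_top_le_coe _)
  map_id p := by
    obtain _ | i := p
    · rfl
    · exact φ.map_id _
  map_comp {p q r} f g := by
    have h1 := leOfHom f
    have h2 := leOfHom g
    obtain _ | i := p <;> obtain _ | j := q <;> obtain _ | k := r
    · exact hT.hom_ext _ _
    · exact absurd h2 (WithTop.not_top_le_coe _)
    · exact absurd h1 (WithTop.not_top_le_coe _)
    · exact absurd h1 (WithTop.not_top_le_coe _)
    · exact hT.hom_ext _ _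
    · exact absurd h2 (WithTop.not_top_le_coe _)
    · exact hT.hom_ext _ _
    · exact (map_homOfLE_comp φ _ _ _).symm

/-- The least element of a sequence followed by a terminal object. -/
def topZero (n : ℕ) : WithTop (Fin (n + 1)) := some 0

lemma topZero_le (p : WithTop (Fin (n + 1))) : topZero n ≤ p := by
  obtain _ | i := p
  · exact le_top
  · exact WithTop.coe_le_coe.2 (Fin.zero_le i)

/-- The identification of the vertices of a cone. -/
def lastEmb (n : ℕ) : Fin (n + 2) ↪o WithTop (Fin (n + 1)) :=
  OrderEmbedding.ofMapLEIff
    (Fin.lastCases (motive := fun _ => WithTop (Fin (n + 1))) ⊤ fun i => (i : WithTop (Fin (n + 1))))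
    fun i j => by
      cases i using Fin.lastCases <;> cases j using Fin.lastCases <;> simp [Fin.le_last]

lemma lastEmb_last (n : ℕ) : lastEmb n (Fin.last _) = ⊤ :=
  Fin.lastCases_last (motive := fun _ => WithTop (Fin (n + 1)))

lemma lastEmb_castSucc (i : Fin (n + 1)) : lastEmb n i.castSucc = (i : WithTop (Fin (n + 1))) :=
  Fin.lastCases_castSucc (motive := fun _ => WithTop (Fin (n + 1))) i

/-- The inclusion of the vertices of the base. -/
def coeEmb (n : ℕ) : Fin (n + 1) ↪o WithTop (Fin (n + 1)) :=
  OrderEmbedding.ofMapLEIff (fun i => (i : WithTop (Fin (n + 1)))) fun _ _ => WithTop.coe_le_coe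

/-- The inclusion of the last vertex. -/
def topEmb (n : ℕ) : Fin (0 + 1) ↪o WithTop (Fin (n + 1)) :=
  OrderEmbedding.ofMapLEIff (fun _ => ⊤) fun a b => by simp [Subsingleton.elim (α := Fin 1) a b]

/-- The map of vertices of cones given by a face. -/
def withTopFace (η : Fin (m + 1) ↪o Fin (n + 1)) :
    WithTop (Fin (m + 1)) ↪o WithTop (Fin (n + 1)) := η.withTopMap

lemma lastConeFace_trans_lastEmb (η : Fin (m + 1) ↪o Fin (n + 1)) :
    (lastConeFace η).trans (lastEmb n) = (lastEmb m).trans (withTopFace η) := by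
  ext i : 1
  change lastEmb n (lastConeFace η i) = withTopFace η (lastEmb m i)
  cases i using Fin.lastCases with
  | last => rw [lastConeFace_last, lastEmb_last, lastEmb_last]; rfl
  | cast i => rw [lastConeFace_castSucc, lastEmb_castSucc, lastEmb_castSucc]; rfl

lemma castSucc_trans_lastEmb : Fin.castSuccOrderEmb.trans (lastEmb n) = coeEmb n := by
  ext i : 1
  exact lastEmb_castSucc i

lemma vertexEmb_trans_lastEmb : (vertexEmb (Fin.last _)).trans (lastEmb n) = topEmb n := by
  ext i : 1
  exact lastEmb_last n

lemma terminalFunctor_face (φ : ComposableArrows B n) (η : Fin (m + 1) ↪o Fin (n + 1)) :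
    terminalFunctor hT (faceSeq φ η) =
      (withTopFace η).monotone.functor ⋙ terminalFunctor hT φ := by
  refine CategoryTheory.Functor.ext (fun p => ?_) fun p q f => ?_
  · obtain _ | i := p <;> rfl
  · have h1 := leOfHom f
    obtain _ | i := p <;> obtain _ | j := q
    · exact hT.hom_ext _ _
    · exact absurd h1 (WithTop.not_top_le_coe _)
    · exact hT.hom_ext _ _
    · exact ((Category.id_comp _).trans (Category.comp_id _)).symm

variable {H : Bᵒᵖ ⥤ TopCat.{w}}

/-- The value of the contraction of a section to its value at the terminal object. -/
def terminalValue (g : Sections H) (φ : ComposableArrows B n) (s : unitInterval)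
    (t : stdSimplex ℝ (Fin (n + 1))) : H.obj (op (φ.obj 0)) :=
  chainValue (terminalFunctor hT φ) topZero_le g (lastEmb n) (lastCone s t)

lemma chainValue_congr {Ψ Ψ' : WithTop (Fin (n + 1)) ⥤ B} (h : Ψ = Ψ') (g : Sections H)
    (e : Fin (m + 1) ↪o WithTop (Fin (n + 1))) (t : stdSimplex ℝ (Fin (m + 1))) :
    H.map (eqToHom (congrArg (fun Ψ => Ψ.obj (topZero n)) h)).op (chainValue Ψ' topZero_le g e t) =
      chainValue Ψ topZero_le g e t := by
  subst h
  exact ConcreteCategory.congr_hom (H.map_id _) _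

/-- The cone to the terminal object commutes with faces, so at every stage of the contraction the
values still form a section. -/
lemma terminalValue_map (g : Sections H) (φ : ComposableArrows B n)
    (η : Fin (m + 1) ↪o Fin (n + 1)) (s : unitInterval) (t : stdSimplex ℝ (Fin (m + 1))) :
    terminalValue hT g φ s (stdSimplex.map η t) =
      H.map (φ.map (homOfLE (Fin.zero_le (η 0)))).op (terminalValue hT g (faceSeq φ η) s t) := by
  rw [terminalValue, lastCone_map, chainValue_map, lastConeFace_trans_lastEmb,
    ← map_chainValue (terminalFunctor hT φ) topZero_le topZero_le]
  refine congrArg (H.map (φ.map (homOfLE (Fin.zero_le (η 0)))).op) ?_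
  exact ((ConcreteCategory.congr_hom (H.map_id _) _).symm.trans
    (chainValue_congr (terminalFunctor_face hT φ η) g (lastEmb m) (lastCone s t)))

lemma terminalValue_zero (g : Sections H) (φ : ComposableArrows B n)
    (t : stdSimplex ℝ (Fin (n + 1))) : terminalValue hT g φ 0 t = g.1 ⟨n, φ⟩ t := by
  rw [terminalValue, lastCone_zero, chainValue_map, castSucc_trans_lastEmb]
  exact (congrArg (fun k => H.map (Quiver.Hom.op k) (g.1 ⟨n, φ⟩ t)) (φ.map_id 0)).trans
    (ConcreteCategory.congr_hom (H.map_id _) _)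

lemma terminalValue_one (g : Sections H) (φ : ComposableArrows B n)
    (t : stdSimplex ℝ (Fin (n + 1))) : terminalValue hT g φ 1 t =
      H.map (hT.from (φ.obj 0)).op (g.1 ⟨0, ComposableArrows.mk₀ T⟩ default) := by
  rw [terminalValue, lastCone_one, chainValue_map, vertexEmb_trans_lastEmb]
  have h : (topEmb n).monotone.functor ⋙ terminalFunctor hT φ = ComposableArrows.mk₀ T :=
    ComposableArrows.ext₀ rfl
  have h1 := eq_of_heq (Sections.apply_congr g h default)
  exact congrArg (H.map (hT.from (φ.obj 0)).op) h1

lemma continuous_terminalValue (φ : ComposableArrows B n) :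
    Continuous fun p : (Sections H × unitInterval) × stdSimplex ℝ (Fin (n + 1)) =>
      terminalValue hT p.1.1 φ p.1.2 p.2 := by
  refine (H.map _).hom.continuous.comp ?_
  have h1 : Continuous fun p : (Sections H × unitInterval) × stdSimplex ℝ (Fin (n + 1)) =>
      p.1.1.1 ⟨n + 1, (lastEmb n).monotone.functor ⋙ terminalFunctor hT φ⟩ :=
    (continuous_apply (⟨n + 1, (lastEmb n).monotone.functor ⋙ terminalFunctor hT φ⟩ :
      Σ n : ℕ, ComposableArrows B n)).comp
      (continuous_subtype_val.comp (continuous_fst.comp continuous_fst))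
  exact h1.eval (continuous_lastCone.comp
    ((continuous_snd.comp continuous_fst).prodMk continuous_snd))

/-- The contraction of the space of sections to the value at the terminal object. -/
def terminalHomotopy (p : Sections H × unitInterval) : Sections H :=
  ⟨fun φ => ⟨terminalValue hT p.1 φ.2 p.2, (continuous_terminalValue hT φ.2).comp
    ((continuous_const (y := p)).prodMk continuous_id)⟩,
    fun _ _ φ η t => terminalValue_map hT p.1 φ η p.2 t⟩

/-- For the compact-open topologies it suffices that the uncurried map is continuous. That follows
from continuity of evaluation, as simplices are locally compact. -/
lemma continuous_terminalHomotopy : Continuous (terminalHomotopy hT (H := H)) :=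
  Continuous.subtype_mk (continuous_pi fun φ => ContinuousMap.continuous_of_continuous_uncurry _
    (continuous_terminalValue hT φ.2)) _

end Terminal

/-! ### Constant sections and the first claim -/

section ToSigma

variable {C : Type u} [Category.{v} C] (J : GrothendieckTopology C)

/-- The terminal object of the maximal sieve. -/
def topObj (X : C) : ((CoverPair.xi J).obj X).cat := ⟨Over.mk (𝟙 X), trivial⟩

/-- The identity is terminal in the maximal sieve. -/
def isTerminalTopObj (X : C) : Limits.IsTerminal (topObj J X) :=
  Limits.IsTerminal.ofUniqueHom (fun b => ObjectProperty.homMk (Over.homMk b.obj.hom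
    (Category.comp_id _))) fun b f => by
      refine ObjectProperty.hom_ext _ (Over.OverMorphism.ext ?_)
      exact (Category.comp_id _).symm.trans (Over.w f.hom)

/-- The identity of `X` is terminal in the slice. Moving along the cone to it deforms every section
to the constant section at its value there, and evaluation at the identity retracts the constant
sections. -/
theorem weakEquiv_toSigma (G : Cᵒᵖ ⥤ TopCat.{max u v w}) (X : Cᵒᵖ) :
    WeakEquiv ((toSigma.{w} J G).app X) := by
  refine WeakEquiv.of_deformation_retract (f := constSection J G X.unop)
    (r := fun g => g.1 ⟨0, ComposableArrows.mk₀ (topObj J X.unop)⟩ default)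
    (D := terminalHomotopy (isTerminalTopObj J X.unop)) (ContinuousMap.continuous _) ?_
    (continuous_terminalHomotopy _) (fun x => ?_) (fun g => ?_) fun g => ?_
  · have h1 : Continuous fun g : Sections (((CoverPair.xi J).obj X.unop).proj.op ⋙ G) =>
        g.1 ⟨0, ComposableArrows.mk₀ (topObj J X.unop)⟩ :=
      (continuous_apply (⟨0, ComposableArrows.mk₀ (topObj J X.unop)⟩ :
        Σ n : ℕ, ComposableArrows ((CoverPair.xi J).obj X.unop).cat n)).comp continuous_subtype_val
    exact h1.eval continuous_const
  · exact ConcreteCategory.congr_hom (G.map_id X) x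
  · exact Subtype.ext (funext fun φ => ContinuousMap.ext fun t => terminalValue_zero _ g φ.2 t)
  · exact Subtype.ext (funext fun φ => ContinuousMap.ext fun t => terminalValue_one _ g φ.2 t)

theorem weakEquiv_realization_toGammaPrime {F : C ⥤ TopCat.{w₁}} (hF : CovariantDescent J F)
    (G : Cᵒᵖ ⥤ TopCat.{max u v w}) :
    WeakEquiv (Realization.map (𝟙 F) (toGammaPrime.{w} J G)) := by
  rw [toGammaPrime, realization_map_comp]
  exact (weakEquiv_realization_sigmaToGammaPrime G hF).comp
    (weakEquiv_realization_map F (toSigma.{w} J G) (weakEquiv_toSigma J G))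

end ToSigma

/-! ### Gluing along a subspace with a deformable neighborhood -/

section Gluing

open Set Topology

variable {A B X W : Type*} [TopologicalSpace A] [TopologicalSpace B] [TopologicalSpace X]
  [TopologicalSpace W]

/-- A commutative square of spaces is a gluing square if it is a pushout of spaces along an
injective map, described by points and open sets. -/
structure IsGluing (e : A → B) (i : A → X) (inl : B → W) (inr : X → W) : Prop where
  comm : ∀ a, inl (e a) = inr (i a)
  continuous_inl : Continuous inl
  continuous_inr : Continuous inr
  surjective : ∀ w, (∃ b, inl b = w) ∨ ∃ x, inr x = w
  injective_inl : Function.Injective inl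
  of_inl_eq_inr : ∀ {b x}, inl b = inr x → ∃ a, i a = x ∧ e a = b
  of_inr_eq_inr : ∀ {x x'}, inr x = inr x' → x ∉ range i → x = x'
  isOpen : ∀ {V : Set W}, IsOpen (inl ⁻¹' V) → IsOpen (inr ⁻¹' V) → IsOpen V

namespace IsGluing

variable {e : A → B} {i : A → X} {inl : B → W} {inr : X → W} {N : Set X}

lemma preimage_image (h : IsGluing e i inl inr) {s : Set X} (hs : Disjoint s (range i)) : inr ⁻¹' (inr '' s) = s := by
  refine Subset.antisymm ?_ (subset_preimage_image _ _)
  rintro x ⟨y, hy, hxy⟩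
  rwa [← h.of_inr_eq_inr hxy fun hy' => hs.ne_of_mem hy hy' rfl]

lemma preimage_inl_image (h : IsGluing e i inl inr) {s : Set X} (hs : Disjoint s (range i)) : inl ⁻¹' (inr '' s) = ∅ := by
  refine eq_empty_of_forall_notMem ?_
  rintro b ⟨x, hx, hxb⟩
  obtain ⟨a, ha, -⟩ := h.of_inl_eq_inr hxb.symm
  exact hs.ne_of_mem hx ⟨a, ha⟩ rfl

lemma isOpen_image (h : IsGluing e i inl inr) {s : Set X} (hs : Disjoint s (range i)) (ho : IsOpen s) : IsOpen (inr '' s) := by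
  refine h.isOpen ?_ ?_
  · rw [h.preimage_inl_image hs]; exact isOpen_empty
  · rwa [h.preimage_image hs]

lemma weakEquiv_restrictPreimage (h : IsGluing e i inl inr) {V : Set W} (hV : IsOpen V) (hV' : V ⊆ inr '' (range i)ᶜ) :
    WeakEquiv (V.restrictPreimage inr) := by
  have hd : Disjoint (inr ⁻¹' V) (range i) := by
    refine disjoint_left.2 fun x hx hx' => ?_
    have h1 : x ∈ inr ⁻¹' (inr '' (range i)ᶜ) := hV' hx
    rw [h.preimage_image disjoint_compl_left] at h1
    exact h1 hx'
  have hbij : Function.Bijective (V.restrictPreimage inr) := by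
    constructor
    · rintro ⟨x, hx⟩ ⟨y, hy⟩ hxy
      exact Subtype.ext (h.of_inr_eq_inr (congrArg Subtype.val hxy)
        fun hx' => hd.ne_of_mem hx hx' rfl)
    · rintro ⟨w, hw⟩
      obtain ⟨x, -, rfl⟩ := hV' hw
      exact ⟨⟨x, hw⟩, rfl⟩
  have hopen : IsOpenMap (V.restrictPreimage inr) := by
    intro s hs
    obtain ⟨t, ht, rfl⟩ := hs
    have h1 : IsOpen (inr '' (t ∩ inr ⁻¹' V)) :=
      h.isOpen_image (hd.mono_left inter_subset_right) (ht.inter (hV.preimage h.continuous_inr))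
    convert h1.preimage continuous_subtype_val using 1
    ext ⟨w, hw⟩
    constructor
    · rintro ⟨x, hx, hxw⟩
      exact ⟨x.1, ⟨hx, x.2⟩, congrArg Subtype.val hxw⟩
    · rintro ⟨x, hx, hxw⟩
      exact ⟨⟨x, hx.2⟩, hx.1, Subtype.ext hxw⟩
  exact .of_homeomorph ((Equiv.ofBijective _ hbij).toHomeomorphOfContinuousOpen
    (h.continuous_inr.restrictPreimage) hopen)

lemma preimage_nhd (h : IsGluing e i inl inr) (hiN : range i ⊆ N) : inr ⁻¹' (range inl ∪ inr '' N) = N := by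
  refine Subset.antisymm ?_ fun x hx => Or.inr ⟨x, hx, rfl⟩
  rintro x (⟨b, hb⟩ | ⟨y, hy, hyx⟩)
  · obtain ⟨a, ha, -⟩ := h.of_inl_eq_inr hb
    exact hiN ⟨a, ha⟩
  · by_cases hx : x ∈ range i
    · exact hiN hx
    · rwa [h.of_inr_eq_inr hyx.symm hx]

/-- The parametrization of a neighborhood of the first space. -/
def nhdMk (inl : B → W) (inr : X → W) (N : Set X) : B ⊕ N → (range inl ∪ inr '' N : Set W) :=
  Sum.elim (fun b => ⟨inl b, Or.inl ⟨b, rfl⟩⟩) fun x => ⟨inr x, Or.inr ⟨x, x.2, rfl⟩⟩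

/-- The saturation property `preimage_nhd` makes a set that is open in both pieces open in `W`. Maps
and homotopies on the neighborhood may then be given separately on `B` and on `N`. -/
lemma isQuotientMap_nhdMk (h : IsGluing e i inl inr) (hiN : range i ⊆ N)
    (hN : IsOpen N) : IsQuotientMap (nhdMk inl inr N) := by
  have hc : Continuous (nhdMk inl inr N) :=
    continuous_sum_dom.2 ⟨h.continuous_inl.subtype_mk _,
      (h.continuous_inr.comp continuous_subtype_val).subtype_mk _⟩
  refine ⟨.of_isOpen_preimage_iff_isOpen fun s => ⟨fun hs => ?_, fun h => h.preimage hc⟩, ?_⟩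
  rotate_left
  · rintro ⟨w, ⟨b, rfl⟩ | ⟨x, hx, rfl⟩⟩
    · exact ⟨.inl b, rfl⟩
    · exact ⟨.inr ⟨x, hx⟩, rfl⟩
  · obtain ⟨h1, h2⟩ := isOpen_sum_iff.1 hs
    have h3 : IsOpen (Subtype.val '' s) := by
      refine h.isOpen ?_ ?_
      · convert h1 using 1
        ext b
        simp [nhdMk]
      · convert hN.isOpenMap_subtype_val _ h2 using 1
        ext x
        constructor
        · rintro ⟨w, hw, hwx⟩
          have hx : x ∈ inr ⁻¹' (range inl ∪ inr '' N) := by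
            rw [mem_preimage, ← hwx]; exact w.2
          rw [h.preimage_nhd hiN] at hx
          refine ⟨⟨x, hx⟩, ?_, rfl⟩
          rwa [mem_preimage, mem_preimage, show nhdMk inl inr N (.inr ⟨x, hx⟩) = w from
            Subtype.ext hwx.symm]
        · rintro ⟨y, hy, rfl⟩
          exact ⟨_, hy, rfl⟩
    rw [← preimage_image_eq s Subtype.val_injective]
    exact h3.preimage continuous_subtype_val

lemma factorsThrough_nhdMk (h : IsGluing e i inl inr) (hiN : range i ⊆ N)
    {Z : Type*} {Φ : B ⊕ N → Z}
    (hΦ : ∀ a, Φ (.inr ⟨i a, hiN ⟨a, rfl⟩⟩) = Φ (.inl (e a))) :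
    Function.FactorsThrough Φ (nhdMk inl inr N) := by
  have hlr : ∀ (b : B) (x : N), inl b = inr x → Φ (.inl b) = Φ (.inr x) := by
    rintro b ⟨x, hx⟩ hbx
    obtain ⟨a, rfl, rfl⟩ := h.of_inl_eq_inr hbx
    exact (hΦ a).symm
  rintro (b | x) (b' | x') hy
  · rw [h.injective_inl (congrArg Subtype.val hy)]
  · exact hlr b x' (congrArg Subtype.val hy)
  · exact (hlr b' x (congrArg Subtype.val hy).symm).symm
  · have hy' : inr x = inr x' := congrArg Subtype.val hy
    by_cases hx : x.1 ∈ range i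
    · obtain ⟨a, ha⟩ := hx
      have h1 := h.comm a
      rw [ha] at h1
      exact (hlr _ x h1).symm.trans (hlr _ x' (h1.trans hy'))
    · rw [Subtype.ext (h.of_inr_eq_inr hy' hx)]

/-- The inclusion of the first space in its neighborhood is a weak equivalence. -/
lemma weakEquiv_nhd (h : IsGluing e i inl inr) (hiN : range i ⊆ N)
    (hN : IsOpen N) (he : Continuous e) {ρ : N → A} (hρ : Continuous ρ)
    {D : N × unitInterval → N} (hD : Continuous D) (hD0 : ∀ x, D (x, 0) = x)
    (hD1 : ∀ x, (D (x, 1)).1 = i (ρ x))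
    (hDi : ∀ a s, D (⟨i a, hiN ⟨a, rfl⟩⟩, s) = ⟨i a, hiN ⟨a, rfl⟩⟩)
    (hρi : ∀ a, ρ ⟨i a, hiN ⟨a, rfl⟩⟩ = a) :
    WeakEquiv (fun b => (⟨inl b, Or.inl ⟨b, rfl⟩⟩ : (range inl ∪ inr '' N : Set W))) := by
  have hq := h.isQuotientMap_nhdMk hiN hN
  set p := nhdMk inl inr N with hp
  have hpi : ∀ a, p (.inr ⟨i a, hiN ⟨a, rfl⟩⟩) = p (.inl (e a)) := fun a =>
    Subtype.ext (h.comm a).symm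
  let Φ : B ⊕ N → B := Sum.elim _root_.id (e ∘ ρ)
  have hΦ : Function.FactorsThrough Φ p :=
    h.factorsThrough_nhdMk hiN fun a => congrArg e (hρi a)
  let Ψ : (B ⊕ N) × unitInterval → B ⊕ N := fun y => Sum.map _root_.id (fun x => D (x, y.2)) y.1
  have hΨ : ∀ s, Function.FactorsThrough (fun y => p (Ψ (y, s))) p := fun s =>
    h.factorsThrough_nhdMk hiN fun a => (congrArg (fun x => p (.inr x)) (hDi a s)).trans (hpi a)
  let r := fun w => Φ (Function.surjInv hq.surjective w)
  have hr : ∀ y, r (p y) = Φ y := fun y => hΦ (Function.surjInv_eq hq.surjective _)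
  let K := fun q : (range inl ∪ inr '' N : Set W) × unitInterval =>
    p (Ψ (Function.surjInv hq.surjective q.1, q.2))
  have hK : ∀ y s, K (p y, s) = p (Ψ (y, s)) := fun y s =>
    hΨ s (Function.surjInv_eq hq.surjective _)
  refine .of_deformation_retract (r := r) (D := K) ((h.continuous_inl).subtype_mk _) ?_ ?_
    (fun b => hr (.inl b)) (fun w => ?_) fun w => ?_
  · refine hq.continuous_iff.2 ?_
    rw [show r ∘ p = Φ from funext hr]
    exact continuous_id.sumElim (he.comp hρ)
  · refine hq.continuous_lift_prod_left ?_
    simp only [hK]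
    refine hq.continuous.comp ?_
    refine (Homeomorph.sumProdDistrib (X := B) (Y := N) (Z := unitInterval)).symm.isQuotientMap
      |>.continuous_iff.2 ?_
    exact continuous_sum_dom.2 ⟨_root_.continuous_inl.comp continuous_fst,
      _root_.continuous_inr.comp hD⟩
  · obtain ⟨y, rfl⟩ := hq.surjective w
    rw [hK]
    obtain b | x := y
    · rfl
    · exact congrArg (fun x => p (.inr x)) (hD0 x)
  · obtain ⟨y, rfl⟩ := hq.surjective w
    rw [hK, hr]
    obtain b | x := y
    · rfl
    · refine Subtype.ext ?_
      exact (congrArg inr (hD1 x)).trans (h.comm (ρ x)).symm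

/-- Gluing along a closed subspace with a neighborhood which deforms to it preserves weak
equivalences. -/
theorem weakEquiv_inr (h : IsGluing e i inl inr) (hiN : range i ⊆ N)
    (he : WeakEquiv e) (hi : Continuous i) (hclosed : IsClosed (range i))
    (hN : IsOpen N) {ρ : N → A} (hρ : Continuous ρ)
    {D : N × unitInterval → N} (hD : Continuous D) (hD0 : ∀ x, D (x, 0) = x)
    (hD1 : ∀ x, (D (x, 1)).1 = i (ρ x))
    (hDi : ∀ a s, D (⟨i a, hiN ⟨a, rfl⟩⟩, s) = ⟨i a, hiN ⟨a, rfl⟩⟩)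
    (hρi : ∀ a, ρ ⟨i a, hiN ⟨a, rfl⟩⟩ = a) : WeakEquiv inr := by
  -- The cover consists of the complement of the glued part, over which `inr` is a homeomorphism,
  -- and a neighborhood of the image of `B`. Any intersection involving the first is of the first
  -- kind. Over the second alone, source and target deform to `A` and `B`, and the map becomes `e`.
  set U : Bool → Set W := fun b => bif b then range inl ∪ inr '' N else inr '' (range i)ᶜ with hU
  have hUo : ∀ b, IsOpen (U b) := by
    rintro (_ | _)
    · exact h.isOpen_image disjoint_compl_left hclosed.isOpen_compl
    · refine h.isOpen ?_ ?_
      · have : inl ⁻¹' (U true) = univ := eq_univ_of_forall fun b => Or.inl ⟨b, rfl⟩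
        rw [this]; exact isOpen_univ
      · exact (h.preimage_nhd hiN).symm ▸ hN
  refine .of_openCover h.continuous_inr hUo ?_ fun s hs => ?_
  · refine eq_univ_of_forall fun w => mem_iUnion.2 ?_
    obtain ⟨b, rfl⟩ | ⟨x, rfl⟩ := h.surjective w
    · exact ⟨true, Or.inl ⟨b, rfl⟩⟩
    · by_cases hx : x ∈ range i
      · exact ⟨true, Or.inr ⟨x, hiN hx, rfl⟩⟩
      · exact ⟨false, x, hx, rfl⟩
  · by_cases hf : false ∈ s
    · exact h.weakEquiv_restrictPreimage (isOpen_biInter_finset fun b _ => hUo b)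
        (biInter_subset_of_mem hf)
    · have hs' : ⋂ b ∈ s, U b = range inl ∪ inr '' N := by
        have : s = {true} := by
          refine Finset.eq_singleton_iff_nonempty_unique_mem.2 ⟨hs, fun b hb => ?_⟩
          cases b
          · exact absurd hb hf
          · rfl
        rw [this]
        simp [hU]
      rw [hs']
      have h1 : WeakEquiv (fun a => (⟨i a, hiN ⟨a, rfl⟩⟩ : N)) :=
        .of_deformation_retract (r := ρ) (D := D) (hi.subtype_mk _) hρ hD hρi hD0
          fun x => Subtype.ext (hD1 x)
      have h2 := (WeakEquiv.of_homeomorph (Homeomorph.setCongr (h.preimage_nhd hiN).symm)).comp h1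
      refine .of_comp_right (h.continuous_inr.restrictPreimage) h2 ?_
      have h3 := (h.weakEquiv_nhd hiN hN he.continuous hρ hD hD0 hD1 hDi hρi).comp he
      refine Eq.mp (congrArg WeakEquiv (funext fun a => Subtype.ext ?_)) h3
      exact h.comm a

end IsGluing

end Gluing

/-! ### Neighborhoods of vertices in a fat realization -/

section VertexNeighborhood

open Set Topology SemiSimplicialSpace

variable {X : SemiSimplicialSpace.{w}} {Z : Type*} [TopologicalSpace Z] {m n : ℕ}

instance : Subsingleton (stdSimplex ℝ (Fin (0 + 1))) :=
  inferInstanceAs (Subsingleton (stdSimplex ℝ (Fin 1)))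

lemma hasGap_default : HasGap 0 (default : stdSimplex ℝ (Fin (0 + 1))) := by
  obtain ⟨k, e, h⟩ := exists_hasGap (default : stdSimplex ℝ (Fin (0 + 1)))
  have := Fintype.card_le_of_injective e e.injective
  obtain rfl : k = 0 := by simpa using this
  exact ⟨e, h⟩

lemma face_fin_one (e : Fin (0 + 1) ↪o Fin (0 + 1)) (x : X.obj 0) : X.face e x = x := by
  have : e = RelEmbedding.refl _ := by
    ext i
    exact congrArg Fin.val (Subsingleton.elim (α := Fin 1) _ _)
  rw [this, X.face_refl]

lemma eq_vertex {t : stdSimplex ℝ (Fin (n + 1))} {i : Fin (n + 1)} (h : t i = 1) :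
    t = stdSimplex.map (vertexEmb i) default := by
  have h1 : ∀ k ∉ range (vertexEmb i), t k = 0 := fun k hk => by
    have hki : k ≠ i := fun hki => hk ⟨0, hki.symm⟩
    have h2 := stdSimplex.sum_eq_one t
    rw [← Finset.add_sum_erase _ _ (Finset.mem_univ i), h] at h2
    have h3 : ∑ x ∈ Finset.univ.erase i, t x = 0 := by linarith
    exact (Finset.sum_eq_zero_iff_of_nonneg fun j _ => t.2.1 j).1 h3 k
      (Finset.mem_erase.2 ⟨hki, Finset.mem_univ k⟩)
  rw [← map_pullSimplex (vertexEmb i).injective t h1]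
  exact congrArg _ (Subsingleton.elim _ _)

lemma map_vertexEmb_apply (i : Fin (n + 1)) :
    stdSimplex.map (vertexEmb i) (default : stdSimplex ℝ (Fin (0 + 1))) i = 1 := by
  rw [← vertex_eq_map]; simp

/-- The points of the fat realization lying at vertices of a given kind. -/
def vertexSet (X : SemiSimplicialSpace.{w}) (K : Set (X.obj 0)) : Set X.Fat :=
  {q | Fat.lift (fun _ x t => ∃ v, t v = 1 ∧ X.face (vertexEmb v) x ∈ K) (fun {m n} η x t => by
    refine propext ⟨?_, ?_⟩
    · rintro ⟨v, hv, hK⟩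
      by_cases hη : v ∈ range η
      · obtain ⟨v, rfl⟩ := hη
        refine ⟨v, by rwa [stdSimplex_map_apply η.injective] at hv, ?_⟩
        rwa [X.face_face]
      · rw [stdSimplex_map_apply_of_notMem t hη] at hv
        exact absurd hv zero_ne_one
    · rintro ⟨v, hv, hK⟩
      refine ⟨η v, by rwa [stdSimplex_map_apply η.injective], ?_⟩
      rwa [X.face_face] at hK) q}

lemma isClosed_vertexSet {K : Set (X.obj 0)} (hK : IsClosed K) : IsClosed (vertexSet X K) := by
  refine isQuotientMap_quot_mk.isClosed_preimage.1 (isClosed_sigma_iff.2 fun n => ?_)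
  have h1 : ∀ v : Fin (n + 1), IsClosed {p : X.obj n × stdSimplex ℝ (Fin (n + 1)) |
      p.2 v = 1 ∧ X.face (vertexEmb v) p.1 ∈ K} := fun v =>
    (isClosed_eq ((continuous_stdSimplex_apply v).comp continuous_snd) continuous_const).inter
      (hK.preimage ((X.continuous_face _).comp continuous_fst))
  convert isClosed_iUnion_of_finite h1 using 1
  ext p
  simp only [mem_iUnion]
  exact Iff.rfl

lemma range_cell (j : Z → X.obj 0) : range (fun z => cell (X := X) (j z) default) =
    vertexSet X (range j) := by
  refine Subset.antisymm ?_ fun q hq => ?_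
  · rintro _ ⟨z, rfl⟩
    refine ⟨0, ?_, z, (face_fin_one _ _).symm⟩
    rw [Subsingleton.elim (default : stdSimplex ℝ (Fin (0 + 1)))
      (stdSimplex.map (vertexEmb 0) default)]
    exact map_vertexEmb_apply 0
  · induction q using Fat.ind with | h n x t
    obtain ⟨v, hv, z, hz⟩ := hq
    exact ⟨z, (congrArg (fun y : X.obj 0 => cell y default) hz).trans
      ((cell_map (vertexEmb v) x default).symm.trans (congrArg (cell x) (eq_vertex hv).symm))⟩

/-- The retraction of the first stratum to the vertices. -/
def vertexRetract (q : X.stratum {0}) : X.obj 0 :=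
  (stratumRetract (Finset.mem_singleton_self 0) (by simp) q).1

lemma continuous_vertexRetract : Continuous (vertexRetract (X := X)) :=
  continuous_fst.comp (continuous_stratumRetract (Finset.mem_singleton_self 0) (by simp))

/-- The deformation of the first stratum to the vertices. -/
def vertexPush (p : X.stratum {0} × unitInterval) : X.stratum {0} :=
  stratumPush (Finset.mem_singleton_self 0) (by simp) p

lemma continuous_vertexPush : Continuous (vertexPush (X := X)) :=
  continuous_stratumPush (Finset.mem_singleton_self 0) (by simp)

lemma cell_default_mem (x : X.obj 0) : cell x default ∈ X.stratum {0} :=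
  cell_mem_stratum.2 fun i hi => by
    obtain rfl := Finset.mem_singleton.1 hi
    exact hasGap_default

lemma vertexRetract_cell (x : X.obj 0) : vertexRetract ⟨cell x default, cell_default_mem x⟩ = x :=
  (congrArg Prod.fst (stratumRetract_cell _ _ x default _)).trans (face_fin_one _ x)

/-- The retraction of the first stratum recovers the vertex. -/
lemma injective_cell_default : Function.Injective fun x : X.obj 0 => cell (X := X) x default :=
  fun x y hxy => by
    have h1 : (⟨cell x default, cell_default_mem x⟩ : X.stratum {0}) =
      ⟨cell y default, cell_default_mem y⟩ := Subtype.ext hxy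
    rw [← vertexRetract_cell x, h1, vertexRetract_cell]

lemma vertexPush_zero (q : X.stratum {0}) : vertexPush (q, 0) = q := stratumPush_zero _ _ q

lemma vertexPush_one (q : X.stratum {0}) :
    (vertexPush (q, 1)).1 = cell (vertexRetract q) default := by
  refine (congrArg Subtype.val (stratumPush_one _ _ q)).trans ?_
  exact congrArg (cell (vertexRetract q)) (Subsingleton.elim _ _)

lemma vertexPush_cell (x : X.obj 0) (s : unitInterval) :
    vertexPush (⟨cell x default, cell_default_mem x⟩, s) =
      ⟨cell x default, cell_default_mem x⟩ := by
  refine Subtype.ext ((pushMap_cell x hasGap_default s).trans ?_)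
  exact congrArg (cell x) (Subsingleton.elim _ _)

/-- The part of the first stratum which retracts to vertices of a given kind. -/
def vertexNhd (X : SemiSimplicialSpace.{w}) (K : Set (X.obj 0)) : Set X.Fat :=
  {q | ∃ h : q ∈ X.stratum {0}, vertexRetract ⟨q, h⟩ ∈ K}

lemma isOpen_vertexNhd {K : Set (X.obj 0)} (hK : IsOpen K) : IsOpen (vertexNhd X K) := by
  convert (isOpen_stratum (X := X) {0}).isOpenMap_subtype_val _
    (hK.preimage continuous_vertexRetract) using 1
  ext q
  constructor
  · rintro ⟨h, hq⟩
    exact ⟨⟨q, h⟩, hq, rfl⟩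
  · rintro ⟨⟨q, h⟩, hq, rfl⟩
    exact ⟨h, hq⟩

/-- The retraction of a point moves continuously along its push, and a path cannot leave an open and
closed set. -/
lemma vertexRetract_vertexPush {K : Set (X.obj 0)} (hK : IsClopen K) {q : X.stratum {0}}
    (hq : vertexRetract q ∈ K) (s : unitInterval) : vertexRetract (vertexPush (q, s)) ∈ K := by
  have h1 : Continuous fun s : unitInterval => vertexRetract (vertexPush (q, s)) :=
    continuous_vertexRetract.comp (continuous_vertexPush.comp (.prodMk_right q))
  have h2 := (hK.preimage h1).eq_univ ⟨0, by
    rw [mem_preimage, vertexPush_zero]; exact hq⟩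
  exact h2.ge (mem_univ s)

/-- Gluing along an open and closed part of the space of vertices preserves weak equivalences. -/
theorem IsGluing.weakEquiv_inr_of_vertex {B W : Type*} [TopologicalSpace B] [TopologicalSpace W]
    {e : Z → B} {j : Z → X.obj 0} {inl : B → W} {inr : X.Fat → W}
    (h : IsGluing e (fun z => cell (X := X) (j z) default) inl inr) (he : WeakEquiv e)
    (hj : IsEmbedding j) (hjr : IsClopen (range j)) : WeakEquiv inr := by
  have hsub : range (fun z => cell (X := X) (j z) default) ⊆ vertexNhd X (range j) := by
    rintro _ ⟨z, rfl⟩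
    exact ⟨cell_default_mem _, z, (vertexRetract_cell _).symm⟩
  let ι : vertexNhd X (range j) → X.stratum {0} := fun q => ⟨q.1, q.2.choose⟩
  have hι : Continuous ι := continuous_subtype_val.subtype_mk _
  let ρ : vertexNhd X (range j) → Z := fun q =>
    hj.toHomeomorph.symm ⟨vertexRetract (ι q), q.2.choose_spec⟩
  have hρ : Continuous ρ :=
    hj.toHomeomorph.symm.continuous.comp ((continuous_vertexRetract.comp hι).subtype_mk _)
  have hjρ : ∀ q, j (ρ q) = vertexRetract (ι q) := fun q =>
    congrArg Subtype.val (hj.toHomeomorph.apply_symm_apply _)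
  refine h.weakEquiv_inr hsub he ?_ ?_ (isOpen_vertexNhd hjr.isOpen) hρ
    (D := fun p => ⟨vertexPush (ι p.1, p.2), (vertexPush (ι p.1, p.2)).2,
      vertexRetract_vertexPush hjr p.1.2.choose_spec p.2⟩) ?_ (fun q => ?_) (fun q => ?_)
    (fun z s => ?_) fun z => ?_
  · exact (continuous_cell 0).comp (hj.continuous.prodMk continuous_const)
  · rw [range_cell]
    exact isClosed_vertexSet hjr.isClosed
  · exact (continuous_subtype_val.comp (continuous_vertexPush.comp
      ((hι.comp continuous_fst).prodMk continuous_snd))).subtype_mk _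
  · have h1 : (vertexPush (ι q, 0)).1 = q.1 := congrArg Subtype.val (vertexPush_zero (ι q))
    exact Subtype.ext h1
  · exact (vertexPush_one (ι q)).trans (congrArg (fun x => cell (X := X) x default) (hjρ q).symm)
  · have h1 : (vertexPush (⟨cell (j z) default, cell_default_mem (j z)⟩, s)).1 = cell (j z) default :=
      congrArg Subtype.val (vertexPush_cell (j z) s)
    exact Subtype.ext h1
  · exact hj.injective ((hjρ _).trans (vertexRetract_cell (j z)))

end VertexNeighborhood

/-! ### The pushout along the maximal sieve and the second claim -/

section Pushout

open Set Topology SemiSimplicialSpace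

/-- The underlying square of sets is a pushout along an injection, which gives the statements on
points, and a pushout of spaces carries the final topology. -/
lemma IsGluing.of_isPushout {A B X W : TopCat.{w}} {e : A ⟶ B} {i : A ⟶ X} {inl : B ⟶ W}
    {inr : X ⟶ W} (h : IsPushout e i inl inr) (hi : Function.Injective i) :
    IsGluing e i inl inr := by
  have ht : IsPushout ((forget TopCat).map e) ((forget TopCat).map i) ((forget TopCat).map inl)
    ((forget TopCat).map inr) := h.map (forget TopCat)
  refine ⟨fun a => ConcreteCategory.congr_hom h.w a, inl.hom.continuous, inr.hom.continuous,
    fun w => Limits.Types.eq_or_eq_of_isPushout ht w,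
    Limits.Types.pushoutCocone_inr_injective_of_isColimit ht.flip.isColimit hi,
    fun {b x} hbx => (Limits.Types.pushoutCocone_inl_eq_inr_iff_of_isColimit ht.flip.isColimit hi
      x b).1 hbx.symm, fun {x x'} hxx' hx => ?_, fun {V} hl hr => ?_⟩
  · classical
    -- The map collapsing the image of `i` to one extra point factors through the pushout, so `inr`
    -- identifies no points outside that image.
    let p : (X : Type w) ⟶ (Option X : Type w) := ↾fun x => if x ∈ range i then none else some x
    let q : (B : Type w) ⟶ (Option X : Type w) := ↾fun _ => none
    have hw : (forget TopCat).map e ≫ q = (forget TopCat).map i ≫ p := by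
      refine ConcreteCategory.hom_ext _ _ fun a => ?_
      exact (if_pos (c := i a ∈ range i) ⟨a, rfl⟩).symm
    have h1 : ∀ y, ht.desc q p hw (inr y) = p y := fun y =>
      ConcreteCategory.congr_hom (ht.inr_desc q p hw) y
    have h2 : p x = p x' := by rw [← h1, ← h1, hxx']
    have h3 : p x = some x := if_neg hx
    rw [h3] at h2
    by_cases hx' : x' ∈ range i
    · exact absurd (h2.trans (if_pos hx')) (by simp)
    · exact Option.some_injective _ (h2.trans (if_neg hx'))
  · refine (TopCat.isOpen_iff_of_isColimit _ h.isColimit V).2 fun j => ?_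
    obtain _ | _ | _ := j
    · exact hl.preimage e.hom.continuous
    · exact hl
    · exact hr

lemma IsGluing.comp_homeomorph {A B X X' W : Type*} [TopologicalSpace A] [TopologicalSpace B]
    [TopologicalSpace X] [TopologicalSpace X'] [TopologicalSpace W] {e : A → B} {i : A → X}
    {inl : B → W} {inr : X → W} (h : IsGluing e i inl inr) (β : X ≃ₜ X') :
    IsGluing e (β ∘ i) inl (inr ∘ β.symm) where
  comm a := (h.comm a).trans (congrArg inr (β.symm_apply_apply (i a)).symm)
  continuous_inl := h.continuous_inl
  continuous_inr := h.continuous_inr.comp β.symm.continuous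
  surjective w := (h.surjective w).imp _root_.id fun ⟨x, hx⟩ =>
    ⟨β x, (congrArg inr (β.symm_apply_apply x)).trans hx⟩
  injective_inl := h.injective_inl
  of_inl_eq_inr {b x} hbx := by
    obtain ⟨a, ha, hb⟩ := h.of_inl_eq_inr hbx
    exact ⟨a, by simp [ha], hb⟩
  of_inr_eq_inr {x x'} hx hxi := β.symm.injective (h.of_inr_eq_inr hx fun ⟨a, ha⟩ =>
    hxi ⟨a, by simp [ha]⟩)
  isOpen {V} hl hr := h.isOpen hl (by
    have := hr.preimage β.continuous
    rwa [← preimage_comp, Function.comp_assoc, β.symm_comp_self] at this)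

variable {C : Type u} [Category.{v} C] (J : GrothendieckTopology C)

/-- The vertex at the maximal sieve. -/
def maximalVertex (H : (CoverPair J)ᵒᵖ ⥤ TopCat.{w}) (X : C)
    (h : H.obj (op ((CoverPair.xi J).obj X))) :
    BarObj (pt (J.Cover X)) ((CoverPair.fiber J X).op ⋙ H) 0 :=
  ⟨ComposableArrows.mk₀ (⊤ : J.Cover X), PUnit.unit, h⟩

lemma isOpenEmbedding_maximalVertex (H : (CoverPair J)ᵒᵖ ⥤ TopCat.{w}) (X : C) :
    IsOpenEmbedding (maximalVertex J H X) ∧ IsClosed (range (maximalVertex J H X)) := by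
  let Y : ComposableArrows (J.Cover X) 0 → Type _ := fun φ => (pt (J.Cover X)).obj (φ.obj 0) ×
    ((CoverPair.fiber J X).op ⋙ H).obj (op (φ.obj (Fin.last 0)))
  let φ₀ : ComposableArrows (J.Cover X) 0 := ComposableArrows.mk₀ ⊤
  have h1 : maximalVertex J H X = (Sigma.mk φ₀ : Y φ₀ → Sigma Y) ∘
      (Homeomorph.uniqueProd PUnit (H.obj (op ((CoverPair.xi J).obj X)))).symm := rfl
  have h2 : IsOpenEmbedding (Sigma.mk φ₀ : Y φ₀ → Sigma Y) := IsOpenEmbedding.sigmaMk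
  have h3 : IsClosedEmbedding (Sigma.mk φ₀ : Y φ₀ → Sigma Y) := IsClosedEmbedding.sigmaMk
  rw [h1]
  exact ⟨h2.comp (Homeomorph.isOpenEmbedding _), (h3.comp
    (Homeomorph.isClosedEmbedding _)).isClosed_range⟩

variable {J} (G : Cᵒᵖ ⥤ TopCat.{w})

lemma injective_sigmaToGammaPrime (X : Cᵒᵖ) :
    Function.Injective ((sigmaToGammaPrime J G).app X) := by
  intro s t hst
  have h1 := congrArg (barHomeomorph (pt (J.Cover X.unop))
    ((CoverPair.fiber J X.unop).op ⋙ gammaTilde J G)) hst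
  have h2 := injective_cell_default (X := bar (pt (J.Cover X.unop))
    ((CoverPair.fiber J X.unop).op ⋙ gammaTilde J G))
    (a₁ := maximalVertex J (gammaTilde J G) X.unop s)
    (a₂ := maximalVertex J (gammaTilde J G) X.unop t) h1
  exact (isOpenEmbedding_maximalVertex J (gammaTilde J G) X.unop).1.injective h2

/-- The map to the pushout along the inclusion of the maximal sieve is a weak equivalence. -/
theorem weakEquiv_pushout_inr {P : Cᵒᵖ ⥤ TopCat.{max u v w}} (e : sigma J G ⟶ P)
    (he : ∀ X, WeakEquiv (e.app X)) (X : Cᵒᵖ) :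
    WeakEquiv ((Limits.pushout.inr e (sigmaToGammaPrime J G)).app X) := by
  -- Pushouts of presheaves are computed object by object, so the value at `X` is a gluing of
  -- spaces.
  have h := (IsPushout.of_hasPushout e (sigmaToGammaPrime J G)).map ((evaluation _ _).obj X)
  have h1 := IsGluing.of_isPushout h (injective_sigmaToGammaPrime G X)
  have h2 := h1.comp_homeomorph (barHomeomorph (pt (J.Cover X.unop))
    ((CoverPair.fiber J X.unop).op ⋙ gammaTilde J G))
  obtain ⟨h3, h4⟩ := isOpenEmbedding_maximalVertex J (gammaTilde J G) X.unop
  have h5 := IsGluing.weakEquiv_inr_of_vertex (X := bar (pt (J.Cover X.unop))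
    ((CoverPair.fiber J X.unop).op ⋙ gammaTilde J G))
    (j := maximalVertex J (gammaTilde J G) X.unop) h2 (he X) h3.isEmbedding ⟨h4, h3.isOpen_range⟩
  have h6 := h5.comp (.of_homeomorph (barHomeomorph (pt (J.Cover X.unop))
    ((CoverPair.fiber J X.unop).op ⋙ gammaTilde J G)))
  refine Eq.mp (congrArg WeakEquiv (funext fun q => ?_)) h6
  exact congrArg _ ((barHomeomorph _ _).symm_apply_apply q)

/-- In the realized pushout square `e` and the map to the pushout from `γ'` are weak equivalences
because they are so at each object, and `σ → γ'` is one by descent. Two out of three gives the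
fourth side. -/
theorem weakEquiv_realization_pushout_inl {F : C ⥤ TopCat.{w₁}} (hF : CovariantDescent J F)
    {P : Cᵒᵖ ⥤ TopCat.{max u v w}} (e : sigma J G ⟶ P) (he : ∀ X, WeakEquiv (e.app X)) :
    WeakEquiv (Realization.map (𝟙 F) (Limits.pushout.inl e (sigmaToGammaPrime J G))) := by
  refine .of_comp_right (ContinuousMap.continuous _) (weakEquiv_realization_map F e he) ?_
  rw [← realization_map_comp, Limits.pushout.condition, realization_map_comp]
  exact (weakEquiv_realization_map F _ (weakEquiv_pushout_inr G e he)).comp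
    (weakEquiv_realization_sigmaToGammaPrime G hF)

end Pushout

end TopRealization

end

theorem mainTheorem2 {C : Type u} [Category.{v} C] (J : GrothendieckTopology C)
    (F : C ⥤ TopCat.{w₁}) (hF : TopRealization.CovariantDescent J F)
    (G : Cᵒᵖ ⥤ TopCat.{max u v w}) :
    TopRealization.IsWeakHomotopyEquiv
        (TopRealization.Realization.map (𝟙 F) (TopRealization.toGammaPrime.{w} J G)) ∧
      ∀ e : TopRealization.sigma.{max u v w} J G ⟶ G, TopRealization.ObjectwiseWeakEquiv e →
        TopRealization.IsWeakHomotopyEquiv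
          (TopRealization.Realization.map (𝟙 F)
            (Limits.pushout.inl e (TopRealization.sigmaToGammaPrime.{max u v w} J G))) := by
  refine ⟨TopRealization.isWeakHomotopyEquiv_iff.2
    (TopRealization.weakEquiv_realization_toGammaPrime J hF G), fun e he =>
    TopRealization.isWeakHomotopyEquiv_iff.2
      (TopRealization.weakEquiv_realization_pushout_inl G hF e fun X =>
        TopRealization.isWeakHomotopyEquiv_iff.1 (he X))⟩
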